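/- Let $M$ be a smooth 4-manifold with a smooth pseudo-Riemannian metric $g$ of any signature. Let $\nabla$ be the Levi-Civita connection, $R_{ab}$ and $R$ the Ricci and scalar curvature (positive on round spheres), and $\mathsf P_{ab}=\tfrac12\bigl(R_{ab}-\tfrac16 R\,g_{ab}\bigr)$. An algebraic Weyl tensor is a tensor $Z_{abcd}$ with $Z_{abcd}=-Z_{bacd}=Z_{cdab}$, $Z_{abcd}+Z_{acdb}+Z_{adbc}=0$ and all traces zero. Let $\mathcal W_{abcd}$ be the bundle of these (real or complexified), and let $\mathcal W^a{}_b{}^c{}_d$ be the bundle of tensors $Y^a{}_b{}^c{}_d$ for which $g_{ap}g_{cq}Y^p{}_b{}^q{}_d$ lies in $\mathcal W_{abcd}$; both depend only on the conformal class of $g$. For a smooth section $Y$ of $\mathcal W^a{}_b{}^c{}_d$ put $$Q_{acef}Y=\nabla_a\nabla_c\nabla_e\nabla_f Y+10\,\mathsf P_{ac}\nabla_e\nabla_f Y+10(\nabla_a\mathsf P_{ce})\nabla_f Y+3(\nabla_a\nabla_c\mathsf P_{ef})Y+9\,\mathsf P_{ac}\mathsf P_{ef}Y ,$$ let $Q_{(acef)_0}$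 denote the trace-free symmetric part in the four indices of $Q$, and define $$(D_gY)_{abcd}=Q_{(acef)_0}Y^e{}_b{}^f{}_d-Q_{(adef)_0}Y^e{}_b{}^f{}_c+Q_{(bdef)_0}Y^e{}_a{}^f{}_c-Q_{(bcef)_0}Y^e{}_a{}^f{}_d .$$ Then this formula gives the same tensor in all coordinate systems, $D_gY$ is a smooth section of $\mathcal W_{abcd}$, and $D$ is conformally invariant from $\mathcal W^a{}_b{}^c{}_d$ to $\mathcal W_{abcd}$: for every smooth function $\Omega>0$ and $\hat g=\Omega^2 g$ one has $D_{\hat g}Y=D_gY$. If moreover $M$ is oriented and $\star$ is the Hodge star acting in the index pair $cd$ (after lowering indices with $g$), then $D$ reverses duality: if $\star Y=cY$ for a constant $c$, then $\star D_gY=-c\,D_gY$. In particular $D$ interchanges the self-dual and anti-self-dual tensors ($c=\pm1$) in Riemannian signature and in signature $(2,2)$, and the $\sqrt{-1}$-dual and $-\sqrt{-1}$-dual complexified tensors ($c=\pm\sqrt{-1}$) in Lorentzian signature. -/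

import Mathlib

open scoped Manifold ContDiff

noncomputable section

namespace WeylOp

/-- The model space of a 4-manifold. -/
abbrev E4 : Type := EuclideanSpace ℝ (Fin 4)

/-! ### Tensor calculus in coordinates

A `Comps 𝕜 r s` is the array of components of a tensor field of type `(r, s)` in a coordinate
system, as functions of the coordinates; the first list of indices holds the `r` upper (vector)
indices, the second list the `s` lower (covector) indices. -/

section Coordinates

/-- Component functions of a tensor field of type `(r, s)` with values in `𝕜`. -/
abbrev Comps (𝕜 : Type*) (r s : ℕ) : Type _ := E4 → (Fin r → Fin 4) → (Fin s → Fin 4) → 𝕜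

/-- The partial derivative `∂ f / ∂ u^a`. -/
def partialDeriv {𝕜 : Type*} [RCLike 𝕜] (a : Fin 4) (f : E4 → 𝕜) (u : E4) : 𝕜 :=
  fderiv ℝ f u (EuclideanSpace.single a (1 : ℝ))

/-- Christoffel symbols `Γ^k_{ij}` of the metric with component matrix `G`. -/
def christoffel (G : E4 → Matrix (Fin 4) (Fin 4) ℝ) (u : E4) (k i j : Fin 4) : ℝ :=
  (1 / 2) * ∑ l, (G u)⁻¹ k l *
    (partialDeriv i (fun v => G v j l) u + partialDeriv j (fun v => G v i l) u
      - partialDeriv l (fun v => G v i j) u)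

/-- The Levi-Civita covariant derivative `∇_a T^{U}_{L}`; the derivative index `a` becomes the
first lower index of the result. -/
def covDeriv {𝕜 : Type*} [RCLike 𝕜] (G : E4 → Matrix (Fin 4) (Fin 4) ℝ) {r s : ℕ}
    (T : Comps 𝕜 r s) : Comps 𝕜 r (s + 1) := fun u U L =>
  partialDeriv (L 0) (fun v => T v U (Fin.tail L)) u
    + ∑ k, ∑ m, ((christoffel G u (U k) (L 0) m : ℝ) : 𝕜) *
        T u (Function.update U k m) (Fin.tail L)
    - ∑ k, ∑ m, ((christoffel G u m (L 0) (Fin.tail L k) : ℝ) : 𝕜) *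
        T u U (Function.update (Fin.tail L) k m)

/-- The Ricci tensor `R_{lj} = R^k_{lkj}`, with
`R^k_{lij} = ∂_i Γ^k_{jl} - ∂_j Γ^k_{il} + Γ^k_{im} Γ^m_{jl} - Γ^k_{jm} Γ^m_{il}`
(it is positive on round spheres). -/
def ricci (G : E4 → Matrix (Fin 4) (Fin 4) ℝ) (u : E4) (l j : Fin 4) : ℝ :=
  ∑ k, (partialDeriv k (fun v => christoffel G v k j l) u
      - partialDeriv j (fun v => christoffel G v k k l) u
      + ∑ m, (christoffel G u k k m * christoffel G u m j l
          - christoffel G u k j m * christoffel G u m k l))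

/-- The scalar curvature. -/
def scalarCurv (G : E4 → Matrix (Fin 4) (Fin 4) ℝ) (u : E4) : ℝ :=
  ∑ i, ∑ j, (G u)⁻¹ i j * ricci G u i j

/-- The Schouten tensor `P_{ab} = (1/2) (R_{ab} - (R/6) g_{ab})` in dimension 4, so that
`R_{ab} = 2 P_{ab} + P^c_c g_{ab}`. -/
def schouten (G : E4 → Matrix (Fin 4) (Fin 4) ℝ) : Comps ℝ 0 2 := fun u _ L =>
  (1 / 2) * (ricci G u (L 0) (L 1) - scalarCurv G u / 6 * G u (L 0) (L 1))

/-- The 4-index expression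
`(∇_a∇_c∇_e∇_f + 10 P_{ac}∇_e∇_f + 10 (∇_a P_{ce})∇_f + 3 (∇_a∇_c P_{ef}) + 9 P_{ac}P_{ef})`
applied to a `(2,2)`-tensor field `Y`. The arguments are the four indices `I = (a, c, e, f)` of
the expression and the upper and lower indices of `Y`. -/
def quarticExpr {𝕜 : Type*} [RCLike 𝕜] (G : E4 → Matrix (Fin 4) (Fin 4) ℝ) (Y : Comps 𝕜 2 2)
    (u : E4) (I : Fin 4 → Fin 4) (U L : Fin 2 → Fin 4) : 𝕜 :=
  covDeriv G (covDeriv G (covDeriv G (covDeriv G Y))) u U ![I 0, I 1, I 2, I 3, L 0, L 1]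
    + 10 * ((schouten G u ![] ![I 0, I 1] : ℝ) : 𝕜) *
        covDeriv G (covDeriv G Y) u U ![I 2, I 3, L 0, L 1]
    + 10 * ((covDeriv G (schouten G) u ![] ![I 0, I 1, I 2] : ℝ) : 𝕜) *
        covDeriv G Y u U ![I 3, L 0, L 1]
    + 3 * ((covDeriv G (covDeriv G (schouten G)) u ![] ![I 0, I 1, I 2, I 3] : ℝ) : 𝕜) *
        Y u U L
    + 9 * ((schouten G u ![] ![I 0, I 1] * schouten G u ![] ![I 2, I 3] : ℝ) : 𝕜) * Y u U L

/-- Symmetrization `Q_{(abcd)}` over four indices. -/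
def symmPart {𝕜 : Type*} [RCLike 𝕜] (Q : (Fin 4 → Fin 4) → 𝕜) (I : Fin 4 → Fin 4) : 𝕜 :=
  (1 / 24) * ∑ σ : Equiv.Perm (Fin 4), Q (I ∘ σ)

/-- The trace `g^{pq} S_{pqcd}` over the first two indices. -/
def trace₁₂ {𝕜 : Type*} [RCLike 𝕜] (g : Matrix (Fin 4) (Fin 4) ℝ) (S : (Fin 4 → Fin 4) → 𝕜)
    (c d : Fin 4) : 𝕜 :=
  ∑ p, ∑ q, ((g⁻¹ p q : ℝ) : 𝕜) * S ![p, q, c, d]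

/-- The trace-free symmetric part `Q_{(abcd)_0}` with respect to the metric `g` on a
4-dimensional space. -/
def tfSymmPart {𝕜 : Type*} [RCLike 𝕜] (g : Matrix (Fin 4) (Fin 4) ℝ)
    (Q : (Fin 4 → Fin 4) → 𝕜) (I : Fin 4 → Fin 4) : 𝕜 :=
  let S := symmPart Q
  let t := trace₁₂ g S
  let tt : 𝕜 := ∑ p, ∑ q, ((g⁻¹ p q : ℝ) : 𝕜) * t p q
  let h : Fin 4 → Fin 4 → 𝕜 := fun i j => ((g (I i) (I j) : ℝ) : 𝕜)
  S I
    - (1 / 8) * (h 0 1 * t (I 2) (I 3) + h 0 2 * t (I 1) (I 3) + h 0 3 * t (I 1) (I 2)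
        + h 1 2 * t (I 0) (I 3) + h 1 3 * t (I 0) (I 2) + h 2 3 * t (I 0) (I 1))
    + (1 / 48) * (h 0 1 * h 2 3 + h 0 2 * h 1 3 + h 0 3 * h 1 2) * tt

/-- `Q_{(acef)_0} Y^e_b^f_d` for the 4-index expression `Q` of `quarticExpr`. -/
def contracted {𝕜 : Type*} [RCLike 𝕜] (G : E4 → Matrix (Fin 4) (Fin 4) ℝ) (Y : Comps 𝕜 2 2)
    (u : E4) (a c b d : Fin 4) : 𝕜 :=
  ∑ e, ∑ f, tfSymmPart (G u) (fun I => quarticExpr G Y u I ![e, f] ![b, d]) ![a, c, e, f]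

/-- The coordinate formula of the operator:
`Q_{(acef)_0} Y^e_b^f_d - Q_{(adef)_0} Y^e_b^f_c + Q_{(bdef)_0} Y^e_a^f_c - Q_{(bcef)_0} Y^e_a^f_d`.
The components of `Y` are `Y^a_b^c_d = Y u ![a, c] ![b, d]`. -/
def weylFormula {𝕜 : Type*} [RCLike 𝕜] (G : E4 → Matrix (Fin 4) (Fin 4) ℝ) (Y : Comps 𝕜 2 2)
    (u : E4) (L : Fin 4 → Fin 4) : 𝕜 :=
  contracted G Y u (L 0) (L 2) (L 1) (L 3) - contracted G Y u (L 0) (L 3) (L 1) (L 2)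
    + contracted G Y u (L 1) (L 3) (L 0) (L 2) - contracted G Y u (L 1) (L 2) (L 0) (L 3)

end Coordinates

/-! ### Algebraic Weyl tensors and duality at a point -/

section Algebra

/-- `Z_{abcd}` has the symmetries of the Weyl tensor: the curvature symmetries, and all traces with
respect to the metric `g` vanish (by the symmetries it is enough to say this for the `ac`-trace). -/
structure IsAlgWeyl {𝕜 : Type*} [RCLike 𝕜] (g : Matrix (Fin 4) (Fin 4) ℝ)
    (Z : (Fin 4 → Fin 4) → 𝕜) : Prop where
  antisymm : ∀ a b c d, Z ![a, b, c, d] = - Z ![b, a, c, d]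
  pair : ∀ a b c d, Z ![a, b, c, d] = Z ![c, d, a, b]
  bianchi : ∀ a b c d, Z ![a, b, c, d] + Z ![a, c, d, b] + Z ![a, d, b, c] = 0
  traceFree : ∀ b d, ∑ a, ∑ c, ((g⁻¹ a c : ℝ) : 𝕜) * Z ![a, b, c, d] = 0

/-- Lowering the indices of `Y^a_b^c_d` (with `Y ![a, c] ![b, d] = Y^a_b^c_d`). -/
def lower {𝕜 : Type*} [RCLike 𝕜] (g : Matrix (Fin 4) (Fin 4) ℝ)
    (Y : (Fin 2 → Fin 4) → (Fin 2 → Fin 4) → 𝕜) (L : Fin 4 → Fin 4) : 𝕜 :=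
  ∑ p, ∑ q, ((g (L 0) p * g (L 2) q : ℝ) : 𝕜) * Y ![p, q] ![L 1, L 3]

/-- The Levi-Civita permutation symbol: the sign of `I` if `I` is a permutation, and otherwise
`0`. -/
def leviCivita (I : Fin 4 → Fin 4) : ℝ :=
  Matrix.det (Matrix.of fun i j => if I i = j then (1 : ℝ) else 0)

/-- The Hodge star `(⋆Z)_{abcd} = (1/2) ε_{cd}^{ef} Z_{abef}` in the index pair `cd`, in a
positively oriented basis with Gram matrix `g`; here `ε_{abcd} = √|det g| [abcd]`. -/
def star {𝕜 : Type*} [RCLike 𝕜] (g : Matrix (Fin 4) (Fin 4) ℝ) (Z : (Fin 4 → Fin 4) → 𝕜)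
    (L : Fin 4 → Fin 4) : 𝕜 :=
  (1 / 2) * ∑ e, ∑ f,
    ((∑ p, ∑ q, Real.sqrt |g.det| * leviCivita ![L 2, L 3, p, q] * g⁻¹ p e * g⁻¹ q f : ℝ) : 𝕜) *
      Z ![L 0, L 1, e, f]

end Algebra

/-! ### Tensor fields on a 4-manifold -/

section Manifold

variable (M : Type*) [TopologicalSpace M] [ChartedSpace E4 M]

/-- Smooth charts: the members of the maximal atlas of the smooth structure. -/
abbrev smoothCharts : Set (OpenPartialHomeomorph M E4) :=
  IsManifold.maximalAtlas (𝓡 4) ∞ M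

variable {M}

/-- The coordinate vector field `∂/∂u^i` of the chart `φ`, at the point with coordinates `u`. -/
def coordVec (φ : OpenPartialHomeomorph M E4) (u : E4) (i : Fin 4) :
    TangentSpace (𝓡 4) (φ.symm u) :=
  mfderiv (𝓡 4) (𝓡 4) φ.symm u (EuclideanSpace.single i (1 : ℝ))

/-- The coordinate differential `du^i` of the chart `φ`, at the point `x`. -/
def coordForm (φ : OpenPartialHomeomorph M E4) (x : M) (i : Fin 4) :
    Module.Dual ℝ (TangentSpace (𝓡 4) x) :=
  ((EuclideanSpace.proj i : E4 →L[ℝ] ℝ) : E4 →ₗ[ℝ] ℝ) ∘ₗ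
    (mfderiv (𝓡 4) (𝓡 4) φ x).toLinearMap

variable (M) in
/-- Tensor fields of type `(r, s)` with values in `𝕜` (real tensors for `𝕜 = ℝ`, complexified
tensors for `𝕜 = ℂ`), without any regularity. -/
abbrev TensorField (𝕜 : Type*) [RCLike 𝕜] (r s : ℕ) : Type _ :=
  ∀ x : M, MultilinearMap ℝ (fun _ : Fin r => Module.Dual ℝ (TangentSpace (𝓡 4) x))
    (MultilinearMap ℝ (fun _ : Fin s => TangentSpace (𝓡 4) x) 𝕜)

/-- The components of a tensor field in a chart. -/
def TensorField.comps {𝕜 : Type*} [RCLike 𝕜] {r s : ℕ} (T : TensorField M 𝕜 r s)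
    (φ : OpenPartialHomeomorph M E4) : Comps 𝕜 r s := fun u U L =>
  T (φ.symm u) (fun k => coordForm φ (φ.symm u) (U k)) (fun k => coordVec φ u (L k))

/-- A tensor field is smooth if its components are smooth in all smooth charts. -/
def TensorField.IsSmooth {𝕜 : Type*} [RCLike 𝕜] {r s : ℕ} (T : TensorField M 𝕜 r s) : Prop :=
  ∀ φ ∈ smoothCharts M, ∀ U L, ContDiffOn ℝ ∞ (fun u => T.comps φ u U L) φ.target

/-- The covariant tensor at `x` with components `z` in the coordinate frame of the chart `φ`. -/
def ofComponents {𝕜 : Type*} [RCLike 𝕜] {s : ℕ} (φ : OpenPartialHomeomorph M E4) (x : M)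
    (z : (Fin s → Fin 4) → 𝕜) :
    MultilinearMap ℝ (fun _ : Fin 0 => Module.Dual ℝ (TangentSpace (𝓡 4) x))
      (MultilinearMap ℝ (fun _ : Fin s => TangentSpace (𝓡 4) x) 𝕜) :=
  MultilinearMap.constOfIsEmpty ℝ _
    (∑ L, ((MultilinearMap.mkPiAlgebra ℝ (Fin s) ℝ).compLinearMap
      (fun k => coordForm φ x (L k))).smulRight (z L))

variable (M) in
/-- Smooth pseudo-Riemannian metrics on `M`, of any signature. -/
structure Metric where
  /-- The bilinear form on each tangent space. -/
  inner : ∀ x : M, LinearMap.BilinForm ℝ (TangentSpace (𝓡 4) x)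
  symm : ∀ x v w, inner x v w = inner x w v
  nondegenerate : ∀ x, (inner x).Nondegenerate
  smooth : ∀ φ ∈ smoothCharts M, ∀ i j,
    ContDiffOn ℝ ∞ (fun u => inner (φ.symm u) (coordVec φ u i) (coordVec φ u j)) φ.target

/-- The matrix `g_{ij}` of a metric in a chart. -/
def Metric.comps (g : Metric M) (φ : OpenPartialHomeomorph M E4) (u : E4) :
    Matrix (Fin 4) (Fin 4) ℝ :=
  Matrix.of fun i j => g.inner (φ.symm u) (coordVec φ u i) (coordVec φ u j)

/-- Conformal change of metric, `g' = Ω² g` with `Ω` smooth and positive. -/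
def Metric.IsConformalTo (g g' : Metric M) : Prop :=
  ∃ Ω : M → ℝ, ContMDiff (𝓡 4) 𝓘(ℝ, ℝ) ∞ Ω ∧ (∀ x, 0 < Ω x) ∧
    ∀ x v w, g'.inner x v w = Ω x ^ 2 * g.inner x v w

/-- `Y` is a section of `𝒲^a_b^c_d`: lowering its upper indices gives an algebraic Weyl tensor.
(The two upper indices of `Y` are `a, c` and the two lower ones are `b, d`.) -/
def IsWeylUDUD {𝕜 : Type*} [RCLike 𝕜] (g : Metric M) (Y : TensorField M 𝕜 2 2) : Prop :=
  ∀ φ ∈ smoothCharts M, ∀ u ∈ φ.target,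
    IsAlgWeyl (g.comps φ u) (lower (g.comps φ u) (Y.comps φ u))

/-- `Z` is a section of `𝒲_{abcd}`. -/
def IsWeylDDDD {𝕜 : Type*} [RCLike 𝕜] (g : Metric M) (Z : TensorField M 𝕜 0 4) : Prop :=
  ∀ φ ∈ smoothCharts M, ∀ u ∈ φ.target, IsAlgWeyl (g.comps φ u) (Z.comps φ u ![])

variable (M) in
/-- An orientation of `M`, given by a set of smooth charts (the positively oriented ones) that
cover `M` and have orientation preserving coordinate changes. -/
structure OrientedAtlas where
  /-- The positively oriented charts. -/
  charts : Set (OpenPartialHomeomorph M E4)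
  smooth : charts ⊆ smoothCharts M
  cover : ∀ x : M, ∃ φ ∈ charts, x ∈ φ.source
  positive : ∀ φ ∈ charts, ∀ ψ ∈ charts, ∀ u ∈ (φ.symm ≫ₕ ψ).source,
    0 < (fderiv ℝ (φ.symm ≫ₕ ψ) u).det

/-- `Y^a_b^c_d` is an eigensection of the Hodge star with eigenvalue `c`. -/
def IsDualUDUD {𝕜 : Type*} [RCLike 𝕜] (g : Metric M) (o : OrientedAtlas M) (c : 𝕜)
    (Y : TensorField M 𝕜 2 2) : Prop :=
  ∀ φ ∈ o.charts, ∀ u ∈ φ.target, ∀ L,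
    star (g.comps φ u) (lower (g.comps φ u) (Y.comps φ u)) L =
      c * lower (g.comps φ u) (Y.comps φ u) L

/-- `Z_{abcd}` is an eigensection of the Hodge star with eigenvalue `c`. -/
def IsDualDDDD {𝕜 : Type*} [RCLike 𝕜] (g : Metric M) (o : OrientedAtlas M) (c : 𝕜)
    (Z : TensorField M 𝕜 0 4) : Prop :=
  ∀ φ ∈ o.charts, ∀ u ∈ φ.target, ∀ L,
    star (g.comps φ u) (Z.comps φ u ![]) L = c * Z.comps φ u ![] L

/-- The fourth order operator `D_g`. At each point it is computed in the preferred chart there. -/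
def weylOperator {𝕜 : Type*} [RCLike 𝕜] (g : Metric M) (Y : TensorField M 𝕜 2 2) :
    TensorField M 𝕜 0 4 := fun x =>
  ofComponents (chartAt E4 x) x
    (weylFormula (g.comps (chartAt E4 x)) (Y.comps (chartAt E4 x)) (chartAt E4 x x))

end Manifold

end WeylOp

end

open scoped Manifold ContDiff

noncomputable section

namespace WeylOp

section

attribute [local instance] Matrix.normedAddCommGroup Matrix.normedSpace

open Filter Topology

/-! In terms of spinors, a self-dual Weyl tensor is a section of `S⁴` of one spin bundle, an
anti-self-dual one is a section of `S⁴` of the other, and the tensor product of these two bundles is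
the bundle of trace-free symmetric tensors with four indices. Contracting four symmetrized
trace-free derivatives with a Weyl tensor therefore leads from each half to the other, and only the
lower order terms have to be adjusted for conformal invariance. The proof carries this out with
tensors, in all signatures at once.

Conformal invariance. Let `θ = d log Ω`. The Levi-Civita connections of `g` and `Ω² g` differ by the
tensor `confMat` (`IsConformalOn.conn_eq`), whose covariant derivative is obtained by
differentiating `θ` alone (`pd_confMat`). The Schouten tensor changes into `P - ∇θ + θ ⊗ θ` plus a
multiple of the metric (`schouten_conf`). Both values of the operator are Weyl tensors, so it is
enough to compare their pairings with an arbitrary Weyl tensor `N` (`IsWeyl4.eq_zero_of_pairing`).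

The point special to dimension 4 concerns the contraction `Y^{ef}_{bd} N^{abcd}` of two Weyl
tensors: once it is symmetrized in `e, a` and freed of its trace in this pair, it is totally
symmetric and trace-free in all four indices (`symContr_isTotSymm`, `symContr_trace`). By
`symContr_eq` it is the contraction of `Y` with `N` minus the normalized contraction of `⋆Y` with
`⋆N`, in which only the products of opposite duality survive. In the pairing the projection of `Q`
to its trace-free symmetric part can therefore be dropped (`pairing_weylContr`). What remains is a
linear functional `Φ` of `QY` that is symmetric in the four indices of `Q` and vanishes on multiples
of the metric. By total symmetry the last index of `Q` may be contracted with an upper index of `Y`,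
and there the action of `confMat` amounts to multiplication by `3θ` (`sum_derMixed_conf`). So `Φ`
sees `Y` with weight 3, and every further lower index reduces the weight by 2 (`confAct_down`): the
successive derivatives of `Y` have weights 1, -1, -3, while `P` and `∇P` have weights -4 and -6.
Under `Φ` the order of the indices is irrelevant, so derivatives commute and the computation
(`IsConfFunctional.quarticJet_eq`) is the one-dimensional one for `y'''' + 10 q y'' + 10 q' y' + (3
q'' + 9 q²) y`, the third symmetric power of `y'' + q y`, with `q` changing into `q - θ' + θ²`.

Duality. The Weyl tensors, and those among them with `⋆Y = cY`, form parallel families of subspaces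
(`isParSub_mixedSub`, `isParSub_dualSub`), so `QY` has the duality of `Y` in the indices of `Y`. In
the last index pair the operator lets trace-free symmetric matrices act on two-forms, and such an
action anticommutes with the star (`hodge_reverse`) because the permutation symbol is invariant
under trace-free matrices (`dualMat_der`).

Coordinates. Tensors of all types are treated at once as representations of `GL(4)` with a single
covariant derivative `cov`. Its naturality (`cov_natural`), the naturality of the Schouten tensor
that follows, and the equivariance of the final contraction (`weylContr_pull`) show that the formula
does not depend on the chart. -/

/-- Real `4 × 4` matrices. -/
abbrev Mat : Type := Matrix (Fin 4) (Fin 4) ℝ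

/-- The partial derivative of a vector-valued function. -/
def pd {V : Type*} [NormedAddCommGroup V] [NormedSpace ℝ V] (a : Fin 4) (T : E4 → V) (u : E4) : V :=
  fderiv ℝ T u (EuclideanSpace.single a (1 : ℝ))

/-! ### Representations of `GL(4)` -/

/-- A representation of `GL(4)` with the corresponding representation of its Lie algebra. The group
element is given by a matrix together with its inverse. -/
structure TRep (V : Type*) [NormedAddCommGroup V] [NormedSpace ℝ V] where
  /-- The action of the Lie algebra. -/
  ρ : Mat →ₗ[ℝ] V →ₗ[ℝ] V
  /-- The action of the group. -/
  act : Mat → Mat → V →ₗ[ℝ] V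
  bracket : ∀ A B v, ρ (A * B - B * A) v = ρ A (ρ B v) - ρ B (ρ A v)
  conj : ∀ J K, J * K = 1 → ∀ A v, ρ A (act J K v) = act J K (ρ (K * A * J) v)
  contDiffAt_act : ∀ {J K : E4 → Mat} {T : E4 → V} {u : E4}, ContDiffAt ℝ ∞ J u →
    ContDiffAt ℝ ∞ K u → ContDiffAt ℝ ∞ T u → ContDiffAt ℝ ∞ (fun x => act (J x) (K x) (T x)) u
  -- The Lie algebra action is the derivative of the group action: the logarithmic derivative of `J`
  -- is `J⁻¹ ∂J`. The inverse is a separate argument `K`, constrained only through its value and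
  -- first derivatives at `u`.
  pd_act : ∀ {J K : E4 → Mat} {T : E4 → V} {u : E4} (a : Fin 4), ContDiffAt ℝ ∞ J u →
    ContDiffAt ℝ ∞ K u → ContDiffAt ℝ ∞ T u → J u * K u = 1 →
    pd a K u = - (K u * pd a J u * K u) →
    pd a (fun x => act (J x) (K x) (T x)) u =
      act (J u) (K u) (pd a T u + ρ (K u * pd a J u) (T u))

/-! ### Calculus of partial derivatives -/

section basics

variable {V : Type*} [NormedAddCommGroup V] [NormedSpace ℝ V]

theorem differentiableAt_of_smooth {W : Type*} [NormedAddCommGroup W] [NormedSpace ℝ W]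
    {T : E4 → W} {u : E4} (h : ContDiffAt ℝ ∞ T u) : DifferentiableAt ℝ T u :=
  h.differentiableAt (by simp)

theorem pd_apply {ι : Type*} [Fintype ι] {T : E4 → ι → V} {u : E4}
    (h : ContDiffAt ℝ ∞ T u) (a : Fin 4) (i : ι) : pd a T u i = pd a (fun x => T x i) u := by
  unfold pd
  have := differentiableAt_of_smooth h
  rw [fderiv_apply (by simpa [differentiableAt_pi] using this)]
  simp

theorem smooth_apply {ι : Type*} [Fintype ι] {T : E4 → ι → V} {u : E4}
    (h : ContDiffAt ℝ ∞ T u) (i : ι) : ContDiffAt ℝ ∞ (fun x => T x i) u :=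
  contDiffAt_pi.1 h i

theorem smooth_entry {T : E4 → Mat} {u : E4}
    (h : ContDiffAt ℝ ∞ T u) (i j : Fin 4) : ContDiffAt ℝ ∞ (fun x => T x i j) u :=
  smooth_apply (smooth_apply (T := fun x => (T x : Fin 4 → Fin 4 → ℝ)) h i) j

theorem smooth_mat {T : E4 → Mat} {u : E4}
    (h : ∀ i j, ContDiffAt ℝ ∞ (fun x => T x i j) u) : ContDiffAt ℝ ∞ T u :=
  contDiffAt_pi.2 fun i => contDiffAt_pi.2 fun j => h i j

theorem pd_entry {T : E4 → Mat} {u : E4}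
    (h : ContDiffAt ℝ ∞ T u) (a i j : Fin 4) : pd a T u i j = pd a (fun x => T x i j) u := by
  have h1 := pd_apply (T := fun x => (T x : Fin 4 → Fin 4 → ℝ)) h a i
  have h2 := pd_apply (smooth_apply (T := fun x => (T x : Fin 4 → Fin 4 → ℝ)) h i) a j
  rw [← h2, ← h1]; rfl

theorem pd_sum {ι : Type*} (s : Finset ι) {T : ι → E4 → V} {u : E4}
    (h : ∀ i ∈ s, ContDiffAt ℝ ∞ (T i) u) (a : Fin 4) :
    pd a (fun x => ∑ i ∈ s, T i x) u = ∑ i ∈ s, pd a (T i) u := by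
  unfold pd
  rw [fderiv_fun_sum fun i hi => differentiableAt_of_smooth (h i hi)]
  simp

theorem pd_add {S T : E4 → V} {u : E4} (hS : ContDiffAt ℝ ∞ S u) (hT : ContDiffAt ℝ ∞ T u)
    (a : Fin 4) : pd a (fun x => S x + T x) u = pd a S u + pd a T u := by
  unfold pd
  rw [fderiv_fun_add (differentiableAt_of_smooth hS) (differentiableAt_of_smooth hT)]
  simp

theorem pd_sub {S T : E4 → V} {u : E4} (hS : ContDiffAt ℝ ∞ S u) (hT : ContDiffAt ℝ ∞ T u)
    (a : Fin 4) : pd a (fun x => S x - T x) u = pd a S u - pd a T u := by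
  unfold pd
  rw [fderiv_fun_sub (differentiableAt_of_smooth hS) (differentiableAt_of_smooth hT)]
  simp

theorem pd_neg {S : E4 → V} {u : E4} (a : Fin 4) :
    pd a (fun x => - S x) u = - pd a S u := by
  unfold pd
  rw [fderiv_fun_neg]
  simp

theorem pd_smul {c : E4 → ℝ} {T : E4 → V} {u : E4} (hc : ContDiffAt ℝ ∞ c u)
    (hT : ContDiffAt ℝ ∞ T u) (a : Fin 4) :
    pd a (fun x => c x • T x) u = c u • pd a T u + pd a c u • T u := by
  unfold pd
  rw [fderiv_fun_smul (differentiableAt_of_smooth hc) (differentiableAt_of_smooth hT)]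
  simp

theorem pd_mul {c d : E4 → ℝ} {u : E4} (hc : ContDiffAt ℝ ∞ c u)
    (hd : ContDiffAt ℝ ∞ d u) (a : Fin 4) :
    pd a (fun x => c x * d x) u = pd a c u * d u + c u * pd a d u := by
  have := pd_smul hc hd a
  simp only [smul_eq_mul] at this
  rw [this]; ring

theorem pd_const (v : V) (a : Fin 4) (u : E4) : pd a (fun _ => v) u = 0 := by
  simp [pd]

theorem pd_congr {S T : E4 → V} {u : E4} (h : S =ᶠ[𝓝 u] T) (a : Fin 4) : pd a S u = pd a T u := by
  unfold pd; rw [h.fderiv_eq]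

theorem pd_congr_on {S T : E4 → V} {s : Set E4} (hs : IsOpen s) (h : ∀ x ∈ s, S x = T x) {u : E4}
    (hu : u ∈ s) (a : Fin 4) : pd a S u = pd a T u :=
  pd_congr (eventually_of_mem (hs.mem_nhds hu) h) a

/-- The partial derivatives of a bilinear expression. -/
theorem pd_bilin {V₁ V₂ : Type*} [NormedAddCommGroup V₁] [NormedSpace ℝ V₁]
    [FiniteDimensional ℝ V₁] [NormedAddCommGroup V₂] [NormedSpace ℝ V₂] [FiniteDimensional ℝ V₂]
    (B : V₁ →ₗ[ℝ] V₂ →ₗ[ℝ] V) {S : E4 → V₁} {T : E4 → V₂} {u : E4}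
    (hS : ContDiffAt ℝ ∞ S u) (hT : ContDiffAt ℝ ∞ T u) (a : Fin 4) :
    pd a (fun x => B (S x) (T x)) u = B (pd a S u) (T u) + B (S u) (pd a T u) := by
  have h := (LinearMap.toContinuousBilinearMap B).hasFDerivAt_of_bilinear
    (differentiableAt_of_smooth hS).hasFDerivAt (differentiableAt_of_smooth hT).hasFDerivAt
  unfold pd
  have h2 := h.fderiv
  simp only [LinearMap.toContinuousBilinearMap_apply] at h2
  rw [h2]
  simp [add_comm]

theorem smooth_bilin {V₁ V₂ : Type*} [NormedAddCommGroup V₁] [NormedSpace ℝ V₁]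
    [FiniteDimensional ℝ V₁] [NormedAddCommGroup V₂] [NormedSpace ℝ V₂] [FiniteDimensional ℝ V₂]
    (B : V₁ →ₗ[ℝ] V₂ →ₗ[ℝ] V) {S : E4 → V₁} {T : E4 → V₂} {u : E4}
    (hS : ContDiffAt ℝ ∞ S u) (hT : ContDiffAt ℝ ∞ T u) :
    ContDiffAt ℝ ∞ (fun x => B (S x) (T x)) u :=
  (LinearMap.toContinuousBilinearMap B).isBoundedBilinearMap.contDiff.contDiffAt.comp u
    (hS.prodMk hT)

theorem smooth_pd {T : E4 → V} {u : E4} (hT : ContDiffAt ℝ ∞ T u) (a : Fin 4) :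
    ContDiffAt ℝ ∞ (pd a T) u :=
  (hT.fderiv_right (m := ∞) (by simp)).clm_apply contDiffAt_const

theorem sum_mul_smul (M N : Mat) (F : Fin 4 → V) (c : Fin 4) :
    ∑ p, M p c • ∑ q, N q p • F q = ∑ q, (N * M) q c • F q := by
  simp only [Finset.smul_sum, Matrix.mul_apply, Finset.sum_smul, smul_smul]
  rw [Finset.sum_comm]
  refine Finset.sum_congr rfl fun q _ => Finset.sum_congr rfl fun p _ => ?_
  rw [mul_comm]

theorem sum_mul_smul' (M N : Mat) (F : Fin 4 → V) (k : Fin 4) :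
    ∑ p, M k p • ∑ q, N p q • F q = ∑ q, (M * N) k q • F q := by
  simp only [Finset.smul_sum, Matrix.mul_apply, Finset.sum_smul, smul_smul]
  rw [Finset.sum_comm]

end basics

/-! ### Adding lower and upper indices to a representation -/

namespace TRep

variable {V : Type*} [NormedAddCommGroup V] [NormedSpace ℝ V]

variable (V) in
/-- The trivial representation. -/
def triv : TRep V where
  ρ := 0
  act _ _ := LinearMap.id
  bracket := by simp
  conj := by simp
  contDiffAt_act _ _ hT := by simpa using hT
  pd_act := by intros; simp

/-- The tensor product with the dual of the standard representation: adds a lower index. -/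
def down (r : TRep V) : TRep (Fin 4 → V) where
  ρ := LinearMap.mk₂ ℝ (fun A F c => r.ρ A (F c) - ∑ p, A p c • F p)
    (by intro A B F; ext c; simp [add_smul, Finset.sum_add_distrib]; abel)
    (by intro t A F; ext c; simp [smul_sub, Finset.smul_sum, smul_smul])
    (by intro A F F'; ext c; simp [Finset.sum_add_distrib]; abel)
    (by intro t A F; ext c; simp [smul_sub, Finset.smul_sum, smul_smul, mul_comm])
  act J K :=
    { toFun := fun F c => ∑ p, K p c • r.act J K (F p)
      map_add' := by intro F F'; ext c; simp [Finset.sum_add_distrib]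
      map_smul' := by intro t F; ext c; simp [Finset.smul_sum, smul_smul, mul_comm] }
  bracket := by
    intro A B F; ext c
    change r.ρ (A * B - B * A) (F c) - ∑ p, (A * B - B * A) p c • F p = _
    rw [r.bracket]
    simp only [LinearMap.mk₂_apply, map_sub, map_sum, map_smul, Pi.sub_apply, smul_sub,
      Finset.sum_sub_distrib, sum_mul_smul, Matrix.sub_apply, sub_smul]
    abel
  conj := by
    intro J K h A F; ext c
    simp only [LinearMap.mk₂_apply, LinearMap.coe_mk, AddHom.coe_mk, map_sum, map_smul,
      r.conj J K h, map_sub, smul_sub, Finset.sum_sub_distrib]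
    congr 1
    have := sum_mul_smul K (K * A * J) (fun q => r.act J K (F q)) c
    rw [this, sum_mul_smul, mul_assoc, h, mul_one]
  contDiffAt_act := by
    intro J K T u hJ hK hT
    exact contDiffAt_pi.2 fun c => ContDiffAt.sum (s := Finset.univ)
      (f := fun p x => K x p c • r.act (J x) (K x) (T x p)) fun p _ =>
      (smooth_entry hK p c).smul (r.contDiffAt_act hJ hK (smooth_apply hT p))
  pd_act := by
    intro J K T u a hJ hK hT h dK
    have key : ContDiffAt ℝ ∞ (fun x => fun c => ∑ p, K x p c • r.act (J x) (K x) (T x p)) u := by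
      refine contDiffAt_pi.2 fun c => ContDiffAt.sum fun p _ => ?_
      exact (smooth_entry hK p c).smul (r.contDiffAt_act hJ hK (smooth_apply hT p))
    ext c
    simp only [LinearMap.coe_mk, AddHom.coe_mk]
    rw [pd_apply key, pd_sum]
    · simp only [Pi.add_apply, LinearMap.mk₂_apply]
      -- Differentiating the factor `K = J⁻¹` gives `-K (∂J) K`, which is the contribution of the
      -- new lower index to the Lie algebra action.
      have e : ∀ p, pd a (fun x => K x p c • r.act (J x) (K x) (T x p)) u =
          K u p c • r.act (J u) (K u) (pd a T u p + r.ρ (K u * pd a J u) (T u p))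
            - (K u * pd a J u * K u) p c • r.act (J u) (K u) (T u p) := by
        intro p
        rw [pd_smul (smooth_entry hK p c) (r.contDiffAt_act hJ hK (smooth_apply hT p)),
          r.pd_act a hJ hK (smooth_apply hT p) h dK, ← pd_entry hK, dK, ← pd_apply hT]
        simp [sub_eq_add_neg]
      simp only [e, map_add, map_sub, map_sum, map_smul, smul_add, smul_sub,
        Finset.sum_sub_distrib, Finset.sum_add_distrib,
        sum_mul_smul (K u) (K u * pd a J u) (fun q => r.act (J u) (K u) (T u q)) c]
      abel
    · intro p _
      exact (smooth_entry hK p c).smul (r.contDiffAt_act hJ hK (smooth_apply hT p))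

/-- The tensor product with the standard representation: adds an upper index. -/
def up (r : TRep V) : TRep (Fin 4 → V) where
  ρ := LinearMap.mk₂ ℝ (fun A F k => r.ρ A (F k) + ∑ p, A k p • F p)
    (by intro A B F; ext c; simp [add_smul, Finset.sum_add_distrib]; abel)
    (by intro t A F; ext c; simp [smul_add, Finset.smul_sum, smul_smul])
    (by intro A F F'; ext c; simp [Finset.sum_add_distrib]; abel)
    (by intro t A F; ext c; simp [smul_add, Finset.smul_sum, smul_smul, mul_comm])
  act J K :=
    { toFun := fun F k => ∑ p, J k p • r.act J K (F p)
      map_add' := by intro F F'; ext c; simp [Finset.sum_add_distrib]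
      map_smul' := by intro t F; ext c; simp [Finset.smul_sum, smul_smul, mul_comm] }
  bracket := by
    intro A B F; ext c
    simp only [LinearMap.mk₂_apply, r.bracket, map_sum, map_smul, Pi.sub_apply, map_add, smul_add,
      Finset.sum_add_distrib, sum_mul_smul', Matrix.sub_apply, sub_smul, Finset.sum_sub_distrib]
    abel
  conj := by
    intro J K h A F; ext c
    simp only [LinearMap.mk₂_apply, LinearMap.coe_mk, AddHom.coe_mk, map_sum, map_smul,
      r.conj J K h, map_add, smul_add, Finset.sum_add_distrib]
    congr 1
    have := sum_mul_smul' J (K * A * J) (fun q => r.act J K (F q)) c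
    rw [this, sum_mul_smul', ← mul_assoc, ← mul_assoc, h, one_mul]
  contDiffAt_act := by
    intro J K T u hJ hK hT
    exact contDiffAt_pi.2 fun c => ContDiffAt.sum (s := Finset.univ)
      (f := fun p x => J x c p • r.act (J x) (K x) (T x p)) fun p _ =>
      (smooth_entry hJ c p).smul (r.contDiffAt_act hJ hK (smooth_apply hT p))
  pd_act := by
    intro J K T u a hJ hK hT h dK
    have key : ContDiffAt ℝ ∞ (fun x => fun k => ∑ p, J x k p • r.act (J x) (K x) (T x p)) u := by
      refine contDiffAt_pi.2 fun c => ContDiffAt.sum fun p _ => ?_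
      exact (smooth_entry hJ c p).smul (r.contDiffAt_act hJ hK (smooth_apply hT p))
    ext c
    simp only [LinearMap.coe_mk, AddHom.coe_mk]
    rw [pd_apply key, pd_sum]
    · simp only [Pi.add_apply, LinearMap.mk₂_apply]
      have e : ∀ p, pd a (fun x => J x c p • r.act (J x) (K x) (T x p)) u =
          J u c p • r.act (J u) (K u) (pd a T u p + r.ρ (K u * pd a J u) (T u p))
            + (pd a J u) c p • r.act (J u) (K u) (T u p) := by
        intro p
        rw [pd_smul (smooth_entry hJ c p) (r.contDiffAt_act hJ hK (smooth_apply hT p)),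
          r.pd_act a hJ hK (smooth_apply hT p) h dK, ← pd_entry hJ, ← pd_apply hT]
      have e2 := sum_mul_smul' (J u) (K u * pd a J u) (fun q => r.act (J u) (K u) (T u q)) c
      rw [← mul_assoc, h, one_mul] at e2
      simp only [e, map_add, map_sum, map_smul, smul_add, Finset.sum_add_distrib, e2]
      abel
    · intro p _
      exact (smooth_entry hJ c p).smul (r.contDiffAt_act hJ hK (smooth_apply hT p))

@[simp] theorem triv_ρ (A : Mat) (v : V) : (triv V).ρ A v = 0 := rfl

@[simp] theorem triv_act (J K : Mat) (v : V) : (triv V).act J K v = v := rfl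

@[simp] theorem down_ρ (r : TRep V) (A : Mat) (F : Fin 4 → V) (c : Fin 4) :
    r.down.ρ A F c = r.ρ A (F c) - ∑ p, A p c • F p := rfl

@[simp] theorem up_ρ (r : TRep V) (A : Mat) (F : Fin 4 → V) (c : Fin 4) :
    r.up.ρ A F c = r.ρ A (F c) + ∑ p, A c p • F p := rfl

@[simp] theorem down_act (r : TRep V) (J K : Mat) (F : Fin 4 → V) (c : Fin 4) :
    r.down.act J K F c = ∑ p, K p c • r.act J K (F p) := rfl

@[simp] theorem up_act (r : TRep V) (J K : Mat) (F : Fin 4 → V) (c : Fin 4) :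
    r.up.act J K F c = ∑ p, J c p • r.act J K (F p) := rfl

end TRep

/-! ### Covariant derivatives and their naturality -/

section Cov

variable {V : Type*} [NormedAddCommGroup V] [NormedSpace ℝ V]

/-- The covariant derivative of a field with values in a representation, for the connection with
coefficients `Γ^k_{am} = Γ u a k m`. -/
def cov (r : TRep V) (Γ : E4 → Fin 4 → Mat) (T : E4 → V) : E4 → Fin 4 → V := fun u a =>
  pd a T u + r.ρ (Γ u a) (T u)

theorem smooth_cov [FiniteDimensional ℝ V] (r : TRep V) {Γ : E4 → Fin 4 → Mat} {T : E4 → V}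
    {u : E4} (hΓ : ∀ a, ContDiffAt ℝ ∞ (fun x => Γ x a) u) (hT : ContDiffAt ℝ ∞ T u) :
    ContDiffAt ℝ ∞ (cov r Γ T) u :=
  contDiffAt_pi.2 fun a => (smooth_pd hT a).add (smooth_bilin r.ρ (hΓ a) hT)

theorem cov_congr_on (r : TRep V) {Γ : E4 → Fin 4 → Mat} {S T : E4 → V} {s : Set E4}
    (hs : IsOpen s) (h : ∀ x ∈ s, S x = T x) {u : E4} (hu : u ∈ s) : cov r Γ S u = cov r Γ T u := by
  ext a; simp only [cov, pd_congr_on hs h hu, h u hu]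

/-- The Jacobian matrix of a map. -/
def jac (τ : E4 → E4) (x : E4) : Mat := Matrix.of fun p c => pd c τ x p

theorem pd_comp {τ : E4 → E4} {T : E4 → V} {u : E4} (hτ : ContDiffAt ℝ ∞ τ u)
    (hT : ContDiffAt ℝ ∞ T (τ u)) (a : Fin 4) :
    pd a (fun x => T (τ x)) u = ∑ q, jac τ u q a • pd q T (τ u) := by
  have h : pd a (fun x => T (τ x)) u = fderiv ℝ T (τ u) (pd a τ u) := by
    unfold pd
    have := fderiv_comp u (differentiableAt_of_smooth hT) (differentiableAt_of_smooth hτ)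
    simp only [Function.comp_def] at this
    rw [this]; rfl
  rw [h]
  have e : pd a τ u = ∑ q, (pd a τ u q) • EuclideanSpace.single q (1 : ℝ) := by
    ext i; simp [Finset.sum_apply, Pi.single_apply]
  conv_lhs => rw [e]
  simp only [map_sum, map_smul]
  rfl

/-- The naturality of the covariant derivative under a change of coordinates. -/
theorem cov_natural [FiniteDimensional ℝ V] (r : TRep V) {Γ Γ' : E4 → Fin 4 → Mat} {τ : E4 → E4} {J : E4 → Mat}
    {s : Set E4} (hs : IsOpen s) {u : E4} (hu : u ∈ s) (hτ : ContDiffAt ℝ ∞ τ u)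
    (hJ : ContDiffAt ℝ ∞ J u) (hK : ContDiffAt ℝ ∞ (jac τ) u) (hJK : J u * jac τ u = 1)
    (dK : ∀ a, pd a (jac τ) u = - (jac τ u * pd a J u * jac τ u))
    (hΓ : ∀ a, Γ' u a = J u * (∑ q, jac τ u q a • Γ (τ u) q) * jac τ u + J u * pd a (jac τ) u)
    {T T' : E4 → V} (hT : ContDiffAt ℝ ∞ T (τ u))
    (hT' : ∀ x ∈ s, T' x = r.act (J x) (jac τ x) (T (τ x))) :
    cov r Γ' T' u = r.down.act (J u) (jac τ u) (cov r Γ T (τ u)) := by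
  have hKJ : jac τ u * J u = 1 := mul_eq_one_comm.1 hJK
  ext a
  simp only [cov, TRep.down_act]
  have hTτ : ContDiffAt ℝ ∞ (fun x => T (τ x)) u := hT.comp u hτ
  rw [pd_congr_on hs hT' hu, r.pd_act a hJ hK hTτ hJK (dK a), hT' u hu, r.conj _ _ hJK,
    ← map_add, pd_comp hτ hT, add_assoc, ← LinearMap.add_apply, ← map_add]
  -- The inhomogeneous term in the transformation law of the connection is exactly what compensates
  -- the derivative of `act`; only the pulled back coefficients `Γ` are left.
  have e : jac τ u * pd a J u + jac τ u * Γ' u a * J u = ∑ q, jac τ u q a • Γ (τ u) q := by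
    have e1 : jac τ u * pd a J u = - (pd a (jac τ) u * J u) := by
      rw [dK a]; simp [mul_assoc, hKJ]
    rw [hΓ a, e1, mul_add, add_mul, ← mul_assoc, ← mul_assoc, ← mul_assoc, hKJ, one_mul, one_mul,
      mul_assoc, hKJ, mul_one]
    abel
  rw [e]
  simp [map_sum, Finset.sum_add_distrib, smul_add]

end Cov

end

section

attribute [local instance] Matrix.normedAddCommGroup Matrix.normedSpace

open Filter Topology

/-! ### Calculus of matrix-valued functions -/

section Matrices

theorem smooth_matmul {A B : E4 → Mat} {u : E4} (hA : ContDiffAt ℝ ∞ A u)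
    (hB : ContDiffAt ℝ ∞ B u) : ContDiffAt ℝ ∞ (fun x => A x * B x) u :=
  smooth_bilin (LinearMap.mul ℝ Mat) hA hB

theorem pd_matmul {A B : E4 → Mat} {u : E4} (hA : ContDiffAt ℝ ∞ A u)
    (hB : ContDiffAt ℝ ∞ B u) (a : Fin 4) :
    pd a (fun x => A x * B x) u = pd a A u * B u + A u * pd a B u :=
  pd_bilin (LinearMap.mul ℝ Mat) hA hB a

theorem smooth_transpose {A : E4 → Mat} {u : E4} (hA : ContDiffAt ℝ ∞ A u) :
    ContDiffAt ℝ ∞ (fun x => (A x).transpose) u :=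
  smooth_mat fun i j => smooth_entry hA j i

theorem pd_transpose {A : E4 → Mat} {u : E4} (hA : ContDiffAt ℝ ∞ A u) (a : Fin 4) :
    pd a (fun x => (A x).transpose) u = (pd a A u).transpose := by
  ext i j
  rw [pd_entry (smooth_transpose hA), Matrix.transpose_apply, pd_entry hA]; rfl

theorem smooth_det {n : ℕ} {A : E4 → Matrix (Fin n) (Fin n) ℝ} {u : E4}
    (hA : ∀ i j, ContDiffAt ℝ ∞ (fun x => A x i j) u) :
    ContDiffAt ℝ ∞ (fun x => (A x).det) u := by
  simp only [Matrix.det_apply']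
  exact ContDiffAt.sum fun σ _ => contDiffAt_const.mul (contDiffAt_prod fun i _ => hA _ _)

theorem smooth_inv {A : E4 → Mat} {u : E4} (hA : ContDiffAt ℝ ∞ A u) (h : (A u).det ≠ 0) :
    ContDiffAt ℝ ∞ (fun x => (A x)⁻¹) u := by
  refine smooth_mat fun i j => ?_
  simp only [Matrix.inv_def, Ring.inverse_eq_inv', Matrix.smul_apply, smul_eq_mul,
    Matrix.adjugate_apply]
  refine ((smooth_det (smooth_entry hA)).inv h).mul (smooth_det fun k l => ?_)
  by_cases hk : k = j
  · subst hk; simpa using contDiffAt_const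
  · simpa [Matrix.updateRow_ne hk] using smooth_entry hA k l

theorem pd_of_mul_eq_one {A B : E4 → Mat} {s : Set E4} (hs : IsOpen s) {u : E4} (hu : u ∈ s)
    (hA : ContDiffAt ℝ ∞ A u) (hB : ContDiffAt ℝ ∞ B u) (h : ∀ x ∈ s, A x * B x = 1) (a : Fin 4) :
    pd a B u = - (B u * pd a A u * B u) := by
  have h1 := pd_matmul hA hB a
  rw [pd_congr_on hs h hu, pd_const] at h1
  have h2 : B u * A u = 1 := mul_eq_one_comm.1 (h u hu)
  have h3 := congrArg (B u * ·) h1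
  simp only [mul_zero, mul_add, ← mul_assoc, h2, one_mul] at h3
  rw [eq_neg_iff_add_eq_zero, add_comm]; exact h3.symm

end Matrices

/-! ### Metrics in coordinates and the Levi-Civita connection -/

/-- A smooth nondegenerate symmetric matrix function on an open set. -/
structure IsMetricOn (G : E4 → Mat) (s : Set E4) : Prop where
  isOpen : IsOpen s
  smooth : ∀ u ∈ s, ContDiffAt ℝ ∞ G u
  symm : ∀ u ∈ s, (G u).transpose = G u
  det : ∀ u ∈ s, (G u).det ≠ 0

/-- The connection matrices of a metric. -/
def conn (G : E4 → Mat) (u : E4) (a : Fin 4) : Mat := Matrix.of fun k m => christoffel G u k a m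

namespace IsMetricOn

variable {G : E4 → Mat} {s : Set E4} (hG : IsMetricOn G s) {u : E4} (hu : u ∈ s)
include hG hu

theorem inv_mul : (G u)⁻¹ * G u = 1 := Matrix.nonsing_inv_mul _ (hG.det u hu).isUnit

theorem mul_inv : G u * (G u)⁻¹ = 1 := Matrix.mul_nonsing_inv _ (hG.det u hu).isUnit

theorem symm_apply (i j : Fin 4) : G u i j = G u j i := by
  conv_lhs => rw [← hG.symm u hu]
  rfl

theorem inv_transpose : ((G u)⁻¹).transpose = (G u)⁻¹ := by
  rw [Matrix.transpose_nonsing_inv, hG.symm u hu]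

theorem smooth_inv : ContDiffAt ℝ ∞ (fun x => (G x)⁻¹) u :=
  WeylOp.smooth_inv (hG.smooth u hu) (hG.det u hu)

theorem pd_symm (a i j : Fin 4) : pd a (fun x => G x i j) u = pd a (fun x => G x j i) u :=
  pd_congr_on hG.isOpen (fun _ hx => hG.symm_apply hx i j) hu a

theorem smooth_conn (a : Fin 4) : ContDiffAt ℝ ∞ (fun x => conn G x a) u := by
  refine smooth_mat fun k m => ?_
  refine contDiffAt_const.mul (ContDiffAt.sum fun l _ => ?_)
  exact (smooth_entry (hG.smooth_inv hu) k l).mul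
    (((smooth_pd (smooth_entry (hG.smooth u hu) m l) a).add
      (smooth_pd (smooth_entry (hG.smooth u hu) a l) m)).sub
      (smooth_pd (smooth_entry (hG.smooth u hu) a m) l))

theorem conn_symm (a k m : Fin 4) : conn G u a k m = conn G u m k a := by
  simp only [conn, Matrix.of_apply, christoffel]
  congr 1
  refine Finset.sum_congr rfl fun l _ => ?_
  have := hG.pd_symm hu l a m
  simp only [pd] at this
  simp only [partialDeriv, this]
  ring

theorem lower_conn (a i j : Fin 4) : ∑ k, G u j k * conn G u a k i =
    1 / 2 * (pd a (fun v => G v i j) u + pd i (fun v => G v a j) u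
      - pd j (fun v => G v a i) u) := by
  have h : ∀ X : Fin 4 → ℝ, ∑ k, G u j k * ∑ l, (G u)⁻¹ k l * X l = X j := by
    intro X
    have := sum_mul_smul' (G u) (G u)⁻¹ X j
    simp only [smul_eq_mul] at this
    rw [this, hG.mul_inv hu]
    simp [Matrix.one_apply]
  simp only [conn, Matrix.of_apply, christoffel]
  have e : ∀ k, G u j k * (1 / 2 * ∑ l, (G u)⁻¹ k l *
      (partialDeriv a (fun v => G v i l) u + partialDeriv i (fun v => G v a l) u
      - partialDeriv l (fun v => G v a i) u)) = 1 / 2 * (G u j k * ∑ l, (G u)⁻¹ k l *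
      (partialDeriv a (fun v => G v i l) u + partialDeriv i (fun v => G v a l) u
      - partialDeriv l (fun v => G v a i) u)) := fun k => by ring
  rw [Finset.sum_congr rfl fun k _ => e k, ← Finset.mul_sum, h]
  rfl

/-- This is `∇g = 0`. Both terms on the right are Christoffel symbols of the first kind by
`lower_conn`, and in their sum everything except `∂_a g_{ij}` cancels. -/
theorem pd_metric (a : Fin 4) :
    pd a G u = (conn G u a).transpose * G u + G u * conn G u a := by
  ext i j
  rw [pd_entry (hG.smooth u hu)]
  simp only [Matrix.add_apply, Matrix.mul_apply, Matrix.transpose_apply]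
  have e : ∑ k, conn G u a k i * G u k j = ∑ k, G u j k * conn G u a k i :=
    Finset.sum_congr rfl fun k _ => by rw [hG.symm_apply hu, mul_comm]
  rw [e, hG.lower_conn hu, hG.lower_conn hu, hG.pd_symm hu i a j, hG.pd_symm hu j a i,
    hG.pd_symm hu a j i]
  rw [hG.pd_symm hu i j a, hG.pd_symm hu j i a]
  ring

/-- The Levi-Civita connection is the only symmetric metric connection. -/
theorem conn_eq {Λ : Fin 4 → Mat} (hs : ∀ a k m, Λ a k m = Λ m k a)
    (hc : ∀ a, pd a G u = (Λ a).transpose * G u + G u * Λ a) (a : Fin 4) : conn G u a = Λ a := by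
  have hc' : ∀ a i j, pd a (fun x => G x i j) u =
      ∑ m, G u j m * Λ a m i + ∑ m, G u i m * Λ a m j := by
    intro a i j
    rw [← pd_entry (hG.smooth u hu), hc a]
    simp only [Matrix.add_apply, Matrix.mul_apply, Matrix.transpose_apply]
    congr 1
    exact Finset.sum_congr rfl fun k _ => by rw [hG.symm_apply hu, mul_comm]
  -- Koszul's argument: the three derivatives of the metric in `lower_conn` are expressed through
  -- `Λ`, and by the symmetry of `Λ` all but two equal terms cancel.
  have h : ∀ j i, ∑ k, G u j k * conn G u a k i = ∑ k, G u j k * Λ a k i := by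
    intro j i
    rw [hG.lower_conn hu, hc', hc', hc']
    have e1 : ∀ b c d : Fin 4, ∑ m, G u b m * Λ c m d = ∑ m, G u b m * Λ d m c := fun b c d =>
      Finset.sum_congr rfl fun m _ => by rw [hs]
    rw [e1 j i a, e1 a i j, e1 i j a]; ring
  have h2 : G u * conn G u a = G u * Λ a := by ext j i; exact h j i
  have h3 := congrArg ((G u)⁻¹ * ·) h2
  simpa only [← mul_assoc, hG.inv_mul hu, one_mul] using h3

theorem pd_inv (a : Fin 4) : pd a (fun x => (G x)⁻¹) u =
    - (conn G u a * (G u)⁻¹ + (G u)⁻¹ * (conn G u a).transpose) := by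
  rw [pd_of_mul_eq_one hG.isOpen hu (hG.smooth u hu) (hG.smooth_inv hu)
    (fun x hx => hG.mul_inv hx), hG.pd_metric hu, mul_add, add_mul]
  congr 1
  have h1 := hG.mul_inv hu
  have h2 := hG.inv_mul hu
  simp only [mul_assoc, h1, mul_one]
  rw [← mul_assoc _ (G u), h2, one_mul, add_comm]

end IsMetricOn

/-! ### Curvature and the Ricci identity -/

section Curvature

variable {V : Type*} [NormedAddCommGroup V] [NormedSpace ℝ V]

/-- The curvature endomorphisms of a connection. -/
def curv (Γ : E4 → Fin 4 → Mat) (u : E4) (i j : Fin 4) : Mat :=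
  pd i (fun x => Γ x j) u - pd j (fun x => Γ x i) u + (Γ u i * Γ u j - Γ u j * Γ u i)

theorem pd_comm {T : E4 → V} {u : E4} (hT : ContDiffAt ℝ ∞ T u) (i j : Fin 4) :
    pd i (pd j T) u = pd j (pd i T) u := by
  have h : IsSymmSndFDerivAt ℝ T u := hT.isSymmSndFDerivAt
    (by simpa using WithTop.coe_le_coe.2 (le_top : (2 : ℕ∞) ≤ ⊤))
  have e : ∀ i j, pd i (pd j T) u = fderiv ℝ (fderiv ℝ T) u (EuclideanSpace.single i (1 : ℝ))
      (EuclideanSpace.single j (1 : ℝ)) := by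
    intro i j
    unfold pd
    have hd : DifferentiableAt ℝ (fderiv ℝ T) u :=
      differentiableAt_of_smooth (hT.fderiv_right (m := ∞) (by simp))
    rw [fderiv_clm_apply hd (differentiableAt_const _)]
    simp
  rw [e, e, h.eq]

/-- The Ricci identity. -/
theorem cov_cov_comm [FiniteDimensional ℝ V] (r : TRep V) {Γ : E4 → Fin 4 → Mat} {T : E4 → V}
    {u : E4} (hΓ : ∀ a, ContDiffAt ℝ ∞ (fun x => Γ x a) u) (hT : ContDiffAt ℝ ∞ T u)
    (hs : ∀ a k m, Γ u a k m = Γ u m k a) (i j : Fin 4) :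
    cov r.down Γ (cov r Γ T) u i j - cov r.down Γ (cov r Γ T) u j i =
      r.ρ (curv Γ u i j) (T u) := by
  have e : ∀ i j, cov r.down Γ (cov r Γ T) u i j =
      pd i (pd j T) u + r.ρ (pd i (fun x => Γ x j) u) (T u) + r.ρ (Γ u j) (pd i T u)
        + r.ρ (Γ u i) (pd j T u) + r.ρ (Γ u i) (r.ρ (Γ u j) (T u))
        - ∑ p, Γ u i p j • cov r Γ T u p := by
    intro i j
    rw [cov, Pi.add_apply, pd_apply (smooth_cov r hΓ hT), TRep.down_ρ]
    simp only [cov]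
    rw [pd_add (smooth_pd hT j) (smooth_bilin r.ρ (hΓ j) hT), pd_bilin r.ρ (hΓ j) hT, map_add]
    abel
  -- The terms from the first derivative index are symmetric in `i, j` because there is no torsion,
  -- so they drop out of the commutator.
  have hsum : ∑ p, Γ u i p j • cov r Γ T u p = ∑ p, Γ u j p i • cov r Γ T u p :=
    Finset.sum_congr rfl fun p _ => by rw [hs]
  rw [e, e, pd_comm hT i j, hsum, curv, map_add, map_sub]
  simp only [LinearMap.add_apply, LinearMap.sub_apply, r.bracket]
  abel

theorem ricci_eq {G : E4 → Mat} {s : Set E4} (hG : IsMetricOn G s) {u : E4} (hu : u ∈ s)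
    (l j : Fin 4) : ricci G u l j = ∑ k, curv (conn G) u k j k l := by
  unfold ricci
  refine Finset.sum_congr rfl fun k _ => ?_
  simp only [curv, Matrix.add_apply, Matrix.sub_apply, Matrix.mul_apply,
    pd_entry (hG.smooth_conn hu _), Finset.sum_sub_distrib]
  rfl

end Curvature

end

section

attribute [local instance] Matrix.normedAddCommGroup Matrix.normedSpace

open Filter Topology

/-- Smoothness at all points of a set. -/
def SmoothOn {V : Type*} [NormedAddCommGroup V] [NormedSpace ℝ V] (s : Set E4) (T : E4 → V) :
    Prop :=
  ∀ u ∈ s, ContDiffAt ℝ ∞ T u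

/-! ### Parallel bilinear maps and parallel families of subspaces -/

section Parallel

variable {V V₁ V₂ V₃ : Type*} [NormedAddCommGroup V] [NormedSpace ℝ V]
  [NormedAddCommGroup V₁] [NormedSpace ℝ V₁] [NormedAddCommGroup V₂] [NormedSpace ℝ V₂]
  [NormedAddCommGroup V₃] [NormedSpace ℝ V₃] {Γ : E4 → Fin 4 → Mat} {s : Set E4}

theorem SmoothOn.apply {ι : Type*} [Fintype ι] {T : E4 → ι → V} (h : SmoothOn s T) (i : ι) :
    SmoothOn s (fun x => T x i) := fun u hu => smooth_apply (h u hu) i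

theorem SmoothOn.pi {ι : Type*} [Fintype ι] {T : E4 → ι → V} (h : ∀ i, SmoothOn s fun x => T x i) :
    SmoothOn s T := fun u hu => contDiffAt_pi.2 fun i => h i u hu

theorem SmoothOn.add {S T : E4 → V} (hS : SmoothOn s S) (hT : SmoothOn s T) :
    SmoothOn s (fun x => S x + T x) := fun u hu => (hS u hu).add (hT u hu)

theorem SmoothOn.cov [FiniteDimensional ℝ V] (r : TRep V) (hΓ : ∀ a, SmoothOn s fun x => Γ x a)
    {T : E4 → V} (hT : SmoothOn s T) : SmoothOn s (cov r Γ T) :=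
  fun u hu => smooth_cov r (fun a => hΓ a u hu) (hT u hu)

theorem cov_down (r : TRep V) {F : E4 → Fin 4 → V} {u : E4} (hF : ContDiffAt ℝ ∞ F u)
    (a c : Fin 4) : cov r.down Γ F u a c =
      cov r Γ (fun x => F x c) u a - ∑ p, Γ u a p c • F u p := by
  simp only [cov, Pi.add_apply, TRep.down_ρ, pd_apply hF]
  abel

theorem cov_add (r : TRep V) {S T : E4 → V} {u : E4} (hS : ContDiffAt ℝ ∞ S u)
    (hT : ContDiffAt ℝ ∞ T u) :
    cov r Γ (fun x => S x + T x) u = cov r Γ S u + cov r Γ T u := by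
  ext a
  simp only [cov, Pi.add_apply, pd_add hS hT, map_add]
  abel

/-- A family of bilinear maps that satisfies the Leibniz rule for covariant derivatives. -/
structure IsParBilin (Γ : E4 → Fin 4 → Mat) (s : Set E4) (r₁ : TRep V₁) (r₂ : TRep V₂)
    (r₃ : TRep V₃) (B : E4 → V₁ →ₗ[ℝ] V₂ →ₗ[ℝ] V₃) : Prop where
  smooth : ∀ {S : E4 → V₁} {T : E4 → V₂}, SmoothOn s S → SmoothOn s T →
    SmoothOn s fun x => B x (S x) (T x)
  leibniz : ∀ {S : E4 → V₁} {T : E4 → V₂}, SmoothOn s S → SmoothOn s T → ∀ u ∈ s, ∀ a,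
    cov r₃ Γ (fun x => B x (S x) (T x)) u a =
      B u (cov r₁ Γ S u a) (T u) + B u (S u) (cov r₂ Γ T u a)

/-- Extension of a bilinear map by an additional index of the first argument. -/
def liftL (B : V₁ →ₗ[ℝ] V₂ →ₗ[ℝ] V₃) : (Fin 4 → V₁) →ₗ[ℝ] V₂ →ₗ[ℝ] (Fin 4 → V₃) :=
  LinearMap.mk₂ ℝ (fun F T c => B (F c) T) (by intros; ext; simp) (by intros; ext; simp)
    (by intros; ext; simp) (by intros; ext; simp)

/-- Extension of a bilinear map by an additional index of the second argument. -/
def liftR (B : V₁ →ₗ[ℝ] V₂ →ₗ[ℝ] V₃) : V₁ →ₗ[ℝ] (Fin 4 → V₂) →ₗ[ℝ] (Fin 4 → V₃) :=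
  LinearMap.mk₂ ℝ (fun S F c => B S (F c)) (by intros; ext; simp) (by intros; ext; simp)
    (by intros; ext; simp) (by intros; ext; simp)

@[simp] theorem liftL_apply (B : V₁ →ₗ[ℝ] V₂ →ₗ[ℝ] V₃) (F : Fin 4 → V₁) (T : V₂) (c : Fin 4) :
    liftL B F T c = B (F c) T := rfl

@[simp] theorem liftR_apply (B : V₁ →ₗ[ℝ] V₂ →ₗ[ℝ] V₃) (S : V₁) (F : Fin 4 → V₂) (c : Fin 4) :
    liftR B S F c = B S (F c) := rfl

variable {r₁ : TRep V₁} {r₂ : TRep V₂} {r₃ : TRep V₃} {B : E4 → V₁ →ₗ[ℝ] V₂ →ₗ[ℝ] V₃}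

theorem IsParBilin.liftL (h : IsParBilin Γ s r₁ r₂ r₃ B) :
    IsParBilin Γ s r₁.down r₂ r₃.down (fun x => liftL (B x)) where
  smooth hS hT := SmoothOn.pi fun c => h.smooth (hS.apply c) hT
  leibniz {S T} hS hT u hu a := by
    have hs : SmoothOn s fun x => WeylOp.liftL (B x) (S x) (T x) :=
      SmoothOn.pi fun c => h.smooth (hS.apply c) hT
    ext c
    rw [cov_down _ (hs u hu)]
    simp only [liftL_apply, Pi.add_apply, h.leibniz (hS.apply c) hT u hu, cov_down _ (hS u hu),
      map_sub, map_sum, map_smul, LinearMap.sub_apply, LinearMap.sum_apply, LinearMap.smul_apply]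
    abel

theorem IsParBilin.liftR (h : IsParBilin Γ s r₁ r₂ r₃ B) :
    IsParBilin Γ s r₁ r₂.down r₃.down (fun x => liftR (B x)) where
  smooth hS hT := SmoothOn.pi fun c => h.smooth hS (hT.apply c)
  leibniz {S T} hS hT u hu a := by
    have hs : SmoothOn s fun x => WeylOp.liftR (B x) (S x) (T x) :=
      SmoothOn.pi fun c => h.smooth hS (hT.apply c)
    ext c
    rw [cov_down _ (hs u hu)]
    simp only [liftR_apply, Pi.add_apply, h.leibniz hS (hT.apply c) u hu, cov_down _ (hT u hu),
      map_sub, map_sum, map_smul]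
    abel

/-- Scalar multiplication as a bilinear map. -/
def scal (V : Type*) [NormedAddCommGroup V] [NormedSpace ℝ V] : ℝ →ₗ[ℝ] V →ₗ[ℝ] V :=
  LinearMap.lsmul ℝ V

@[simp] theorem scal_apply (c : ℝ) (v : V) : scal V c v = c • v := rfl

theorem isParBilin_scal (r : TRep V) : IsParBilin Γ s (TRep.triv ℝ) r r (fun _ => scal V) where
  smooth hS hT u hu := (hS u hu).smul (hT u hu)
  leibniz hS hT u hu a := by
    simp only [cov, scal_apply, pd_smul (hS u hu) (hT u hu), TRep.triv_ρ, map_smul, smul_add,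
      add_zero]
    abel

/-- A family of subspaces that is preserved by covariant differentiation. -/
def IsParSub (Γ : E4 → Fin 4 → Mat) (s : Set E4) (r : TRep V) (W : E4 → Submodule ℝ V) : Prop :=
  ∀ T : E4 → V, SmoothOn s T → (∀ x ∈ s, T x ∈ W x) → ∀ u ∈ s, ∀ a, cov r Γ T u a ∈ W u

/-- The arrays with entries in a given subspace. -/
def piSub (W : Submodule ℝ V) : Submodule ℝ (Fin 4 → V) := Submodule.pi Set.univ fun _ => W

@[simp] theorem mem_piSub {W : Submodule ℝ V} {F : Fin 4 → V} : F ∈ piSub W ↔ ∀ c, F c ∈ W := by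
  simp [piSub]

theorem IsParSub.down {r : TRep V} {W : E4 → Submodule ℝ V} (h : IsParSub Γ s r W) :
    IsParSub Γ s r.down (fun x => piSub (W x)) := by
  intro T hT hW u hu a
  rw [mem_piSub]
  intro c
  rw [cov_down _ (hT u hu)]
  exact sub_mem (h _ (hT.apply c) (fun x hx => mem_piSub.1 (hW x hx) c) u hu a)
    (sum_mem fun p _ => (W u).smul_mem _ (mem_piSub.1 (hW u hu) p))

theorem IsParSub.cov_mem {r : TRep V} {W : E4 → Submodule ℝ V} (h : IsParSub Γ s r W) {T : E4 → V}
    (hT : SmoothOn s T) (hW : ∀ x ∈ s, T x ∈ W x) : ∀ x ∈ s, cov r Γ T x ∈ piSub (W x) :=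
  fun u hu => mem_piSub.2 fun a => h T hT hW u hu a

end Parallel

/-! ### The conformal difference tensor -/

section Conformal

/-- The difference of the Levi-Civita connections of conformal metrics. -/
def confMat (g h : Mat) (θ : Fin 4 → ℝ) (c : Fin 4) : Mat :=
  Matrix.of fun k m => (if k = c then θ m else 0) + (if k = m then θ c else 0)
    - g c m * ∑ p, h k p * θ p

theorem confMat_add (g h : Mat) (θ θ' : Fin 4 → ℝ) (c : Fin 4) :
    confMat g h (θ + θ') c = confMat g h θ c + confMat g h θ' c := by
  ext k m
  simp only [confMat, Matrix.of_apply, Matrix.add_apply, Pi.add_apply, mul_add,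
    Finset.sum_add_distrib]
  split_ifs <;> ring

theorem confMat_smul (g h : Mat) (t : ℝ) (θ : Fin 4 → ℝ) (c : Fin 4) :
    confMat g h (t • θ) c = t • confMat g h θ c := by
  ext k m
  have : ∑ p, h k p * (t * θ p) = t * ∑ p, h k p * θ p := by
    rw [Finset.mul_sum]; exact Finset.sum_congr rfl fun p _ => by ring
  simp only [confMat, Matrix.of_apply, Matrix.smul_apply, Pi.smul_apply, smul_eq_mul, this]
  split_ifs <;> ring

variable {V : Type*} [NormedAddCommGroup V] [NormedSpace ℝ V]

/-- The action of `confMat` on tensors. -/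
def confAct (r : TRep V) (g h : Mat) : (Fin 4 → ℝ) →ₗ[ℝ] V →ₗ[ℝ] (Fin 4 → V) :=
  LinearMap.mk₂ ℝ (fun θ T c => r.ρ (confMat g h θ c) T)
    (by intros; ext; simp [confMat_add]) (by intros; ext; simp [confMat_smul])
    (by intros; ext; simp) (by intros; ext; simp)

@[simp] theorem confAct_apply (r : TRep V) (g h : Mat) (θ : Fin 4 → ℝ) (T : V) (c : Fin 4) :
    confAct r g h θ T c = r.ρ (confMat g h θ c) T := rfl

variable {G : E4 → Mat} {s : Set E4} (hG : IsMetricOn G s)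
include hG

theorem smooth_confMat {θ : E4 → Fin 4 → ℝ} {u : E4} (hu : u ∈ s) (hθ : ContDiffAt ℝ ∞ θ u)
    (c : Fin 4) : ContDiffAt ℝ ∞ (fun x => confMat (G x) (G x)⁻¹ (θ x) c) u := by
  refine smooth_mat fun k m => ?_
  simp only [confMat, Matrix.of_apply]
  refine (ContDiffAt.add ?_ ?_).sub ((smooth_entry (hG.smooth u hu) c m).mul
    (ContDiffAt.sum fun p _ => (smooth_entry (hG.smooth_inv hu) k p).mul (smooth_apply hθ p)))
  · split_ifs
    · exact smooth_apply hθ m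
    · exact contDiffAt_const
  · split_ifs
    · exact smooth_apply hθ c
    · exact contDiffAt_const

/-- The left-hand side is the covariant derivative of the difference tensor, with a commutator for
its endomorphism indices and a sum for its lower index. The tensor is composed of `θ`, the metric,
its inverse and the Kronecker delta; all of these except `θ` are parallel, so only `θ` gets
differentiated. -/
theorem pd_confMat {θ : E4 → Fin 4 → ℝ} {u : E4} (hu : u ∈ s) (hθ : ContDiffAt ℝ ∞ θ u)
    (a c : Fin 4) :
    pd a (fun x => confMat (G x) (G x)⁻¹ (θ x) c) u
      + (conn G u a * confMat (G u) (G u)⁻¹ (θ u) c - confMat (G u) (G u)⁻¹ (θ u) c * conn G u a)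
      - ∑ p, conn G u a p c • confMat (G u) (G u)⁻¹ (θ u) p =
    confMat (G u) (G u)⁻¹ (cov (TRep.triv ℝ).down (conn G) θ u a) c := by
  have hg := hG.smooth u hu
  have hh := hG.smooth_inv hu
  have hS : ∀ k, ContDiffAt ℝ ∞ (fun x => ∑ p, (G x)⁻¹ k p * θ x p) u := fun k =>
    ContDiffAt.sum fun p _ => (smooth_entry hh k p).mul (smooth_apply hθ p)
  have hif : ∀ (P : Prop) [Decidable P] (m : Fin 4),
      ContDiffAt ℝ ∞ (fun x => if P then θ x m else 0) u := by
    intro P _ m; split_ifs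
    · exact smooth_apply hθ m
    · exact contDiffAt_const
  have pdif : ∀ (P : Prop) [Decidable P] (m : Fin 4),
      pd a (fun x => if P then θ x m else 0) u = if P then pd a θ u m else 0 := by
    intro P _ m; split_ifs
    · rw [pd_apply hθ]
    · exact pd_const _ _ _
  set Γ := conn G u a with hΓ
  set t : Fin 4 → ℝ := θ u with ht
  set S : Fin 4 → ℝ := fun k => ∑ p, (G u)⁻¹ k p * t p with hSdef
  set D := cov (TRep.triv ℝ).down (conn G) θ u a with hD
  have hDa : ∀ m, D m = pd a θ u m - ∑ p, Γ p m * t p := by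
    intro m
    simp only [hD, cov, Pi.add_apply, TRep.down_ρ, TRep.triv_ρ, smul_eq_mul]
    ring
  -- Raising the index commutes with covariant differentiation; `pd_inv` supplies the connection
  -- term of the upper index.
  have pS : ∀ k, pd a (fun x => ∑ p, (G x)⁻¹ k p * θ x p) u =
      ∑ p, (G u)⁻¹ k p * D p - ∑ p, Γ k p * S p := by
    intro k
    rw [pd_sum _ fun p _ => (smooth_entry hh k p).mul (smooth_apply hθ p)]
    have e : ∀ p, pd a (fun x => (G x)⁻¹ k p * θ x p) u =
        (G u)⁻¹ k p * pd a θ u p - (∑ q, Γ k q * (G u)⁻¹ q p + ∑ q, (G u)⁻¹ k q * Γ p q) * t p := by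
      intro p
      rw [pd_mul (smooth_entry hh k p) (smooth_apply hθ p), ← pd_entry hh, hG.pd_inv hu,
        ← pd_apply hθ]
      simp only [Matrix.neg_apply, Matrix.add_apply, Matrix.mul_apply, Matrix.transpose_apply]
      ring
    rw [Finset.sum_congr rfl fun p _ => e p]
    simp only [hDa, hSdef, mul_sub, Finset.sum_sub_distrib, add_mul, Finset.sum_add_distrib,
      Finset.sum_mul, Finset.mul_sum]
    have c1 : ∑ p, ∑ q, Γ k q * (G u)⁻¹ q p * t p = ∑ p, ∑ q, Γ k p * ((G u)⁻¹ p q * t q) := by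
      rw [Finset.sum_comm]; simp only [mul_assoc]
    have c2 : ∑ p, ∑ q, (G u)⁻¹ k q * Γ p q * t p = ∑ p, ∑ q, (G u)⁻¹ k p * (Γ q p * t q) := by
      rw [Finset.sum_comm]; simp only [mul_assoc]
    rw [c1, c2]; ring
  ext k m
  rw [Matrix.sub_apply, Matrix.add_apply, pd_entry (smooth_confMat hG hu hθ c)]
  simp only [confMat, Matrix.of_apply]
  rw [pd_sub ((hif _ _).add (hif _ _)) ((smooth_entry hg c m).mul (hS k)),
    pd_add (hif _ _) (hif _ _), pd_mul (smooth_entry hg c m) (hS k), pdif, pdif, pS,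
    ← pd_entry hg, hG.pd_metric hu, hDa m, hDa c]
  have e1 : ∀ (A : Mat), (A * confMat (G u) (G u)⁻¹ t c) k m =
      A k c * t m + A k m * t c - G u c m * ∑ p, A k p * S p := by
    intro A
    simp only [Matrix.mul_apply, confMat, Matrix.of_apply, mul_sub, mul_add,
      Finset.sum_add_distrib, Finset.sum_sub_distrib, mul_ite, mul_zero, Finset.sum_ite_eq',
      Finset.mem_univ, if_true]
    congr 1
    rw [Finset.mul_sum]
    exact Finset.sum_congr rfl fun p _ => by simp only [hSdef]; ring
  have e2 : (confMat (G u) (G u)⁻¹ t c * Γ) k m =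
      (if k = c then ∑ p, Γ p m * t p else 0) + Γ k m * t c
        - (∑ p, G u c p * Γ p m) * S k := by
    simp only [Matrix.mul_apply, confMat, Matrix.of_apply, sub_mul, add_mul,
      Finset.sum_add_distrib, Finset.sum_sub_distrib, ite_mul, zero_mul, Finset.sum_ite_eq,
      Finset.mem_univ, if_true]
    congr 1
    · congr 1
      · split_ifs
        · exact Finset.sum_congr rfl fun p _ => mul_comm _ _
        · simp
      · ring
    · rw [Finset.sum_mul]
      exact Finset.sum_congr rfl fun p _ => by simp only [hSdef]; ring
  have e3 : (∑ p, Γ p c • confMat (G u) (G u)⁻¹ t p) k m =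
      Γ k c * t m + (if k = m then ∑ p, Γ p c * t p else 0) - (∑ p, Γ p c * G u p m) * S k := by
    simp only [Matrix.sum_apply, Matrix.smul_apply, confMat, Matrix.of_apply, smul_eq_mul, mul_sub,
      mul_add, Finset.sum_add_distrib, Finset.sum_sub_distrib, mul_ite, mul_zero,
      Finset.sum_ite_eq, Finset.mem_univ, if_true]
    congr 1
    · congr 1
      split_ifs <;> simp
    · rw [Finset.sum_mul]
      exact Finset.sum_congr rfl fun p _ => by simp only [hSdef]; ring
  have e1' := e1 Γ
  simp only [← ht]
  rw [Matrix.sub_apply]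
  have f1 : (Γ * Matrix.of fun k m => ((if k = c then t m else 0) + if k = m then t c else 0)
      - G u c m * ∑ p, (G u)⁻¹ k p * t p) k m = _ := e1'
  have f2 : ((Matrix.of fun k m => ((if k = c then t m else 0) + if k = m then t c else 0)
      - G u c m * ∑ p, (G u)⁻¹ k p * t p) * Γ) k m = _ := e2
  have f3 : (∑ p, Γ p c • (Matrix.of fun k m => ((if k = p then t m else 0) +
      if k = m then t p else 0) - G u p m * ∑ p, (G u)⁻¹ k p * t p)) k m = _ := e3
  rw [f1, f2, f3]
  have e4 : ((conn G u a).transpose * G u + G u * conn G u a) c m =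
      ∑ p, Γ p c * G u p m + ∑ p, G u c p * Γ p m := by
    simp only [Matrix.add_apply, Matrix.mul_apply, Matrix.transpose_apply]; rfl
  rw [e4]
  have e5 : ∑ p, (G u)⁻¹ k p * t p = S k := rfl
  rw [e5]
  split_ifs <;> ring

/-- By `pd_confMat` the derivative of the matrix is the matrix of `∇θ` up to a commutator with the
connection, and the bracket relation of the representation turns this commutator into the terms that
the Leibniz rule requires. -/
theorem isParBilin_confAct [FiniteDimensional ℝ V] (r : TRep V) :
    IsParBilin (conn G) s (TRep.triv ℝ).down r r.down
      (fun x => confAct r (G x) (G x)⁻¹) where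
  smooth hS hT := SmoothOn.pi fun c u hu =>
    smooth_bilin r.ρ (smooth_confMat hG hu (hS u hu) c) (hT u hu)
  leibniz {S T} hS hT u hu a := by
    have hs : SmoothOn s fun x => confAct r (G x) (G x)⁻¹ (S x) (T x) :=
      SmoothOn.pi fun c u hu => smooth_bilin r.ρ (smooth_confMat hG hu (hS u hu) c) (hT u hu)
    ext c
    rw [cov_down _ (hs u hu)]
    simp only [Pi.add_apply, confAct_apply, ← pd_confMat hG hu (hS u hu) a c]
    simp only [cov, pd_bilin r.ρ (smooth_confMat hG hu (hS u hu) c) (hT u hu), map_add, map_sub,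
      map_sum, map_smul, LinearMap.add_apply, LinearMap.sub_apply, LinearMap.sum_apply,
      LinearMap.smul_apply]
    have := r.bracket (conn G u a) (confMat (G u) (G u)⁻¹ (S u) c) (T u)
    rw [map_sub, LinearMap.sub_apply] at this
    rw [this]
    abel

/-- The metric is parallel. -/
theorem cov_metric {u : E4} (hu : u ∈ s) (a : Fin 4) :
    cov (TRep.triv ℝ).down.down (conn G) (fun x => (fun i j => G x i j : Fin 4 → Fin 4 → ℝ)) u a =
      0 := by
  ext i j
  have hg := hG.smooth u hu
  have h1 : pd a (fun x => (fun i j => G x i j : Fin 4 → Fin 4 → ℝ)) u i j = pd a G u i j := rfl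
  simp only [cov, Pi.add_apply, Pi.sub_apply, TRep.down_ρ, TRep.triv_ρ, h1, hG.pd_metric hu, Matrix.add_apply,
    Matrix.mul_apply, Matrix.transpose_apply, Finset.sum_apply, Pi.smul_apply, smul_eq_mul,
    Pi.zero_apply, mul_comm (G u _ _)]
  ring

end Conformal

end

section

attribute [local instance] Matrix.normedAddCommGroup Matrix.normedSpace

open Filter Topology

/-- The Schouten tensor as a field of arrays. -/
def schoutenField (G : E4 → Mat) (u : E4) (a c : Fin 4) : ℝ := schouten G u ![] ![a, c]

/-! ### Smoothness of the curvature tensors -/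

section Smoothness

variable {G : E4 → Mat} {s : Set E4} (hG : IsMetricOn G s)
include hG

theorem smooth_curv {u : E4} (hu : u ∈ s) (i j : Fin 4) :
    ContDiffAt ℝ ∞ (fun x => curv (conn G) x i j) u :=
  ((smooth_pd (hG.smooth_conn hu j) i).sub (smooth_pd (hG.smooth_conn hu i) j)).add
    ((smooth_matmul (hG.smooth_conn hu i) (hG.smooth_conn hu j)).sub
      (smooth_matmul (hG.smooth_conn hu j) (hG.smooth_conn hu i)))

theorem smooth_ricci {u : E4} (hu : u ∈ s) (l j : Fin 4) :
    ContDiffAt ℝ ∞ (fun x => ricci G x l j) u := by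
  have h : ContDiffAt ℝ ∞ (fun x => ∑ k, curv (conn G) x k j k l) u :=
    ContDiffAt.sum fun k _ => smooth_entry (smooth_curv hG hu k j) k l
  exact h.congr_of_eventuallyEq
    (eventually_of_mem (hG.isOpen.mem_nhds hu) fun x hx => ricci_eq hG hx l j)

theorem smooth_scalarCurv {u : E4} (hu : u ∈ s) : ContDiffAt ℝ ∞ (scalarCurv G) u :=
  ContDiffAt.sum fun i _ => ContDiffAt.sum fun j _ =>
    (smooth_entry (hG.smooth_inv hu) i j).mul (smooth_ricci hG hu i j)

theorem smooth_schoutenField : SmoothOn s (schoutenField G) := fun u hu =>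
  contDiffAt_pi.2 fun a => contDiffAt_pi.2 fun c =>
    contDiffAt_const.mul ((smooth_ricci hG hu a c).sub
      (((smooth_scalarCurv hG hu).div_const 6).mul (smooth_entry (hG.smooth u hu) a c)))

end Smoothness

/-! ### Conformal change of the connection, the curvature and the Schouten tensor -/

section Conformal

/-- The logarithmic derivative of a positive function. -/
def dlog (Ω : E4 → ℝ) (u : E4) (a : Fin 4) : ℝ := (Ω u)⁻¹ * pd a Ω u

/-- Conformal metrics on an open set. -/
structure IsConformalOn (G G' : E4 → Mat) (Ω : E4 → ℝ) (s : Set E4) : Prop where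
  left : IsMetricOn G s
  right : IsMetricOn G' s
  smooth : SmoothOn s Ω
  pos : ∀ u ∈ s, 0 < Ω u
  eq : ∀ u ∈ s, G' u = (Ω u ^ 2) • G u

variable {G G' : E4 → Mat} {Ω : E4 → ℝ} {s : Set E4} (h : IsConformalOn G G' Ω s)
include h

namespace IsConformalOn

theorem smooth_dlog : SmoothOn s (dlog Ω) := fun u hu => contDiffAt_pi.2 fun a =>
  ((h.smooth u hu).inv (h.pos u hu).ne').mul (smooth_pd (h.smooth u hu) a)

/-- By uniqueness of the Levi-Civita connection, it is enough that the right-hand side is symmetric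
and makes `Ω² G` parallel. The difference tensor is a skew part plus `θ_a` times the identity, which
matches the derivative `2 Ω² θ_a` of the conformal factor. -/
theorem conn_eq {u : E4} (hu : u ∈ s) (a : Fin 4) :
    conn G' u a = conn G u a + confMat (G u) (G u)⁻¹ (dlog Ω u) a := by
  have hG := h.left
  have hΩ := (h.pos u hu).ne'
  have hS : ∀ j, ∑ k, G u j k * ∑ p, (G u)⁻¹ k p * dlog Ω u p = dlog Ω u j := by
    intro j
    have := sum_mul_smul' (G u) (G u)⁻¹ (dlog Ω u) j
    simp only [smul_eq_mul] at this
    rw [this, hG.mul_inv hu]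
    simp [Matrix.one_apply]
  refine h.right.conn_eq hu (Λ := fun a => conn G u a + confMat (G u) (G u)⁻¹ (dlog Ω u) a)
    ?_ ?_ a
  · intro a k m
    simp only [Matrix.add_apply, hG.conn_symm hu a k m, confMat, Matrix.of_apply,
      hG.symm_apply hu a m]
    ring
  · intro a
    have hsm : ContDiffAt ℝ ∞ (fun x => Ω x ^ 2) u := (h.smooth u hu).pow 2
    rw [pd_congr_on hG.isOpen h.eq hu, pd_smul hsm (hG.smooth u hu), h.eq u hu, hG.pd_metric hu]
    have e1 : pd a (fun x => Ω x ^ 2) u = 2 * (Ω u ^ 2 * dlog Ω u a) := by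
      have e : (fun x => Ω x ^ 2) = fun x => Ω x * Ω x := by ext; ring
      rw [e, pd_mul (h.smooth u hu) (h.smooth u hu), dlog]
      field_simp
      ring
    have e2 : (confMat (G u) (G u)⁻¹ (dlog Ω u) a).transpose * G u
        + G u * confMat (G u) (G u)⁻¹ (dlog Ω u) a = (2 * dlog Ω u a) • G u := by
      have e3 : ∀ i j, (G u * confMat (G u) (G u)⁻¹ (dlog Ω u) a) i j =
          G u i a * dlog Ω u j + G u i j * dlog Ω u a - G u a j * dlog Ω u i := by
        intro i j
        simp only [Matrix.mul_apply, confMat, Matrix.of_apply, mul_sub, mul_add,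
          Finset.sum_add_distrib, Finset.sum_sub_distrib, mul_ite, mul_zero, Finset.sum_ite_eq',
          Finset.mem_univ, if_true]
        congr 1
        rw [← hS i, Finset.mul_sum]
        exact Finset.sum_congr rfl fun p _ => by ring
      have e4 : (confMat (G u) (G u)⁻¹ (dlog Ω u) a).transpose * G u =
          (G u * confMat (G u) (G u)⁻¹ (dlog Ω u) a).transpose := by
        rw [Matrix.transpose_mul, hG.symm u hu]
      ext i j
      rw [e4, Matrix.add_apply, Matrix.transpose_apply, e3, e3, Matrix.smul_apply, smul_eq_mul,
        hG.symm_apply hu i a, hG.symm_apply hu j a, hG.symm_apply hu j i]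
      ring
    rw [Matrix.transpose_add, add_mul, mul_add, e1, Matrix.mul_smul, Matrix.mul_smul,
      Matrix.smul_mul, Matrix.smul_mul]
    have e5 := congrArg ((Ω u ^ 2) • ·) e2
    simp only [smul_add] at e5 ⊢
    rw [← sub_eq_zero] at e5 ⊢
    rw [← neg_eq_zero, ← e5, smul_smul]
    have : 2 * (Ω u ^ 2 * dlog Ω u a) = Ω u ^ 2 * (2 * dlog Ω u a) := by ring
    rw [this]
    abel

/-- The gradient of the logarithmic derivative is symmetric. -/
theorem cov_dlog_symm {u : E4} (hu : u ∈ s) (a c : Fin 4) :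
    cov (TRep.triv ℝ).down (conn G) (dlog Ω) u a c =
      cov (TRep.triv ℝ).down (conn G) (dlog Ω) u c a := by
  have hΩ := (h.pos u hu).ne'
  have e : ∀ a c, pd a (dlog Ω) u c =
      pd a (fun x => (Ω x)⁻¹) u * pd c Ω u + (Ω u)⁻¹ * pd a (pd c Ω) u := by
    intro a c
    rw [pd_apply (h.smooth_dlog u hu)]
    exact pd_mul ((h.smooth u hu).inv hΩ) (smooth_pd (h.smooth u hu) c) a
  have e2 : ∀ a, pd a (fun x => (Ω x)⁻¹) u = - (pd a Ω u * (Ω u)⁻¹ ^ 2) := by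
    intro a
    have h1 := pd_mul (d := fun x => (Ω x)⁻¹) (h.smooth u hu) ((h.smooth u hu).inv hΩ) a
    rw [pd_congr_on (T := fun _ => (1 : ℝ)) h.left.isOpen
      (fun x hx => mul_inv_cancel₀ (h.pos x hx).ne') hu, pd_const] at h1
    field_simp at h1 ⊢
    linear_combination -h1
  simp only [cov, Pi.add_apply, e, e2, TRep.down_ρ, TRep.triv_ρ, pd_comm (h.smooth u hu) a c,
    h.left.conn_symm hu a _ c]
  ring

/-- The curvature of a connection changed by a one-form with matrix values is the old one plus the
covariant exterior derivative of this form plus its commutator square. The exterior derivative is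
given by `pd_confMat`, and its torsion terms cancel. -/
theorem curv_eq {u : E4} (hu : u ∈ s) (i j : Fin 4) :
    curv (conn G') u i j = curv (conn G) u i j
      + confMat (G u) (G u)⁻¹ (cov (TRep.triv ℝ).down (conn G) (dlog Ω) u i) j
      - confMat (G u) (G u)⁻¹ (cov (TRep.triv ℝ).down (conn G) (dlog Ω) u j) i
      + (confMat (G u) (G u)⁻¹ (dlog Ω u) i * confMat (G u) (G u)⁻¹ (dlog Ω u) j
        - confMat (G u) (G u)⁻¹ (dlog Ω u) j * confMat (G u) (G u)⁻¹ (dlog Ω u) i) := by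
  have hG := h.left
  have hθ := h.smooth_dlog u hu
  have e : ∀ i j, pd i (fun x => conn G' x j) u = pd i (fun x => conn G x j) u +
      pd i (fun x => confMat (G x) (G x)⁻¹ (dlog Ω x) j) u := by
    intro i j
    rw [pd_congr_on hG.isOpen (fun x hx => h.conn_eq hx j) hu,
      pd_add (hG.smooth_conn hu j) (smooth_confMat hG hu hθ j)]
  have hsum : ∑ p, conn G u i p j • confMat (G u) (G u)⁻¹ (dlog Ω u) p =
      ∑ p, conn G u j p i • confMat (G u) (G u)⁻¹ (dlog Ω u) p :=
    Finset.sum_congr rfl fun p _ => by rw [hG.conn_symm hu]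
  rw [← pd_confMat hG hu hθ i j, ← pd_confMat hG hu hθ j i, hsum]
  simp only [curv, e, h.conn_eq hu]
  noncomm_ring

/-- The multiple of the metric can stay implicit, since multiples of the metric are invisible to the
trace-free projection in the operator. -/
theorem ricci_conf {u : E4} (hu : u ∈ s) : ∃ c : ℝ, ∀ l j, ricci G' u l j = ricci G u l j
    - 2 * cov (TRep.triv ℝ).down (conn G) (dlog Ω) u l j + 2 * (dlog Ω u l * dlog Ω u j)
      + c * G u l j := by
  have hG := h.left
  set g := G u with hg
  set H := (G u)⁻¹ with hH
  set θ := dlog Ω u with hθ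
  set η := cov (TRep.triv ℝ).down (conn G) (dlog Ω) u with hη
  set S : (Fin 4 → ℝ) → Fin 4 → ℝ := fun t k => ∑ p, H k p * t p with hS
  have hgs : ∀ i j, g i j = g j i := hG.symm_apply hu
  have gS : ∀ t j, ∑ k, g j k * S t k = t j := by
    intro t j
    have := sum_mul_smul' g H t j
    simp only [smul_eq_mul] at this
    simp only [hS]
    rw [this, hG.mul_inv hu]
    simp [Matrix.one_apply]
  have gS' : ∀ t j, ∑ k, g k j * S t k = t j := fun t j => by
    rw [← gS t j]; exact Finset.sum_congr rfl fun k _ => by rw [hgs]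
  have cm : ∀ t c k m, confMat g H t c k m = (if k = c then t m else 0) +
      (if k = m then t c else 0) - g c m * S t k := fun t c k m => rfl
  have hηs : ∀ a c, η a c = η c a := h.cov_dlog_symm hu
  -- The traces of the four correction terms in `curv_eq` are `2∇θ`, `4∇θ`, `8 θθ` and `6 θθ` modulo
  -- the metric, and combine to `-2∇θ + 2 θθ`.
  have t1 : ∀ l j, ∑ k, confMat g H (η k) j k l = 2 * η l j - (∑ k, S (η k) k) * g l j := by
    intro l j
    simp only [cm, Finset.sum_sub_distrib, Finset.sum_add_distrib, Finset.sum_ite_eq',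
      Finset.mem_univ, if_true, ← Finset.mul_sum]
    rw [hηs j l, hgs j l]; ring
  have t2 : ∀ l j, ∑ k, confMat g H (η j) k k l = 4 * η l j := by
    intro l j
    simp only [cm, Finset.sum_sub_distrib, Finset.sum_add_distrib, Finset.sum_ite_eq',
      Finset.mem_univ, if_true, gS', Finset.sum_const, Finset.card_univ, Fintype.card_fin]
    rw [hηs j l]; simp
  have t3 : ∀ l j, ∑ k, (confMat g H θ k * confMat g H θ j) k l =
      8 * (θ l * θ j) - 4 * (∑ m, θ m * S θ m) * g l j := by
    intro l j
    have e0 : ∀ m, ∑ k, confMat g H θ k k m = 4 * θ m := by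
      intro m
      simp only [cm, Finset.sum_sub_distrib, Finset.sum_add_distrib, Finset.sum_ite_eq',
        Finset.mem_univ, if_true, gS', Finset.sum_const, Finset.card_univ, Fintype.card_fin]
      simp
    simp only [Matrix.mul_apply]
    rw [Finset.sum_comm]
    simp only [← Finset.sum_mul, e0]
    simp only [cm, mul_sub, mul_add, Finset.sum_sub_distrib, Finset.sum_add_distrib, mul_ite,
      mul_zero, Finset.sum_ite_eq', Finset.mem_univ, if_true]
    have : ∑ x, 4 * θ x * (g j l * S θ x) = 4 * g j l * ∑ m, θ m * S θ m := by
      rw [Finset.mul_sum]; exact Finset.sum_congr rfl fun p _ => by ring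
    rw [this, hgs j l]; ring
  have t4 : ∀ l j, ∑ k, (confMat g H θ j * confMat g H θ k) k l =
      6 * (θ l * θ j) - 2 * (∑ m, θ m * S θ m) * g l j := by
    intro l j
    have e1 : ∀ k, (confMat g H θ j * confMat g H θ k) k l =
        (if k = j then ∑ m, θ m * confMat g H θ k m l else 0) + θ j * confMat g H θ k k l
          - S θ k * ∑ m, g j m * confMat g H θ k m l := by
      intro k
      simp only [Matrix.mul_apply, cm θ j k, sub_mul, add_mul, Finset.sum_sub_distrib,
        Finset.sum_add_distrib, ite_mul, zero_mul, Finset.sum_ite_eq, Finset.mem_univ, if_true]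
      congr 1
      · congr 1
        split_ifs <;> simp
      · rw [Finset.mul_sum]; exact Finset.sum_congr rfl fun p _ => by ring
    have e2 : ∀ k, ∑ m, θ m * confMat g H θ k m l =
        θ k * θ l + θ l * θ k - (∑ m, θ m * S θ m) * g k l := by
      intro k
      simp only [cm, mul_sub, mul_add, Finset.sum_sub_distrib, Finset.sum_add_distrib, mul_ite,
        mul_zero, Finset.sum_ite_eq', Finset.mem_univ, if_true]
      congr 1
      rw [Finset.sum_mul]; exact Finset.sum_congr rfl fun p _ => by ring
    have e3 : ∀ k, ∑ m, g j m * confMat g H θ k m l = g j k * θ l + g j l * θ k - θ j * g k l := by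
      intro k
      simp only [cm, mul_sub, mul_add, Finset.sum_sub_distrib, Finset.sum_add_distrib, mul_ite,
        mul_zero, Finset.sum_ite_eq', Finset.mem_univ, if_true]
      congr 1
      rw [← gS θ j, Finset.sum_mul]; exact Finset.sum_congr rfl fun p _ => by ring
    have e0 : ∑ k, confMat g H θ k k l = 4 * θ l := by
      simp only [cm, Finset.sum_sub_distrib, Finset.sum_add_distrib, Finset.sum_ite_eq',
        Finset.mem_univ, if_true, gS', Finset.sum_const, Finset.card_univ, Fintype.card_fin]
      simp
    simp only [e1, e2, e3, Finset.sum_sub_distrib, Finset.sum_add_distrib, Finset.sum_ite_eq',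
      Finset.mem_univ, if_true, ← Finset.mul_sum, e0]
    have e4 : ∑ k, S θ k * (g j k * θ l + g j l * θ k - θ j * g k l) =
        (∑ k, g j k * S θ k) * θ l + g j l * (∑ m, θ m * S θ m) - θ j * ∑ k, g k l * S θ k := by
      simp only [Finset.sum_mul, Finset.mul_sum, ← Finset.sum_add_distrib,
        ← Finset.sum_sub_distrib]
      exact Finset.sum_congr rfl fun p _ => by ring
    rw [e4, gS, gS', hgs j l]; ring
  -- The witness collects the multiples of the metric in `t1`, `t3` and `t4`.
  refine ⟨-(∑ k, S (η k) k) - 2 * ∑ m, θ m * S θ m, fun l j => ?_⟩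
  rw [ricci_eq h.right hu, ricci_eq hG hu]
  simp only [h.curv_eq hu, Matrix.add_apply, Matrix.sub_apply, Finset.sum_add_distrib,
    Finset.sum_sub_distrib]
  rw [t1, t2, t3, t4]
  ring

/-- The conformal change of the Schouten tensor. -/
theorem schouten_conf : ∃ φ : E4 → ℝ, SmoothOn s φ ∧ ∀ u ∈ s, ∀ a c,
    schoutenField G' u a c = schoutenField G u a c
      - cov (TRep.triv ℝ).down (conn G) (dlog Ω) u a c + dlog Ω u a * dlog Ω u c
        + φ u * G u a c := by
  have hG := h.left
  have key : ∀ u ∈ s, ∃ t : ℝ, ∀ a c, schoutenField G' u a c = schoutenField G u a c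
      - cov (TRep.triv ℝ).down (conn G) (dlog Ω) u a c + dlog Ω u a * dlog Ω u c
        + t * G u a c := by
    intro u hu
    obtain ⟨c, hc⟩ := h.ricci_conf hu
    refine ⟨1 / 2 * (c - scalarCurv G' u / 6 * Ω u ^ 2 + scalarCurv G u / 6), fun i j => ?_⟩
    simp only [schoutenField, schouten, Matrix.cons_val_zero, Matrix.cons_val_one, hc, h.eq u hu,
      Matrix.smul_apply, smul_eq_mul]
    ring
  choose! φ hφ using key
  refine ⟨φ, ?_, hφ⟩
  -- So far `φ` is only a pointwise choice. Tracing its defining equation, where the metric has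
  -- trace 4, expresses it through smooth functions.
  have e : ∀ u ∈ s, φ u = 1 / 4 * ∑ a, ∑ c, (G u)⁻¹ a c * (schoutenField G' u a c -
      schoutenField G u a c + cov (TRep.triv ℝ).down (conn G) (dlog Ω) u a c
        - dlog Ω u a * dlog Ω u c) := by
    intro u hu
    have e1 : ∀ a c, (G u)⁻¹ a c * (schoutenField G' u a c -
      schoutenField G u a c + cov (TRep.triv ℝ).down (conn G) (dlog Ω) u a c
        - dlog Ω u a * dlog Ω u c) = φ u * ((G u)⁻¹ a c * G u c a) := by
      intro a c; rw [hφ u hu a c, hG.symm_apply hu c a]; ring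
    have e2 : ∑ a, ∑ c, (G u)⁻¹ a c * G u c a = 4 := by
      have : ∀ a, ∑ c, (G u)⁻¹ a c * G u c a = 1 := fun a => by
        rw [← Matrix.mul_apply, hG.inv_mul hu]; simp
      simp [this]
    simp only [e1, ← Finset.mul_sum, e2]
    ring
  intro u hu
  have hη : SmoothOn s (cov (TRep.triv ℝ).down (conn G) (dlog Ω)) :=
    h.smooth_dlog.cov _ fun a x hx => hG.smooth_conn hx a
  have hs : ContDiffAt ℝ ∞ (fun u => 1 / 4 * ∑ a, ∑ c, (G u)⁻¹ a c * (schoutenField G' u a c -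
      schoutenField G u a c + cov (TRep.triv ℝ).down (conn G) (dlog Ω) u a c
        - dlog Ω u a * dlog Ω u c)) u := by
    refine contDiffAt_const.mul (ContDiffAt.sum fun a _ => ContDiffAt.sum fun c _ => ?_)
    exact (smooth_entry (hG.smooth_inv hu) a c).mul
      ((((((smooth_schoutenField h.right).apply a).apply c u hu).sub
        (((smooth_schoutenField hG).apply a).apply c u hu)).add
        ((hη.apply a).apply c u hu)).sub
        ((h.smooth_dlog.apply a u hu).mul (h.smooth_dlog.apply c u hu)))
  exact hs.congr_of_eventuallyEq (eventually_of_mem (hG.isOpen.mem_nhds hu) e)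

theorem cov_eq {V : Type*} [NormedAddCommGroup V] [NormedSpace ℝ V] (r : TRep V) (T : E4 → V)
    {u : E4} (hu : u ∈ s) :
    cov r (conn G') T u = cov r (conn G) T u + confAct r (G u) (G u)⁻¹ (dlog Ω u) (T u) := by
  ext a
  simp only [cov, h.conn_eq hu, map_add, Pi.add_apply, LinearMap.add_apply, confAct_apply]
  abel

end IsConformalOn

end Conformal

/-! ### Connection and curvature under changes of coordinates -/

section Coordinates

/-- A change of coordinates between two open sets with metrics. -/
structure IsTransition (τ : E4 → E4) (G' G : E4 → Mat) (s' s : Set E4) : Prop where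
  left : IsMetricOn G' s'
  right : IsMetricOn G s
  maps : ∀ u ∈ s', τ u ∈ s
  smooth : SmoothOn s' τ
  det : ∀ u ∈ s', (jac τ u).det ≠ 0
  eq : ∀ u ∈ s', G' u = (jac τ u).transpose * G (τ u) * jac τ u

namespace IsTransition

variable {τ : E4 → E4} {G' G : E4 → Mat} {s' s : Set E4} (h : IsTransition τ G' G s' s)
include h

theorem smooth_jac {u : E4} (hu : u ∈ s') : ContDiffAt ℝ ∞ (jac τ) u :=
  smooth_mat fun p c => by
    have := smooth_pd (h.smooth u hu) c
    exact (EuclideanSpace.proj (𝕜 := ℝ) p).contDiff.contDiffAt.comp u this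

theorem smooth_jac_inv {u : E4} (hu : u ∈ s') : ContDiffAt ℝ ∞ (fun x => (jac τ x)⁻¹) u :=
  smooth_inv (h.smooth_jac hu) (h.det u hu)

theorem inv_mul {u : E4} (hu : u ∈ s') : (jac τ u)⁻¹ * jac τ u = 1 :=
  Matrix.nonsing_inv_mul _ (h.det u hu).isUnit

theorem mul_inv {u : E4} (hu : u ∈ s') : jac τ u * (jac τ u)⁻¹ = 1 :=
  Matrix.mul_nonsing_inv _ (h.det u hu).isUnit

theorem pd_jac_symm {u : E4} (hu : u ∈ s') (a p c : Fin 4) :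
    pd a (jac τ) u p c = pd c (jac τ) u p a := by
  have e : ∀ a c, pd a (jac τ) u p c = pd a (pd c τ) u p := by
    intro a c
    rw [pd_entry (h.smooth_jac hu)]
    have h1 := differentiableAt_of_smooth (smooth_pd (h.smooth u hu) c)
    unfold pd
    have h2 := ((EuclideanSpace.proj (𝕜 := ℝ) p).hasFDerivAt.comp u h1.hasFDerivAt).fderiv
    have h3 : (fun x => jac τ x p c) = (EuclideanSpace.proj (𝕜 := ℝ) p : E4 → ℝ) ∘ pd c τ := rfl
    rw [h3, h2]
    rfl
  rw [e, e, pd_comm (h.smooth u hu)]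

/-- Uniqueness of the Levi-Civita connection once more: the transformed coefficients are symmetric
because the second derivatives of `τ` are, and they are compatible with the pulled back metric. -/
theorem conn_eq {u : E4} (hu : u ∈ s') (a : Fin 4) :
    conn G' u a = (jac τ u)⁻¹ * (∑ q, jac τ u q a • conn G (τ u) q) * jac τ u
      + (jac τ u)⁻¹ * pd a (jac τ) u := by
  have hm := h.maps u hu
  set K := jac τ u with hK
  set J := (jac τ u)⁻¹ with hJ
  have hKJ : K * J = 1 := h.mul_inv hu
  refine h.left.conn_eq hu (Λ := fun a => J * (∑ q, K q a • conn G (τ u) q) * K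
    + J * pd a (jac τ) u) ?_ ?_ a
  · intro a k m
    simp only [Matrix.add_apply]
    congr 1
    · have e : ∀ a m, (J * (∑ q, K q a • conn G (τ u) q) * K) k m =
          ∑ t, ∑ p, J k p * ∑ q, K q a * conn G (τ u) q p t * K t m := by
        intro a m
        simp only [Matrix.mul_apply, Matrix.sum_apply, Matrix.smul_apply, smul_eq_mul,
          Finset.sum_mul, Finset.mul_sum]
        refine Finset.sum_congr rfl fun t _ => ?_
        rw [Finset.sum_comm]
        exact Finset.sum_congr rfl fun p _ => Finset.sum_congr rfl fun q _ => by ring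
      rw [e, e]
      simp only [Finset.mul_sum]
      rw [Finset.sum_comm]
      conv_rhs => rw [Finset.sum_comm]
      refine Finset.sum_congr rfl fun p _ => ?_
      rw [Finset.sum_comm]
      refine Finset.sum_congr rfl fun q _ => Finset.sum_congr rfl fun t _ => ?_
      rw [h.right.conn_symm hm q p t]; ring
    · simp only [Matrix.mul_apply]
      exact Finset.sum_congr rfl fun p _ => by rw [h.pd_jac_symm hu]
  · intro a
    have sK := h.smooth_jac hu
    have sG : ContDiffAt ℝ ∞ (fun x => G (τ x)) u := (h.right.smooth _ hm).comp u (h.smooth u hu)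
    rw [pd_congr_on h.left.isOpen h.eq hu, pd_matmul (smooth_matmul (smooth_transpose sK) sG) sK,
      pd_matmul (smooth_transpose sK) sG, pd_transpose sK,
      pd_comp (h.smooth u hu) (h.right.smooth _ hm), h.eq u hu]
    have e : ∑ q, jac τ u q a • pd q G (τ u) =
        (∑ q, K q a • conn G (τ u) q).transpose * G (τ u)
          + G (τ u) * ∑ q, K q a • conn G (τ u) q := by
      rw [Matrix.transpose_sum, Matrix.sum_mul, Matrix.mul_sum, ← Finset.sum_add_distrib]
      refine Finset.sum_congr rfl fun q _ => ?_
      rw [h.right.pd_metric hm, smul_add, Matrix.transpose_smul, Matrix.smul_mul, Matrix.mul_smul]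
    rw [e, ← hK]
    set L := ∑ q, K q a • conn G (τ u) q
    have hKJt : J.transpose * K.transpose = 1 := by
      rw [← Matrix.transpose_mul, hKJ, Matrix.transpose_one]
    simp only [Matrix.transpose_add, Matrix.transpose_mul, add_mul, mul_add]
    have f1 : ∀ X : Mat, J.transpose * (K.transpose * X) = X := fun X => by
      rw [← mul_assoc, hKJt, one_mul]
    have f2 : ∀ X : Mat, K * (J * X) = X := fun X => by
      rw [← mul_assoc, hKJ, one_mul]
    simp only [mul_assoc, f1, f2]
    abel

theorem cov_nat {V : Type*} [NormedAddCommGroup V] [NormedSpace ℝ V] [FiniteDimensional ℝ V]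
    (r : TRep V) {T T' : E4 → V} (hT : SmoothOn s T)
    (hT' : ∀ x ∈ s', T' x = r.act (jac τ x)⁻¹ (jac τ x) (T (τ x))) :
    ∀ u ∈ s', cov r (conn G') T' u =
      r.down.act (jac τ u)⁻¹ (jac τ u) (cov r (conn G) T (τ u)) := by
  intro u hu
  exact cov_natural r h.left.isOpen hu (h.smooth u hu) (h.smooth_jac_inv hu) (h.smooth_jac hu)
    (h.inv_mul hu) (pd_of_mul_eq_one h.left.isOpen hu (h.smooth_jac_inv hu) (h.smooth_jac hu)
      fun x hx => h.inv_mul hx) (h.conn_eq hu) (hT _ (h.maps u hu)) hT'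

/-- The transformation law of the connection need not be differentiated. The Ricci identity
expresses the curvature by second covariant derivatives, which are natural, and a matrix is
determined by its action on vectors, so it suffices to transport constant vector fields. -/
theorem curv_eq {u : E4} (hu : u ∈ s') (i j : Fin 4) :
    curv (conn G') u i j = (jac τ u)⁻¹ *
      (∑ p, ∑ q, (jac τ u p i * jac τ u q j) • curv (conn G) (τ u) p q) * jac τ u := by
  have hm := h.maps u hu
  have sΓ : ∀ a, SmoothOn s fun x => conn G x a := fun a x hx => h.right.smooth_conn hx a
  have main : ∀ v : Fin 4 → ℝ,
      (TRep.triv ℝ).up.ρ (curv (conn G') u i j) ((TRep.triv ℝ).up.act (jac τ u)⁻¹ (jac τ u) v) =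
      (TRep.triv ℝ).up.act (jac τ u)⁻¹ (jac τ u) ((TRep.triv ℝ).up.ρ
        (∑ p, ∑ q, (jac τ u p i * jac τ u q j) • curv (conn G) (τ u) p q) v) := by
    intro v
    set r := (TRep.triv ℝ).up
    have hT : SmoothOn s fun _ : E4 => v := fun _ _ => contDiffAt_const
    set T' : E4 → Fin 4 → ℝ := fun x => r.act (jac τ x)⁻¹ (jac τ x) v with hT'
    have hsT' : SmoothOn s' T' := fun x hx =>
      r.contDiffAt_act (h.smooth_jac_inv hx) (h.smooth_jac hx) contDiffAt_const
    have n1 := h.cov_nat r hT (T' := T') fun x _ => rfl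
    have n2 := h.cov_nat r.down (hT.cov r sΓ) n1
    have c1 := cov_cov_comm r (fun a => h.left.smooth_conn hu a) (hsT' u hu)
      (h.left.conn_symm hu) i j
    have c2 := fun p q => cov_cov_comm r (fun a => h.right.smooth_conn hm a) (hT _ hm)
      (h.right.conn_symm hm) p q
    rw [← c1, n2 u hu]
    simp only [map_sum, map_smul, LinearMap.sum_apply, LinearMap.smul_apply, ← c2, TRep.down_act,
      map_sub, smul_sub, Finset.sum_sub_distrib, Finset.smul_sum, smul_smul, Finset.sum_apply,
      Pi.smul_apply]
    congr 1
    rw [Finset.sum_comm]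
    simp only [mul_comm]
  set M := ∑ p, ∑ q, (jac τ u p i * jac τ u q j) • curv (conn G) (τ u) p q with hM
  have e : curv (conn G') u i j * (jac τ u)⁻¹ = (jac τ u)⁻¹ * M := by
    ext k l
    have := congrFun (main (Pi.single l 1)) k
    simpa [TRep.up_ρ, TRep.up_act, Matrix.mul_apply, Pi.single_apply] using this
  rw [← e, mul_assoc, h.inv_mul hu, mul_one]

theorem ricci_eq {u : E4} (hu : u ∈ s') (l j : Fin 4) :
    ricci G' u l j = ∑ m, ∑ q, jac τ u m l * jac τ u q j * ricci G (τ u) m q := by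
  rw [WeylOp.ricci_eq h.left hu]
  simp only [h.curv_eq hu, WeylOp.ricci_eq h.right (h.maps u hu)]
  set K := jac τ u
  set J := K⁻¹
  have hKJ : K * J = 1 := h.mul_inv hu
  set R := curv (conn G) (τ u)
  have e : ∀ k, (J * (∑ p, ∑ q, (K p k * K q j) • R p q) * K) k l =
      ∑ p, K p k * ∑ t, J k t * ∑ q, ∑ m, K q j * R p q t m * K m l := by
    intro k
    rw [mul_assoc, Matrix.mul_apply]
    simp only [Matrix.mul_apply, Matrix.sum_apply, Matrix.smul_apply, smul_eq_mul, Finset.mul_sum,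
      Finset.sum_mul]
    conv_rhs => rw [Finset.sum_comm]
    refine Finset.sum_congr rfl fun t _ => ?_
    rw [Finset.sum_comm]
    refine Finset.sum_congr rfl fun p _ => ?_
    rw [Finset.sum_comm]
    refine Finset.sum_congr rfl fun q _ => Finset.sum_congr rfl fun m _ => by ring
  simp only [e]
  rw [Finset.sum_comm]
  have e2 : ∀ p, ∑ k, K p k * ∑ t, J k t * ∑ q, ∑ m, K q j * R p q t m * K m l =
      ∑ q, ∑ m, K q j * R p q p m * K m l := by
    intro p
    have := sum_mul_smul' K J (fun t => ∑ q, ∑ m, K q j * R p q t m * K m l) p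
    simp only [smul_eq_mul] at this
    rw [this, hKJ]
    simp [Matrix.one_apply]
  simp only [e2]
  simp only [Finset.mul_sum]
  rw [Finset.sum_comm]
  conv_rhs => rw [Finset.sum_comm]
  refine Finset.sum_congr rfl fun q _ => ?_
  rw [Finset.sum_comm]
  refine Finset.sum_congr rfl fun m _ => Finset.sum_congr rfl fun p _ => by ring

theorem metric_inv {u : E4} (hu : u ∈ s') :
    jac τ u * (G' u)⁻¹ * (jac τ u).transpose = (G (τ u))⁻¹ := by
  rw [h.eq u hu, Matrix.mul_inv_rev, Matrix.mul_inv_rev]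
  have h1 := h.mul_inv hu
  have h2 : ((jac τ u).transpose)⁻¹ * (jac τ u).transpose = 1 :=
    Matrix.nonsing_inv_mul _ (by rw [Matrix.det_transpose]; exact (h.det u hu).isUnit)
  simp only [← mul_assoc, h1, one_mul]
  rw [mul_assoc, h2, mul_one]

theorem scalarCurv_eq {u : E4} (hu : u ∈ s') : scalarCurv G' u = scalarCurv G (τ u) := by
  simp only [scalarCurv, h.ricci_eq hu, ← h.metric_inv hu]
  set K := jac τ u
  set H := (G' u)⁻¹
  simp only [Matrix.mul_apply, Matrix.transpose_apply, Finset.mul_sum, Finset.sum_mul]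
  have : ∀ i, ∑ j, ∑ m, ∑ q, H i j * (K m i * K q j * ricci G (τ u) m q) =
      ∑ m, ∑ q, ∑ j, K m i * H i j * K q j * ricci G (τ u) m q := by
    intro i
    rw [Finset.sum_comm]
    refine Finset.sum_congr rfl fun m _ => ?_
    rw [Finset.sum_comm]
    exact Finset.sum_congr rfl fun q _ => Finset.sum_congr rfl fun j _ => by ring
  simp only [this]
  rw [Finset.sum_comm]
  refine Finset.sum_congr rfl fun m _ => ?_
  rw [Finset.sum_comm]
  refine Finset.sum_congr rfl fun q _ => ?_
  rw [Finset.sum_comm]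

theorem schouten_eq : ∀ u ∈ s', schoutenField G' u =
    (TRep.triv ℝ).down.down.act (jac τ u)⁻¹ (jac τ u) (schoutenField G (τ u)) := by
  intro u hu
  ext a c
  simp only [schoutenField, schouten, Matrix.cons_val_zero, Matrix.cons_val_one, TRep.down_act,
    Finset.sum_apply, Pi.smul_apply, TRep.triv_act, smul_eq_mul]
  rw [h.ricci_eq hu, h.scalarCurv_eq hu, h.eq u hu]
  have e : ((jac τ u).transpose * G (τ u) * jac τ u) a c =
      ∑ m, ∑ q, jac τ u m a * jac τ u q c * G (τ u) m q := by
    simp only [Matrix.mul_apply, Matrix.transpose_apply, Finset.sum_mul]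
    rw [Finset.sum_comm]
    exact Finset.sum_congr rfl fun m _ => Finset.sum_congr rfl fun q _ => by ring
  rw [e]
  simp only [Finset.mul_sum, ← Finset.sum_sub_distrib]
  exact Finset.sum_congr rfl fun m _ => Finset.sum_congr rfl fun q _ => by ring

end IsTransition

end Coordinates

end

/-! ### Duality of two-forms in dimension four -/

section TwoForms

variable {𝕜 : Type*} [RCLike 𝕜]

/-- Square matrices of size 4 over a field. -/
abbrev M4 (𝕜 : Type*) := Matrix (Fin 4) (Fin 4) 𝕜

/-- Arrays with four indices. -/
abbrev Arr4 (𝕜 : Type*) := Fin 4 → Fin 4 → Fin 4 → Fin 4 → 𝕜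

/-- The contraction `(1/2) [abcd] u^{cd}` of an antisymmetric matrix with the permutation symbol. -/
def dualMat : M4 𝕜 →ₗ[𝕜] M4 𝕜 where
  toFun u := !![0, u 2 3, -u 1 3, u 1 2; -u 2 3, 0, u 0 3, -u 0 2; u 1 3, -u 0 3, 0, u 0 1;
    -u 1 2, u 0 2, -u 0 1, 0]
  map_add' u v := by
    ext i j; fin_cases i <;> fin_cases j <;> simp [add_comm]
  map_smul' c u := by
    ext i j; fin_cases i <;> fin_cases j <;> simp

theorem dualMat_apply (u : M4 𝕜) : dualMat u = !![0, u 2 3, -u 1 3, u 1 2; -u 2 3, 0, u 0 3,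
    -u 0 2; u 1 3, -u 0 3, 0, u 0 1; -u 1 2, u 0 2, -u 0 1, 0] := rfl

theorem dualMat_entries (u : M4 𝕜) :
    (dualMat u 0 0 = 0 ∧ dualMat u 0 1 = u 2 3 ∧ dualMat u 0 2 = -u 1 3 ∧ dualMat u 0 3 = u 1 2) ∧
    (dualMat u 1 0 = -u 2 3 ∧ dualMat u 1 1 = 0 ∧ dualMat u 1 2 = u 0 3 ∧ dualMat u 1 3 = -u 0 2) ∧
    (dualMat u 2 0 = u 1 3 ∧ dualMat u 2 1 = -u 0 3 ∧ dualMat u 2 2 = 0 ∧ dualMat u 2 3 = u 0 1) ∧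
    (dualMat u 3 0 = -u 1 2 ∧ dualMat u 3 1 = u 0 2 ∧ dualMat u 3 2 = -u 0 1 ∧
      dualMat u 3 3 = 0) :=
  ⟨⟨rfl, rfl, rfl, rfl⟩, ⟨rfl, rfl, rfl, rfl⟩, ⟨rfl, rfl, rfl, rfl⟩, ⟨rfl, rfl, rfl, rfl⟩⟩

theorem antisymm_entries {u : M4 𝕜} (h : u.transpose = -u) :
    (u 0 0 = 0 ∧ u 1 1 = 0 ∧ u 2 2 = 0 ∧ u 3 3 = 0) ∧
    (u 1 0 = -u 0 1 ∧ u 2 0 = -u 0 2 ∧ u 3 0 = -u 0 3 ∧ u 2 1 = -u 1 2 ∧ u 3 1 = -u 1 3 ∧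
      u 3 2 = -u 2 3) := by
  have h' : ∀ i j, u j i = - u i j := fun i j => congrFun (congrFun h i) j
  have h0 : ∀ i, u i i = 0 := fun i => self_eq_neg.1 (h' i i)
  exact ⟨⟨h0 _, h0 _, h0 _, h0 _⟩, h' _ _, h' _ _, h' _ _, h' _ _, h' _ _, h' _ _⟩

theorem antisymm_ext {u v : M4 𝕜} (hu : u.transpose = -u) (hv : v.transpose = -v)
    (h01 : u 0 1 = v 0 1) (h02 : u 0 2 = v 0 2) (h03 : u 0 3 = v 0 3) (h12 : u 1 2 = v 1 2)
    (h13 : u 1 3 = v 1 3) (h23 : u 2 3 = v 2 3) : u = v := by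
  obtain ⟨⟨a0, a1, a2, a3⟩, a4, a5, a6, a7, a8, a9⟩ := antisymm_entries hu
  obtain ⟨⟨b0, b1, b2, b3⟩, b4, b5, b6, b7, b8, b9⟩ := antisymm_entries hv
  ext i j
  fin_cases i <;> fin_cases j <;>
    simp only [Fin.zero_eta, Fin.mk_one, Fin.reduceFinMk, *]

theorem dualMat_antisymm (u : M4 𝕜) : (dualMat u).transpose = - dualMat u := by
  rw [dualMat_apply]
  ext i j
  fin_cases i <;> fin_cases j <;> simp

/-- `dualMat` is the Euclidean star, which splits the skew matrices into two commuting ideals;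
within each ideal `F * G + G * F` is a scalar. Comparing the products of the components gives the
identity, and the trace identifies the scalar. -/
theorem dualMat_mul_dualMat {F G : M4 𝕜} (hF : F.transpose = -F) (hG : G.transpose = -G) :
    dualMat F * dualMat G = - (G * F) + ((1 / 2) * (F * G).trace) • (1 : M4 𝕜) := by
  obtain ⟨⟨a0, a1, a2, a3⟩, a4, a5, a6, a7, a8, a9⟩ := antisymm_entries hF
  obtain ⟨⟨b0, b1, b2, b3⟩, b4, b5, b6, b7, b8, b9⟩ := antisymm_entries hG
  obtain ⟨⟨c1, c2, c3, c4⟩, ⟨c5, c6, c7, c8⟩, ⟨c9, c10, c11, c12⟩, ⟨c13, c14, c15, c16⟩⟩ :=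
    dualMat_entries F
  obtain ⟨⟨d1, d2, d3, d4⟩, ⟨d5, d6, d7, d8⟩, ⟨d9, d10, d11, d12⟩, ⟨d13, d14, d15, d16⟩⟩ :=
    dualMat_entries G
  ext i j
  fin_cases i <;> fin_cases j <;>
    simp [Matrix.mul_apply, Fin.sum_univ_four, Matrix.trace, *] <;> ring

/-- The infinitesimal form of `dualMat_conj`, at `P = 1 + tN`. It is the source of both the
parallelism of the Hodge star, where the trace is absorbed by the volume density, and the reversal
of duality, where the trace is zero. -/
theorem dualMat_der {F : M4 𝕜} (hF : F.transpose = -F) (N : M4 𝕜) :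
    N.transpose * dualMat F + dualMat F * N + dualMat (N * F + F * N.transpose) =
      N.trace • dualMat F := by
  obtain ⟨⟨a0, a1, a2, a3⟩, a4, a5, a6, a7, a8, a9⟩ := antisymm_entries hF
  obtain ⟨⟨c1, c2, c3, c4⟩, ⟨c5, c6, c7, c8⟩, ⟨c9, c10, c11, c12⟩, ⟨c13, c14, c15, c16⟩⟩ :=
    dualMat_entries F
  obtain ⟨⟨d1, d2, d3, d4⟩, ⟨d5, d6, d7, d8⟩, ⟨d9, d10, d11, d12⟩, ⟨d13, d14, d15, d16⟩⟩ :=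
    dualMat_entries (N * F + F * N.transpose)
  have hD := dualMat_antisymm F
  refine antisymm_ext ?_ (by rw [Matrix.transpose_smul, hD, smul_neg]) ?_ ?_ ?_ ?_ ?_ ?_
  · rw [Matrix.transpose_add, Matrix.transpose_add, dualMat_antisymm, Matrix.transpose_mul,
      Matrix.transpose_mul, hD, Matrix.transpose_transpose, neg_mul, mul_neg]
    abel
  all_goals
    rw [Matrix.add_apply]
    simp only [d2, d3, d4, d7, d8, d12, Matrix.add_apply, Matrix.mul_apply, Fin.sum_univ_four,
      Matrix.trace, Matrix.transpose_apply, Matrix.diag_apply, Matrix.smul_apply, smul_eq_mul,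
      a0, a1, a2, a3, a4, a5, a6, a7, a8, a9, c1, c2, c3, c4, c5, c6, c7, c8, c9, c10, c11, c12,
      c13, c14, c15, c16]
    ring

theorem det_four (P : M4 𝕜) : P.det =
    P 0 0 * (P 1 1 * (P 2 2 * P 3 3 - P 2 3 * P 3 2) - P 1 2 * (P 2 1 * P 3 3 - P 2 3 * P 3 1)
      + P 1 3 * (P 2 1 * P 3 2 - P 2 2 * P 3 1))
    - P 0 1 * (P 1 0 * (P 2 2 * P 3 3 - P 2 3 * P 3 2) - P 1 2 * (P 2 0 * P 3 3 - P 2 3 * P 3 0)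
      + P 1 3 * (P 2 0 * P 3 2 - P 2 2 * P 3 0))
    + P 0 2 * (P 1 0 * (P 2 1 * P 3 3 - P 2 3 * P 3 1) - P 1 1 * (P 2 0 * P 3 3 - P 2 3 * P 3 0)
      + P 1 3 * (P 2 0 * P 3 1 - P 2 1 * P 3 0))
    - P 0 3 * (P 1 0 * (P 2 1 * P 3 2 - P 2 2 * P 3 1) - P 1 1 * (P 2 0 * P 3 2 - P 2 2 * P 3 0)
      + P 1 2 * (P 2 0 * P 3 1 - P 2 1 * P 3 0)) := by
  rw [Matrix.det_succ_row_zero]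
  simp [Fin.sum_univ_succ, Matrix.det_fin_three, Fin.succAbove]
  ring

/-- The permutation symbol contracted with four copies of `P` is `P.det` times itself. -/
theorem dualMat_conj {F : M4 𝕜} (hF : F.transpose = -F) (P : M4 𝕜) :
    P.transpose * dualMat (P * F * P.transpose) * P = P.det • dualMat F := by
  obtain ⟨⟨a0, a1, a2, a3⟩, a4, a5, a6, a7, a8, a9⟩ := antisymm_entries hF
  obtain ⟨⟨c1, c2, c3, c4⟩, ⟨c5, c6, c7, c8⟩, ⟨c9, c10, c11, c12⟩, ⟨c13, c14, c15, c16⟩⟩ :=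
    dualMat_entries F
  obtain ⟨⟨d1, d2, d3, d4⟩, ⟨d5, d6, d7, d8⟩, ⟨d9, d10, d11, d12⟩, ⟨d13, d14, d15, d16⟩⟩ :=
    dualMat_entries (P * F * P.transpose)
  refine antisymm_ext ?_ (by rw [Matrix.transpose_smul, dualMat_antisymm, smul_neg])
    ?_ ?_ ?_ ?_ ?_ ?_
  · rw [Matrix.transpose_mul, Matrix.transpose_mul, dualMat_antisymm, Matrix.transpose_transpose]
    simp [mul_assoc]
  all_goals
    simp only [Matrix.mul_apply (N := P), Matrix.mul_apply (M := P.transpose),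
      Fin.sum_univ_four, d1, d2, d3, d4, d5, d6, d7, d8, d9, d10, d11, d12, d13, d14, d15, d16,
      Matrix.smul_apply, smul_eq_mul, c2, c3, c4, c7, c8, c12, det_four]
    simp only [Matrix.mul_apply, Fin.sum_univ_four, Matrix.transpose_apply,
      a0, a1, a2, a3, a4, a5, a6, a7, a8, a9]
    ring

end TwoForms

/-! ### Curvature and Weyl arrays, left and right duals -/

section CurvatureArrays

variable {𝕜 : Type*} [RCLike 𝕜]

/-- Arrays with the symmetries of a curvature tensor. -/
structure IsCurv (Z : Arr4 𝕜) : Prop where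
  antisymm : ∀ a b c d, Z a b c d = - Z b a c d
  pair : ∀ a b c d, Z a b c d = Z c d a b
  bianchi : ∀ a b c d, Z a b c d + Z a c d b + Z a d b c = 0

/-- Arrays with the symmetries of a Weyl tensor, for the inverse metric `h`. -/
structure IsWeyl4 (h : M4 𝕜) (Z : Arr4 𝕜) : Prop extends IsCurv Z where
  trace : ∀ b d, ∑ a, ∑ c, h a c * Z a b c d = 0

theorem IsCurv.antisymm' {Z : Arr4 𝕜} (hZ : IsCurv Z) (a b c d : Fin 4) :
    Z a b c d = - Z a b d c := by
  rw [hZ.pair, hZ.antisymm, hZ.pair]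

/-- The action of an operator on the first pair of indices. -/
def map₁ (f : M4 𝕜 →ₗ[𝕜] M4 𝕜) (U : Arr4 𝕜) : Arr4 𝕜 := fun a b c d =>
  f (Matrix.of fun p q => U p q c d) a b

/-- The action of an operator on the second pair of indices. -/
def map₂ (f : M4 𝕜 →ₗ[𝕜] M4 𝕜) (U : Arr4 𝕜) : Arr4 𝕜 := fun a b c d =>
  f (Matrix.of fun p q => U a b p q) c d

/-- Exchange of the two pairs of indices. -/
def swapPairs (U : Arr4 𝕜) : Arr4 𝕜 := fun a b c d => U c d a b

theorem IsCurv.swap {U : Arr4 𝕜} (h : IsCurv U) : swapPairs U = U := by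
  ext a b c d; exact (h.pair a b c d).symm

theorem map₂_eq (f : M4 𝕜 →ₗ[𝕜] M4 𝕜) (U : Arr4 𝕜) :
    map₂ f U = swapPairs (map₁ f (swapPairs U)) := rfl

theorem map₁_map₁ (f f' : M4 𝕜 →ₗ[𝕜] M4 𝕜) (U : Arr4 𝕜) :
    map₁ f (map₁ f' U) = map₁ (f ∘ₗ f') U := rfl

theorem linearMap_entry (f : M4 𝕜 →ₗ[𝕜] M4 𝕜) (X : M4 𝕜) (a b : Fin 4) :
    f X a b = ∑ p, ∑ q, X p q * f (Matrix.single p q 1) a b := by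
  conv_lhs => rw [Matrix.matrix_eq_sum_single X]
  simp only [map_sum, Matrix.sum_apply]
  refine Finset.sum_congr rfl fun p _ => Finset.sum_congr rfl fun q _ => ?_
  have : Matrix.single p q (X p q) = X p q • Matrix.single p q (1 : 𝕜) := by simp
  rw [this, map_smul]; rfl

theorem map₁_map₂ (f f' : M4 𝕜 →ₗ[𝕜] M4 𝕜) (U : Arr4 𝕜) :
    map₁ f (map₂ f' U) = map₂ f' (map₁ f U) := by
  ext a b c d
  simp only [map₁, map₂]
  rw [linearMap_entry f, linearMap_entry f']
  simp only [Matrix.of_apply]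
  have e1 : ∀ p q, f' (Matrix.of fun r s => U p q r s) c d =
      ∑ r, ∑ s, U p q r s * f' (Matrix.single r s 1) c d := fun p q => linearMap_entry f' _ c d
  have e2 : ∀ r s, f (Matrix.of fun p q => U p q r s) a b =
      ∑ p, ∑ q, U p q r s * f (Matrix.single p q 1) a b := fun r s => linearMap_entry f _ a b
  simp only [e1, e2, Finset.sum_mul]
  have sw : ∀ F : Fin 4 → Fin 4 → Fin 4 → Fin 4 → 𝕜,
      ∑ p, ∑ q, ∑ r, ∑ s, F p q r s = ∑ r, ∑ s, ∑ p, ∑ q, F p q r s := by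
    intro F
    have h1 : ∀ p, ∑ q, ∑ r, ∑ s, F p q r s = ∑ r, ∑ s, ∑ q, F p q r s := fun p => by
      rw [Finset.sum_comm]
      exact Finset.sum_congr rfl fun r _ => Finset.sum_comm
    simp only [h1]
    rw [Finset.sum_comm]
    exact Finset.sum_congr rfl fun r _ => Finset.sum_comm
  rw [sw]
  exact Finset.sum_congr rfl fun r _ => Finset.sum_congr rfl fun s _ =>
    Finset.sum_congr rfl fun p _ => Finset.sum_congr rfl fun q _ => by ring

/-- Congruence of matrices. -/
def conjMap (P : M4 𝕜) : M4 𝕜 →ₗ[𝕜] M4 𝕜 where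
  toFun F := P * F * P.transpose
  map_add' F G := by rw [mul_add, add_mul]
  map_smul' c F := by simp

@[simp] theorem conjMap_apply (P F : M4 𝕜) : conjMap P F = P * F * P.transpose := rfl

theorem conjMap_entry (P F : M4 𝕜) (a b : Fin 4) :
    conjMap P F a b = ∑ p, ∑ q, P a p * P b q * F p q := by
  simp only [conjMap_apply, Matrix.mul_apply, Matrix.transpose_apply, Finset.sum_mul]
  rw [Finset.sum_comm]
  exact Finset.sum_congr rfl fun p _ => Finset.sum_congr rfl fun q _ => by ring

/-- The (unnormalized) Hodge star on two-vectors of the metric `g`. -/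
def starMap (g : M4 𝕜) : M4 𝕜 →ₗ[𝕜] M4 𝕜 := dualMat ∘ₗ conjMap g

theorem conjMap_antisymm {F : M4 𝕜} (hF : F.transpose = -F) (P : M4 𝕜) :
    (conjMap P F).transpose = - conjMap P F := by
  simp only [conjMap_apply, Matrix.transpose_mul, Matrix.transpose_transpose, hF, neg_mul,
    mul_neg, mul_assoc]

variable {g h : M4 𝕜}

theorem conj_starMap (hg : g.transpose = g) {F : M4 𝕜} (hF : F.transpose = -F) :
    conjMap g (starMap g F) = g.det • dualMat F := by
  have := dualMat_conj hF g
  rw [hg] at this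
  simpa [starMap, hg] using this

theorem conjMap_cancel (hg : g.transpose = g) (hhg : h * g = 1) (F : M4 𝕜) :
    conjMap h (conjMap g F) = F := by
  have h2 : g * h.transpose = 1 := by
    have := congrArg Matrix.transpose hhg
    rwa [Matrix.transpose_mul, Matrix.transpose_one, hg] at this
  simp only [conjMap_apply, hg, ← mul_assoc, hhg, one_mul]
  rw [mul_assoc, h2, mul_one]

/-- This is `dualMat_mul_dualMat` for a general metric. One star is written as `g.det` times a dual
with both indices raised, the other as the dual of a form with lowered indices; the metric between
them then cancels. -/
theorem starMap_mul_starMap (hg : g.transpose = g) (hhg : h * g = 1) {F G : M4 𝕜}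
    (hF : F.transpose = -F) (hG : G.transpose = -G) :
    starMap g F * g * (starMap g G).transpose =
      g.det • (-(G * g * F.transpose) + ((1 / 2) * (F * g * G.transpose * g).trace) • h) := by
  have hgh : g * h = 1 := mul_eq_one_comm.1 hhg
  have hh : h.transpose = h := by
    have := congrArg Matrix.transpose hgh
    rw [Matrix.transpose_mul, Matrix.transpose_one, hg] at this
    calc h.transpose = h.transpose * (g * h) := by rw [hgh, mul_one]
      _ = h := by rw [← mul_assoc, this, one_mul]
  have e1 : starMap g F = g.det • (h * dualMat F * h) := by
    rw [← conjMap_cancel hg hhg (starMap g F), conj_starMap hg hF, map_smul, conjMap_apply, hh]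
  have e2 : (starMap g G).transpose = - starMap g G := dualMat_antisymm _
  have e3 : starMap g G = dualMat (g * G * g) := by simp [starMap, hg]
  have hG' : (g * G * g).transpose = -(g * G * g) := by
    simpa [hg] using conjMap_antisymm hG g
  rw [e2, e1, e3, Matrix.smul_mul, Matrix.smul_mul, mul_neg]
  have e4 : h * dualMat F * h * g * dualMat (g * G * g) =
      h * (dualMat F * dualMat (g * G * g)) := by
    rw [mul_assoc (h * dualMat F) h g, hhg, mul_one, mul_assoc]
  rw [e4, dualMat_mul_dualMat hF hG', hF, hG, mul_add, mul_neg, Matrix.mul_smul, mul_one]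
  have e5 : h * (g * G * g * F) = G * g * F := by
    simp only [← mul_assoc, hhg, one_mul]
  have e6 : F * (g * G * g) = F * g * G * g := by simp only [mul_assoc]
  rw [e5, e6]
  congr 1
  simp only [mul_neg, neg_mul, Matrix.trace_neg, neg_smul, neg_neg, neg_add]

/-- Cyclic identity for the dual of a trace-free array. -/
theorem dualMat_cyclic (A : Fin 4 → M4 𝕜) (hA : ∀ a, (A a).transpose = - A a)
    (ht : ∀ p, ∑ d, A d p d = 0) (a b c : Fin 4) :
    dualMat (A a) b c + dualMat (A b) c a + dualMat (A c) a b = 0 := by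
  have hs : ∀ x i j, A x j i = - A x i j := fun x i j => congrFun (congrFun (hA x) i) j
  have h0 : ∀ x i, A x i i = 0 := fun x i => self_eq_neg.1 (hs x i i)
  have t0 := ht 0
  have t1 := ht 1
  have t2 := ht 2
  have t3 := ht 3
  simp only [Fin.sum_univ_four, h0, hs _ 0 1, hs _ 0 2, hs _ 0 3, hs _ 1 2, hs _ 1 3,
    hs _ 2 3] at t0 t1 t2 t3
  have D := fun x => dualMat_entries (A x)
  -- Each cyclic sum either vanishes by antisymmetry or is, up to sign, one of the four trace
  -- conditions.
  fin_cases a <;> fin_cases b <;> fin_cases c <;>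
    simp only [Fin.zero_eta, Fin.mk_one, Fin.reduceFinMk, D] <;>
    first
    | ring1
    | linear_combination t0
    | linear_combination -t0
    | linear_combination t1
    | linear_combination -t1
    | linear_combination t2
    | linear_combination -t2
    | linear_combination t3
    | linear_combination -t3

variable {U N : Arr4 𝕜}

theorem IsCurv.slice (hU : IsCurv U) (c d : Fin 4) :
    (Matrix.of fun p q => U p q c d : M4 𝕜).transpose = - Matrix.of fun p q => U p q c d := by
  ext p q; exact hU.antisymm q p c d

theorem IsCurv.slice' (hU : IsCurv U) (a b : Fin 4) :
    (Matrix.of fun p q => U a b p q : M4 𝕜).transpose = - Matrix.of fun p q => U a b p q := by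
  ext p q; exact hU.antisymm' a b q p

/-- The classical derivation of the pair symmetry from the Bianchi identity: four cyclic identities
are combined with signs so that only the two wanted terms remain. -/
theorem pair_symm_of_cyclic {T : Arr4 𝕜} (h1 : ∀ a b c d, T a b c d = - T b a c d)
    (h2 : ∀ a b c d, T a b c d = - T a b d c)
    (h3 : ∀ a b c d, T b c a d + T c a b d + T a b c d = 0) (a b c d : Fin 4) :
    T a b c d = T c d a b := by
  have e1 := h3 a b c d
  have e2 := h3 b c d a
  have e3 := h3 c d a b
  have e4 := h3 d a b c
  have : (2 : 𝕜) * T a b c d = 2 * T c d a b := by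
    rw [h2 c d b a, h1 d b c a, h2 b c d a] at e2
    rw [h1 d a c b, h2 a d c b, h1 a c d b, h2 c a d b] at e3
    rw [h2 a b d c, h2 b d a c, h1 d a b c] at e4
    linear_combination e1 + e2 - e3 - e4
  exact mul_left_cancel₀ two_ne_zero this

/-- On Weyl tensors, the left dual is the right dual. -/
theorem IsWeyl4.lower_dual (hU : IsWeyl4 g U) :
    (map₁ dualMat (map₂ (conjMap g) U) = map₂ dualMat (map₁ (conjMap g) U)) ∧
      IsCurv (map₁ dualMat (map₂ (conjMap g) U)) := by
  set T := map₁ dualMat (map₂ (conjMap g) U) with hT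
  have hM : ∀ p q a y, map₂ (conjMap g) U p q a y = ∑ c, ∑ d, g a c * g y d * U p q c d :=
    fun p q a y => conjMap_entry g _ a y
  have h1 : ∀ a b c d, T a b c d = - T b a c d := fun a b c d =>
    congrFun (congrFun (dualMat_antisymm (Matrix.of fun p q => map₂ (conjMap g) U p q c d)) b) a
  have h2 : ∀ a b c d, T a b c d = - T a b d c := by
    intro a b c d
    have : T = map₂ (conjMap g) (map₁ dualMat U) := map₁_map₂ _ _ _
    rw [this]
    have sl : (Matrix.of fun p q => map₁ dualMat U a b p q : M4 𝕜).transpose =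
        - Matrix.of fun p q => map₁ dualMat U a b p q := by
      ext p q
      have : (Matrix.of fun r s => U r s q p : M4 𝕜) = - Matrix.of fun r s => U r s p q := by
        ext r s; exact hU.antisymm' r s q p
      simp only [Matrix.transpose_apply, Matrix.of_apply, Matrix.neg_apply, map₁, this, map_neg]
    exact congrFun (congrFun (conjMap_antisymm sl g) d) c
  -- The vanishing of the traces enters here: it gives the left dual the cyclic identity, thus the
  -- pair symmetry, and by the pair symmetry the left dual is also the right dual.
  have h3 : ∀ a b c d, T b c a d + T c a b d + T a b c d = 0 := by
    intro a b c d
    refine dualMat_cyclic (fun x => Matrix.of fun p q => map₂ (conjMap g) U p q x d) ?_ ?_ a b c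
    · intro x
      ext p q
      simp only [Matrix.transpose_apply, Matrix.of_apply, Matrix.neg_apply, hM,
        ← Finset.sum_neg_distrib]
      refine Finset.sum_congr rfl fun r _ => Finset.sum_congr rfl fun s _ => ?_
      rw [hU.antisymm]; ring
    · intro p
      simp only [Matrix.of_apply, hM]
      have : ∀ x, ∑ c, ∑ e, g x c * g d e * U p x c e =
          ∑ e, ∑ c, - g d e * (g x c * U x p c e) := by
        intro x
        rw [Finset.sum_comm]
        refine Finset.sum_congr rfl fun r _ => Finset.sum_congr rfl fun s _ => ?_
        rw [hU.antisymm]; ring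
      simp only [this]
      rw [Finset.sum_comm]
      simp only [← Finset.mul_sum, hU.trace, mul_zero, Finset.sum_const_zero]
  have hp := pair_symm_of_cyclic h1 h2 h3
  refine ⟨?_, h1, hp, fun a b c d => ?_⟩
  · ext a b c d
    rw [hp a b c d, hT, map₂_eq, map₂_eq, hU.toIsCurv.swap]
    rfl
  · have e := h3 b c d a
    rw [h2 c d b a, h2 d b c a, h2 b c d a] at e
    rw [hp a b c d, hp a c d b, hp a d b c]
    linear_combination -e

theorem map₁_congr {f f' : M4 𝕜 →ₗ[𝕜] M4 𝕜} (hU : IsCurv U)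
    (hf : ∀ F : M4 𝕜, F.transpose = -F → f F = f' F) : map₁ f U = map₁ f' U := by
  ext a b c d
  simp only [map₁, hf _ (hU.slice c d)]

theorem map₁_conj_cancel (hg : g.transpose = g) (hhg : h * g = 1) (V : Arr4 𝕜) :
    map₁ (conjMap h) (map₁ (conjMap g) V) = V := by
  ext a b c d
  have := conjMap_cancel hg hhg (Matrix.of fun p q => V p q c d)
  exact congrFun (congrFun this a) b

theorem map₂_conj_cancel (hg : g.transpose = g) (hhg : h * g = 1) (V : Arr4 𝕜) :
    map₂ (conjMap h) (map₂ (conjMap g) V) = V := by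
  have := map₁_conj_cancel hg hhg (swapPairs V)
  exact congrArg swapPairs this

theorem IsCurv.smul {Z : Arr4 𝕜} (hZ : IsCurv Z) (t : 𝕜) : IsCurv (t • Z) where
  antisymm a b c d := by simp [hZ.antisymm a b c d]
  pair a b c d := by simp [hZ.pair a b c d]
  bianchi a b c d := by
    have := hZ.bianchi a b c d
    simp only [Pi.smul_apply, smul_eq_mul]
    linear_combination t * this

theorem IsCurv.conj {Z : Arr4 𝕜} (hZ : IsCurv Z) (P : M4 𝕜) :
    IsCurv (map₁ (conjMap P) (map₂ (conjMap P) Z)) := by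
  have e : ∀ a b c d, map₁ (conjMap P) (map₂ (conjMap P) Z) a b c d =
      ∑ p, ∑ q, ∑ r, ∑ s, P a p * P b q * P c r * P d s * Z p q r s := by
    intro a b c d
    have h1 : map₁ (conjMap P) (map₂ (conjMap P) Z) a b c d =
      ∑ p, ∑ q, P a p * P b q * map₂ (conjMap P) Z p q c d := conjMap_entry P _ a b
    have h2 : ∀ p q, map₂ (conjMap P) Z p q c d = ∑ r, ∑ s, P c r * P d s * Z p q r s :=
      fun p q => conjMap_entry P _ c d
    simp only [h1, h2, Finset.mul_sum]
    exact Finset.sum_congr rfl fun r _ => Finset.sum_congr rfl fun s _ =>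
      Finset.sum_congr rfl fun p _ => Finset.sum_congr rfl fun q _ => by ring
  refine ⟨fun a b c d => ?_, fun a b c d => ?_, fun a b c d => ?_⟩
  · rw [e, e, Finset.sum_comm, ← Finset.sum_neg_distrib]
    refine Finset.sum_congr rfl fun q _ => ?_
    rw [← Finset.sum_neg_distrib]
    refine Finset.sum_congr rfl fun p _ => ?_
    rw [← Finset.sum_neg_distrib]
    refine Finset.sum_congr rfl fun r _ => ?_
    rw [← Finset.sum_neg_distrib]
    refine Finset.sum_congr rfl fun s _ => ?_
    rw [hZ.antisymm]; ring
  · have := congrArg (fun V => map₁ (conjMap P) (map₂ (conjMap P) V)) hZ.swap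
    have e2 : swapPairs (map₁ (conjMap P) (map₂ (conjMap P) Z)) =
        map₁ (conjMap P) (map₂ (conjMap P) (swapPairs Z)) := by
      rw [map₁_map₂]; rfl
    exact (congrFun (congrFun (congrFun (congrFun (e2.trans this) a) b) c) d).symm
  · rw [e, e, e, ← Finset.sum_add_distrib, ← Finset.sum_add_distrib]
    refine Finset.sum_eq_zero fun p _ => ?_
    have c1 : ∑ q, ∑ r, ∑ s, P a p * P c q * P d r * P b s * Z p q r s =
        ∑ q, ∑ r, ∑ s, P a p * P c r * P d s * P b q * Z p r s q := by
      rw [Finset.sum_congr rfl fun q _ => Finset.sum_comm, Finset.sum_comm]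
    have c2 : ∑ q, ∑ r, ∑ s, P a p * P d q * P b r * P c s * Z p q r s =
        ∑ q, ∑ r, ∑ s, P a p * P d s * P b q * P c r * Z p s q r := by
      rw [Finset.sum_comm, Finset.sum_congr rfl fun q _ => Finset.sum_comm]
    rw [c1, c2, ← Finset.sum_add_distrib, ← Finset.sum_add_distrib]
    refine Finset.sum_eq_zero fun q _ => ?_
    rw [← Finset.sum_add_distrib, ← Finset.sum_add_distrib]
    refine Finset.sum_eq_zero fun r _ => ?_
    rw [← Finset.sum_add_distrib, ← Finset.sum_add_distrib]
    refine Finset.sum_eq_zero fun s _ => ?_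
    linear_combination P a p * P b q * P c r * P d s * hZ.bianchi p q r s

/-- Lowering all four indices turns the left star into `g.det` times the left dual of
`IsWeyl4.lower_dual`. Raising the indices again preserves the curvature symmetries, and the pair
symmetry identifies the two stars. -/
theorem IsWeyl4.star (hg : g.transpose = g) (hhg : h * g = 1) (hU : IsWeyl4 g U) :
    map₁ (starMap g) U = map₂ (starMap g) U ∧ IsCurv (map₁ (starMap g) U) := by
  obtain ⟨h1, h2⟩ := hU.lower_dual
  have key : map₁ (conjMap g) (map₂ (conjMap g) (map₁ (starMap g) U)) =
      g.det • map₁ dualMat (map₂ (conjMap g) U) := by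
    rw [map₁_map₂, map₁_map₁, map₁_congr (f' := g.det • dualMat) hU.toIsCurv
      (fun F hF => conj_starMap hg hF), map₁_map₂]
    ext a b c d
    simp only [map₁, map₂, LinearMap.smul_apply, Matrix.smul_apply, Pi.smul_apply]
    rw [← Matrix.smul_apply, ← map_smul]; rfl
  have e1 : map₁ (starMap g) U =
      map₂ (conjMap h) (map₁ (conjMap h) (g.det • map₁ dualMat (map₂ (conjMap g) U))) := by
    rw [← key, map₁_conj_cancel hg hhg, map₂_conj_cancel hg hhg]
  have e2 : map₂ (starMap g) U = swapPairs (map₁ (starMap g) U) := by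
    rw [map₂_eq, hU.toIsCurv.swap]
  have e3 : IsCurv (map₁ (starMap g) U) := by
    rw [e1, ← map₁_map₂]; exact (h2.smul _).conj h
  exact ⟨by rw [e2, e3.swap], e3⟩

end CurvatureArrays

/-! ### A totally symmetric trace-free contraction of two Weyl tensors -/

section Contraction

variable {𝕜 : Type*} [RCLike 𝕜] {g h : M4 𝕜} {U N : Arr4 𝕜}

/-- The tensor `Y^{ef}_{bd}` obtained from `U^{ebfd}` by lowering `b` and `d`. -/
def lowerMid (g : M4 𝕜) (U : Arr4 𝕜) : Arr4 𝕜 := fun e f b d =>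
  ∑ p, ∑ q, g b p * g d q * U e p f q

/-- The partial contraction `Y^{ef}_{bd} N^{abcd}`. -/
def contrBD (Y N : Arr4 𝕜) : Arr4 𝕜 := fun e a f c => ∑ b, ∑ d, Y e f b d * N a b c d

/-- The symmetrization of the partial contraction that turns out to be totally symmetric. -/
def symContr (g h : M4 𝕜) (Y N : Arr4 𝕜) : Arr4 𝕜 := fun e a f c =>
  contrBD Y N e a f c + contrBD Y N a e f c
    - (1 / 2) * h e a * ∑ p, ∑ q, g p q * contrBD Y N p q f c

/-- The contraction as a sum of matrix products in the first index pairs, the form to which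
`starMap_mul_starMap` applies. -/
theorem contrBD_lowerMid (hg : g.transpose = g) (U N : Arr4 𝕜) (e a f c : Fin 4) :
    contrBD (lowerMid g U) N e a f c = ∑ d, ∑ q, g d q *
      ((Matrix.of fun p r => U p r f q : M4 𝕜) * g *
        (Matrix.of fun p r => N p r c d : M4 𝕜).transpose) e a := by
  have hs : ∀ i j, g i j = g j i := fun i j => congrFun (congrFun hg j) i
  simp only [contrBD, lowerMid, Matrix.mul_apply, Matrix.transpose_apply, Matrix.of_apply,
    Finset.sum_mul, Finset.mul_sum]
  rw [Finset.sum_comm]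
  refine Finset.sum_congr rfl fun d _ => ?_
  have : ∀ b, ∑ p, ∑ q, g b p * g d q * U e p f q * N a b c d =
      ∑ q, ∑ p, g b p * g d q * U e p f q * N a b c d := fun b => Finset.sum_comm
  simp only [this]
  rw [Finset.sum_comm]
  refine Finset.sum_congr rfl fun q _ => Finset.sum_congr rfl fun b _ =>
    Finset.sum_congr rfl fun p _ => ?_
  rw [hs b p]; ring

theorem contrBD_swapPairs (U N : Arr4 𝕜) (e a f c : Fin 4) :
    contrBD (lowerMid g (swapPairs U)) (swapPairs N) e a f c =
      contrBD (lowerMid g U) N f c e a := by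
  simp only [contrBD, lowerMid, swapPairs]
  rw [Finset.sum_comm]
  refine Finset.sum_congr rfl fun b _ => Finset.sum_congr rfl fun d _ => ?_
  rw [Finset.sum_comm]
  congr 1
  exact Finset.sum_congr rfl fun p _ => Finset.sum_congr rfl fun q _ => by ring

theorem contrBD_star₁ (hg : g.transpose = g) (hhg : h * g = 1)
    (hU : ∀ a b c d, U a b c d = - U b a c d) (hN : ∀ a b c d, N a b c d = - N b a c d)
    (e a f c : Fin 4) :
    contrBD (lowerMid g (map₁ (starMap g) U)) (map₁ (starMap g) N) e a f c =
      g.det * (- contrBD (lowerMid g U) N a e f c +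
        (1 / 2) * h e a * ∑ p, ∑ q, g p q * contrBD (lowerMid g U) N p q f c) := by
  have hs : ∀ i j, g i j = g j i := fun i j => congrFun (congrFun hg j) i
  have tU : ∀ c d, (Matrix.of fun p q => U p q c d : M4 𝕜).transpose =
      - Matrix.of fun p q => U p q c d := fun c d => by ext p q; exact hU q p c d
  have tN : ∀ c d, (Matrix.of fun p q => N p q c d : M4 𝕜).transpose =
      - Matrix.of fun p q => N p q c d := fun c d => by ext p q; exact hN q p c d
  simp only [contrBD_lowerMid hg]
  have key : ∀ q d, ((Matrix.of fun p r => map₁ (starMap g) U p r f q : M4 𝕜) * g *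
        (Matrix.of fun p r => map₁ (starMap g) N p r c d : M4 𝕜).transpose) e a =
      g.det * (- ((Matrix.of fun p r => U p r f q : M4 𝕜) * g *
        (Matrix.of fun p r => N p r c d : M4 𝕜).transpose) a e + (1 / 2) * h e a *
        ∑ i, ∑ j, g i j * ((Matrix.of fun p r => U p r f q : M4 𝕜) * g *
        (Matrix.of fun p r => N p r c d : M4 𝕜).transpose) i j) := by
    intro q d
    have e0 := starMap_mul_starMap hg hhg (tU f q) (tN c d)
    have e1 := congrFun (congrFun e0 e) a
    refine Eq.trans (by rfl) (e1.trans ?_)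
    have e2 : ((Matrix.of fun p r => N p r c d : M4 𝕜) * g *
        (Matrix.of fun p r => U p r f q : M4 𝕜).transpose) e a =
        ((Matrix.of fun p r => U p r f q : M4 𝕜) * g *
        (Matrix.of fun p r => N p r c d : M4 𝕜).transpose) a e := by
      conv_rhs => rw [← Matrix.transpose_apply (_ * _) e a, Matrix.transpose_mul,
        Matrix.transpose_mul, hg, Matrix.transpose_transpose, ← mul_assoc]
    have e3 : ((Matrix.of fun p r => U p r f q : M4 𝕜) * g *
        (Matrix.of fun p r => N p r c d : M4 𝕜).transpose * g).trace =
        ∑ i, ∑ j, g i j * ((Matrix.of fun p r => U p r f q : M4 𝕜) * g *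
        (Matrix.of fun p r => N p r c d : M4 𝕜).transpose) i j := by
      simp only [Matrix.trace, Matrix.diag_apply]
      refine Finset.sum_congr rfl fun i _ => ?_
      rw [Matrix.mul_apply]
      exact Finset.sum_congr rfl fun j _ => by rw [hs i j, mul_comm]
    simp only [Matrix.smul_apply, Matrix.add_apply, Matrix.neg_apply, smul_eq_mul]
    rw [e2, e3]; ring
  simp only [key]
  have e4 : ∀ i j, g i j * ∑ d, ∑ q, g d q *
      ((Matrix.of fun p r => U p r f q : M4 𝕜) * g *
        (Matrix.of fun p r => N p r c d : M4 𝕜).transpose) i j =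
      ∑ d, ∑ q, g d q * (g i j * ((Matrix.of fun p r => U p r f q : M4 𝕜) * g *
        (Matrix.of fun p r => N p r c d : M4 𝕜).transpose) i j) := fun i j => by
    rw [Finset.mul_sum]; refine Finset.sum_congr rfl fun d _ => ?_
    rw [Finset.mul_sum]; exact Finset.sum_congr rfl fun q _ => by ring
  have e5 : ∀ F : Fin 4 → Fin 4 → Fin 4 → Fin 4 → 𝕜,
      ∑ i, ∑ j, ∑ d, ∑ q, g d q * F i j d q = ∑ d, ∑ q, g d q * ∑ i, ∑ j, F i j d q := by
    intro F
    have h1 : ∀ i, ∑ j, ∑ d, ∑ q, g d q * F i j d q = ∑ d, ∑ q, ∑ j, g d q * F i j d q := by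
      intro i
      rw [Finset.sum_comm]
      exact Finset.sum_congr rfl fun d _ => Finset.sum_comm
    simp only [h1]
    rw [Finset.sum_comm]
    refine Finset.sum_congr rfl fun d _ => ?_
    rw [Finset.sum_comm]
    refine Finset.sum_congr rfl fun q _ => ?_
    simp only [Finset.mul_sum]
  simp only [e4]
  rw [e5]
  simp only [← Finset.sum_neg_distrib, Finset.mul_sum, ← Finset.sum_add_distrib, mul_add]
  refine Finset.sum_congr rfl fun d _ => Finset.sum_congr rfl fun q _ => ?_
  congr 1
  · ring
  · exact Finset.sum_congr rfl fun i _ => Finset.sum_congr rfl fun j _ => by ring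

theorem IsCurv.bianchi_swap (hU : IsCurv U) (e b f d : Fin 4) :
    U e b f d - U e d f b = U e f b d := by
  have h1 := hU.bianchi e b f d
  rw [hU.antisymm' e f d b, hU.antisymm' e d b f] at h1
  linear_combination h1

/-- By the Bianchi identity, antisymmetrizing `U^{ebfd}` in `e, f` moves these indices into one
pair. The result is skew in the contracted indices, so the same happens to `N`, with a factor `1/2`.
What remains is a pairing of two-forms, which the star preserves up to the determinant. -/
theorem contrBD_sub_swap (hU : IsCurv U) (hN : IsCurv N) (e a f c : Fin 4) :
    contrBD (lowerMid g U) N e a f c - contrBD (lowerMid g U) N f a e c =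
      (1 / 2) * ∑ b, ∑ d, ∑ p, ∑ q, g b p * g d q * U e f p q * N a c b d := by
  have h1 : contrBD (lowerMid g U) N e a f c - contrBD (lowerMid g U) N f a e c =
      ∑ b, ∑ d, ∑ p, ∑ q, g b p * g d q * U e f p q * N a b c d := by
    simp only [contrBD, lowerMid, ← Finset.sum_sub_distrib, Finset.sum_mul]
    refine Finset.sum_congr rfl fun b _ => Finset.sum_congr rfl fun d _ =>
      Finset.sum_congr rfl fun p _ => Finset.sum_congr rfl fun q _ => ?_
    have := hU.bianchi_swap e p f q
    rw [hU.pair e q f p] at this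
    linear_combination (g b p * g d q * N a b c d) * this
  have h2 : ∑ b, ∑ d, ∑ p, ∑ q, g b p * g d q * U e f p q * N a b c d =
      - ∑ b, ∑ d, ∑ p, ∑ q, g b p * g d q * U e f p q * N a d c b := by
    rw [Finset.sum_comm, ← Finset.sum_neg_distrib]
    refine Finset.sum_congr rfl fun b _ => ?_
    rw [← Finset.sum_neg_distrib]
    refine Finset.sum_congr rfl fun d _ => ?_
    rw [Finset.sum_comm, ← Finset.sum_neg_distrib]
    refine Finset.sum_congr rfl fun p _ => ?_
    rw [← Finset.sum_neg_distrib]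
    refine Finset.sum_congr rfl fun q _ => ?_
    rw [hU.antisymm' e f q p]; ring
  have h3 : ∑ b, ∑ d, ∑ p, ∑ q, g b p * g d q * U e f p q * N a c b d =
      (∑ b, ∑ d, ∑ p, ∑ q, g b p * g d q * U e f p q * N a b c d) -
      ∑ b, ∑ d, ∑ p, ∑ q, g b p * g d q * U e f p q * N a d c b := by
    simp only [← Finset.sum_sub_distrib]
    refine Finset.sum_congr rfl fun b _ => Finset.sum_congr rfl fun d _ =>
      Finset.sum_congr rfl fun p _ => Finset.sum_congr rfl fun q _ => ?_
    linear_combination -(g b p * g d q * U e f p q) * hN.bianchi_swap a b c d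
  rw [h1, h3]
  linear_combination (1 / 2 : 𝕜) * h2

theorem pairing_eq_trace (hg : g.transpose = g) (F G : M4 𝕜) :
    ∑ b, ∑ d, ∑ p, ∑ q, g b p * g d q * F p q * G b d = (F * g * G.transpose * g).trace := by
  have hs : ∀ i j, g i j = g j i := fun i j => congrFun (congrFun hg j) i
  simp only [Matrix.trace, Matrix.diag_apply, Matrix.mul_apply, Matrix.transpose_apply,
    Finset.sum_mul]
  have c1 : ∀ b : Fin 4, ∑ d, ∑ p, ∑ q, g b p * g d q * F p q * G b d =
      ∑ p, ∑ d, ∑ q, g b p * g d q * F p q * G b d := fun b => Finset.sum_comm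
  simp only [c1]
  rw [Finset.sum_comm]
  refine Finset.sum_congr rfl fun p _ => Finset.sum_congr rfl fun b _ =>
    Finset.sum_congr rfl fun d _ => Finset.sum_congr rfl fun q _ => ?_
  rw [hs d q, hs b p]; ring

/-- The trace of `starMap_mul_starMap`, with coefficient `-1 + (1/2) * 4 = 1`. -/
theorem trace_star (hg : g.transpose = g) (hhg : h * g = 1) {F G : M4 𝕜}
    (hF : F.transpose = -F) (hG : G.transpose = -G) :
    (starMap g F * g * (starMap g G).transpose * g).trace =
      g.det * (F * g * G.transpose * g).trace := by
  have e : (G * g * F.transpose * g).trace = (F * g * G.transpose * g).trace := by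
    rw [← Matrix.trace_transpose]
    simp only [Matrix.transpose_mul, Matrix.transpose_transpose, hg]
    rw [Matrix.trace_mul_comm]
    simp only [mul_assoc]
  rw [starMap_mul_starMap hg hhg hF hG, Matrix.smul_mul, Matrix.trace_smul, add_mul,
    Matrix.trace_add, neg_mul, Matrix.trace_neg, e, Matrix.smul_mul, hhg, Matrix.trace_smul,
    Matrix.trace_one, Fintype.card_fin]
  simp only [smul_eq_mul]
  push_cast
  ring

theorem det_ne_zero_of_mul (hhg : h * g = 1) : g.det ≠ 0 := by
  intro h0
  have := congrArg Matrix.det hhg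
  rw [Matrix.det_mul, h0] at this
  simp at this

/-- The square of `starMap g` on skew matrices is `g.det`. If both arrays are split into eigenparts
of the star, over an extension of the field if necessary, the products of equal duality cancel on
the right and those of opposite duality are doubled. Each of the two contractions has the symmetries
inherited from `IsCurv`, and these yield the total symmetry. -/
theorem symContr_eq (hg : g.transpose = g) (hhg : h * g = 1) (hU : IsWeyl4 g U)
    (hN : IsWeyl4 g N) (e a f c : Fin 4) :
    symContr g h (lowerMid g U) N e a f c = contrBD (lowerMid g U) N e a f c - (g.det)⁻¹ *
      contrBD (lowerMid g (map₁ (starMap g) U)) (map₁ (starMap g) N) e a f c := by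
  rw [contrBD_star₁ hg hhg hU.antisymm hN.antisymm, ← mul_assoc,
    inv_mul_cancel₀ (det_ne_zero_of_mul hhg), symContr]
  ring

theorem contrBD_pair (hU : IsCurv U) (hN : IsCurv N) (e a f c : Fin 4) :
    contrBD (lowerMid g U) N e a f c = contrBD (lowerMid g U) N f c e a := by
  rw [← contrBD_swapPairs, hU.swap, hN.swap]

theorem symContr_pair (hg : g.transpose = g) (hhg : h * g = 1) (hU : IsWeyl4 g U)
    (hN : IsWeyl4 g N) (e a f c : Fin 4) :
    symContr g h (lowerMid g U) N e a f c = symContr g h (lowerMid g U) N f c e a := by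
  rw [symContr_eq hg hhg hU hN, symContr_eq hg hhg hU hN, contrBD_pair hU.toIsCurv hN.toIsCurv,
    contrBD_pair (hU.star hg hhg).2 (hN.star hg hhg).2]

theorem symm_of_mul_eq_one (hg : g.transpose = g) (hhg : h * g = 1) : h.transpose = h := by
  have := congrArg Matrix.transpose (mul_eq_one_comm.1 hhg)
  rw [Matrix.transpose_mul, Matrix.transpose_one, hg] at this
  calc h.transpose = h.transpose * (g * h) := by rw [mul_eq_one_comm.1 hhg, mul_one]
    _ = h := by rw [← mul_assoc, this, one_mul]

theorem symContr_swap_fst (hg : g.transpose = g) (hhg : h * g = 1) (Y N : Arr4 𝕜)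
    (e a f c : Fin 4) : symContr g h Y N e a f c = symContr g h Y N a e f c := by
  have hs : h e a = h a e := congrFun (congrFun (symm_of_mul_eq_one hg hhg) a) e
  simp only [symContr, hs]; ring

/-- For each term of `symContr_eq` the failure of symmetry is the pairing of second index pairs in
`contrBD_sub_swap`. The star can be moved to the second pair by `IsWeyl4.star`, and there
`trace_star` shows that the two pairings cancel. -/
theorem symContr_swap_odd (hg : g.transpose = g) (hhg : h * g = 1) (hU : IsWeyl4 g U)
    (hN : IsWeyl4 g N) (e a f c : Fin 4) :
    symContr g h (lowerMid g U) N e a f c = symContr g h (lowerMid g U) N f a e c := by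
  obtain ⟨u1, u2⟩ := hU.star hg hhg
  obtain ⟨n1, n2⟩ := hN.star hg hhg
  have key := contrBD_sub_swap (g := g) hU.toIsCurv hN.toIsCurv e a f c
  have key' := contrBD_sub_swap (g := g) u2 n2 e a f c
  have e1 := pairing_eq_trace hg (Matrix.of fun p q => U e f p q) (Matrix.of fun p q => N a c p q)
  have e2 := pairing_eq_trace hg (starMap g (Matrix.of fun p q => U e f p q))
    (starMap g (Matrix.of fun p q => N a c p q))
  rw [trace_star hg hhg (hU.toIsCurv.slice' e f) (hN.toIsCurv.slice' a c), ← e1] at e2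
  have e3 : ∑ b, ∑ d, ∑ p, ∑ q, g b p * g d q * map₁ (starMap g) U e f p q *
      map₁ (starMap g) N a c b d =
      g.det * ∑ b, ∑ d, ∑ p, ∑ q, g b p * g d q * U e f p q * N a c b d := by
    rw [u1, n1]; exact e2
  rw [e3] at key'
  have hd := inv_mul_cancel₀ (det_ne_zero_of_mul hhg)
  rw [symContr_eq hg hhg hU hN, symContr_eq hg hhg hU hN]
  linear_combination key - (g.det)⁻¹ * key' - (1 / 2 *
    ∑ b, ∑ d, ∑ p, ∑ q, g b p * g d q * U e f p q * N a c b d) * hd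

theorem sum_mul_inv (hg : g.transpose = g) (hhg : h * g = 1) : ∑ p, ∑ q, g p q * h p q = 4 := by
  have hs : ∀ i j, g i j = g j i := fun i j => congrFun (congrFun hg j) i
  have := congrArg Matrix.trace hhg
  rw [Matrix.trace_one] at this
  simp only [Matrix.trace, Matrix.diag_apply, Matrix.mul_apply, Fintype.card_fin] at this
  refine Eq.trans ?_ (this.trans (by norm_num))
  exact Finset.sum_congr rfl fun p _ => Finset.sum_congr rfl fun q _ => by rw [hs p q, mul_comm]

/-- This fixes the coefficient `1/2` in `symContr`: the trace is multiplied by `1 + 1 - (1/2) * 4 =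
0`. -/
theorem symContr_trace (hg : g.transpose = g) (hhg : h * g = 1) (Y N : Arr4 𝕜)
    (f c : Fin 4) : ∑ p, ∑ q, g p q * symContr g h Y N p q f c = 0 := by
  have hs : ∀ i j, g i j = g j i := fun i j => congrFun (congrFun hg j) i
  set t := ∑ p, ∑ q, g p q * contrBD Y N p q f c with ht
  have e1 : ∑ p, ∑ q, g p q * contrBD Y N q p f c = t := by
    rw [ht, Finset.sum_comm]
    exact Finset.sum_congr rfl fun p _ => Finset.sum_congr rfl fun q _ => by rw [hs p q]
  have e2 : ∑ p, ∑ q, g p q * (1 / 2 * h p q * t) = 2 * t := by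
    have : ∀ p q, g p q * (1 / 2 * h p q * t) = (g p q * h p q) * (t / 2) := fun p q => by ring
    simp only [this, ← Finset.sum_mul, sum_mul_inv hg hhg]; ring
  simp only [symContr, ← ht, mul_add, mul_sub, Finset.sum_add_distrib, Finset.sum_sub_distrib]
  rw [e1, e2]; ring

end Contraction

/-! ### The trace-free symmetric part of a tensor with four indices -/

section Pairing

variable {𝕜 : Type*} [RCLike 𝕜]

theorem sum_index (F : (Fin 4 → Fin 4) → 𝕜) :
    ∑ I, F I = ∑ a, ∑ b, ∑ c, ∑ d, F ![a, b, c, d] := by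
  have step : ∀ {n : ℕ} (H : (Fin (n + 1) → Fin 4) → 𝕜),
      ∑ I, H I = ∑ a, ∑ J : Fin n → Fin 4, H (Matrix.vecCons a J) := by
    intro n H
    rw [← (Fin.consEquiv fun _ => Fin 4).sum_comp, Fintype.sum_prod_type]
    rfl
  rw [step]
  refine Finset.sum_congr rfl fun a _ => ?_
  rw [step]
  refine Finset.sum_congr rfl fun b _ => ?_
  rw [step]
  refine Finset.sum_congr rfl fun c _ => ?_
  rw [step]
  refine Finset.sum_congr rfl fun d _ => ?_
  rw [Fintype.sum_unique]
  congr 1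

/-- Entrywise coercion of a real matrix. -/
def castMat (𝕜 : Type*) [RCLike 𝕜] (A : Mat) : M4 𝕜 := A.map (fun x => (x : 𝕜))

@[simp] theorem castMat_apply (A : Mat) (i j : Fin 4) : castMat 𝕜 A i j = (A i j : 𝕜) := rfl

theorem castMat_transpose (A : Mat) : (castMat 𝕜 A).transpose = castMat 𝕜 A.transpose := rfl

theorem castMat_mul (A B : Mat) : castMat 𝕜 (A * B) = castMat 𝕜 A * castMat 𝕜 B := by
  ext i j
  simp [Matrix.mul_apply]

theorem castMat_one : castMat 𝕜 1 = 1 := by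
  ext i j
  by_cases h : i = j <;> simp [Matrix.one_apply, h]

theorem castMat_inv_mul {g : Mat} (hd : g.det ≠ 0) : castMat 𝕜 g⁻¹ * castMat 𝕜 g = 1 := by
  rw [← castMat_mul, Matrix.nonsing_inv_mul _ (isUnit_iff_ne_zero.2 hd), castMat_one]

variable {g : Mat}

theorem symmPart_comp (Q : (Fin 4 → Fin 4) → 𝕜) (I : Fin 4 → Fin 4) (π : Equiv.Perm (Fin 4)) :
    symmPart Q (I ∘ π) = symmPart Q I := by
  unfold symmPart
  congr 1
  exact Fintype.sum_equiv (Equiv.mulLeft π) _ _ fun σ => rfl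

theorem symmPart_symm (Q : (Fin 4 → Fin 4) → 𝕜) (a b c d : Fin 4) :
    symmPart Q ![b, a, c, d] = symmPart Q ![a, b, c, d] ∧
    symmPart Q ![a, c, b, d] = symmPart Q ![a, b, c, d] ∧
    symmPart Q ![a, b, d, c] = symmPart Q ![a, b, c, d] := by
  refine ⟨?_, ?_, ?_⟩
  · rw [← symmPart_comp Q ![a, b, c, d] (Equiv.swap 0 1)]
    congr 1; ext i; fin_cases i <;> rfl
  · rw [← symmPart_comp Q ![a, b, c, d] (Equiv.swap 1 2)]
    congr 1; ext i; fin_cases i <;> rfl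
  · rw [← symmPart_comp Q ![a, b, c, d] (Equiv.swap 2 3)]
    congr 1; ext i; fin_cases i <;> rfl

theorem trace₁₂_symm (Q : (Fin 4 → Fin 4) → 𝕜) (c d : Fin 4) :
    trace₁₂ g (symmPart Q) c d = trace₁₂ g (symmPart Q) d c :=
  Finset.sum_congr rfl fun p _ => Finset.sum_congr rfl fun q _ => by
    rw [(symmPart_symm Q p q c d).2.2]

theorem tfSymmPart_symm (hg : g.transpose = g) (Q : (Fin 4 → Fin 4) → 𝕜) (a b c d : Fin 4) :
    tfSymmPart g Q ![b, a, c, d] = tfSymmPart g Q ![a, b, c, d] ∧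
    tfSymmPart g Q ![a, c, b, d] = tfSymmPart g Q ![a, b, c, d] ∧
    tfSymmPart g Q ![a, b, d, c] = tfSymmPart g Q ![a, b, c, d] := by
  have hs : ∀ i j, g i j = g j i := fun i j => congrFun (congrFun hg j) i
  have ht := trace₁₂_symm (g := g) Q
  obtain ⟨h1, h2, h3⟩ := symmPart_symm Q a b c d
  refine ⟨?_, ?_, ?_⟩
  · simp only [tfSymmPart, h1, Matrix.cons_val, hs b a, ht b a]; ring
  · simp only [tfSymmPart, h2, Matrix.cons_val, hs c b, ht c b]; ring
  · simp only [tfSymmPart, h3, Matrix.cons_val, hs d c, ht d c]; ring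

/-- Taking the trace-free symmetric part, as a linear map. -/
def tfSymmLin (g : Mat) : ((Fin 4 → Fin 4) → 𝕜) →ₗ[𝕜] ((Fin 4 → Fin 4) → 𝕜) where
  toFun Q := tfSymmPart g Q
  map_add' Q Q' := by
    have h1 : ∀ I, symmPart (Q + Q') I = symmPart Q I + symmPart Q' I := fun I => by
      simp [symmPart, Finset.sum_add_distrib, mul_add]
    have h2 : ∀ c d, trace₁₂ g (symmPart (Q + Q')) c d =
        trace₁₂ g (symmPart Q) c d + trace₁₂ g (symmPart Q') c d := fun c d => by
      simp [trace₁₂, h1, Finset.sum_add_distrib, mul_add]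
    ext I
    simp only [tfSymmPart, h1, h2, Pi.add_apply, mul_add, Finset.sum_add_distrib]
    ring
  map_smul' t Q := by
    have h1 : ∀ I, symmPart (t • Q) I = t * symmPart Q I := fun I => by
      simp only [symmPart, Pi.smul_apply, smul_eq_mul, ← Finset.mul_sum]; ring
    have h2 : ∀ c d, trace₁₂ g (symmPart (t • Q)) c d = t * trace₁₂ g (symmPart Q) c d :=
      fun c d => by
      simp only [trace₁₂, h1, Finset.mul_sum]
      exact Finset.sum_congr rfl fun p _ => Finset.sum_congr rfl fun q _ => by ring
    have h3 : ∑ p, ∑ q, ((g⁻¹ p q : ℝ) : 𝕜) * (t * trace₁₂ g (symmPart Q) p q) =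
        t * ∑ p, ∑ q, ((g⁻¹ p q : ℝ) : 𝕜) * trace₁₂ g (symmPart Q) p q := by
      simp only [Finset.mul_sum]
      exact Finset.sum_congr rfl fun p _ => Finset.sum_congr rfl fun q _ => by ring
    ext I
    simp only [tfSymmPart, h1, h2, h3, Pi.smul_apply, smul_eq_mul, RingHom.id_apply]
    ring

/-- The kernel of the projection. It separates the indices of `Q` from those of the section: each
component of `QY` can be treated as a single Weyl array with a coefficient in front. -/
theorem tfSymmPart_eq_sum (Q : (Fin 4 → Fin 4) → 𝕜) (I : Fin 4 → Fin 4) :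
    tfSymmPart g Q I = ∑ J, tfSymmPart g (Pi.single J (1 : 𝕜)) I * Q J := by
  have h1 : Q = ∑ J, Q J • (Pi.single J (1 : 𝕜) : (Fin 4 → Fin 4) → 𝕜) := by
    ext K
    simp [Finset.sum_apply, Pi.single_apply]
  have h2 := congrArg (fun R => tfSymmLin (𝕜 := 𝕜) g R I) h1
  simp only [map_sum, map_smul, Finset.sum_apply, Pi.smul_apply, smul_eq_mul] at h2
  exact h2.trans (Finset.sum_congr rfl fun J _ => mul_comm _ _)

theorem sum_inv_mul (hd : g.det ≠ 0) (i j : Fin 4) :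
    ∑ p, ((g⁻¹ i p : ℝ) : 𝕜) * ((g p j : ℝ) : 𝕜) = if i = j then 1 else 0 := by
  have := congrFun (congrFun (castMat_inv_mul (𝕜 := 𝕜) hd) i) j
  rwa [Matrix.mul_apply, Matrix.one_apply] at this

theorem inv_symm_entry (hg : g.transpose = g) (i j : Fin 4) : g⁻¹ i j = g⁻¹ j i := by
  have : (g⁻¹).transpose = g⁻¹ := by rw [Matrix.transpose_nonsing_inv, hg]
  exact congrFun (congrFun this j) i

/-- The constants belong to dimension 4. The six terms with `t` have trace `8 t + tt g` and the
three terms with two metrics have trace `6 g`; `1 - 8/8` and `-1/8 + 6/48` both vanish. -/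
theorem tfSymmPart_trace (hg : g.transpose = g) (hd : g.det ≠ 0) (Q : (Fin 4 → Fin 4) → 𝕜)
    (c d : Fin 4) : ∑ p, ∑ q, ((g⁻¹ p q : ℝ) : 𝕜) * tfSymmPart g Q ![p, q, c, d] = 0 := by
  have hs : ∀ i j, g i j = g j i := fun i j => congrFun (congrFun hg j) i
  have hi : ∀ i j, g⁻¹ i j = g⁻¹ j i := inv_symm_entry hg
  set t := trace₁₂ g (symmPart Q) with ht
  have htt : ∀ i j, t i j = t j i := trace₁₂_symm Q
  set tt : 𝕜 := ∑ p, ∑ q, ((g⁻¹ p q : ℝ) : 𝕜) * t p q with htt'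
  have s1 : ∀ x : Fin 4 → 𝕜, ∀ i, ∑ p, ∑ q, ((g⁻¹ p q : ℝ) : 𝕜) * (((g p i : ℝ) : 𝕜) * x q) =
      x i := by
    intro x i
    rw [Finset.sum_comm]
    have : ∀ q, ∑ p, ((g⁻¹ p q : ℝ) : 𝕜) * (((g p i : ℝ) : 𝕜) * x q) =
        (if q = i then 1 else 0) * x q := fun q => by
      rw [← sum_inv_mul hd, Finset.sum_mul]
      exact Finset.sum_congr rfl fun p _ => by rw [hi q p, mul_assoc]
    simp [this]
  have s2 : ∀ x : Fin 4 → 𝕜, ∀ i, ∑ p, ∑ q, ((g⁻¹ p q : ℝ) : 𝕜) * (((g q i : ℝ) : 𝕜) * x p) =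
      x i := by
    intro x i
    rw [Finset.sum_comm, ← s1 x i]
    exact Finset.sum_congr rfl fun p _ => Finset.sum_congr rfl fun q _ => by rw [hi]
  have s3 : ∑ p, ∑ q, ((g⁻¹ p q : ℝ) : 𝕜) * ((g p q : ℝ) : 𝕜) = 4 := by
    have : ∀ p, ∑ q, ((g⁻¹ p q : ℝ) : 𝕜) * ((g p q : ℝ) : 𝕜) = 1 := fun p => by
      have e := sum_inv_mul (𝕜 := 𝕜) hd p p
      rw [if_pos rfl] at e
      rw [← e]
      exact Finset.sum_congr rfl fun q _ => by rw [hs]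
    simp [this]
  have e : ∀ p q, ((g⁻¹ p q : ℝ) : 𝕜) * tfSymmPart g Q ![p, q, c, d] =
      ((g⁻¹ p q : ℝ) : 𝕜) * symmPart Q ![p, q, c, d]
      - (1 / 8) * (((g⁻¹ p q : ℝ) : 𝕜) * ((g p q : ℝ) : 𝕜) * t c d
        + ((g⁻¹ p q : ℝ) : 𝕜) * (((g p c : ℝ) : 𝕜) * t q d)
        + ((g⁻¹ p q : ℝ) : 𝕜) * (((g p d : ℝ) : 𝕜) * t q c)
        + ((g⁻¹ p q : ℝ) : 𝕜) * (((g q c : ℝ) : 𝕜) * t p d)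
        + ((g⁻¹ p q : ℝ) : 𝕜) * (((g q d : ℝ) : 𝕜) * t p c)
        + ((g⁻¹ p q : ℝ) : 𝕜) * t p q * ((g c d : ℝ) : 𝕜))
      + (1 / 48) * tt * (((g⁻¹ p q : ℝ) : 𝕜) * ((g p q : ℝ) : 𝕜) * ((g c d : ℝ) : 𝕜)
        + ((g⁻¹ p q : ℝ) : 𝕜) * (((g p c : ℝ) : 𝕜) * ((g q d : ℝ) : 𝕜))
        + ((g⁻¹ p q : ℝ) : 𝕜) * (((g p d : ℝ) : 𝕜) * ((g q c : ℝ) : 𝕜))) := by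
    intro p q
    simp only [tfSymmPart, Matrix.cons_val, ← ht, ← htt']
    ring
  simp only [e, Finset.sum_add_distrib, Finset.sum_sub_distrib, ← Finset.mul_sum, ← Finset.sum_mul]
  rw [s3, s1 (fun q => t q d), s1 (fun q => t q c), s2 (fun q => t q d), s2 (fun q => t q c),
    s1 (fun q => ((g q d : ℝ) : 𝕜)), s1 (fun q => ((g q c : ℝ) : 𝕜)), ← htt']
  have e2 : ∑ p, ∑ q, ((g⁻¹ p q : ℝ) : 𝕜) * symmPart Q ![p, q, c, d] = t c d := rfl
  rw [e2, htt d c, hs d c]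
  ring

/-- Total symmetry of an array with four indices. -/
structure IsTotSymm (K : Arr4 𝕜) : Prop where
  swap₁ : ∀ a b c d, K b a c d = K a b c d
  swap₂ : ∀ a b c d, K a c b d = K a b c d
  swap₃ : ∀ a b c d, K a b d c = K a b c d

/-- The adjacent transpositions generate the symmetric group as a monoid. -/
theorem IsTotSymm.comp_perm {K : Arr4 𝕜} (hK : IsTotSymm K) (π : Equiv.Perm (Fin 4))
    (I : Fin 4 → Fin 4) :
    K ((I ∘ π) 0) ((I ∘ π) 1) ((I ∘ π) 2) ((I ∘ π) 3) = K (I 0) (I 1) (I 2) (I 3) := by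
  let S : Submonoid (Equiv.Perm (Fin 4)) :=
    { carrier := {σ | ∀ I : Fin 4 → Fin 4,
        K ((I ∘ σ) 0) ((I ∘ σ) 1) ((I ∘ σ) 2) ((I ∘ σ) 3) = K (I 0) (I 1) (I 2) (I 3)}
      one_mem' := fun _ => rfl
      mul_mem' := fun {σ ρ} hσ hρ I => (hρ (I ∘ σ)).trans (hσ I) }
  have hS : S = ⊤ := by
    rw [eq_top_iff, ← Equiv.Perm.mclosure_swap_castSucc_succ 3, Submonoid.closure_le]
    rintro _ ⟨i, rfl⟩ I
    fin_cases i
    · exact hK.swap₁ _ _ _ _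
    · exact hK.swap₂ _ _ _ _
    · exact hK.swap₃ _ _ _ _
  have : π ∈ S := by rw [hS]; trivial
  exact this I

/-- Against a totally symmetric `K`, symmetrization is undone by relabelling the summation indices;
every correction term contains a metric and vanishes against the trace-free `K`. -/
theorem sum_tfSymmPart_mul {K : Arr4 𝕜} (hK : IsTotSymm K)
    (ht : ∀ c d, ∑ p, ∑ q, ((g p q : ℝ) : 𝕜) * K p q c d = 0) (Q : (Fin 4 → Fin 4) → 𝕜) :
    ∑ a, ∑ b, ∑ c, ∑ d, tfSymmPart g Q ![a, b, c, d] * K a b c d =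
      ∑ a, ∑ b, ∑ c, ∑ d, Q ![a, b, c, d] * K a b c d := by
  have h1 : ∑ a, ∑ b, ∑ c, ∑ d, symmPart Q ![a, b, c, d] * K a b c d =
      ∑ a, ∑ b, ∑ c, ∑ d, Q ![a, b, c, d] * K a b c d := by
    have e1 := sum_index fun I => symmPart Q I * K (I 0) (I 1) (I 2) (I 3)
    have e2 := sum_index fun I => Q I * K (I 0) (I 1) (I 2) (I 3)
    refine e1.symm.trans (Eq.trans ?_ e2)
    simp only [symmPart, Finset.mul_sum, Finset.sum_mul]
    rw [Finset.sum_comm]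
    have : ∀ σ : Equiv.Perm (Fin 4),
        ∑ I : Fin 4 → Fin 4, 1 / 24 * Q (I ∘ σ) * K (I 0) (I 1) (I 2) (I 3) =
        1 / 24 * ∑ I : Fin 4 → Fin 4, Q I * K (I 0) (I 1) (I 2) (I 3) := by
      intro σ
      rw [Finset.mul_sum]
      refine Fintype.sum_equiv (Equiv.arrowCongr σ.symm (Equiv.refl _)) _ _ fun I => ?_
      have := hK.comp_perm σ I
      have e : (Equiv.arrowCongr σ.symm (Equiv.refl (Fin 4))) I = I ∘ σ := by
        ext i; simp [Equiv.arrowCongr_apply]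
      rw [e, this]; ring
    simp only [this, Finset.sum_const, Finset.card_univ, Fintype.card_perm, Fintype.card_fin]
    rw [nsmul_eq_mul]
    norm_num [Nat.factorial]
    rw [← mul_assoc]
    norm_num
  have k2 : ∀ a b c d, K a c b d = K a b c d := hK.swap₂
  have p01 : ∀ t : Fin 4 → Fin 4 → 𝕜,
      ∑ a, ∑ b, ∑ c, ∑ d, ((g a b : ℝ) : 𝕜) * t c d * K a b c d = 0 := by
    intro t
    have : ∀ a, ∑ b, ∑ c, ∑ d, ((g a b : ℝ) : 𝕜) * t c d * K a b c d =
        ∑ c, ∑ d, ∑ b, ((g a b : ℝ) : 𝕜) * t c d * K a b c d := fun a => by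
      rw [Finset.sum_comm]; exact Finset.sum_congr rfl fun c _ => Finset.sum_comm
    simp only [this]
    rw [Finset.sum_comm]
    refine Finset.sum_eq_zero fun c _ => ?_
    rw [Finset.sum_comm]
    refine Finset.sum_eq_zero fun d _ => ?_
    have e : ∀ a b, ((g a b : ℝ) : 𝕜) * t c d * K a b c d =
      t c d * (((g a b : ℝ) : 𝕜) * K a b c d) := fun a b => by ring
    simp only [e, ← Finset.mul_sum, ht, mul_zero]
  -- the six positions of the metric are exchanged by permutations of the summation indices
  have c12 : ∀ F : Arr4 𝕜, ∑ a, ∑ b, ∑ c, ∑ d, F a b c d = ∑ a, ∑ b, ∑ c, ∑ d, F a c b d :=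
    fun F => Finset.sum_congr rfl fun a _ => Finset.sum_comm
  have c01 : ∀ F : Arr4 𝕜, ∑ a, ∑ b, ∑ c, ∑ d, F a b c d = ∑ a, ∑ b, ∑ c, ∑ d, F b a c d :=
    fun F => Finset.sum_comm
  have c23 : ∀ F : Arr4 𝕜, ∑ a, ∑ b, ∑ c, ∑ d, F a b c d = ∑ a, ∑ b, ∑ c, ∑ d, F a b d c :=
    fun F => Finset.sum_congr rfl fun a _ => Finset.sum_congr rfl fun b _ => Finset.sum_comm
  have p02 : ∀ t : Fin 4 → Fin 4 → 𝕜,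
      ∑ a, ∑ b, ∑ c, ∑ d, ((g a c : ℝ) : 𝕜) * t b d * K a b c d = 0 := by
    intro t; rw [c12]; simp only [k2]; exact p01 t
  have p03 : ∀ t : Fin 4 → Fin 4 → 𝕜,
      ∑ a, ∑ b, ∑ c, ∑ d, ((g a d : ℝ) : 𝕜) * t b c * K a b c d = 0 := by
    intro t; rw [c23]; simp only [hK.swap₃]; exact p02 t
  have p12 : ∀ t : Fin 4 → Fin 4 → 𝕜,
      ∑ a, ∑ b, ∑ c, ∑ d, ((g b c : ℝ) : 𝕜) * t a d * K a b c d = 0 := by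
    intro t; rw [c01]; simp only [hK.swap₁]; exact p02 t
  have p13 : ∀ t : Fin 4 → Fin 4 → 𝕜,
      ∑ a, ∑ b, ∑ c, ∑ d, ((g b d : ℝ) : 𝕜) * t a c * K a b c d = 0 := by
    intro t; rw [c23]; simp only [hK.swap₃]; exact p12 t
  have p23 : ∀ t : Fin 4 → Fin 4 → 𝕜,
      ∑ a, ∑ b, ∑ c, ∑ d, ((g c d : ℝ) : 𝕜) * t a b * K a b c d = 0 := by
    intro t; rw [c12]; simp only [k2]; exact p13 t
  set t := trace₁₂ g (symmPart Q) with htd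
  set tt : 𝕜 := ∑ p, ∑ q, ((g⁻¹ p q : ℝ) : 𝕜) * t p q with htt'
  have e : ∀ a b c d, tfSymmPart g Q ![a, b, c, d] * K a b c d =
      symmPart Q ![a, b, c, d] * K a b c d
      - (1 / 8) * (((g a b : ℝ) : 𝕜) * t c d * K a b c d + ((g a c : ℝ) : 𝕜) * t b d * K a b c d
        + ((g a d : ℝ) : 𝕜) * t b c * K a b c d + ((g b c : ℝ) : 𝕜) * t a d * K a b c d
        + ((g b d : ℝ) : 𝕜) * t a c * K a b c d + ((g c d : ℝ) : 𝕜) * t a b * K a b c d)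
      + (1 / 48) * tt * (((g a b : ℝ) : 𝕜) * ((g c d : ℝ) : 𝕜) * K a b c d
        + ((g a c : ℝ) : 𝕜) * ((g b d : ℝ) : 𝕜) * K a b c d
        + ((g a d : ℝ) : 𝕜) * ((g b c : ℝ) : 𝕜) * K a b c d) := by
    intro a b c d
    simp only [tfSymmPart, Matrix.cons_val, ← htd, ← htt']
    ring
  simp only [e, Finset.sum_add_distrib, Finset.sum_sub_distrib, ← Finset.mul_sum]
  rw [p01 t, p02 t, p03 t, p12 t, p13 t, p23 t, p01 (fun c d => ((g c d : ℝ) : 𝕜)),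
    p02 (fun c d => ((g c d : ℝ) : 𝕜)), p03 (fun c d => ((g c d : ℝ) : 𝕜)), h1]
  ring

end Pairing

/-! ### The contraction to Weyl tensors and its pairing -/

section WeylContraction

variable {𝕜 : Type*} [RCLike 𝕜] {g : Mat}

/-- `X_{(acef)_0}{}^{ef}{}_{bd}`. -/
def tfContr (g : Mat) (X : (Fin 4 → Fin 4) → Arr4 𝕜) (a c b d : Fin 4) : 𝕜 :=
  ∑ e, ∑ f, tfSymmPart g (fun I => X I e f b d) ![a, c, e, f]

/-- The four-term contraction in the definition of the operator. -/
def weylContr (g : Mat) (X : (Fin 4 → Fin 4) → Arr4 𝕜) : Arr4 𝕜 := fun a b c d =>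
  tfContr g X a c b d - tfContr g X a d b c + tfContr g X b d a c - tfContr g X b c a d

/-- Arrays `Y^{ef}_{bd}` that become Weyl tensors when the lower indices are raised. -/
def IsWeylMixed (g : Mat) (Y : Arr4 𝕜) : Prop :=
  ∃ U, IsWeyl4 (castMat 𝕜 g) U ∧ Y = lowerMid (castMat 𝕜 g) U

theorem tfContr_eq_sum (X : (Fin 4 → Fin 4) → Arr4 𝕜) (a c b d : Fin 4) :
    tfContr g X a c b d =
      ∑ J, ∑ e, ∑ f, tfSymmPart g (Pi.single J (1 : 𝕜)) ![a, c, e, f] * X J e f b d := by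
  simp only [tfContr]
  rw [Finset.sum_comm' (t' := Finset.univ) (s' := fun _ => Finset.univ) (by simp)]
  have : ∀ f, ∑ e, tfSymmPart g (fun I => X I e f b d) ![a, c, e, f] =
      ∑ J, ∑ e, tfSymmPart g (Pi.single J (1 : 𝕜)) ![a, c, e, f] * X J e f b d := fun f => by
    rw [Finset.sum_comm]
    exact Finset.sum_congr rfl fun e _ => tfSymmPart_eq_sum _ _
  simp only [this]
  rw [Finset.sum_comm]
  exact Finset.sum_congr rfl fun J _ => Finset.sum_comm

theorem tfContr_swap (hg : g.transpose = g) (X : (Fin 4 → Fin 4) → Arr4 𝕜) (a c b d : Fin 4) :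
    tfContr g X c a b d = tfContr g X a c b d :=
  Finset.sum_congr rfl fun e _ => Finset.sum_congr rfl fun f _ => (tfSymmPart_symm hg _ a c e f).1

theorem lowerMid_pair {g' : M4 𝕜} {U : Arr4 𝕜} (hU : ∀ a b c d, U a b c d = U c d a b)
    (e f b d : Fin 4) : lowerMid g' U f e d b = lowerMid g' U e f b d := by
  simp only [lowerMid]
  rw [Finset.sum_comm]
  exact Finset.sum_congr rfl fun p _ => Finset.sum_congr rfl fun q _ => by rw [hU e]; ring

theorem tfContr_swap' (hg : g.transpose = g) {X : (Fin 4 → Fin 4) → Arr4 𝕜}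
    (hX : ∀ J, IsWeylMixed g (X J)) (a c b d : Fin 4) :
    tfContr g X a c d b = tfContr g X a c b d := by
  simp only [tfContr]
  rw [Finset.sum_comm]
  refine Finset.sum_congr rfl fun e _ => Finset.sum_congr rfl fun f _ => ?_
  rw [(tfSymmPart_symm hg _ a c e f).2.2]
  congr 1
  ext I
  obtain ⟨U, hU, hY⟩ := hX I
  rw [hY, lowerMid_pair hU.pair]

theorem sum_inv_lowerMid (hd : g.det ≠ 0) (U : Arr4 𝕜) (a e f b : Fin 4) :
    ∑ c, ((g⁻¹ a c : ℝ) : 𝕜) * lowerMid (castMat 𝕜 g) U e f b c =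
      ∑ p, ((g b p : ℝ) : 𝕜) * U e p f a := by
  simp only [lowerMid, Finset.mul_sum, castMat_apply]
  rw [Finset.sum_comm]
  refine Finset.sum_congr rfl fun p _ => ?_
  rw [Finset.sum_comm]
  have : ∀ q, ∑ c, ((g⁻¹ a c : ℝ) : 𝕜) * (((g b p : ℝ) : 𝕜) * ((g c q : ℝ) : 𝕜) * U e p f q) =
      (if a = q then 1 else 0) * (((g b p : ℝ) : 𝕜) * U e p f q) := fun q => by
    rw [← sum_inv_mul hd, Finset.sum_mul]
    exact Finset.sum_congr rfl fun c _ => by ring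
  simp [this]

theorem sum_antisymm_eq_zero {S A : Fin 4 → Fin 4 → 𝕜} (hS : ∀ i j, S i j = S j i)
    (hA : ∀ i j, A i j = - A j i) : ∑ i, ∑ j, S i j * A i j = 0 := by
  have h : ∑ i, ∑ j, S i j * A i j = - ∑ i, ∑ j, S i j * A i j := by
    conv_lhs => rw [Finset.sum_comm]
    rw [← Finset.sum_neg_distrib]
    refine Finset.sum_congr rfl fun i _ => ?_
    rw [← Finset.sum_neg_distrib]
    exact Finset.sum_congr rfl fun j _ => by rw [hS, hA]; ring
  exact self_eq_neg.1 h

theorem tfContr_trace₁ (hg : g.transpose = g) (hd : g.det ≠ 0)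
    {X : (Fin 4 → Fin 4) → Arr4 𝕜} (b d : Fin 4) :
    ∑ a, ∑ c, ((g⁻¹ a c : ℝ) : 𝕜) * tfContr g X a c b d = 0 := by
  simp only [tfContr, Finset.mul_sum]
  have e : ∀ F : Arr4 𝕜, ∑ a, ∑ c, ∑ e, ∑ f, F a c e f = ∑ e, ∑ f, ∑ a, ∑ c, F a c e f := by
    intro F
    have h1 : ∀ p, ∑ q, ∑ r, ∑ s, F p q r s = ∑ r, ∑ s, ∑ q, F p q r s := fun p => by
      rw [Finset.sum_comm]
      exact Finset.sum_congr rfl fun r _ => Finset.sum_comm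
    simp only [h1]
    rw [Finset.sum_comm]
    exact Finset.sum_congr rfl fun r _ => Finset.sum_comm
  rw [e]
  exact Finset.sum_eq_zero fun e _ => Finset.sum_eq_zero fun f _ =>
    tfSymmPart_trace hg hd (fun I => X I e f b d) e f

/-- After the trace has raised the lower index, the underlying Weyl array is skew in `f, a`, whereas
the kernel of the projection is symmetric in them. -/
theorem tfContr_trace_mixed (hg : g.transpose = g) (hd : g.det ≠ 0)
    {X : (Fin 4 → Fin 4) → Arr4 𝕜} (hX : ∀ J, IsWeylMixed g (X J)) (b d : Fin 4) :
    ∑ a, ∑ c, ((g⁻¹ a c : ℝ) : 𝕜) * tfContr g X a d b c = 0 := by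
  simp only [tfContr_eq_sum, Finset.mul_sum]
  have e : ∀ F : Fin 4 → Fin 4 → (Fin 4 → Fin 4) → Fin 4 → Fin 4 → 𝕜,
      ∑ a, ∑ c, ∑ J, ∑ e, ∑ f, F a c J e f = ∑ J, ∑ e, ∑ a, ∑ f, ∑ c, F a c J e f := by
    intro F
    have h1 : ∀ a, ∑ c, ∑ J, ∑ e, ∑ f, F a c J e f = ∑ J, ∑ e, ∑ f, ∑ c, F a c J e f :=
      fun a => by
      rw [Finset.sum_comm]
      refine Finset.sum_congr rfl fun J _ => ?_
      rw [Finset.sum_comm]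
      exact Finset.sum_congr rfl fun e _ => Finset.sum_comm
    simp only [h1]
    rw [Finset.sum_comm]
    exact Finset.sum_congr rfl fun J _ => Finset.sum_comm
  rw [e]
  refine Finset.sum_eq_zero fun J _ => Finset.sum_eq_zero fun e _ => ?_
  obtain ⟨U, hU, hY⟩ := hX J
  have : ∀ a f, ∑ c, ((g⁻¹ a c : ℝ) : 𝕜) *
      (tfSymmPart g (Pi.single J (1 : 𝕜)) ![a, d, e, f] * X J e f b c) =
      tfSymmPart g (Pi.single J (1 : 𝕜)) ![a, d, e, f] *
        ∑ p, ((g b p : ℝ) : 𝕜) * U e p f a := fun a f => by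
    rw [← sum_inv_lowerMid hd, Finset.mul_sum, hY]
    exact Finset.sum_congr rfl fun c _ => by ring
  simp only [this]
  refine sum_antisymm_eq_zero (S := fun a f => tfSymmPart g (Pi.single J (1 : 𝕜)) ![a, d, e, f])
    (A := fun a f => ∑ p, ((g b p : ℝ) : 𝕜) * U e p f a) (fun a f => ?_) (fun a f => ?_)
  · have s := fun x y z w => tfSymmPart_symm hg (Pi.single J (1 : 𝕜)) x y z w
    rw [(s f d e a).1.symm, (s d f e a).2.1.symm, (s d e f a).2.2.symm, (s d e a f).2.1.symm,
      (s d a e f).1.symm]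
  · rw [← Finset.sum_neg_distrib]
    exact Finset.sum_congr rfl fun p _ => by rw [hU.toIsCurv.antisymm' e p f a]; ring

theorem tfContr_trace₂ (hg : g.transpose = g) (hd : g.det ≠ 0)
    {X : (Fin 4 → Fin 4) → Arr4 𝕜} (hX : ∀ J, IsWeylMixed g (X J)) (b d : Fin 4) :
    ∑ a, ∑ c, ((g⁻¹ a c : ℝ) : 𝕜) * tfContr g X b d a c = 0 := by
  simp only [tfContr_eq_sum, Finset.mul_sum]
  have e : ∀ F : Fin 4 → Fin 4 → (Fin 4 → Fin 4) → Fin 4 → Fin 4 → 𝕜,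
      ∑ a, ∑ c, ∑ J, ∑ e, ∑ f, F a c J e f = ∑ J, ∑ e, ∑ f, ∑ a, ∑ c, F a c J e f := by
    intro F
    have h1 : ∀ a, ∑ c, ∑ J, ∑ e, ∑ f, F a c J e f = ∑ J, ∑ e, ∑ f, ∑ c, F a c J e f :=
      fun a => by
      rw [Finset.sum_comm]
      refine Finset.sum_congr rfl fun J _ => ?_
      rw [Finset.sum_comm]
      exact Finset.sum_congr rfl fun e _ => Finset.sum_comm
    simp only [h1]
    rw [Finset.sum_comm]
    refine Finset.sum_congr rfl fun J _ => ?_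
    rw [Finset.sum_comm]
    exact Finset.sum_congr rfl fun e _ => Finset.sum_comm
  rw [e]
  refine Finset.sum_eq_zero fun J _ => Finset.sum_eq_zero fun e _ =>
    Finset.sum_eq_zero fun f _ => ?_
  obtain ⟨U, hU, hY⟩ := hX J
  have : ∀ a, ∑ c, ((g⁻¹ a c : ℝ) : 𝕜) *
      (tfSymmPart g (Pi.single J (1 : 𝕜)) ![b, d, e, f] * X J e f a c) =
      tfSymmPart g (Pi.single J (1 : 𝕜)) ![b, d, e, f] *
        ∑ p, ((g a p : ℝ) : 𝕜) * U e p f a := fun a => by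
    rw [← sum_inv_lowerMid hd, Finset.mul_sum, hY]
    exact Finset.sum_congr rfl fun c _ => by ring
  simp only [this, ← Finset.mul_sum]
  have t := hU.trace e f
  rw [Finset.sum_comm] at t
  have t' : ∑ a, ∑ p, ((g a p : ℝ) : 𝕜) * U e p f a = 0 := by
    refine Eq.trans ?_ t
    refine Finset.sum_congr rfl fun a _ => Finset.sum_congr rfl fun p _ => ?_
    have hs : g a p = g p a := congrFun (congrFun hg p) a
    rw [castMat_apply, hs, hU.antisymm p e a f, hU.toIsCurv.antisymm' e p a f, neg_neg]
  rw [t', mul_zero]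

/-- `tfContr` is symmetric in its first and in its last two indices, and the four signed terms turn
such an array into one with the curvature symmetries. The trace decomposes into traces within the
projected indices, within the section indices, and between the two kinds; each of these vanishes. -/
theorem weylContr_isWeyl (hg : g.transpose = g) (hd : g.det ≠ 0)
    {X : (Fin 4 → Fin 4) → Arr4 𝕜} (hX : ∀ J, IsWeylMixed g (X J)) :
    IsWeyl4 (castMat 𝕜 g⁻¹) (weylContr g X) := by
  have s1 := tfContr_swap (𝕜 := 𝕜) hg X
  have s2 := tfContr_swap' (𝕜 := 𝕜) hg hX
  refine ⟨⟨fun a b c d => ?_, fun a b c d => ?_, fun a b c d => ?_⟩, fun b d => ?_⟩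
  · simp only [weylContr]; ring
  · simp only [weylContr]
    linear_combination -(s1 a c d b) - s2 a c b d + s1 b c d a + s2 b c a d - s1 b d c a
      - s2 b d a c + s1 a d c b + s2 a d b c
  · simp only [weylContr]
    linear_combination -(s2 a c b d) + s2 a d b c - s1 b d a c + s1 b c a d + s2 a b c d
      + s1 c d a b
  · simp only [weylContr, castMat_apply, mul_add, mul_sub, Finset.sum_add_distrib,
      Finset.sum_sub_distrib]
    have h4 : ∑ a, ∑ c, ((g⁻¹ a c : ℝ) : 𝕜) * tfContr g X b c a d = 0 := by
      rw [Finset.sum_comm]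
      refine Eq.trans ?_ (tfContr_trace_mixed hg hd hX d b)
      refine Finset.sum_congr rfl fun c _ => Finset.sum_congr rfl fun a _ => ?_
      rw [inv_symm_entry hg a c, s1 b c d a, s2 b c a d]
    rw [tfContr_trace₁ hg hd, tfContr_trace_mixed hg hd hX, tfContr_trace₂ hg hd hX, h4]
    ring

/-- The known symmetries exchange positions 1 and 2, positions 1 and 3, and the two pairs; together
they generate all permutations of the four indices. -/
theorem symContr_isTotSymm {g' h' : M4 𝕜} (hg : g'.transpose = g') (hhg : h' * g' = 1)
    {U N : Arr4 𝕜} (hU : IsWeyl4 g' U) (hN : IsWeyl4 g' N) :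
    IsTotSymm (symContr g' h' (lowerMid g' U) N) := by
  have s1 := symContr_swap_fst hg hhg (lowerMid g' U) N
  have s2 := symContr_swap_odd hg hhg hU hN
  have s3 := symContr_pair hg hhg hU hN
  refine ⟨fun a b c d => s1 b a c d, fun a b c d => ?_, fun a b c d => ?_⟩
  · rw [s1 a c b d, s2 c a b d, s1 b a c d]
  · rw [s3 a b d c, s1 d c a b, s3 c d a b]

/-- The antisymmetries of `N` make the four terms contribute equally (`h1`). Against the trace-free
symmetric kernel the contraction may be replaced by half of `symContr` (`h3`), and as `symContr` is
totally symmetric and trace-free, the kernel then acts as the identity (`h4`). The factor is `4 *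
(1/2)`. -/
theorem pairing_weylContr (hg : g.transpose = g) (hd : g.det ≠ 0)
    {X : (Fin 4 → Fin 4) → Arr4 𝕜} (hX : ∀ J, IsWeylMixed g (X J)) {N : Arr4 𝕜}
    (hN : IsWeyl4 (castMat 𝕜 g) N) :
    ∑ a, ∑ b, ∑ c, ∑ d, weylContr g X a b c d * N a b c d =
      2 * ∑ e, ∑ a, ∑ f, ∑ c,
        symContr (castMat 𝕜 g) (castMat 𝕜 g⁻¹) (X ![e, a, f, c]) N e a f c := by
  have hg' : (castMat 𝕜 g).transpose = castMat 𝕜 g := by rw [castMat_transpose, hg]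
  have hh := castMat_inv_mul (𝕜 := 𝕜) hd
  have h1 : ∑ a, ∑ b, ∑ c, ∑ d, weylContr g X a b c d * N a b c d =
      4 * ∑ a, ∑ b, ∑ c, ∑ d, tfContr g X a c b d * N a b c d := by
    have c1 : ∑ a, ∑ b, ∑ c, ∑ d, tfContr g X a d b c * N a b c d =
        - ∑ a, ∑ b, ∑ c, ∑ d, tfContr g X a c b d * N a b c d := by
      simp only [← Finset.sum_neg_distrib]
      refine Finset.sum_congr rfl fun a _ => Finset.sum_congr rfl fun b _ => ?_
      rw [Finset.sum_comm]
      refine Finset.sum_congr rfl fun c _ => Finset.sum_congr rfl fun d _ => ?_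
      rw [hN.toIsCurv.antisymm']; ring
    have c2 : ∑ a, ∑ b, ∑ c, ∑ d, tfContr g X b c a d * N a b c d =
        - ∑ a, ∑ b, ∑ c, ∑ d, tfContr g X a c b d * N a b c d := by
      rw [Finset.sum_comm]
      simp only [← Finset.sum_neg_distrib]
      refine Finset.sum_congr rfl fun a _ => Finset.sum_congr rfl fun b _ =>
        Finset.sum_congr rfl fun c _ => Finset.sum_congr rfl fun d _ => ?_
      rw [hN.antisymm]; ring
    have c3 : ∑ a, ∑ b, ∑ c, ∑ d, tfContr g X b d a c * N a b c d =
        - ∑ a, ∑ b, ∑ c, ∑ d, tfContr g X a d b c * N a b c d := by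
      rw [Finset.sum_comm]
      simp only [← Finset.sum_neg_distrib]
      refine Finset.sum_congr rfl fun a _ => Finset.sum_congr rfl fun b _ =>
        Finset.sum_congr rfl fun c _ => Finset.sum_congr rfl fun d _ => ?_
      rw [hN.antisymm]; ring
    simp only [weylContr, add_mul, sub_mul, Finset.sum_add_distrib, Finset.sum_sub_distrib]
    rw [c3, c1, c2]; ring
  have h2 : ∑ a, ∑ b, ∑ c, ∑ d, tfContr g X a c b d * N a b c d =
      ∑ J, ∑ e, ∑ a, ∑ f, ∑ c, tfSymmPart g (Pi.single J (1 : 𝕜)) ![e, a, f, c] *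
        contrBD (X J) N e a f c := by
    simp only [tfContr_eq_sum, Finset.sum_mul]
    have q1 : ∑ a, ∑ b, ∑ c, ∑ d, ∑ J, ∑ e, ∑ f,
        tfSymmPart g (Pi.single J (1 : 𝕜)) ![a, c, e, f] * X J e f b d * N a b c d =
        ∑ J, ∑ a, ∑ b, ∑ c, ∑ d, ∑ e, ∑ f,
        tfSymmPart g (Pi.single J (1 : 𝕜)) ![a, c, e, f] * X J e f b d * N a b c d := by
      have w : ∀ a b c, ∑ d, ∑ J, ∑ e, ∑ f,
        tfSymmPart g (Pi.single J (1 : 𝕜)) ![a, c, e, f] * X J e f b d * N a b c d =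
        ∑ J, ∑ d, ∑ e, ∑ f,
        tfSymmPart g (Pi.single J (1 : 𝕜)) ![a, c, e, f] * X J e f b d * N a b c d :=
        fun a b c => Finset.sum_comm
      simp only [w]
      rw [Finset.sum_congr rfl fun a _ => Finset.sum_congr rfl fun b _ => Finset.sum_comm,
        Finset.sum_congr rfl fun a _ => Finset.sum_comm, Finset.sum_comm]
    rw [q1]
    refine Finset.sum_congr rfl fun J _ => ?_
    have s := fun x y z w => tfSymmPart_symm hg (Pi.single J (1 : 𝕜)) x y z w
    simp only [contrBD, Finset.mul_sum]
    -- both sides are sums over `a b c d e f`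
    have l1 : ∀ F : Fin 4 → Fin 4 → Fin 4 → Fin 4 → Fin 4 → Fin 4 → 𝕜,
        ∑ a, ∑ b, ∑ c, ∑ d, ∑ e, ∑ f, F a b c d e f =
        ∑ e, ∑ a, ∑ f, ∑ c, ∑ b, ∑ d, F a b c d e f := by
      intro F
      have m1 : ∀ a b c, ∑ d, ∑ e, ∑ f, F a b c d e f = ∑ e, ∑ f, ∑ d, F a b c d e f :=
        fun a b c => by
        rw [Finset.sum_comm]
        exact Finset.sum_congr rfl fun e _ => Finset.sum_comm
      have m2 : ∀ a b, ∑ c, ∑ e, ∑ f, ∑ d, F a b c d e f = ∑ e, ∑ f, ∑ c, ∑ d, F a b c d e f :=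
        fun a b => by
        rw [Finset.sum_comm]
        exact Finset.sum_congr rfl fun e _ => Finset.sum_comm
      have m3 : ∀ a, ∑ b, ∑ e, ∑ f, ∑ c, ∑ d, F a b c d e f =
          ∑ e, ∑ f, ∑ c, ∑ b, ∑ d, F a b c d e f := fun a => by
        rw [Finset.sum_comm]
        refine Finset.sum_congr rfl fun e _ => ?_
        rw [Finset.sum_comm]
        exact Finset.sum_congr rfl fun f _ => Finset.sum_comm
      simp only [m1, m2, m3]
      rw [Finset.sum_comm]
    rw [l1]
    refine Finset.sum_congr rfl fun e _ => Finset.sum_congr rfl fun a _ =>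
      Finset.sum_congr rfl fun f _ => Finset.sum_congr rfl fun c _ =>
      Finset.sum_congr rfl fun b _ => Finset.sum_congr rfl fun d _ => ?_
    rw [← (s a c e f).2.1, ← (s a e c f).1, ← (s e a c f).2.2]
    ring
  have h3 : ∀ J, ∑ e, ∑ a, ∑ f, ∑ c, tfSymmPart g (Pi.single J (1 : 𝕜)) ![e, a, f, c] *
        contrBD (X J) N e a f c = (1 / 2) *
      ∑ e, ∑ a, ∑ f, ∑ c, tfSymmPart g (Pi.single J (1 : 𝕜)) ![e, a, f, c] *
        symContr (castMat 𝕜 g) (castMat 𝕜 g⁻¹) (X J) N e a f c := by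
    intro J
    have s := fun x y z w => tfSymmPart_symm hg (Pi.single J (1 : 𝕜)) x y z w
    have a1 : ∑ e, ∑ a, ∑ f, ∑ c, tfSymmPart g (Pi.single J (1 : 𝕜)) ![e, a, f, c] *
        contrBD (X J) N a e f c = ∑ e, ∑ a, ∑ f, ∑ c,
        tfSymmPart g (Pi.single J (1 : 𝕜)) ![e, a, f, c] * contrBD (X J) N e a f c := by
      rw [Finset.sum_comm]
      refine Finset.sum_congr rfl fun e _ => Finset.sum_congr rfl fun a _ =>
        Finset.sum_congr rfl fun f _ => Finset.sum_congr rfl fun c _ => ?_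
      rw [(s e a f c).1]
    have a2 : ∀ t : Fin 4 → Fin 4 → 𝕜, ∑ e, ∑ a, ∑ f, ∑ c,
        tfSymmPart g (Pi.single J (1 : 𝕜)) ![e, a, f, c] * (castMat 𝕜 g⁻¹ e a * t f c) = 0 := by
      intro t
      have m : ∀ e, ∑ a, ∑ f, ∑ c,
          tfSymmPart g (Pi.single J (1 : 𝕜)) ![e, a, f, c] * (castMat 𝕜 g⁻¹ e a * t f c) =
          ∑ f, ∑ c, ∑ a,
          tfSymmPart g (Pi.single J (1 : 𝕜)) ![e, a, f, c] * (castMat 𝕜 g⁻¹ e a * t f c) :=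
        fun e => by
          rw [Finset.sum_comm]; exact Finset.sum_congr rfl fun f _ => Finset.sum_comm
      simp only [m]
      rw [Finset.sum_comm]
      refine Finset.sum_eq_zero fun f _ => ?_
      rw [Finset.sum_comm]
      refine Finset.sum_eq_zero fun c _ => ?_
      have m2 : ∀ e a, tfSymmPart g (Pi.single J (1 : 𝕜)) ![e, a, f, c] *
          (castMat 𝕜 g⁻¹ e a * t f c) = t f c * (((g⁻¹ e a : ℝ) : 𝕜) *
          tfSymmPart g (Pi.single J (1 : 𝕜)) ![e, a, f, c]) := fun e a => by
        rw [castMat_apply]; ring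
      simp only [m2, ← Finset.mul_sum, tfSymmPart_trace hg hd, mul_zero]
    have a3 := a2 fun f c => ∑ p, ∑ q, castMat 𝕜 g p q * contrBD (X J) N p q f c
    have a4 : ∀ e a f c, tfSymmPart g (Pi.single J (1 : 𝕜)) ![e, a, f, c] *
        symContr (castMat 𝕜 g) (castMat 𝕜 g⁻¹) (X J) N e a f c =
        tfSymmPart g (Pi.single J (1 : 𝕜)) ![e, a, f, c] * contrBD (X J) N e a f c +
        tfSymmPart g (Pi.single J (1 : 𝕜)) ![e, a, f, c] * contrBD (X J) N a e f c -
        (1 / 2) * (tfSymmPart g (Pi.single J (1 : 𝕜)) ![e, a, f, c] * (castMat 𝕜 g⁻¹ e a *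
          ∑ p, ∑ q, castMat 𝕜 g p q * contrBD (X J) N p q f c)) := fun e a f c => by
      rw [symContr]; ring
    simp only [a4, Finset.sum_add_distrib, Finset.sum_sub_distrib, ← Finset.mul_sum]
    rw [a1, a3]; ring
  have h4 : ∀ J : Fin 4 → Fin 4,
      ∑ e, ∑ a, ∑ f, ∑ c, tfSymmPart g (Pi.single J (1 : 𝕜)) ![e, a, f, c] *
        symContr (castMat 𝕜 g) (castMat 𝕜 g⁻¹) (X J) N e a f c =
      symContr (castMat 𝕜 g) (castMat 𝕜 g⁻¹) (X J) N (J 0) (J 1) (J 2) (J 3) := by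
    intro J
    obtain ⟨U, hU, hY⟩ := hX J
    rw [hY, sum_tfSymmPart_mul (symContr_isTotSymm hg' hh hU hN)
      (symContr_trace hg' hh (lowerMid (castMat 𝕜 g) U) N)]
    have := sum_index fun I => (Pi.single J (1 : 𝕜) : (Fin 4 → Fin 4) → 𝕜) I *
      symContr (castMat 𝕜 g) (castMat 𝕜 g⁻¹) (lowerMid (castMat 𝕜 g) U) N (I 0) (I 1) (I 2) (I 3)
    refine this.symm.trans ?_
    simp [Pi.single_apply]
  rw [h1, h2]
  simp only [h3, h4]
  rw [← Finset.mul_sum, sum_index]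
  simp only [Matrix.cons_val]
  ring

end WeylContraction

/-! ### Nondegeneracy of the pairing on Weyl tensors -/

section Nondegenerate

variable {𝕜 : Type*} [RCLike 𝕜] {g h : M4 𝕜}

/-- The trace-free part of a curvature array `r` with Ricci contraction `R` and scalar
contraction `s`. -/
def weylPart (h : M4 𝕜) (r : Arr4 𝕜) (R : M4 𝕜) (s : 𝕜) : Arr4 𝕜 := fun a b c d =>
  r a b c d - (1 / 2) * (h a c * R b d - h a d * R b c + h b d * R a c - h b c * R a d)
    + s / 6 * (h a c * h b d - h a d * h b c)

theorem sum_metric_mul_inv (hhg : h * g = 1) (hg : g.transpose = g) (i j : Fin 4) :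
    ∑ p, g i p * h j p = if i = j then 1 else 0 := by
  have := congrFun (congrFun hhg j) i
  rw [Matrix.mul_apply, Matrix.one_apply] at this
  rw [show (if i = j then (1 : 𝕜) else 0) = if j = i then 1 else 0 by simp [eq_comm], ← this]
  exact Finset.sum_congr rfl fun p _ => by rw [← congrFun (congrFun hg p) i, mul_comm]; rfl

/-- The constants of `weylPart` are `1/(n-2)` and `1/((n-1)(n-2))` for `n = 4`. -/
theorem weylPart_isWeyl (hg : g.transpose = g) (hhg : h * g = 1) {r : Arr4 𝕜} (hr : IsCurv r) :
    IsWeyl4 g (weylPart h r (Matrix.of fun b d => ∑ a, ∑ c, g a c * r a b c d)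
      (∑ b, ∑ d, g b d * ∑ a, ∑ c, g a c * r a b c d)) := by
  set R : M4 𝕜 := Matrix.of fun b d => ∑ a, ∑ c, g a c * r a b c d with hR
  set s : 𝕜 := ∑ b, ∑ d, g b d * ∑ a, ∑ c, g a c * r a b c d with hs'
  have gs : ∀ i j, g i j = g j i := fun i j => congrFun (congrFun hg j) i
  have hs : ∀ i j, h i j = h j i := fun i j =>
    congrFun (congrFun (symm_of_mul_eq_one hg hhg) j) i
  have Rs : ∀ i j, R i j = R j i := by
    intro i j
    simp only [hR, Matrix.of_apply]
    rw [Finset.sum_comm]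
    exact Finset.sum_congr rfl fun a _ => Finset.sum_congr rfl fun c _ => by
      rw [gs a c, hr.pair]
  refine ⟨⟨fun a b c d => ?_, fun a b c d => ?_, fun a b c d => ?_⟩, fun b d => ?_⟩
  · simp only [weylPart, hr.antisymm a b c d]; ring
  · simp only [weylPart, hr.pair a b c d, hs c a, hs c b, hs d a, hs d b, Rs c a, Rs c b, Rs d a,
      Rs d b]
    ring
  · simp only [weylPart]
    rw [hs d b, hs c b, hs d c, Rs d b, Rs c b, Rs d c]
    linear_combination hr.bianchi a b c d
  · have e : ∀ a c, g a c * weylPart h r R s a b c d =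
        g a c * r a b c d - (1 / 2) * (g a c * h a c * R b d - g a c * (h a d * R b c)
          + g a c * R a c * h b d - g a c * (h b c * R a d))
        + s / 6 * (g a c * h a c * h b d - g a c * (h a d * h b c)) := fun a c => by
      rw [weylPart]; ring
    have t1 : ∀ x : Fin 4 → 𝕜, ∑ a, ∑ c, g a c * (h a d * x c) = x d := by
      intro x
      rw [Finset.sum_comm]
      have : ∀ c, ∑ a, g a c * (h a d * x c) = (if c = d then 1 else 0) * x c := fun c => by
        rw [← sum_metric_mul_inv hhg hg, Finset.sum_mul]
        exact Finset.sum_congr rfl fun a _ => by rw [gs a c, hs a d]; ring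
      simp [this]
    have t2 : ∀ x : Fin 4 → 𝕜, ∑ a, ∑ c, g a c * (h b c * x a) = x b := by
      intro x
      have : ∀ a, ∑ c, g a c * (h b c * x a) = (if a = b then 1 else 0) * x a := fun a => by
        rw [← sum_metric_mul_inv hhg hg, Finset.sum_mul]
        exact Finset.sum_congr rfl fun c _ => by ring
      simp [this]
    have t3 : ∑ a, ∑ c, g a c * R a c = s := rfl
    have t4 : ∑ a, ∑ c, g a c * r a b c d = R b d := rfl
    simp only [e, Finset.sum_add_distrib, Finset.sum_sub_distrib, ← Finset.mul_sum,
      ← Finset.sum_mul]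
    rw [t1 fun c => R b c, t1 fun c => h b c, t2 fun a => R a d, t3, t4, sum_mul_inv hg hhg]
    ring

/-- All correction terms contain the inverse metric `h`, which is contracted with the trace-free
`C`. -/
theorem pairing_weylPart {C : Arr4 𝕜} (hC : IsWeyl4 h C)
    (r : Arr4 𝕜) (R : M4 𝕜) (s : 𝕜) :
    ∑ a, ∑ b, ∑ c, ∑ d, C a b c d * weylPart h r R s a b c d =
      ∑ a, ∑ b, ∑ c, ∑ d, C a b c d * r a b c d := by
  have t1 : ∀ x : M4 𝕜, ∑ a, ∑ b, ∑ c, ∑ d, C a b c d * (h a c * x b d) = 0 := by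
    intro x
    have m : ∑ a, ∑ b, ∑ c, ∑ d, C a b c d * (h a c * x b d) =
        ∑ b, ∑ d, ∑ a, ∑ c, C a b c d * (h a c * x b d) := by
      rw [Finset.sum_comm]
      refine Finset.sum_congr rfl fun b _ => ?_
      rw [Finset.sum_congr rfl fun a _ => Finset.sum_comm, Finset.sum_comm]
    rw [m]
    refine Finset.sum_eq_zero fun b _ => Finset.sum_eq_zero fun d _ => ?_
    have m2 : ∀ a c, C a b c d * (h a c * x b d) = (h a c * C a b c d) * x b d := fun a c => by
      ring
    simp only [m2, ← Finset.sum_mul, hC.trace, zero_mul]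
  have t2 : ∀ x : M4 𝕜, ∑ a, ∑ b, ∑ c, ∑ d, C a b c d * (h a d * x b c) = 0 := by
    intro x
    rw [← neg_eq_zero, ← t1 x]
    simp only [← Finset.sum_neg_distrib]
    refine Finset.sum_congr rfl fun a _ => Finset.sum_congr rfl fun b _ => ?_
    rw [Finset.sum_comm]
    refine Finset.sum_congr rfl fun c _ => Finset.sum_congr rfl fun d _ => ?_
    rw [hC.toIsCurv.antisymm' a b c d]; ring
  have t3 : ∀ x : M4 𝕜, ∑ a, ∑ b, ∑ c, ∑ d, C a b c d * (h b d * x a c) = 0 := by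
    intro x
    rw [← neg_eq_zero, ← t2 x, Finset.sum_comm]
    simp only [← Finset.sum_neg_distrib]
    refine Finset.sum_congr rfl fun a _ => Finset.sum_congr rfl fun b _ =>
      Finset.sum_congr rfl fun c _ => Finset.sum_congr rfl fun d _ => ?_
    rw [hC.antisymm a b c d]; ring
  have t4 : ∀ x : M4 𝕜, ∑ a, ∑ b, ∑ c, ∑ d, C a b c d * (h b c * x a d) = 0 := by
    intro x
    rw [← neg_eq_zero, ← t1 x, Finset.sum_comm]
    simp only [← Finset.sum_neg_distrib]
    refine Finset.sum_congr rfl fun a _ => Finset.sum_congr rfl fun b _ =>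
      Finset.sum_congr rfl fun c _ => Finset.sum_congr rfl fun d _ => ?_
    rw [hC.antisymm a b c d]; ring
  have e : ∀ a b c d, C a b c d * weylPart h r R s a b c d = C a b c d * r a b c d
      - (1 / 2) * (C a b c d * (h a c * R b d) - C a b c d * (h a d * R b c)
        + C a b c d * (h b d * R a c) - C a b c d * (h b c * R a d))
      + s / 6 * (C a b c d * (h a c * h b d) - C a b c d * (h a d * h b c)) := fun a b c d => by
    rw [weylPart]; ring
  simp only [e, Finset.sum_add_distrib, Finset.sum_sub_distrib, ← Finset.mul_sum]
  rw [t1, t2, t3, t4, t1, t2]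
  ring

/-- The bivector of two basis vectors. -/
def bivec (x y i j : Fin 4) : 𝕜 :=
  (if i = x then 1 else 0) * (if j = y then 1 else 0)
    - (if i = y then 1 else 0) * (if j = x then 1 else 0)

theorem sum_mul_bivec (F : Fin 4 → Fin 4 → 𝕜) (x y : Fin 4) :
    ∑ i, ∑ j, F i j * bivec x y i j = F x y - F y x := by
  simp [bivec, mul_sub, Finset.sum_sub_distrib]

theorem sum_mul_bivec_bivec {C : Arr4 𝕜} (hC : IsCurv C) (x y z w : Fin 4) :
    ∑ a, ∑ b, ∑ c, ∑ d, C a b c d * (bivec x y a b * bivec z w c d) = 4 * C x y z w := by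
  have e : ∀ a b, ∑ c, ∑ d, C a b c d * (bivec x y a b * bivec z w c d) =
      (C a b z w - C a b w z) * bivec x y a b := fun a b => by
    rw [← sum_mul_bivec (C a b), Finset.sum_mul]
    refine Finset.sum_congr rfl fun c _ => ?_
    rw [Finset.sum_mul]
    exact Finset.sum_congr rfl fun d _ => by ring
  simp only [e]
  rw [sum_mul_bivec fun a b => C a b z w - C a b w z, hC.antisymm' x y w z, hC.antisymm y x z w,
    hC.antisymm y x w z, hC.antisymm' x y w z]
  ring

/-- A polarized curvature array built from basis vectors. -/
def testCurv (v w v' w' : Fin 4) : Arr4 𝕜 := fun a b c d =>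
  bivec v w a b * bivec v' w' c d + bivec v' w' a b * bivec v w c d
    + bivec v w' a b * bivec v' w c d + bivec v' w a b * bivec v w' c d

theorem testCurv_isCurv (v w v' w' : Fin 4) : IsCurv (testCurv v w v' w' : Arr4 𝕜) where
  antisymm a b c d := by simp only [testCurv, bivec]; ring
  pair a b c d := by simp only [testCurv, bivec]; ring
  bianchi a b c d := by simp only [testCurv, bivec]; ring

/-- A curvature tensor is determined by its sectional curvatures. The trace-free parts of the arrays
`testCurv` detect the polarized sectional curvatures of `C`; when these vanish, the Bianchi identity
leaves `3 C = 0`. -/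
theorem IsWeyl4.eq_zero_of_pairing (hg : g.transpose = g) (hhg : h * g = 1) {C : Arr4 𝕜}
    (hC : IsWeyl4 h C)
    (h0 : ∀ N, IsWeyl4 g N → ∑ a, ∑ b, ∑ c, ∑ d, C a b c d * N a b c d = 0) : C = 0 := by
  have key : ∀ v w v' w', C v w v' w' + C v w' v' w = 0 := by
    intro v w v' w'
    have := h0 _ (weylPart_isWeyl hg hhg (testCurv_isCurv v w v' w'))
    rw [pairing_weylPart hC] at this
    simp only [testCurv, mul_add, Finset.sum_add_distrib, sum_mul_bivec_bivec hC.toIsCurv] at this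
    rw [hC.pair v' w', hC.pair v' w] at this
    have h8 : (8 : 𝕜) * (C v w v' w' + C v w' v' w) = 0 := by linear_combination this
    exact (mul_eq_zero.1 h8).resolve_left (by norm_num)
  ext a b c d
  have k1 := key a b c d
  have k2 := key a c d b
  have b1 := hC.bianchi a b c d
  have s1 := hC.toIsCurv.antisymm' a d c b
  have s2 := hC.toIsCurv.antisymm' a b d c
  have h3 : (3 : 𝕜) * C a b c d = 0 := by
    linear_combination b1 + s2 - k2 + k1 - s1
  simpa using h3

end Nondegenerate

/-! ### The conformal Lie algebra acting on Weyl tensors -/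

section Mixed

variable {𝕜 : Type*} [RCLike 𝕜] {g h : M4 𝕜}

/-- The matrix of the upper indices. -/
def upSlice (Y : Arr4 𝕜) (b d : Fin 4) : M4 𝕜 := Matrix.of fun p q => Y p q b d

/-- Lowering the two upper indices with two matrices. -/
def lowerWith (g g' : M4 𝕜) (Y : Arr4 𝕜) : Arr4 𝕜 := fun a b c d =>
  (g * upSlice Y b d * g'.transpose) a c

theorem lowerWith_apply (g g' : M4 𝕜) (Y : Arr4 𝕜) (a b c d : Fin 4) :
    lowerWith g g' Y a b c d = ∑ p, ∑ q, g a p * g' c q * Y p q b d := by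
  simp only [lowerWith, upSlice, Matrix.mul_apply, Matrix.transpose_apply, Matrix.of_apply,
    Finset.sum_mul]
  rw [Finset.sum_comm]
  exact Finset.sum_congr rfl fun p _ => Finset.sum_congr rfl fun q _ => by ring

/-- The infinitesimal action of a matrix on arrays `Y^{ef}_{bd}`. -/
def derMixed (A : M4 𝕜) (Y : Arr4 𝕜) : Arr4 𝕜 := fun e f b d =>
  (A * upSlice Y b d + upSlice Y b d * A.transpose) e f
    - ∑ p, A p b * Y e f p d - ∑ p, A p d * Y e f b p

/-- The infinitesimal action of a matrix on arrays `Z_{abcd}`. -/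
def derDown (A : M4 𝕜) (Z : Arr4 𝕜) : Arr4 𝕜 := fun a b c d =>
  - ∑ p, A p a * Z p b c d - ∑ p, A p b * Z a p c d - ∑ p, A p c * Z a b p d
    - ∑ p, A p d * Z a b c p

/-- The Leibniz rule for the lowering of indices: `A.transpose * g + g * A` measures how far the
metric is from being invariant. -/
theorem lowerWith_derMixed (A : M4 𝕜) (Y : Arr4 𝕜) :
    lowerWith g g (derMixed A Y) = derDown A (lowerWith g g Y)
      + lowerWith (A.transpose * g + g * A) g Y + lowerWith g (A.transpose * g + g * A) Y := by
  ext a b c d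
  have e1 : upSlice (derMixed A Y) b d = A * upSlice Y b d + upSlice Y b d * A.transpose
      - ∑ p, A p b • upSlice Y p d - ∑ p, A p d • upSlice Y b p := by
    ext i j
    simp [upSlice, derMixed, Matrix.sum_apply]
  have e2 : derDown A (lowerWith g g Y) a b c d =
      (- (A.transpose * (g * upSlice Y b d * g.transpose))
        - (g * upSlice Y b d * g.transpose) * A
        - ∑ p, A p b • (g * upSlice Y p d * g.transpose)
        - ∑ p, A p d • (g * upSlice Y b p * g.transpose)) a c := by
    simp only [derDown, lowerWith, Matrix.sub_apply, Matrix.neg_apply, Matrix.sum_apply,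
      Matrix.smul_apply, smul_eq_mul]
    rw [Matrix.mul_apply (M := A.transpose), Matrix.mul_apply (N := A)]
    simp only [Matrix.transpose_apply, mul_comm (A _ c)]
    ring
  rw [Pi.add_apply, Pi.add_apply, Pi.add_apply, Pi.add_apply, Pi.add_apply, Pi.add_apply,
    Pi.add_apply, Pi.add_apply, e2]
  simp only [lowerWith, e1]
  rw [← Matrix.add_apply, ← Matrix.add_apply]
  refine congrFun (congrFun (?_ : (_ : M4 𝕜) = _) a) c
  simp only [Matrix.transpose_add, Matrix.transpose_mul, Matrix.transpose_transpose, mul_add,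
    add_mul, mul_sub, sub_mul, Finset.mul_sum, Finset.sum_mul, Matrix.mul_smul, Matrix.smul_mul,
    mul_assoc]
  abel

theorem IsCurv.derDown {Z : Arr4 𝕜} (hZ : IsCurv Z) (A : M4 𝕜) : IsCurv (derDown A Z) where
  antisymm a b c d := by
    have h1 : ∑ p, A p a * Z b p c d = - ∑ p, A p a * Z p b c d := by
      rw [← Finset.sum_neg_distrib]
      exact Finset.sum_congr rfl fun p _ => by rw [hZ.antisymm b p]; ring
    have h2 : ∑ p, A p b * Z p a c d = - ∑ p, A p b * Z a p c d := by
      rw [← Finset.sum_neg_distrib]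
      exact Finset.sum_congr rfl fun p _ => by rw [hZ.antisymm p a]; ring
    have h3 : ∑ p, A p c * Z b a p d = - ∑ p, A p c * Z a b p d := by
      rw [← Finset.sum_neg_distrib]
      exact Finset.sum_congr rfl fun p _ => by rw [hZ.antisymm b a]; ring
    have h4 : ∑ p, A p d * Z b a c p = - ∑ p, A p d * Z a b c p := by
      rw [← Finset.sum_neg_distrib]
      exact Finset.sum_congr rfl fun p _ => by rw [hZ.antisymm b a]; ring
    simp only [WeylOp.derDown]
    rw [h1, h2, h3, h4]; ring
  pair a b c d := by
    simp only [WeylOp.derDown, hZ.pair _ d a b, hZ.pair c _ a b]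
    have h1 : ∑ p, A p a * Z c d p b = ∑ p, A p a * Z p b c d :=
      Finset.sum_congr rfl fun p _ => by rw [hZ.pair c d]
    have h2 : ∑ p, A p b * Z c d a p = ∑ p, A p b * Z a p c d :=
      Finset.sum_congr rfl fun p _ => by rw [hZ.pair c d]
    rw [h1, h2]; ring
  bianchi a b c d := by
    have h1 : ∑ p, A p a * Z p b c d + ∑ p, A p a * Z p c d b + ∑ p, A p a * Z p d b c = 0 := by
      rw [← Finset.sum_add_distrib, ← Finset.sum_add_distrib]
      exact Finset.sum_eq_zero fun p _ => by rw [← mul_add, ← mul_add, hZ.bianchi, mul_zero]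
    have h2 : ∑ p, A p b * Z a p c d + ∑ p, A p b * Z a c d p + ∑ p, A p b * Z a d p c = 0 := by
      rw [← Finset.sum_add_distrib, ← Finset.sum_add_distrib]
      exact Finset.sum_eq_zero fun p _ => by rw [← mul_add, ← mul_add, hZ.bianchi, mul_zero]
    have h3 : ∑ p, A p c * Z a b p d + ∑ p, A p c * Z a p d b + ∑ p, A p c * Z a d b p = 0 := by
      rw [← Finset.sum_add_distrib, ← Finset.sum_add_distrib]
      exact Finset.sum_eq_zero fun p _ => by rw [← mul_add, ← mul_add, hZ.bianchi, mul_zero]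
    have h4 : ∑ p, A p d * Z a b c p + ∑ p, A p d * Z a c p b + ∑ p, A p d * Z a p b c = 0 := by
      rw [← Finset.sum_add_distrib, ← Finset.sum_add_distrib]
      exact Finset.sum_eq_zero fun p _ => by rw [← mul_add, ← mul_add, hZ.bianchi, mul_zero]
    simp only [WeylOp.derDown]
    linear_combination -h1 - h2 - h3 - h4

theorem trace_derDown {Z : Arr4 𝕜} (hZ : ∀ b d, ∑ a, ∑ c, h a c * Z a b c d = 0) (A : M4 𝕜)
    (b d : Fin 4) : ∑ a, ∑ c, h a c * derDown A Z a b c d =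
      - ∑ a, ∑ c, (A * h + h * A.transpose) a c * Z a b c d := by
  have h1 : ∑ a, ∑ c, h a c * ∑ p, A p a * Z p b c d = ∑ a, ∑ c, (A * h) a c * Z a b c d := by
    simp only [Matrix.mul_apply, Finset.mul_sum, Finset.sum_mul]
    have : ∀ a, ∑ c, ∑ p, h a c * (A p a * Z p b c d) = ∑ p, ∑ c, h a c * (A p a * Z p b c d) :=
      fun a => Finset.sum_comm
    simp only [this]
    rw [Finset.sum_comm]
    refine Finset.sum_congr rfl fun p _ => ?_
    rw [Finset.sum_comm]
    exact Finset.sum_congr rfl fun c _ => Finset.sum_congr rfl fun a _ => by ring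
  have h2 : ∑ a, ∑ c, h a c * ∑ p, A p c * Z a b p d =
      ∑ a, ∑ c, (h * A.transpose) a c * Z a b c d := by
    simp only [Matrix.mul_apply, Matrix.transpose_apply, Finset.mul_sum, Finset.sum_mul]
    refine Finset.sum_congr rfl fun a _ => ?_
    rw [Finset.sum_comm]
    exact Finset.sum_congr rfl fun p _ => Finset.sum_congr rfl fun c _ => by ring
  have h3 : ∑ a, ∑ c, h a c * ∑ p, A p b * Z a p c d = 0 := by
    simp only [Finset.mul_sum]
    have : ∀ a, ∑ c, ∑ p, h a c * (A p b * Z a p c d) = ∑ p, ∑ c, h a c * (A p b * Z a p c d) :=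
      fun a => Finset.sum_comm
    simp only [this]
    rw [Finset.sum_comm]
    refine Finset.sum_eq_zero fun p _ => ?_
    have m : ∀ a c, h a c * (A p b * Z a p c d) = A p b * (h a c * Z a p c d) := fun a c => by
      ring
    simp only [m, ← Finset.mul_sum, hZ, mul_zero]
  have h4 : ∑ a, ∑ c, h a c * ∑ p, A p d * Z a b c p = 0 := by
    simp only [Finset.mul_sum]
    have : ∀ a, ∑ c, ∑ p, h a c * (A p d * Z a b c p) = ∑ p, ∑ c, h a c * (A p d * Z a b c p) :=
      fun a => Finset.sum_comm
    simp only [this]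
    rw [Finset.sum_comm]
    refine Finset.sum_eq_zero fun p _ => ?_
    have m : ∀ a c, h a c * (A p d * Z a b c p) = A p d * (h a c * Z a b c p) := fun a c => by
      ring
    simp only [m, ← Finset.mul_sum, hZ, mul_zero]
  simp only [WeylOp.derDown, mul_sub, mul_neg, Finset.sum_sub_distrib, Finset.sum_neg_distrib,
    Matrix.add_apply, add_mul, Finset.sum_add_distrib]
  rw [h1, h2, h3, h4]; ring

theorem IsCurv.add {Z Z' : Arr4 𝕜} (hZ : IsCurv Z) (hZ' : IsCurv Z') : IsCurv (Z + Z') where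
  antisymm a b c d := by simp only [Pi.add_apply, hZ.antisymm a b, hZ'.antisymm a b]; ring
  pair a b c d := by simp only [Pi.add_apply, hZ.pair a b, hZ'.pair a b]
  bianchi a b c d := by
    simp only [Pi.add_apply]
    linear_combination hZ.bianchi a b c d + hZ'.bianchi a b c d

theorem IsWeyl4.add {Z Z' : Arr4 𝕜} (hZ : IsWeyl4 h Z) (hZ' : IsWeyl4 h Z') :
    IsWeyl4 h (Z + Z') where
  toIsCurv := hZ.toIsCurv.add hZ'.toIsCurv
  trace b d := by
    simp only [Pi.add_apply, mul_add, Finset.sum_add_distrib, hZ.trace, hZ'.trace, add_zero]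

theorem IsWeyl4.smul {Z : Arr4 𝕜} (hZ : IsWeyl4 h Z) (t : 𝕜) : IsWeyl4 h (t • Z) where
  toIsCurv := hZ.toIsCurv.smul t
  trace b d := by
    have m : ∀ a c, h a c * (t • Z) a b c d = t * (h a c * Z a b c d) := fun a c => by
      simp only [Pi.smul_apply, smul_eq_mul]; ring
    simp only [m, ← Finset.mul_sum, hZ.trace, mul_zero]

theorem isWeyl4_zero : IsWeyl4 h (0 : Arr4 𝕜) where
  antisymm := by simp
  pair := by simp
  bianchi := by simp
  trace := by simp

theorem lowerWith_smul_left (t : 𝕜) (g' : M4 𝕜) (Y : Arr4 𝕜) :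
    lowerWith (t • g) g' Y = t • lowerWith g g' Y := by
  ext a b c d; simp [lowerWith]

theorem lowerWith_smul_right (t : 𝕜) (g' : M4 𝕜) (Y : Arr4 𝕜) :
    lowerWith g (t • g') Y = t • lowerWith g g' Y := by
  ext a b c d; simp [lowerWith]

theorem lowerWith_add (g g' : M4 𝕜) (Y Y' : Arr4 𝕜) :
    lowerWith g g' (Y + Y') = lowerWith g g' Y + lowerWith g g' Y' := by
  ext a b c d
  simp only [lowerWith_apply, Pi.add_apply, mul_add, Finset.sum_add_distrib]

theorem lowerWith_smul (g g' : M4 𝕜) (t : 𝕜) (Y : Arr4 𝕜) :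
    lowerWith g g' (t • Y) = t • lowerWith g g' Y := by
  ext a b c d
  simp only [lowerWith_apply, Pi.smul_apply, smul_eq_mul, Finset.mul_sum]
  exact Finset.sum_congr rfl fun p _ => Finset.sum_congr rfl fun q _ => by ring

/-- The conformal Lie algebra preserves the Weyl symmetries. -/
theorem isWeyl4_derMixed (hhg : h * g = 1) {A : M4 𝕜} {t : 𝕜}
    (hA : A.transpose * g + g * A = t • g) {Y : Arr4 𝕜} (hY : IsWeyl4 h (lowerWith g g Y)) :
    IsWeyl4 h (lowerWith g g (derMixed A Y)) := by
  have hgh : g * h = 1 := mul_eq_one_comm.1 hhg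
  -- The hypothesis in terms of the inverse metric, as needed for the trace.
  have hA' : A * h + h * A.transpose = t • h := by
    have := congrArg (fun B => h * B * h) hA
    simp only [mul_add, add_mul, Matrix.mul_smul, Matrix.smul_mul] at this
    rw [hhg, one_mul, ← mul_assoc, mul_assoc (h * A.transpose), hgh, mul_one, ← mul_assoc h g A,
      hhg, one_mul] at this
    rw [← this, add_comm]
  rw [lowerWith_derMixed, hA, lowerWith_smul_left, lowerWith_smul_right]
  refine (IsWeyl4.add ⟨hY.toIsCurv.derDown A, fun b d => ?_⟩ (hY.smul t)).add (hY.smul t)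
  rw [trace_derDown hY.trace, hA']
  have m : ∀ a c, (t • h) a c * lowerWith g g Y a b c d = t * (h a c * lowerWith g g Y a b c d) :=
    fun a c => by simp only [Matrix.smul_apply, smul_eq_mul]; ring
  simp only [m, ← Finset.mul_sum, hY.trace, mul_zero, neg_zero]

/-- Passage between two descriptions of the fibre of the source bundle: by lowering the upper
indices, suited to the Lie algebra action, and by an array with four upper indices, suited to the
contraction identities. -/
theorem exists_lowerMid (hg : g.transpose = g) (hhg : h * g = 1) {Y : Arr4 𝕜}
    (hY : IsWeyl4 h (lowerWith g g Y)) : ∃ U, IsWeyl4 g U ∧ Y = lowerMid g U := by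
  have hgh : g * h = 1 := mul_eq_one_comm.1 hhg
  have hs := symm_of_mul_eq_one hg hhg
  set Z := lowerWith g g Y with hZ
  have eU : ∀ a b c d, map₁ (conjMap h) (map₂ (conjMap h) Z) a b c d =
      ∑ p, ∑ q, h b p * h d q * Y a c p q := by
    intro a b c d
    have h1 : map₁ (conjMap h) (map₂ (conjMap h) Z) a b c d =
      ∑ p, ∑ q, h a p * h b q * map₂ (conjMap h) Z p q c d := conjMap_entry h _ a b
    have h2 : ∀ p q, map₂ (conjMap h) Z p q c d = ∑ r, ∑ s, h c r * h d s * Z p q r s :=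
      fun p q => conjMap_entry h _ c d
    have h3 : ∀ q s, ∑ p, ∑ r, h a p * h c r * Z p q r s = Y a c q s := by
      intro q s
      have e1 : ∑ p, ∑ r, h a p * h c r * Z p q r s =
          conjMap h (Matrix.of fun p r => Z p q r s) a c := (conjMap_entry h _ a c).symm
      have e2 : (Matrix.of fun p r => Z p q r s) = conjMap g (upSlice Y q s) := rfl
      rw [e1, e2, conjMap_cancel hg hhg]; rfl
    simp only [h1, h2, ← h3, Finset.mul_sum]
    rw [Finset.sum_comm]
    refine Finset.sum_congr rfl fun q _ => ?_
    rw [Finset.sum_congr rfl fun p _ => Finset.sum_comm, Finset.sum_comm]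
    exact Finset.sum_congr rfl fun s _ => Finset.sum_congr rfl fun p _ =>
      Finset.sum_congr rfl fun r _ => by ring
  refine ⟨map₁ (conjMap h) (map₂ (conjMap h) Z), ⟨hY.toIsCurv.conj h, fun b d => ?_⟩, ?_⟩
  · simp only [eU, Finset.mul_sum]
    have m : ∀ F : Arr4 𝕜, ∑ a, ∑ c, ∑ p, ∑ q, F a c p q = ∑ p, ∑ q, ∑ a, ∑ c, F a c p q := by
      intro F
      have h1 : ∀ p, ∑ q, ∑ r, ∑ s, F p q r s = ∑ r, ∑ s, ∑ q, F p q r s := fun p => by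
        rw [Finset.sum_comm]
        exact Finset.sum_congr rfl fun r _ => Finset.sum_comm
      simp only [h1]
      rw [Finset.sum_comm]
      exact Finset.sum_congr rfl fun r _ => Finset.sum_comm
    rw [m]
    have tr : ∀ p q, ∑ a, ∑ c, g a c * Y a c p q = 0 := by
      intro p q
      have e1 : ∑ a, ∑ c, h a c * Z a p c q = (h * Matrix.transpose (conjMap g (upSlice Y p q))).trace := by
        simp only [Matrix.trace, Matrix.diag_apply, Matrix.mul_apply, Matrix.transpose_apply]
        rfl
      have e2 : ∑ a, ∑ c, g a c * Y a c p q = (g * (upSlice Y p q).transpose).trace := by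
        simp only [Matrix.trace, Matrix.diag_apply, Matrix.mul_apply, Matrix.transpose_apply]
        rfl
      have e3 := hY.trace p q
      rw [e1, conjMap_apply, Matrix.transpose_mul, Matrix.transpose_mul, Matrix.transpose_transpose,
        hg, ← mul_assoc, hhg, one_mul, Matrix.trace_mul_comm] at e3
      rw [e2, e3]
    refine Finset.sum_eq_zero fun p _ => Finset.sum_eq_zero fun q _ => ?_
    have m2 : ∀ a c, g a c * (h b p * h d q * Y a c p q) = h b p * h d q * (g a c * Y a c p q) :=
      fun a c => by ring
    simp only [m2, ← Finset.mul_sum, tr, mul_zero]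
  · ext e f b d
    have e1 : lowerMid g (map₁ (conjMap h) (map₂ (conjMap h) Z)) e f b d =
        conjMap g (conjMap h (Matrix.of fun p q => Y e f p q)) b d := by
      rw [conjMap_entry]
      refine Finset.sum_congr rfl fun p _ => Finset.sum_congr rfl fun q _ => ?_
      rw [eU, conjMap_entry]; rfl
    rw [e1, conjMap_cancel hs hgh]; rfl

/-- Contraction of the action of the conformal difference tensor on a Weyl array. -/
theorem sum_derMixed_conf (hg : g.transpose = g) (hhg : h * g = 1) {U : Arr4 𝕜}
    (hU : IsWeyl4 g U) (θ : Fin 4 → 𝕜) (A : Fin 4 → M4 𝕜)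
    (hA : ∀ x k m, A x k m = (if k = x then θ m else 0) + (if k = m then θ x else 0)
      - g x m * ∑ p, h k p * θ p) (e b d : Fin 4) :
    ∑ x, derMixed (A x) (lowerMid g U) e x b d = 3 * ∑ x, θ x * lowerMid g U e x b d := by
  have gs : ∀ i j, g i j = g j i := fun i j => congrFun (congrFun hg j) i
  have hs : ∀ i j, h i j = h j i := fun i j =>
    congrFun (congrFun (symm_of_mul_eq_one hg hhg) j) i
  set Y := lowerMid g U with hY
  set η : Fin 4 → 𝕜 := fun k => ∑ p, h k p * θ p with hη
  have gη : ∀ i, ∑ p, g i p * η p = θ i := by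
    intro i
    simp only [hη, Finset.mul_sum]
    rw [Finset.sum_comm]
    have : ∀ q, ∑ p, g i p * (h p q * θ q) = (if i = q then 1 else 0) * θ q := fun q => by
      rw [← sum_metric_mul_inv hhg hg, Finset.sum_mul]
      exact Finset.sum_congr rfl fun p _ => by rw [hs p q]; ring
    simp [this]
  have ar : ∀ x k (v : Fin 4 → 𝕜), ∑ r, A x k r * v r =
      (if k = x then 1 else 0) * ∑ r, θ r * v r + θ x * v k - η k * ∑ r, g x r * v r := by
    intro x k v
    have : ∀ r, A x k r * v r = (if k = x then 1 else 0) * (θ r * v r)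
        + (if k = r then θ x * v r else 0) - η k * (g x r * v r) := fun r => by
      rw [hA]; split_ifs <;> ring
    simp only [this, Finset.sum_add_distrib, Finset.sum_sub_distrib, ← Finset.mul_sum,
      Finset.sum_ite_eq, Finset.mem_univ, if_true]
  have al : ∀ x m (v : Fin 4 → 𝕜), ∑ r, A x r m * v r =
      θ m * v x + θ x * v m - g x m * ∑ r, η r * v r := by
    intro x m v
    have : ∀ r, A x r m * v r = (if r = x then θ m * v r else 0)
        + (if r = m then θ x * v r else 0) - g x m * (η r * v r) := fun r => by
      rw [hA]; split_ifs <;> ring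
    simp only [this, Finset.sum_add_distrib, Finset.sum_sub_distrib, ← Finset.mul_sum,
      Finset.sum_ite_eq', Finset.mem_univ, if_true]
  have ex : ∀ x, derMixed (A x) Y e x b d =
      (((if e = x then 1 else 0) * ∑ r, θ r * Y r x b d + θ x * Y e x b d
        - η e * ∑ r, g x r * Y r x b d)
      + (∑ r, θ r * Y e r b d + θ x * Y e x b d - η x * ∑ r, g x r * Y e r b d))
      - (θ b * Y e x x d + θ x * Y e x b d - g x b * ∑ r, η r * Y e x r d)
      - (θ d * Y e x b x + θ x * Y e x b d - g x d * ∑ r, η r * Y e x b r) := by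
    intro x
    rw [← al x b (fun r => Y e x r d), ← al x d (fun r => Y e x b r),
      ← ar x e (fun r => Y r x b d)]
    have a2 := ar x x (fun r => Y e r b d)
    rw [if_pos rfl, one_mul] at a2
    rw [← a2]
    simp only [derMixed, Matrix.add_apply, Matrix.mul_apply, Matrix.transpose_apply, upSlice,
      Matrix.of_apply, mul_comm (Y e _ b d)]
  have c1 : ∑ x, ∑ r, g x r * Y r x b d = 0 := by
    have : ∀ x r, g x r * Y r x b d = ∑ p, ∑ q, g b p * g d q * (g r x * U r p x q) :=
      fun x r => by
        simp only [hY, lowerMid, Finset.mul_sum]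
        exact Finset.sum_congr rfl fun p _ => Finset.sum_congr rfl fun q _ => by
          rw [gs x r]; ring
    simp only [this]
    rw [Finset.sum_comm]
    have m : ∀ F : Arr4 𝕜, ∑ a, ∑ c, ∑ p, ∑ q, F a c p q = ∑ p, ∑ q, ∑ a, ∑ c, F a c p q := by
      intro F
      have h1 : ∀ p, ∑ q, ∑ r, ∑ s, F p q r s = ∑ r, ∑ s, ∑ q, F p q r s := fun p => by
        rw [Finset.sum_comm]
        exact Finset.sum_congr rfl fun r _ => Finset.sum_comm
      simp only [h1]
      rw [Finset.sum_comm]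
      exact Finset.sum_congr rfl fun r _ => Finset.sum_comm
    rw [m]
    refine Finset.sum_eq_zero fun p _ => Finset.sum_eq_zero fun q _ => ?_
    simp only [← Finset.mul_sum, hU.trace, mul_zero]
  have c2 : ∑ x, Y e x x d = 0 := by
    simp only [hY, lowerMid]
    have : ∀ x, ∑ p, ∑ q, g x p * g d q * U e p x q =
        ∑ q, ∑ p, - g d q * (g p x * U p e x q) := fun x => by
      rw [Finset.sum_comm]
      exact Finset.sum_congr rfl fun q _ => Finset.sum_congr rfl fun p _ => by
        rw [hU.antisymm, gs x p]; ring
    simp only [this]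
    rw [Finset.sum_comm]
    refine Finset.sum_eq_zero fun q _ => ?_
    rw [Finset.sum_comm]
    simp only [← Finset.mul_sum, hU.trace, mul_zero]
  have c3 : ∑ x, Y e x b x = 0 := by
    simp only [hY, lowerMid]
    rw [Finset.sum_comm]
    refine Finset.sum_eq_zero fun p _ => ?_
    have : ∀ x q, g b p * g x q * U e p x q = g x q * (g b p * U e p x q) := fun x q => by ring
    simp only [this]
    exact sum_antisymm_eq_zero (S := fun x q => g x q) (A := fun x q => g b p * U e p x q) gs
      fun x q => by rw [hU.toIsCurv.antisymm' e p x q]; ring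
  have c4 : ∑ x, η x * ∑ r, g x r * Y e r b d = ∑ x, θ x * Y e x b d := by
    simp only [← gη, Finset.mul_sum, Finset.sum_mul]
    rw [Finset.sum_comm]
    exact Finset.sum_congr rfl fun r _ => Finset.sum_congr rfl fun x _ => by rw [gs x r]; ring
  have c5 : ∑ x, g x b * ∑ r, η r * Y e x r d =
      ∑ r, θ r * ∑ p, ∑ q, g b p * g d q * U e r p q := by
    have : ∀ x, ∑ r, η r * Y e x r d = ∑ p, θ p * ∑ q, g d q * U e p x q := fun x => by
      simp only [hY, lowerMid, ← gη, Finset.mul_sum, Finset.sum_mul]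
      rw [Finset.sum_comm]
      refine Finset.sum_congr rfl fun p _ => ?_
      rw [Finset.sum_comm]
      exact Finset.sum_congr rfl fun q _ => Finset.sum_congr rfl fun r _ => by rw [gs p r]; ring
    simp only [this, Finset.mul_sum]
    rw [Finset.sum_comm]
    exact Finset.sum_congr rfl fun r _ => Finset.sum_congr rfl fun p _ =>
      Finset.sum_congr rfl fun q _ => by rw [gs p b]; ring
  have c6 : ∑ x, g x d * ∑ r, η r * Y e x b r =
      ∑ r, θ r * ∑ p, ∑ q, g b p * g d q * U e p q r := by
    have : ∀ x, ∑ r, η r * Y e x b r = ∑ q, θ q * ∑ p, g b p * U e p x q := fun x => by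
      simp only [hY, lowerMid, ← gη, Finset.mul_sum, Finset.sum_mul]
      have : ∀ r, ∑ p, ∑ q, η r * (g b p * g r q * U e p x q) =
          ∑ q, ∑ p, η r * (g b p * g r q * U e p x q) := fun r => Finset.sum_comm
      simp only [this]
      rw [Finset.sum_comm]
      refine Finset.sum_congr rfl fun q _ => ?_
      rw [Finset.sum_comm]
      exact Finset.sum_congr rfl fun p _ => Finset.sum_congr rfl fun r _ => by rw [gs q r]; ring
    simp only [this, Finset.mul_sum]
    rw [Finset.sum_comm]
    refine Finset.sum_congr rfl fun r _ => ?_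
    rw [Finset.sum_comm]
    exact Finset.sum_congr rfl fun p _ =>
      Finset.sum_congr rfl fun q _ => by rw [gs q d]; ring
  -- The terms in which `θ` occupies another index than the contracted one cancel by the Bianchi
  -- identity.
  have c7 : ∑ r, θ r * Y r e b d + (∑ r, θ r * ∑ p, ∑ q, g b p * g d q * U e r p q)
      + ∑ r, θ r * ∑ p, ∑ q, g b p * g d q * U e p q r = 0 := by
    rw [← Finset.sum_add_distrib, ← Finset.sum_add_distrib]
    refine Finset.sum_eq_zero fun r _ => ?_
    rw [← mul_add, ← mul_add]
    refine mul_eq_zero_of_right _ ?_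
    simp only [hY, lowerMid, ← Finset.sum_add_distrib]
    refine Finset.sum_eq_zero fun p _ => Finset.sum_eq_zero fun q _ => ?_
    have := hU.bianchi e r p q
    rw [← hU.pair r p e q] at this
    linear_combination (g b p * g d q) * this
  have c8 : ∑ x, (if e = x then (1 : 𝕜) else 0) * ∑ r, θ r * Y r x b d = ∑ r, θ r * Y r e b d := by
    simp
  simp only [ex, Finset.sum_add_distrib, Finset.sum_sub_distrib, ← Finset.mul_sum]
  rw [c1, c2, c3, c4, c5, c6, c8]
  -- The contracted upper index contributes `4 + 1 - 1`, the other upper index `1`, and the two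
  -- lower indices `-1` each; the sum is the weight 3.
  simp only [Finset.sum_const, Finset.card_univ, Fintype.card_fin, nsmul_eq_mul]
  push_cast
  linear_combination c7

end Mixed

section

attribute [local instance] Matrix.normedAddCommGroup Matrix.normedSpace

/-! ### Functionals with a conformal weight -/

section Functional

variable {𝕜 : Type*} [RCLike 𝕜] {V : Type*} [NormedAddCommGroup V] [NormedSpace ℝ V]

/-- Arrays with four indices and values in a vector space. -/
abbrev VArr4 (V : Type*) := Fin 4 → Fin 4 → Fin 4 → Fin 4 → V

/-- A symmetric linear functional that vanishes on multiples of the metric, and under which the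
conformal difference tensor acts on the subspace `W` with weight `3`. -/
structure IsConfFunctional (r : TRep V) (g h : Mat) (W : Submodule ℝ V)
    (Φ : VArr4 V →ₗ[ℝ] 𝕜) : Prop where
  swap₁ : ∀ X : VArr4 V, Φ (fun a b c d => X b a c d) = Φ X
  swap₂ : ∀ X : VArr4 V, Φ (fun a b c d => X a c b d) = Φ X
  swap₃ : ∀ X : VArr4 V, Φ (fun a b c d => X a b d c) = Φ X
  metric : ∀ B : Fin 4 → Fin 4 → V, (∀ c d, B c d ∈ W) →
    Φ (fun a b c d => g a b • B c d) = 0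
  conf : ∀ (Q : Fin 4 → Fin 4 → Fin 4 → Fin 4 → ℝ) (R : Fin 4 → Fin 4 → Fin 4 → V),
    (∀ a b c, R a b c ∈ W) → Φ (fun a b c d => confAct r g h (Q a b c) (R a b c) d) =
      3 * Φ (fun a b c d => Q a b c d • R a b c)

/-- The source of all further weights. A symmetric functional that vanishes on multiples of the
metric sees the two middle terms as equal and the last one as zero, so each additional lower index
reduces the weight by 2. -/
theorem confAct_down (r : TRep V) (g h : Mat) (θ : Fin 4 → ℝ) (T : Fin 4 → V) (c x : Fin 4) :
    confAct r.down g h θ T c x = confAct r g h θ (T x) c - θ x • T c - θ c • T x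
      + g c x • ∑ p, (∑ q, h p q * θ q) • T p := by
  have e : ∑ p, confMat g h θ c p x • T p =
      θ x • T c + θ c • T x - g c x • ∑ p, (∑ q, h p q * θ q) • T p := by
    have : ∀ p, confMat g h θ c p x • T p = (if p = c then θ x • T p else 0)
        + (if p = x then θ c • T p else 0) - g c x • (∑ q, h p q * θ q) • T p := fun p => by
      simp only [confMat, Matrix.of_apply, sub_smul, add_smul, smul_smul]
      split_ifs <;> simp
    simp only [this, Finset.sum_add_distrib, Finset.sum_sub_distrib, Finset.sum_ite_eq',
      Finset.mem_univ, if_true, Finset.smul_sum]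
  simp only [confAct_apply, TRep.down_ρ, e]
  abel

theorem confAct_triv (g h : Mat) (θ : Fin 4 → ℝ) (t : ℝ) (c : Fin 4) :
    confAct (TRep.triv ℝ) g h θ t c = 0 := by
  simp [confAct_apply, TRep.triv_ρ]

namespace IsConfFunctional

variable {r : TRep V} {g h : Mat} {W : Submodule ℝ V} {Φ : VArr4 V →ₗ[ℝ] 𝕜}
  (hΦ : IsConfFunctional r g h W Φ)
include hΦ

theorem metric₁₃ (B : Fin 4 → Fin 4 → V) (hB : ∀ c d, B c d ∈ W) :
    Φ (fun a b c d => g a c • B b d) = 0 :=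
  (hΦ.swap₂ fun a b c d => g a b • B c d).trans (hΦ.metric B hB)

theorem metric₂₃ (B : Fin 4 → Fin 4 → V) (hB : ∀ c d, B c d ∈ W) :
    Φ (fun a b c d => g b c • B a d) = 0 :=
  (hΦ.swap₁ fun a b c d => g a c • B b d).trans (hΦ.metric₁₃ B hB)

theorem metric₂₄ (B : Fin 4 → Fin 4 → V) (hB : ∀ c d, B c d ∈ W) :
    Φ (fun a b c d => g b d • B a c) = 0 :=
  (hΦ.swap₃ fun a b c d => g b c • B a d).trans (hΦ.metric₂₃ B hB)

theorem metric₃₄ (B : Fin 4 → Fin 4 → V) (hB : ∀ c d, B c d ∈ W) :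
    Φ (fun a b c d => g c d • B a b) = 0 :=
  (hΦ.swap₂ fun a b c d => g b d • B a c).trans (hΦ.metric₂₄ B hB)

/-- A first derivative has one more lower index than the section, hence weight `3 - 2`. In the same
way second and third derivatives have the weights -1 and -3 in `conf_two` and `conf_three`. -/
theorem conf_one (Q : Fin 4 → Fin 4 → Fin 4 → ℝ) (R : Fin 4 → Fin 4 → Fin 4 → V)
    (hR : ∀ a b c, R a b c ∈ W) :
    Φ (fun a b c d => confAct r.down g h (Q a b) (R a b) c d) =
      Φ (fun a b c d => Q a b c • R a b d) := by
  have e : (fun a b c d => confAct r.down g h (Q a b) (R a b) c d) =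
      (fun a b c d => confAct r g h (Q a b) (R a b d) c) - (fun a b c d => Q a b d • R a b c)
      - (fun a b c d => Q a b c • R a b d)
      + (fun a b c d => g c d • ∑ p, (∑ q, h p q * Q a b q) • R a b p) := by
    funext a b c d; exact confAct_down r g h (Q a b) (R a b) c d
  have e1 : Φ (fun a b c d => confAct r g h (Q a b) (R a b d) c) =
      3 * Φ (fun a b c d => Q a b c • R a b d) :=
    (hΦ.swap₃ fun a b c d => confAct r g h (Q a b) (R a b c) d).trans
      ((hΦ.conf (fun a b _ => Q a b) R hR).trans
        (congrArg _ (hΦ.swap₃ fun a b c d => Q a b c • R a b d)))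
  have e2 : Φ (fun a b c d => Q a b d • R a b c) = Φ (fun a b c d => Q a b c • R a b d) :=
    hΦ.swap₃ fun a b c d => Q a b c • R a b d
  have e3 := hΦ.metric₃₄ (fun a b => ∑ p, (∑ q, h p q * Q a b q) • R a b p)
    fun a b => W.sum_mem fun p _ => W.smul_mem _ (hR a b p)
  rw [e, map_add, map_sub, map_sub, e1, e2, e3]
  ring

theorem conf_two (Q : Fin 4 → Fin 4 → ℝ) (R : Fin 4 → Fin 4 → Fin 4 → V)
    (hR : ∀ a b c, R a b c ∈ W) :
    Φ (fun a b c d => confAct r.down.down g h (Q a) (R a) b c d) =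
      - Φ (fun a b c d => Q a b • R a c d) := by
  have e : (fun a b c d => confAct r.down.down g h (Q a) (R a) b c d) =
      (fun a b c d => confAct r.down g h (Q a) (R a c) b d) - (fun a b c d => Q a c • R a b d)
      - (fun a b c d => Q a b • R a c d)
      + (fun a b c d => g b c • ∑ p, (∑ q, h p q * Q a q) • R a p d) := by
    funext a b c d
    rw [confAct_down]
    simp only [Pi.add_apply, Pi.sub_apply, Pi.smul_apply, Finset.sum_apply]
  have e1 : Φ (fun a b c d => confAct r.down g h (Q a) (R a c) b d) =
      Φ (fun a b c d => Q a b • R a c d) :=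
    (hΦ.swap₂ fun a b c d => confAct r.down g h (Q a) (R a b) c d).trans
      ((hΦ.conf_one (fun a _ => Q a) R hR).trans (hΦ.swap₂ fun a b c d => Q a b • R a c d))
  have e2 : Φ (fun a b c d => Q a c • R a b d) = Φ (fun a b c d => Q a b • R a c d) :=
    hΦ.swap₂ fun a b c d => Q a b • R a c d
  have e3 := hΦ.metric₂₃ (fun a d => ∑ p, (∑ q, h p q * Q a q) • R a p d)
    fun a d => W.sum_mem fun p _ => W.smul_mem _ (hR a p d)
  rw [e, map_add, map_sub, map_sub, e1, e2, e3]
  ring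

theorem conf_three (Q : Fin 4 → ℝ) (R : Fin 4 → Fin 4 → Fin 4 → V)
    (hR : ∀ a b c, R a b c ∈ W) :
    Φ (fun a b c d => confAct r.down.down.down g h Q R a b c d) =
      - 3 * Φ (fun a b c d => Q a • R b c d) := by
  have e : (fun a b c d => confAct r.down.down.down g h Q R a b c d) =
      (fun a b c d => confAct r.down.down g h Q (R b) a c d) - (fun a b c d => Q b • R a c d)
      - (fun a b c d => Q a • R b c d)
      + (fun a b c d => g a b • ∑ p, (∑ q, h p q * Q q) • R p c d) := by
    funext a b c d
    rw [confAct_down]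
    simp only [Pi.add_apply, Pi.sub_apply, Pi.smul_apply, Finset.sum_apply]
  have e1 : Φ (fun a b c d => confAct r.down.down g h Q (R b) a c d) =
      - Φ (fun a b c d => Q a • R b c d) :=
    (hΦ.swap₁ fun a b c d => confAct r.down.down g h Q (R a) b c d).trans
      ((hΦ.conf_two (fun _ => Q) R hR).trans
        (congrArg _ (hΦ.swap₁ fun a b c d => Q a • R b c d)))
  have e2 : Φ (fun a b c d => Q b • R a c d) = Φ (fun a b c d => Q a • R b c d) :=
    hΦ.swap₁ fun a b c d => Q a • R b c d
  have e3 := hΦ.metric (fun c d => ∑ p, (∑ q, h p q * Q q) • R p c d)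
    fun c d => W.sum_mem fun p _ => W.smul_mem _ (hR p c d)
  rw [e, map_add, map_sub, map_sub, e1, e2, e3]
  ring

/-- Scalars have weight 0, so two lower indices give weight -4. This is used for the Schouten tensor
as a coefficient of a first derivative of the section. -/
theorem conf_real_two (Q : Fin 4 → ℝ) (P : Fin 4 → Fin 4 → ℝ) (R : Fin 4 → V)
    (hR : ∀ a, R a ∈ W) :
    Φ (fun a b c d => confAct (TRep.triv ℝ).down.down g h Q P a b c • R d) =
      - 4 * Φ (fun a b c d => (Q a * P b c) • R d) := by
  have e : (fun a b c d => confAct (TRep.triv ℝ).down.down g h Q P a b c • R d) =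
      - (fun a b c d => (Q c * P b a) • R d) - (fun a b c d => (Q a * P b c) • R d)
      + (fun a b c d => g a c • (∑ p, (∑ q, h p q * Q q) * P b p) • R d)
      - (fun a b c d => (Q b * P a c) • R d) - (fun a b c d => (Q a * P b c) • R d)
      + (fun a b c d => g a b • (∑ p, (∑ q, h p q * Q q) * P p c) • R d) := by
    funext a b c d
    rw [confAct_down, Pi.add_apply, Pi.sub_apply, Pi.sub_apply, confAct_down, confAct_triv]
    simp only [Pi.add_apply, Pi.sub_apply, Pi.neg_apply, Pi.smul_apply, Finset.sum_apply,
      smul_eq_mul, smul_smul, ← neg_smul, ← add_smul, ← sub_smul, zero_sub]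
  have e1 : Φ (fun a b c d => (Q c * P b a) • R d) = Φ (fun a b c d => (Q a * P b c) • R d) :=
    ((hΦ.swap₂ fun a b c d => (Q b * P c a) • R d).trans
      (hΦ.swap₁ fun a b c d => (Q a * P c b) • R d)).trans
      (hΦ.swap₂ fun a b c d => (Q a * P b c) • R d)
  have e2 : Φ (fun a b c d => (Q b * P a c) • R d) = Φ (fun a b c d => (Q a * P b c) • R d) :=
    hΦ.swap₁ fun a b c d => (Q a * P b c) • R d
  have e3 := hΦ.metric₁₃ (fun b d => (∑ p, (∑ q, h p q * Q q) * P b p) • R d)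
    fun b d => W.smul_mem _ (hR d)
  have e4 := hΦ.metric (fun c d => (∑ p, (∑ q, h p q * Q q) * P p c) • R d)
    fun c d => W.smul_mem _ (hR d)
  rw [e, map_add, map_sub, map_sub, map_add, map_sub, map_neg, e1, e2, e3, e4]
  ring

theorem conf_real_two' (Q : Fin 4 → Fin 4 → ℝ) (P : Fin 4 → Fin 4 → Fin 4 → ℝ) {R : V}
    (hR : R ∈ W) :
    Φ (fun a b c d => confAct (TRep.triv ℝ).down.down g h (Q a) (P a) b c d • R) =
      - 4 * Φ (fun a b c d => (Q a b * P a c d) • R) := by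
  have e : (fun a b c d => confAct (TRep.triv ℝ).down.down g h (Q a) (P a) b c d • R) =
      - (fun a b c d => (Q a d * P a c b) • R) - (fun a b c d => (Q a b * P a c d) • R)
      + (fun a b c d => g b d • (∑ p, (∑ q, h p q * Q a q) * P a c p) • R)
      - (fun a b c d => (Q a c * P a b d) • R) - (fun a b c d => (Q a b * P a c d) • R)
      + (fun a b c d => g b c • (∑ p, (∑ q, h p q * Q a q) * P a p d) • R) := by
    funext a b c d
    rw [confAct_down, Pi.add_apply, Pi.sub_apply, Pi.sub_apply, confAct_down, confAct_triv]
    simp only [Pi.add_apply, Pi.sub_apply, Pi.neg_apply, Pi.smul_apply, Finset.sum_apply,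
      smul_eq_mul, smul_smul, ← neg_smul, ← add_smul, ← sub_smul, zero_sub]
  have e1 : Φ (fun a b c d => (Q a d * P a c b) • R) = Φ (fun a b c d => (Q a b * P a c d) • R) :=
    ((hΦ.swap₂ fun a b c d => (Q a d * P a b c) • R).trans
      (hΦ.swap₃ fun a b c d => (Q a c * P a b d) • R)).trans
      (hΦ.swap₂ fun a b c d => (Q a b * P a c d) • R)
  have e2 : Φ (fun a b c d => (Q a c * P a b d) • R) = Φ (fun a b c d => (Q a b * P a c d) • R) :=
    hΦ.swap₂ fun a b c d => (Q a b * P a c d) • R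
  have e3 := hΦ.metric₂₄ (fun a c => (∑ p, (∑ q, h p q * Q a q) * P a c p) • R)
    fun b d => W.smul_mem _ hR
  have e4 := hΦ.metric₂₃ (fun a d => (∑ p, (∑ q, h p q * Q a q) * P a p d) • R)
    fun c d => W.smul_mem _ hR
  rw [e, map_add, map_sub, map_sub, map_add, map_sub, map_neg, e1, e2, e3, e4]
  ring

/-- Three lower indices on a scalar give weight -6, as required for the derivative of the Schouten
tensor. -/
theorem conf_real_three (Q : Fin 4 → ℝ) (P : Fin 4 → Fin 4 → Fin 4 → ℝ) {R : V}
    (hR : R ∈ W) :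
    Φ (fun a b c d => confAct (TRep.triv ℝ).down.down.down g h Q P a b c d • R) =
      - 6 * Φ (fun a b c d => (Q a * P b c d) • R) := by
  have e : (fun a b c d => confAct (TRep.triv ℝ).down.down.down g h Q P a b c d • R) =
      (fun a b c d => confAct (TRep.triv ℝ).down.down g h Q (P b) a c d • R)
      - (fun a b c d => (Q b * P a c d) • R) - (fun a b c d => (Q a * P b c d) • R)
      + (fun a b c d => g a b • (∑ p, (∑ q, h p q * Q q) * P p c d) • R) := by
    funext a b c d
    rw [confAct_down]
    simp only [Pi.add_apply, Pi.sub_apply, Pi.smul_apply, Finset.sum_apply,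
      smul_eq_mul, smul_smul, ← add_smul, ← sub_smul]
  have e1 : Φ (fun a b c d => confAct (TRep.triv ℝ).down.down g h Q (P b) a c d • R) =
      - 4 * Φ (fun a b c d => (Q a * P b c d) • R) :=
    (hΦ.swap₁ fun a b c d => confAct (TRep.triv ℝ).down.down g h Q (P a) b c d • R).trans
      ((hΦ.conf_real_two' (fun _ => Q) P hR).trans
        (congrArg _ (hΦ.swap₁ fun a b c d => (Q a * P b c d) • R)))
  have e2 : Φ (fun a b c d => (Q b * P a c d) • R) = Φ (fun a b c d => (Q a * P b c d) • R) :=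
    hΦ.swap₁ fun a b c d => (Q a * P b c d) • R
  have e3 := hΦ.metric (fun c d => (∑ p, (∑ q, h p q * Q q) * P p c d) • R)
    fun c d => W.smul_mem _ hR
  rw [e, map_add, map_sub, map_sub, e1, e2, e3]
  ring

end IsConfFunctional

end Functional

end

section

attribute [local instance] Matrix.normedAddCommGroup Matrix.normedSpace

open Filter Topology

/-! ### Iterated derivatives with respect to two conformal connections -/

section Expansion

variable {V : Type*} [NormedAddCommGroup V] [NormedSpace ℝ V]
  {V₁ V₂ V₃ : Type*} [NormedAddCommGroup V₁] [NormedSpace ℝ V₁] [NormedAddCommGroup V₂]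
  [NormedSpace ℝ V₂] [NormedAddCommGroup V₃] [NormedSpace ℝ V₃]
  {Γ : E4 → Fin 4 → Mat} {s : Set E4}

theorem IsParBilin.cov_eq {r₁ : TRep V₁} {r₂ : TRep V₂} {r₃ : TRep V₃}
    {B : E4 → V₁ →ₗ[ℝ] V₂ →ₗ[ℝ] V₃} (h : IsParBilin Γ s r₁ r₂ r₃ B) {S : E4 → V₁} {T : E4 → V₂}
    (hS : SmoothOn s S) (hT : SmoothOn s T) {u : E4} (hu : u ∈ s) :
    cov r₃ Γ (fun x => B x (S x) (T x)) u =
      WeylOp.liftL (B u) (cov r₁ Γ S u) (T u) + WeylOp.liftR (B u) (S u) (cov r₂ Γ T u) := by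
  ext a; exact h.leibniz hS hT u hu a

theorem cov_sub (r : TRep V) {S T : E4 → V} {u : E4} (hS : ContDiffAt ℝ ∞ S u)
    (hT : ContDiffAt ℝ ∞ T u) :
    cov r Γ (fun x => S x - T x) u = cov r Γ S u - cov r Γ T u := by
  ext a
  simp only [cov, Pi.sub_apply, pd_sub hS hT, map_sub]
  abel

theorem SmoothOn.sub {S T : E4 → V} (hS : SmoothOn s S) (hT : SmoothOn s T) :
    SmoothOn s (fun x => S x - T x) := fun u hu => (hS u hu).sub (hT u hu)

namespace IsConformalOn

variable {G G' : E4 → Mat} {Ω : E4 → ℝ} (h : IsConformalOn G G' Ω s)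
  [FiniteDimensional ℝ V] (r : TRep V)
include h

theorem smooth_conn (a : Fin 4) : SmoothOn s fun x => conn G x a :=
  fun _ hx => h.left.smooth_conn hx a

theorem smooth_conn' (a : Fin 4) : SmoothOn s fun x => conn G' x a :=
  fun _ hx => h.right.smooth_conn hx a

/-- Only the innermost derivative belongs to the changed connection. Since `confAct` is parallel,
the outer derivative falls either on `θ` or on the section. The outer derivatives are converted one
at a time, by applying the same lemma to `r.down` and `r.down.down`. -/
theorem cov_cov {T : E4 → V} (hT : SmoothOn s T) {u : E4} (hu : u ∈ s) (a b : Fin 4) :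
    cov r.down (conn G) (cov r (conn G') T) u a b =
      cov r.down (conn G) (cov r (conn G) T) u a b
      + (confAct r (G u) (G u)⁻¹ (cov (TRep.triv ℝ).down (conn G) (dlog Ω) u a) (T u) b
        + confAct r (G u) (G u)⁻¹ (dlog Ω u) (cov r (conn G) T u a) b) := by
  have hB := isParBilin_confAct h.left r
  have hT1 := hT.cov r h.smooth_conn
  have hs := hB.smooth h.smooth_dlog hT
  have e : ∀ u ∈ s, cov r.down (conn G) (cov r (conn G') T) u =
      cov r.down (conn G) (cov r (conn G) T) u
      + (liftL (confAct r (G u) (G u)⁻¹) (cov (TRep.triv ℝ).down (conn G) (dlog Ω) u) (T u)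
        + liftR (confAct r (G u) (G u)⁻¹) (dlog Ω u) (cov r (conn G) T u)) := by
    intro u hu
    rw [cov_congr_on r.down h.left.isOpen (fun x hx => h.cov_eq r T hx) hu,
      cov_add _ (hT1 u hu) (hs u hu), hB.cov_eq h.smooth_dlog hT hu]
  rw [e u hu]; rfl

theorem cov_cov_cov {T : E4 → V} (hT : SmoothOn s T) {u : E4} (hu : u ∈ s) (a b c : Fin 4) :
    cov r.down.down (conn G) (cov r.down (conn G) (cov r (conn G') T)) u a b c =
      cov r.down.down (conn G) (cov r.down (conn G) (cov r (conn G) T)) u a b c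
      + (confAct r (G u) (G u)⁻¹ (cov (TRep.triv ℝ).down.down (conn G)
            (cov (TRep.triv ℝ).down (conn G) (dlog Ω)) u a b) (T u) c
        + confAct r (G u) (G u)⁻¹ (cov (TRep.triv ℝ).down (conn G) (dlog Ω) u b)
            (cov r (conn G) T u a) c
        + confAct r (G u) (G u)⁻¹ (cov (TRep.triv ℝ).down (conn G) (dlog Ω) u a)
            (cov r (conn G) T u b) c
        + confAct r (G u) (G u)⁻¹ (dlog Ω u)
            (cov r.down (conn G) (cov r (conn G) T) u a b) c) := by
  have hB := isParBilin_confAct h.left r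
  have hθ := h.smooth_dlog
  have hθ1 := hθ.cov (TRep.triv ℝ).down h.smooth_conn
  have hT1 := hT.cov r h.smooth_conn
  have hT2 := hT1.cov r.down h.smooth_conn
  have s1 := hB.liftL.smooth hθ1 hT
  have s2 := hB.liftR.smooth hθ hT1
  have e0 : ∀ u ∈ s, cov r.down (conn G) (cov r (conn G') T) u =
      cov r.down (conn G) (cov r (conn G) T) u
      + (liftL (confAct r (G u) (G u)⁻¹) (cov (TRep.triv ℝ).down (conn G) (dlog Ω) u) (T u)
        + liftR (confAct r (G u) (G u)⁻¹) (dlog Ω u) (cov r (conn G) T u)) := by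
    intro u hu; ext a b; exact congrFun (funext fun b => h.cov_cov r hT hu a b) b
  have e : cov r.down.down (conn G) (cov r.down (conn G) (cov r (conn G') T)) u =
      cov r.down.down (conn G) (cov r.down (conn G) (cov r (conn G) T)) u
      + ((liftL (liftL (confAct r (G u) (G u)⁻¹)) (cov (TRep.triv ℝ).down.down (conn G)
            (cov (TRep.triv ℝ).down (conn G) (dlog Ω)) u) (T u)
          + liftR (liftL (confAct r (G u) (G u)⁻¹)) (cov (TRep.triv ℝ).down (conn G) (dlog Ω) u)
            (cov r (conn G) T u))
        + (liftL (liftR (confAct r (G u) (G u)⁻¹)) (cov (TRep.triv ℝ).down (conn G) (dlog Ω) u)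
            (cov r (conn G) T u)
          + liftR (liftR (confAct r (G u) (G u)⁻¹)) (dlog Ω u)
            (cov r.down (conn G) (cov r (conn G) T) u))) := by
    rw [cov_congr_on r.down.down h.left.isOpen e0 hu,
      cov_add _ (hT2 u hu) ((s1.add s2) u hu), cov_add _ (s1 u hu) (s2 u hu),
      hB.liftL.cov_eq hθ1 hT hu, hB.liftR.cov_eq hθ hT1 hu]
  rw [e]
  simp only [Pi.add_apply, liftL_apply, liftR_apply]
  abel

/-- The eight correction terms correspond to the subsets of `{a, b, c}`: the derivatives in the
subset fall on `θ`, the others on the section. -/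
theorem cov_cov_cov_cov {T : E4 → V} (hT : SmoothOn s T) {u : E4} (hu : u ∈ s)
    (a b c d : Fin 4) :
    cov r.down.down.down (conn G) (cov r.down.down (conn G) (cov r.down (conn G)
        (cov r (conn G') T))) u a b c d =
      cov r.down.down.down (conn G) (cov r.down.down (conn G) (cov r.down (conn G)
        (cov r (conn G) T))) u a b c d
      + (confAct r (G u) (G u)⁻¹ (cov (TRep.triv ℝ).down.down.down (conn G)
            (cov (TRep.triv ℝ).down.down (conn G)
              (cov (TRep.triv ℝ).down (conn G) (dlog Ω))) u a b c) (T u) d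
        + confAct r (G u) (G u)⁻¹ (cov (TRep.triv ℝ).down.down (conn G)
            (cov (TRep.triv ℝ).down (conn G) (dlog Ω)) u b c) (cov r (conn G) T u a) d
        + confAct r (G u) (G u)⁻¹ (cov (TRep.triv ℝ).down.down (conn G)
            (cov (TRep.triv ℝ).down (conn G) (dlog Ω)) u a c) (cov r (conn G) T u b) d
        + confAct r (G u) (G u)⁻¹ (cov (TRep.triv ℝ).down (conn G) (dlog Ω) u c)
            (cov r.down (conn G) (cov r (conn G) T) u a b) d
        + confAct r (G u) (G u)⁻¹ (cov (TRep.triv ℝ).down.down (conn G)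
            (cov (TRep.triv ℝ).down (conn G) (dlog Ω)) u a b) (cov r (conn G) T u c) d
        + confAct r (G u) (G u)⁻¹ (cov (TRep.triv ℝ).down (conn G) (dlog Ω) u b)
            (cov r.down (conn G) (cov r (conn G) T) u a c) d
        + confAct r (G u) (G u)⁻¹ (cov (TRep.triv ℝ).down (conn G) (dlog Ω) u a)
            (cov r.down (conn G) (cov r (conn G) T) u b c) d
        + confAct r (G u) (G u)⁻¹ (dlog Ω u)
            (cov r.down.down (conn G) (cov r.down (conn G) (cov r (conn G) T)) u a b c) d) := by
  have hB := isParBilin_confAct h.left r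
  have hθ := h.smooth_dlog
  have hθ1 := hθ.cov (TRep.triv ℝ).down h.smooth_conn
  have hθ2 := hθ1.cov (TRep.triv ℝ).down.down h.smooth_conn
  have hT1 := hT.cov r h.smooth_conn
  have hT2 := hT1.cov r.down h.smooth_conn
  have hT3 := hT2.cov r.down.down h.smooth_conn
  have s1 := hB.liftL.liftL.smooth hθ2 hT
  have s2 := hB.liftL.liftR.smooth hθ1 hT1
  have s3 := hB.liftR.liftL.smooth hθ1 hT1
  have s4 := hB.liftR.liftR.smooth hθ hT2
  have e0 : ∀ u ∈ s, cov r.down.down (conn G) (cov r.down (conn G) (cov r (conn G') T)) u =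
      cov r.down.down (conn G) (cov r.down (conn G) (cov r (conn G) T)) u
      + (liftL (liftL (confAct r (G u) (G u)⁻¹)) (cov (TRep.triv ℝ).down.down (conn G)
            (cov (TRep.triv ℝ).down (conn G) (dlog Ω)) u) (T u)
          + liftR (liftL (confAct r (G u) (G u)⁻¹)) (cov (TRep.triv ℝ).down (conn G) (dlog Ω) u)
            (cov r (conn G) T u)
        + liftL (liftR (confAct r (G u) (G u)⁻¹)) (cov (TRep.triv ℝ).down (conn G) (dlog Ω) u)
            (cov r (conn G) T u)
          + liftR (liftR (confAct r (G u) (G u)⁻¹)) (dlog Ω u)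
            (cov r.down (conn G) (cov r (conn G) T) u)) := by
    intro u hu; ext a b c; exact congrFun (funext fun c => h.cov_cov_cov r hT hu a b c) c
  rw [cov_congr_on r.down.down.down h.left.isOpen e0 hu,
    cov_add _ (hT3 u hu) ((((s1.add s2).add s3).add s4) u hu),
    cov_add _ (((s1.add s2).add s3) u hu) (s4 u hu), cov_add _ ((s1.add s2) u hu) (s3 u hu),
    cov_add _ (s1 u hu) (s2 u hu),
    hB.liftL.liftL.cov_eq hθ2 hT hu, hB.liftL.liftR.cov_eq hθ1 hT1 hu,
    hB.liftR.liftL.cov_eq hθ1 hT1 hu, hB.liftR.liftR.cov_eq hθ hT2 hu]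
  simp only [Pi.add_apply, liftL_apply, liftR_apply]
  abel

end IsConformalOn

end Expansion

end

section

attribute [local instance] Matrix.normedAddCommGroup Matrix.normedSpace

/-! ### Conformal invariance of the fourth order expression -/

section Identity

variable {𝕜 : Type*} [RCLike 𝕜] {V : Type*} [NormedAddCommGroup V] [NormedSpace ℝ V]
variable {r : TRep V} {g h : Mat} {W : Submodule ℝ V} {Φ : VArr4 V →ₗ[ℝ] 𝕜}

namespace IsConfFunctional

variable (hΦ : IsConfFunctional r g h W Φ)
include hΦ

theorem perm_bcad (X : VArr4 V) : Φ (fun a b c d => X b c a d) = Φ X :=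
  (hΦ.swap₁ fun a b c d => X a c b d).trans (hΦ.swap₂ X)

theorem perm_cabd (X : VArr4 V) : Φ (fun a b c d => X c a b d) = Φ X :=
  (hΦ.swap₂ fun a b c d => X b a c d).trans (hΦ.swap₁ X)

theorem perm_acdb (X : VArr4 V) : Φ (fun a b c d => X a c d b) = Φ X :=
  (hΦ.swap₂ fun a b c d => X a b d c).trans (hΦ.swap₃ X)

theorem perm_adbc (X : VArr4 V) : Φ (fun a b c d => X a d b c) = Φ X :=
  (hΦ.swap₃ fun a b c d => X a c b d).trans (hΦ.swap₂ X)

theorem perm_bcda (X : VArr4 V) : Φ (fun a b c d => X b c d a) = Φ X :=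
  (hΦ.swap₁ fun a b c d => X a c d b).trans (hΦ.perm_acdb X)

theorem perm_dabc (X : VArr4 V) : Φ (fun a b c d => X d a b c) = Φ X :=
  (hΦ.swap₃ fun a b c d => X c a b d).trans (hΦ.perm_cabd X)

theorem perm_bdac (X : VArr4 V) : Φ (fun a b c d => X b d a c) = Φ X :=
  (hΦ.swap₃ fun a b c d => X b c a d).trans (hΦ.perm_bcad X)

theorem perm_cdab (X : VArr4 V) : Φ (fun a b c d => X c d a b) = Φ X :=
  (hΦ.swap₂ fun a b c d => X b d a c).trans (hΦ.perm_bdac X)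

end IsConfFunctional

/-- The components at a point of the derivatives of a section with respect to two connections that
differ by the conformal difference tensor of `θ`: `Y₁, …, Y₄` are the iterated derivatives of `Y`
for the first connection, `T₁, …, T₄` those for the second one, and `Dⁱ Tₖ` are derivatives of `Tₖ`
for the first one. -/
structure ConfJet (r : TRep V) (g h : Mat) (θ : Fin 4 → ℝ) (θ₁ : Fin 4 → Fin 4 → ℝ)
    (θ₂ : Fin 4 → Fin 4 → Fin 4 → ℝ) (θ₃ : Fin 4 → Fin 4 → Fin 4 → Fin 4 → ℝ)
    (Y : V) (Y₁ : Fin 4 → V) (Y₂ : Fin 4 → Fin 4 → V) (Y₃ : Fin 4 → Fin 4 → Fin 4 → V)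
    (Y₄ : VArr4 V) (T₁ : Fin 4 → V) (DT₁ T₂ : Fin 4 → Fin 4 → V)
    (DDT₁ DT₂ T₃ : Fin 4 → Fin 4 → Fin 4 → V) (DDDT₁ DDT₂ DT₃ T₄ : VArr4 V) : Prop where
  t₁ : ∀ d, T₁ d = Y₁ d + confAct r g h θ Y d
  d₁ : ∀ c d, DT₁ c d = Y₂ c d + (confAct r g h (θ₁ c) Y d + confAct r g h θ (Y₁ c) d)
  dd₁ : ∀ b c d, DDT₁ b c d = Y₃ b c d + (confAct r g h (θ₂ b c) Y d
    + confAct r g h (θ₁ c) (Y₁ b) d + confAct r g h (θ₁ b) (Y₁ c) d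
    + confAct r g h θ (Y₂ b c) d)
  ddd₁ : ∀ a b c d, DDDT₁ a b c d = Y₄ a b c d + (confAct r g h (θ₃ a b c) Y d
    + confAct r g h (θ₂ b c) (Y₁ a) d + confAct r g h (θ₂ a c) (Y₁ b) d
    + confAct r g h (θ₁ c) (Y₂ a b) d + confAct r g h (θ₂ a b) (Y₁ c) d
    + confAct r g h (θ₁ b) (Y₂ a c) d + confAct r g h (θ₁ a) (Y₂ b c) d
    + confAct r g h θ (Y₃ a b c) d)
  t₂ : ∀ c d, T₂ c d = DT₁ c d + confAct r.down g h θ T₁ c d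
  d₂ : ∀ b c d, DT₂ b c d = DDT₁ b c d
    + (confAct r.down g h (θ₁ b) T₁ c d + confAct r.down g h θ (DT₁ b) c d)
  dd₂ : ∀ a b c d, DDT₂ a b c d = DDDT₁ a b c d + (confAct r.down g h (θ₂ a b) T₁ c d
    + confAct r.down g h (θ₁ b) (DT₁ a) c d + confAct r.down g h (θ₁ a) (DT₁ b) c d
    + confAct r.down g h θ (DDT₁ a b) c d)
  t₃ : ∀ b c d, T₃ b c d = DT₂ b c d + confAct r.down.down g h θ T₂ b c d
  d₃ : ∀ a b c d, DT₃ a b c d = DDT₂ a b c d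
    + (confAct r.down.down g h (θ₁ a) T₂ b c d + confAct r.down.down g h θ (DT₂ a) b c d)
  t₄ : ∀ a b c d, T₄ a b c d = DT₃ a b c d + confAct r.down.down.down g h θ T₃ a b c d

/-- The conformal change of a symmetric tensor that transforms like the Schouten tensor, and of its
first two derivatives. -/
structure ConfJetSchouten (g h : Mat) (θ : Fin 4 → ℝ) (θ₁ : Fin 4 → Fin 4 → ℝ)
    (θ₂ : Fin 4 → Fin 4 → Fin 4 → ℝ) (θ₃ : Fin 4 → Fin 4 → Fin 4 → Fin 4 → ℝ)
    (φ : ℝ) (φ₁ : Fin 4 → ℝ) (φ₂ : Fin 4 → Fin 4 → ℝ)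
    (P P' : Fin 4 → Fin 4 → ℝ) (P₁ DP' P₁' : Fin 4 → Fin 4 → Fin 4 → ℝ)
    (P₂ DDP' DP₁' P₂' : Fin 4 → Fin 4 → Fin 4 → Fin 4 → ℝ) : Prop where
  p : ∀ a b, P' a b = P a b - θ₁ a b + θ a * θ b + φ * g a b
  dp : ∀ a b c, DP' a b c = P₁ a b c - θ₂ a b c + (θ₁ a b * θ c + θ b * θ₁ a c) + φ₁ a * g b c
  ddp : ∀ a b c d, DDP' a b c d = P₂ a b c d - θ₃ a b c d
    + (θ₂ a b c * θ d + θ₁ b c * θ₁ a d + θ₁ a c * θ₁ b d + θ c * θ₂ a b d) + φ₂ a b * g c d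
  p₁ : ∀ a b c, P₁' a b c = DP' a b c + confAct (TRep.triv ℝ).down.down g h θ P' a b c
  dp₁ : ∀ a b c d, DP₁' a b c d = DDP' a b c d
    + (confAct (TRep.triv ℝ).down.down g h (θ₁ a) P' b c d
      + confAct (TRep.triv ℝ).down.down g h θ (DP' a) b c d)
  p₂ : ∀ a b c d, P₂' a b c d = DP₁' a b c d
    + confAct (TRep.triv ℝ).down.down.down g h θ P₁' a b c d

/-- The fourth order expression in the derivatives of a section and of the Schouten tensor. -/
def quarticJet (P : Fin 4 → Fin 4 → ℝ) (P₁ : Fin 4 → Fin 4 → Fin 4 → ℝ)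
    (P₂ : Fin 4 → Fin 4 → Fin 4 → Fin 4 → ℝ) (Y : V) (Y₁ : Fin 4 → V) (Y₂ : Fin 4 → Fin 4 → V)
    (Y₄ : VArr4 V) : VArr4 V := fun a b c d =>
  Y₄ a b c d + (10 : ℝ) • P a b • Y₂ c d + (10 : ℝ) • P₁ a b c • Y₁ d
    + (3 : ℝ) • P₂ a b c d • Y + (9 : ℝ) • (P a b * P c d) • Y

variable {θ : Fin 4 → ℝ} {θ₁ : Fin 4 → Fin 4 → ℝ}
    {θ₂ : Fin 4 → Fin 4 → Fin 4 → ℝ} {θ₃ : Fin 4 → Fin 4 → Fin 4 → Fin 4 → ℝ}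
    {Y : V} {Y₁ : Fin 4 → V} {Y₂ : Fin 4 → Fin 4 → V} {Y₃ : Fin 4 → Fin 4 → Fin 4 → V}
    {Y₄ : VArr4 V} {T₁ : Fin 4 → V} {DT₁ T₂ : Fin 4 → Fin 4 → V}
    {DDT₁ DT₂ T₃ : Fin 4 → Fin 4 → Fin 4 → V} {DDDT₁ DDT₂ DT₃ T₄ : VArr4 V}
    {φ : ℝ} {φ₁ : Fin 4 → ℝ} {φ₂ : Fin 4 → Fin 4 → ℝ}
    {P P' : Fin 4 → Fin 4 → ℝ} {P₁ DP' P₁' : Fin 4 → Fin 4 → Fin 4 → ℝ}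
    {P₂ DDP' DP₁' P₂' : Fin 4 → Fin 4 → Fin 4 → Fin 4 → ℝ}

/-- The conformal invariance of the fourth order expression, modulo trace terms. -/
theorem IsConfFunctional.quarticJet_eq (hΦ : IsConfFunctional r g h W Φ)
    (hT : ConfJet r g h θ θ₁ θ₂ θ₃ Y Y₁ Y₂ Y₃ Y₄ T₁ DT₁ T₂ DDT₁ DT₂ T₃ DDDT₁ DDT₂ DT₃ T₄)
    (hP : ConfJetSchouten g h θ θ₁ θ₂ θ₃ φ φ₁ φ₂ P P' P₁ DP' P₁' P₂ DDP' DP₁' P₂')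
    (wY : Y ∈ W) (wY₁ : ∀ a, Y₁ a ∈ W) (wY₂ : ∀ a b, Y₂ a b ∈ W) (wY₃ : ∀ a b c, Y₃ a b c ∈ W)
    (wT₁ : ∀ a, T₁ a ∈ W) (wDT₁ : ∀ a b, DT₁ a b ∈ W) (wDDT₁ : ∀ a b c, DDT₁ a b c ∈ W)
    (wT₂ : ∀ a b, T₂ a b ∈ W) (wDT₂ : ∀ a b c, DT₂ a b c ∈ W) (wT₃ : ∀ a b c, T₃ a b c ∈ W) :
    Φ (quarticJet P' P₁' P₂' Y T₁ T₂ T₄) = Φ (quarticJet P P₁ P₂ Y Y₁ Y₂ Y₄) := by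
  have hadd : ∀ X Z : VArr4 V,
      Φ (fun a b c d => X a b c d + Z a b c d) = Φ X + Φ Z := fun X Z => map_add Φ X Z
  have hsub : ∀ X Z : VArr4 V,
      Φ (fun a b c d => X a b c d - Z a b c d) = Φ X - Φ Z := fun X Z => map_sub Φ X Z
  have hsmul : ∀ (t : ℝ) (X : VArr4 V), Φ (fun a b c d => t • X a b c d) = t • Φ X :=
    fun t X => map_smul Φ t X
  -- the conformal difference tensor in front of the sections
  have C0 : ∀ (S : Fin 4 → Fin 4 → Fin 4 → ℝ) (Q : Fin 4 → Fin 4 → Fin 4 → Fin 4 → ℝ)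
      (R : Fin 4 → Fin 4 → Fin 4 → V), (∀ a b c, R a b c ∈ W) →
      Φ (fun a b c d => S a b c • confAct r g h (Q a b c) (R a b c) d) =
        3 * Φ (fun a b c d => (S a b c * Q a b c d) • R a b c) := fun S Q R hR => by
    rw [← hΦ.conf (fun a b c d => S a b c * Q a b c d) R hR]
    congr 1; funext a b c d
    have : (fun d => S a b c * Q a b c d) = S a b c • Q a b c := rfl
    rw [this, map_smul]; rfl
  have C1 : ∀ (S : Fin 4 → Fin 4 → ℝ) (Q : Fin 4 → Fin 4 → Fin 4 → ℝ)
      (R : Fin 4 → Fin 4 → Fin 4 → V), (∀ a b c, R a b c ∈ W) →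
      Φ (fun a b c d => S a b • confAct r.down g h (Q a b) (R a b) c d) =
        Φ (fun a b c d => (S a b * Q a b c) • R a b d) := fun S Q R hR => by
    rw [← hΦ.conf_one (fun a b c => S a b * Q a b c) R hR]
    congr 1; funext a b c d
    have : (fun c => S a b * Q a b c) = S a b • Q a b := rfl
    rw [this, map_smul]; rfl
  have C2 : ∀ (S : Fin 4 → ℝ) (Q : Fin 4 → Fin 4 → ℝ)
      (R : Fin 4 → Fin 4 → Fin 4 → V), (∀ a b c, R a b c ∈ W) →
      Φ (fun a b c d => S a • confAct r.down.down g h (Q a) (R a) b c d) =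
        - Φ (fun a b c d => (S a * Q a b) • R a c d) := fun S Q R hR => by
    rw [← hΦ.conf_two (fun a b => S a * Q a b) R hR]
    congr 1; funext a b c d
    have : (fun b => S a * Q a b) = S a • Q a := rfl
    rw [this, map_smul]; rfl
  -- reduction of `T₄` and `T₃`
  have A1 : Φ T₄ = Φ DT₃ - 3 * Φ (fun a b c d => θ a • T₃ b c d) := by
    have e : T₄ = fun a b c d => DT₃ a b c d + confAct r.down.down.down g h θ T₃ a b c d := by
      funext a b c d; exact hT.t₄ a b c d
    rw [e, hadd, hΦ.conf_three θ T₃ wT₃]; ring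
  have A2 : Φ DT₃ = Φ DDT₂ - Φ (fun a b c d => θ₁ a b • T₂ c d)
      - Φ (fun a b c d => θ a • DT₂ b c d) := by
    have e : DT₃ = fun a b c d => DDT₂ a b c d
        + (confAct r.down.down g h (θ₁ a) T₂ b c d
          + confAct r.down.down g h θ (DT₂ a) b c d) := by
      funext a b c d; exact hT.d₃ a b c d
    rw [e, hadd, hadd, hΦ.conf_two θ₁ (fun _ => T₂) fun _ => wT₂,
      hΦ.conf_two (fun _ => θ) DT₂ wDT₂, hΦ.swap₁ fun a b c d => θ a • DT₂ b c d]
    ring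
  have A3 : Φ (fun a b c d => θ a • T₃ b c d) = Φ (fun a b c d => θ a • DT₂ b c d)
      - Φ (fun a b c d => (θ a * θ b) • T₂ c d) := by
    simp only [hT.t₃, smul_add, hadd]
    rw [C2 θ (fun _ => θ) (fun _ => T₂) fun _ => wT₂]
    ring
  -- reduction of `T₂`
  have B1 : Φ DDT₂ = Φ DDDT₁ + Φ (fun a b c d => θ₂ a b c • T₁ d)
      + 2 * Φ (fun a b c d => θ₁ a b • DT₁ c d) + Φ (fun a b c d => θ a • DDT₁ b c d) := by
    have e : DDT₂ = fun a b c d => DDDT₁ a b c d + (confAct r.down g h (θ₂ a b) T₁ c d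
        + confAct r.down g h (θ₁ b) (DT₁ a) c d + confAct r.down g h (θ₁ a) (DT₁ b) c d
        + confAct r.down g h θ (DDT₁ a b) c d) := by
      funext a b c d; exact hT.dd₂ a b c d
    rw [e, hadd, hadd, hadd, hadd, hΦ.conf_one θ₂ (fun _ _ => T₁) fun _ _ => wT₁,
      hΦ.conf_one (fun _ b => θ₁ b) (fun a _ => DT₁ a) fun a _ => wDT₁ a,
      hΦ.conf_one (fun a _ => θ₁ a) (fun _ b => DT₁ b) fun _ b => wDT₁ b,
      hΦ.conf_one (fun _ _ => θ) DDT₁ wDDT₁, hΦ.perm_bcad fun a b c d => θ₁ a b • DT₁ c d,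
      hΦ.swap₂ fun a b c d => θ₁ a b • DT₁ c d, hΦ.perm_cabd fun a b c d => θ a • DDT₁ b c d]
    ring
  have B2 : ∀ S : Fin 4 → Fin 4 → ℝ, Φ (fun a b c d => S a b • T₂ c d) =
      Φ (fun a b c d => S a b • DT₁ c d) + Φ (fun a b c d => (S a b * θ c) • T₁ d) := by
    intro S
    simp only [hT.t₂, smul_add, hadd]
    rw [C1 S (fun _ _ => θ) (fun _ _ => T₁) fun _ _ => wT₁]
  have B3 : Φ (fun a b c d => θ a • DT₂ b c d) = Φ (fun a b c d => θ a • DDT₁ b c d)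
      + Φ (fun a b c d => (θ a * θ₁ b c) • T₁ d) + Φ (fun a b c d => (θ a * θ b) • DT₁ c d) := by
    simp only [hT.d₂, smul_add, hadd]
    rw [C1 (fun a _ => θ a) (fun _ b => θ₁ b) (fun _ _ => T₁) fun _ _ => wT₁,
      C1 (fun a _ => θ a) (fun _ _ => θ) (fun _ b => DT₁ b) fun _ b => wDT₁ b,
      hΦ.swap₂ fun a b c d => (θ a * θ b) • DT₁ c d]
    ring
  -- reduction of `T₁`
  have D1 : ∀ S : Fin 4 → Fin 4 → Fin 4 → ℝ, Φ (fun a b c d => S a b c • T₁ d) =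
      Φ (fun a b c d => S a b c • Y₁ d) + 3 * Φ (fun a b c d => (S a b c * θ d) • Y) := by
    intro S
    simp only [hT.t₁, smul_add, hadd]
    rw [C0 S (fun _ _ _ => θ) (fun _ _ _ => Y) fun _ _ _ => wY]
  have D2 : ∀ S : Fin 4 → Fin 4 → ℝ, Φ (fun a b c d => S a b • DT₁ c d) =
      Φ (fun a b c d => S a b • Y₂ c d) + 3 * Φ (fun a b c d => (S a b * θ₁ c d) • Y)
      + 3 * Φ (fun a b c d => (S a b * θ c) • Y₁ d) := by
    intro S
    simp only [hT.d₁, smul_add, hadd]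
    rw [C0 (fun a b _ => S a b) (fun _ _ c => θ₁ c) (fun _ _ _ => Y) fun _ _ _ => wY,
      C0 (fun a b _ => S a b) (fun _ _ _ => θ) (fun _ _ c => Y₁ c) fun _ _ c => wY₁ c,
      hΦ.swap₃ fun a b c d => (S a b * θ c) • Y₁ d]
    ring
  have D3 : Φ (fun a b c d => θ a • DDT₁ b c d) =
      Φ (fun a b c d => θ a • Y₃ b c d) + 3 * Φ (fun a b c d => (θ a * θ₂ b c d) • Y)
      + 6 * Φ (fun a b c d => (θ a * θ₁ b c) • Y₁ d)
      + 3 * Φ (fun a b c d => (θ a * θ b) • Y₂ c d) := by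
    simp only [hT.dd₁, smul_add, hadd]
    rw [C0 (fun a _ _ => θ a) (fun _ b c => θ₂ b c) (fun _ _ _ => Y) fun _ _ _ => wY,
      C0 (fun a _ _ => θ a) (fun _ _ c => θ₁ c) (fun _ b _ => Y₁ b) fun _ b _ => wY₁ b,
      C0 (fun a _ _ => θ a) (fun _ b _ => θ₁ b) (fun _ _ c => Y₁ c) fun _ _ c => wY₁ c,
      C0 (fun a _ _ => θ a) (fun _ _ _ => θ) (fun _ b c => Y₂ b c) fun _ b c => wY₂ b c,
      hΦ.perm_acdb fun a b c d => (θ a * θ₁ b c) • Y₁ d,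
      hΦ.swap₃ fun a b c d => (θ a * θ₁ b c) • Y₁ d,
      hΦ.perm_adbc fun a b c d => (θ a * θ b) • Y₂ c d]
    ring
  have D4 : Φ DDDT₁ = Φ Y₄ + 3 * Φ (fun a b c d => θ₃ a b c d • Y)
      + 9 * Φ (fun a b c d => θ₂ a b c • Y₁ d) + 9 * Φ (fun a b c d => θ₁ a b • Y₂ c d)
      + 3 * Φ (fun a b c d => θ a • Y₃ b c d) := by
    have e : DDDT₁ = fun a b c d => Y₄ a b c d + (confAct r g h (θ₃ a b c) Y d
        + confAct r g h (θ₂ b c) (Y₁ a) d + confAct r g h (θ₂ a c) (Y₁ b) d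
        + confAct r g h (θ₁ c) (Y₂ a b) d + confAct r g h (θ₂ a b) (Y₁ c) d
        + confAct r g h (θ₁ b) (Y₂ a c) d + confAct r g h (θ₁ a) (Y₂ b c) d
        + confAct r g h θ (Y₃ a b c) d) := by
      funext a b c d; exact hT.ddd₁ a b c d
    rw [e, hadd, hadd, hadd, hadd, hadd, hadd, hadd, hadd,
      hΦ.conf θ₃ (fun _ _ _ => Y) fun _ _ _ => wY,
      hΦ.conf (fun _ b c => θ₂ b c) (fun a _ _ => Y₁ a) fun a _ _ => wY₁ a,
      hΦ.conf (fun a _ c => θ₂ a c) (fun _ b _ => Y₁ b) fun _ b _ => wY₁ b,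
      hΦ.conf (fun _ _ c => θ₁ c) (fun a b _ => Y₂ a b) fun a b _ => wY₂ a b,
      hΦ.conf (fun a b _ => θ₂ a b) (fun _ _ c => Y₁ c) fun _ _ c => wY₁ c,
      hΦ.conf (fun _ b _ => θ₁ b) (fun a _ c => Y₂ a c) fun a _ c => wY₂ a c,
      hΦ.conf (fun a _ _ => θ₁ a) (fun _ b c => Y₂ b c) fun _ b c => wY₂ b c,
      hΦ.conf (fun _ _ _ => θ) Y₃ wY₃,
      hΦ.perm_bcda fun a b c d => θ₂ a b c • Y₁ d,
      hΦ.perm_acdb fun a b c d => θ₂ a b c • Y₁ d,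
      hΦ.perm_cdab fun a b c d => θ₁ a b • Y₂ c d,
      hΦ.swap₃ fun a b c d => θ₂ a b c • Y₁ d,
      hΦ.perm_bdac fun a b c d => θ₁ a b • Y₂ c d,
      hΦ.perm_adbc fun a b c d => θ₁ a b • Y₂ c d,
      hΦ.perm_dabc fun a b c d => θ a • Y₃ b c d]
    ring
  -- the terms with the Schouten tensor
  have E1 : Φ (fun a b c d => P' a b • T₂ c d) = Φ (fun a b c d => P a b • T₂ c d)
      - Φ (fun a b c d => θ₁ a b • T₂ c d) + Φ (fun a b c d => (θ a * θ b) • T₂ c d) := by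
    have m := hΦ.metric (fun c d => φ • T₂ c d) fun c d => W.smul_mem _ (wT₂ c d)
    have e : ∀ a b c d, (φ * g a b) • T₂ c d = g a b • φ • T₂ c d := fun a b c d => by
      rw [smul_smul, mul_comm]
    simp only [hP.p, add_smul, sub_smul, hadd, hsub, e, m, add_zero]
  have E2 : Φ (fun a b c d => P₁' a b c • T₁ d) = Φ (fun a b c d => DP' a b c • T₁ d)
      - 4 * Φ (fun a b c d => (θ a * P' b c) • T₁ d) := by
    simp only [hP.p₁, add_smul, hadd]
    rw [hΦ.conf_real_two θ P' T₁ wT₁]; ring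
  have E3 : Φ (fun a b c d => DP' a b c • T₁ d) = Φ (fun a b c d => P₁ a b c • T₁ d)
      - Φ (fun a b c d => θ₂ a b c • T₁ d) + 2 * Φ (fun a b c d => (θ a * θ₁ b c) • T₁ d) := by
    have m := hΦ.metric₂₃ (fun a d => φ₁ a • T₁ d) fun c d => W.smul_mem _ (wT₁ d)
    have e : ∀ a b c d, (φ₁ a * g b c) • T₁ d = g b c • φ₁ a • T₁ d := fun a b c d => by
      rw [smul_smul, mul_comm]
    have s1 := hΦ.perm_cabd fun a b c d => (θ a * θ₁ b c) • T₁ d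
    have s2 := hΦ.swap₁ fun a b c d => (θ a * θ₁ b c) • T₁ d
    simp only [hP.dp, add_smul, sub_smul, hadd, hsub, e, m, add_zero, mul_comm (θ₁ _ _) (θ _), s1,
      s2]
    ring
  have E4 : Φ (fun a b c d => (θ a * P' b c) • T₁ d) = Φ (fun a b c d => (P a b * θ c) • T₁ d)
      - Φ (fun a b c d => (θ a * θ₁ b c) • T₁ d)
      + Φ (fun a b c d => (θ a * θ b * θ c) • T₁ d) := by
    have m := hΦ.metric₂₃ (fun a d => (θ a * φ) • T₁ d) fun c d => W.smul_mem _ (wT₁ d)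
    have e : ∀ a b c d, (θ a * (φ * g b c)) • T₁ d = g b c • (θ a * φ) • T₁ d :=
      fun a b c d => by rw [smul_smul]; congr 1; ring
    have s1 := hΦ.perm_bcad fun a b c d => (P a b * θ c) • T₁ d
    simp only [mul_comm (P _ _) (θ _)] at s1
    simp only [hP.p, mul_add, mul_sub, add_smul, sub_smul, hadd, hsub, e, m, add_zero, s1,
      mul_assoc, mul_comm (P _ _) (θ _)]
  have F1 : Φ (fun a b c d => P₂' a b c d • Y) = Φ (fun a b c d => DDP' a b c d • Y)
      - 4 * Φ (fun a b c d => (θ₁ a b * P' c d) • Y)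
      - 4 * Φ (fun a b c d => (θ a * DP' b c d) • Y)
      - 6 * Φ (fun a b c d => (θ a * P₁' b c d) • Y) := by
    simp only [hP.p₂, hP.dp₁, add_smul, hadd]
    rw [hΦ.conf_real_three θ P₁' wY, hΦ.conf_real_two' θ₁ (fun _ => P') wY,
      hΦ.conf_real_two' (fun _ => θ) DP' wY, hΦ.swap₁ fun a b c d => (θ a * DP' b c d) • Y]
    ring
  have F2 : Φ (fun a b c d => (θ a * P₁' b c d) • Y) = Φ (fun a b c d => (θ a * DP' b c d) • Y)
      - 4 * Φ (fun a b c d => (θ a * θ b * P' c d) • Y) := by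
    have e := hΦ.conf_real_two' (fun a b => θ a * θ b) (fun _ => P') wY
    have e' : ∀ a b c d, confAct (TRep.triv ℝ).down.down g h (fun b => θ a * θ b) P' b c d =
        θ a * confAct (TRep.triv ℝ).down.down g h θ P' b c d := fun a b c d => by
      have : (fun b => θ a * θ b) = θ a • θ := rfl
      rw [this, map_smul]; rfl
    simp only [e'] at e
    simp only [hP.p₁, mul_add, add_smul, hadd, e]
    ring
  have F3 : Φ (fun a b c d => DDP' a b c d • Y) = Φ (fun a b c d => P₂ a b c d • Y)
      - Φ (fun a b c d => θ₃ a b c d • Y) + 2 * Φ (fun a b c d => (θ a * θ₂ b c d) • Y)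
      + 2 * Φ (fun a b c d => (θ₁ a b * θ₁ c d) • Y) := by
    have m := hΦ.metric₃₄ (fun a b => φ₂ a b • Y) fun c d => W.smul_mem _ wY
    have e : ∀ a b c d, (φ₂ a b * g c d) • Y = g c d • φ₂ a b • Y := fun a b c d => by
      rw [smul_smul, mul_comm]
    have s1 := hΦ.perm_dabc fun a b c d => (θ a * θ₂ b c d) • Y
    have s2 := hΦ.perm_bcad fun a b c d => (θ₁ a b * θ₁ c d) • Y
    have s3 := hΦ.swap₂ fun a b c d => (θ₁ a b * θ₁ c d) • Y
    have s4 := hΦ.perm_cabd fun a b c d => (θ a * θ₂ b c d) • Y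
    simp only [hP.ddp, add_smul, sub_smul, hadd, hsub, e, m, add_zero, mul_comm (θ₂ _ _ _) (θ _),
      s1, s2, s3, s4]
    ring
  have F4 : Φ (fun a b c d => (θ₁ a b * P' c d) • Y) = Φ (fun a b c d => (P a b * θ₁ c d) • Y)
      - Φ (fun a b c d => (θ₁ a b * θ₁ c d) • Y)
      + Φ (fun a b c d => (θ a * θ b * θ₁ c d) • Y) := by
    have m := hΦ.metric₃₄ (fun a b => (θ₁ a b * φ) • Y) fun c d => W.smul_mem _ wY
    have e : ∀ a b c d, (θ₁ a b * (φ * g c d)) • Y = g c d • (θ₁ a b * φ) • Y :=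
      fun a b c d => by rw [smul_smul]; congr 1; ring
    have s1 := hΦ.perm_cdab fun a b c d => (P a b * θ₁ c d) • Y
    have s2 := hΦ.perm_cdab fun a b c d => (θ a * θ b * θ₁ c d) • Y
    rw [← s1, ← s2]
    simp only [hP.p, mul_add, mul_sub, add_smul, sub_smul, hadd, hsub, e, m, add_zero,
      mul_comm (P _ _) (θ₁ _ _), mul_comm (θ _ * θ _) (θ₁ _ _)]
  have F5 : Φ (fun a b c d => (θ a * DP' b c d) • Y) = Φ (fun a b c d => (P₁ a b c * θ d) • Y)
      - Φ (fun a b c d => (θ a * θ₂ b c d) • Y)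
      + 2 * Φ (fun a b c d => (θ a * θ b * θ₁ c d) • Y) := by
    have m := hΦ.metric₃₄ (fun a b => (θ a * φ₁ b) • Y) fun c d => W.smul_mem _ wY
    have s1 := hΦ.perm_bcda fun a b c d => (P₁ a b c * θ d) • Y
    have s2 := hΦ.perm_adbc fun a b c d => (θ a * θ b * θ₁ c d) • Y
    have s3 := hΦ.swap₂ fun a b c d => (θ a * θ b * θ₁ c d) • Y
    have e : ∀ a b c d, (θ a * DP' b c d) • Y = (P₁ b c d * θ a) • Y
        - (θ a * θ₂ b c d) • Y + (θ a * θ d * θ₁ b c) • Y + (θ a * θ c * θ₁ b d) • Y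
        + g c d • (θ a * φ₁ b) • Y := fun a b c d => by
      rw [hP.dp, smul_smul, ← sub_smul, ← add_smul, ← add_smul, ← add_smul]
      congr 1; ring
    simp only [e, hadd, hsub, m, s1, s2, s3]
    ring
  have F6 : Φ (fun a b c d => (θ a * θ b * P' c d) • Y) =
      Φ (fun a b c d => (P a b * θ c * θ d) • Y)
      - Φ (fun a b c d => (θ a * θ b * θ₁ c d) • Y)
      + Φ (fun a b c d => (θ a * θ b * θ c * θ d) • Y) := by
    have m := hΦ.metric₃₄ (fun a b => (θ a * θ b * φ) • Y) fun c d => W.smul_mem _ wY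
    have s1 := hΦ.perm_cdab fun a b c d => (P a b * θ c * θ d) • Y
    have e : ∀ a b c d, (θ a * θ b * P' c d) • Y = (P c d * θ a * θ b) • Y
        - (θ a * θ b * θ₁ c d) • Y + (θ a * θ b * θ c * θ d) • Y
        + g c d • (θ a * θ b * φ) • Y := fun a b c d => by
      rw [hP.p, smul_smul, ← sub_smul, ← add_smul, ← add_smul]
      congr 1; ring
    simp only [e, hadd, hsub, m, s1]
    ring
  have F7 : Φ (fun a b c d => (P' a b * P' c d) • Y) = Φ (fun a b c d => (P a b * P c d) • Y)
      - 2 * Φ (fun a b c d => (P a b * θ₁ c d) • Y)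
      + 2 * Φ (fun a b c d => (P a b * θ c * θ d) • Y)
      + Φ (fun a b c d => (θ₁ a b * θ₁ c d) • Y)
      - 2 * Φ (fun a b c d => (θ a * θ b * θ₁ c d) • Y)
      + Φ (fun a b c d => (θ a * θ b * θ c * θ d) • Y) := by
    have m := hΦ.metric₃₄ (fun a b => (P' a b * φ) • Y) fun c d => W.smul_mem _ wY
    have m2 := hΦ.metric (fun c d => (φ * (P c d - θ₁ c d + θ c * θ d)) • Y)
      fun c d => W.smul_mem _ wY
    have s1 := hΦ.perm_cdab fun a b c d => (P a b * θ₁ c d) • Y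
    have s2 := hΦ.perm_cdab fun a b c d => (P a b * θ c * θ d) • Y
    have s3 := hΦ.perm_cdab fun a b c d => (θ a * θ b * θ₁ c d) • Y
    have e : ∀ a b c d, (P' a b * P' c d) • Y = (P a b * P c d) • Y
        - (P a b * θ₁ c d) • Y + (P a b * θ c * θ d) • Y - (P c d * θ₁ a b) • Y
        + (θ₁ a b * θ₁ c d) • Y - (θ c * θ d * θ₁ a b) • Y + (P c d * θ a * θ b) • Y
        - (θ a * θ b * θ₁ c d) • Y + (θ a * θ b * θ c * θ d) • Y
        + g a b • (φ * (P c d - θ₁ c d + θ c * θ d)) • Y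
        + g c d • (P' a b * φ) • Y := fun a b c d => by
      rw [smul_smul, smul_smul, ← sub_smul, ← add_smul, ← sub_smul, ← add_smul, ← sub_smul,
        ← add_smul, ← sub_smul, ← add_smul, ← add_smul, ← add_smul, hP.p c d]
      congr 1
      rw [hP.p a b]; ring
    simp only [e, hadd, hsub, m, m2, s1, s2, s3]
    ring
  have sm : ∀ (t : ℝ) (z : 𝕜), t • z = (t : 𝕜) * z := fun t z => RCLike.real_smul_eq_coe_mul t z
  have L : Φ (quarticJet P' P₁' P₂' Y T₁ T₂ T₄) = Φ T₄
      + 10 * Φ (fun a b c d => P' a b • T₂ c d) + 10 * Φ (fun a b c d => P₁' a b c • T₁ d)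
      + 3 * Φ (fun a b c d => P₂' a b c d • Y)
      + 9 * Φ (fun a b c d => (P' a b * P' c d) • Y) := by
    unfold quarticJet
    simp only [hadd, hsmul, sm]
    push_cast; rfl
  have R : Φ (quarticJet P P₁ P₂ Y Y₁ Y₂ Y₄) = Φ Y₄
      + 10 * Φ (fun a b c d => P a b • Y₂ c d) + 10 * Φ (fun a b c d => P₁ a b c • Y₁ d)
      + 3 * Φ (fun a b c d => P₂ a b c d • Y)
      + 9 * Φ (fun a b c d => (P a b * P c d) • Y) := by
    unfold quarticJet
    simp only [hadd, hsmul, sm]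
    push_cast; rfl
  -- Products that agree up to a permutation of the indices are brought to one normal form.
  have x1 : Φ (fun a b c d => (θ₁ a b * θ c) • T₁ d) =
      Φ (fun a b c d => (θ a * θ₁ b c) • T₁ d) := by
    rw [← hΦ.perm_cabd fun a b c d => (θ a * θ₁ b c) • T₁ d]
    simp only [mul_comm]
  have x2 : Φ (fun a b c d => (θ₁ a b * θ c) • Y₁ d) =
      Φ (fun a b c d => (θ a * θ₁ b c) • Y₁ d) := by
    rw [← hΦ.perm_cabd fun a b c d => (θ a * θ₁ b c) • Y₁ d]
    simp only [mul_comm]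
  have x3 : Φ (fun a b c d => (θ₂ a b c * θ d) • Y) =
      Φ (fun a b c d => (θ a * θ₂ b c d) • Y) := by
    rw [← hΦ.perm_dabc fun a b c d => (θ a * θ₂ b c d) • Y]
    simp only [mul_comm]
  have x4 : Φ (fun a b c d => (θ a * θ₁ b c * θ d) • Y) =
      Φ (fun a b c d => (θ a * θ b * θ₁ c d) • Y) := by
    rw [← hΦ.perm_adbc fun a b c d => (θ a * θ b * θ₁ c d) • Y]
    congr 1; funext a b c d; congr 1; ring
  have b1 := B2 θ₁
  have b2 := B2 fun a b => θ a * θ b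
  have b3 := B2 P
  have d1 := D1 θ₂
  have d2 := D1 fun a b c => θ a * θ₁ b c
  have d3 := D1 fun a b c => θ a * θ b * θ c
  have d4 := D1 P₁
  have d5 := D1 fun a b c => P a b * θ c
  have d6 := D2 θ₁
  have d7 := D2 fun a b => θ a * θ b
  have d8 := D2 P
  -- Both sides are now linear combinations of values of `Φ` on monomials in `P`, `θ` and their
  -- derivatives, times derivatives of `Y`. Treated as unknowns, these values cancel as in the
  -- one-dimensional computation with weights 3, 1, -1, -3; this is where the coefficients 10, 10, 3
  -- and 9 are used.
  rw [L, R]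
  simp only [A1, A2, A3, B1, b1, b2, b3, B3, d1, d2, d3, d4, d5, d6, d7, d8, D3, D4, E1, E2, E3,
    E4, F1, F2, F3, F4, F5, F6, F7, x1, x2, x3, x4]
  ring

end Identity

end

/-! ### The pairing with a Weyl tensor as a conformal functional -/

section MixedRep

variable {𝕜 : Type*} [RCLike 𝕜]

variable (𝕜) in
/-- The representation on arrays `Y^{ef}_{bd}`. -/
def mixedRep : TRep (Arr4 𝕜) := (TRep.triv 𝕜).down.down.up.up

theorem mixedRep_ρ (A : Mat) (Y : Arr4 𝕜) : (mixedRep 𝕜).ρ A Y = derMixed (castMat 𝕜 A) Y := by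
  ext e f b d
  simp only [mixedRep, TRep.up_ρ, TRep.down_ρ, derMixed, upSlice, Pi.add_apply,
    Matrix.add_apply, Matrix.mul_apply, Matrix.of_apply, Matrix.transpose_apply, castMat_apply,
    Finset.sum_apply, Pi.smul_apply, Pi.sub_apply, RCLike.real_smul_eq_coe_mul]
  rw [TRep.triv_ρ]
  simp only [mul_comm (Y e _ b d)]
  ring

variable (𝕜) in
/-- The arrays `Y^{ef}_{bd}` that become Weyl tensors when the upper indices are lowered. -/
def mixedSub (g : Mat) : Submodule ℝ (Arr4 𝕜) where
  carrier := {Y | IsWeyl4 (castMat 𝕜 g⁻¹) (lowerWith (castMat 𝕜 g) (castMat 𝕜 g) Y)}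
  add_mem' hY hY' := by
    simp only [Set.mem_ofPred_eq, lowerWith_add] at *
    exact hY.add hY'
  zero_mem' := by
    have : lowerWith (castMat 𝕜 g) (castMat 𝕜 g) (0 : Arr4 𝕜) = 0 := by
      ext; simp [lowerWith_apply]
    simp only [Set.mem_ofPred_eq, this]
    exact isWeyl4_zero
  smul_mem' t Y hY := by
    have e : t • Y = (t : 𝕜) • Y := by ext; simp [RCLike.real_smul_eq_coe_mul]
    simp only [Set.mem_ofPred_eq, e, lowerWith_smul] at *
    exact hY.smul _

theorem mem_mixedSub {g : Mat} {Y : Arr4 𝕜} : Y ∈ mixedSub 𝕜 g ↔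
    IsWeyl4 (castMat 𝕜 g⁻¹) (lowerWith (castMat 𝕜 g) (castMat 𝕜 g) Y) := Iff.rfl

theorem castMat_symm {g : Mat} (hg : g.transpose = g) :
    (castMat 𝕜 g).transpose = castMat 𝕜 g := by
  rw [castMat_transpose, hg]

theorem isWeylMixed_of_mem {g : Mat} (hg : g.transpose = g) (hd : g.det ≠ 0) {Y : Arr4 𝕜}
    (hY : Y ∈ mixedSub 𝕜 g) : IsWeylMixed g Y :=
  exists_lowerMid (castMat_symm hg) (castMat_inv_mul hd) hY

/-- The difference tensor takes values in the conformal Lie algebra, which makes its action preserve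
Weyl tensors: the two connections share the parallel family `mixedSub`. -/
theorem confMat_conformal {g : Mat} (hg : g.transpose = g) (hd : g.det ≠ 0) (θ : Fin 4 → ℝ)
    (x : Fin 4) : (confMat g g⁻¹ θ x).transpose * g + g * confMat g g⁻¹ θ x = (2 * θ x) • g := by
  have gs : ∀ i j, g i j = g j i := fun i j => congrFun (congrFun hg j) i
  have hi : ∀ k, ∑ m, g k m * ∑ p, g⁻¹ m p * θ p = θ k := fun k => by
    have e : g.mulVec (g⁻¹.mulVec θ) = θ := by
      rw [Matrix.mulVec_mulVec, Matrix.mul_nonsing_inv _ (Ne.isUnit hd), Matrix.one_mulVec]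
    exact congrFun e k
  have e : ∀ i j, (g * confMat g g⁻¹ θ x) i j = g i x * θ j + g i j * θ x - g x j * θ i := by
    intro i j
    simp only [Matrix.mul_apply, confMat, Matrix.of_apply, mul_sub, mul_add,
      Finset.sum_sub_distrib, Finset.sum_add_distrib]
    congr 1
    · simp
    · rw [← hi i, Finset.mul_sum]
      exact Finset.sum_congr rfl fun m _ => by ring
  have e' : (confMat g g⁻¹ θ x).transpose * g = (g * confMat g g⁻¹ θ x).transpose := by
    rw [Matrix.transpose_mul, hg]
  ext i j
  rw [e', Matrix.add_apply, Matrix.transpose_apply, e, e, Matrix.smul_apply, gs j x, gs i x, gs j i]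
  simp only [smul_eq_mul]
  ring

theorem confAct_mem {g : Mat} (hg : g.transpose = g) (hd : g.det ≠ 0) (θ : Fin 4 → ℝ) {Y : Arr4 𝕜}
    (hY : Y ∈ mixedSub 𝕜 g) (x : Fin 4) : confAct (mixedRep 𝕜) g g⁻¹ θ Y x ∈ mixedSub 𝕜 g := by
  rw [confAct_apply, mixedRep_ρ, mem_mixedSub]
  refine isWeyl4_derMixed (t := ((2 * θ x : ℝ) : 𝕜)) (castMat_inv_mul hd) ?_ hY
  have := congrArg (castMat 𝕜) (confMat_conformal hg hd θ x)
  rw [castMat_transpose, ← castMat_mul, ← castMat_mul]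
  ext i j
  have := congrFun (congrFun this i) j
  simp only [castMat_apply, Matrix.add_apply, Matrix.smul_apply, smul_eq_mul] at this ⊢
  exact_mod_cast this

theorem tfSymmPart_comp (g : Mat) (Q : (Fin 4 → Fin 4) → 𝕜) (π : Equiv.Perm (Fin 4)) :
    tfSymmPart g (fun I => Q (I ∘ π)) = tfSymmPart g Q := by
  have h : symmPart (fun I => Q (I ∘ π)) = symmPart Q := by
    ext I
    unfold symmPart
    congr 1
    exact Equiv.sum_comp (Equiv.mulRight π) fun σ => Q (I ∘ σ)
  unfold tfSymmPart
  rw [h]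

theorem weylContr_comp (g : Mat) (X : (Fin 4 → Fin 4) → Arr4 𝕜) (π : Equiv.Perm (Fin 4)) :
    weylContr g (fun I => X (I ∘ π)) = weylContr g X := by
  have h : tfContr g (fun I => X (I ∘ π)) = tfContr g X := by
    ext a c b d
    exact Finset.sum_congr rfl fun e _ => Finset.sum_congr rfl fun f _ =>
      congrFun (tfSymmPart_comp g (fun I => X I e f b d) π) _
  unfold weylContr
  rw [h]

theorem tfContr_add (g : Mat) (X X' : (Fin 4 → Fin 4) → Arr4 𝕜) :
    tfContr g (X + X') = tfContr g X + tfContr g X' := by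
  ext a c b d
  simp only [tfContr_eq_sum, Pi.add_apply, mul_add, Finset.sum_add_distrib]

theorem tfContr_smul (g : Mat) (t : 𝕜) (X : (Fin 4 → Fin 4) → Arr4 𝕜) :
    tfContr g (t • X) = t • tfContr g X := by
  ext a c b d
  simp only [tfContr_eq_sum, Pi.smul_apply, smul_eq_mul, Finset.mul_sum]
  exact Finset.sum_congr rfl fun _ _ => Finset.sum_congr rfl fun _ _ =>
    Finset.sum_congr rfl fun _ _ => by ring

/-- The array with four indices as a function of a multi-index. -/
def uncurry₄ {V : Type*} (X : VArr4 V) (I : Fin 4 → Fin 4) : V := X (I 0) (I 1) (I 2) (I 3)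

/-- The pairing of `weylContr` with an array. -/
def weylPairing (g : Mat) (N : Arr4 𝕜) : VArr4 (Arr4 𝕜) →ₗ[ℝ] 𝕜 where
  toFun X := ∑ a, ∑ b, ∑ c, ∑ d, weylContr g (uncurry₄ X) a b c d * N a b c d
  map_add' X X' := by
    have e : uncurry₄ (X + X') = uncurry₄ X + uncurry₄ X' := rfl
    simp only [e, weylContr, tfContr_add, Pi.add_apply, ← Finset.sum_add_distrib]
    exact Finset.sum_congr rfl fun _ _ => Finset.sum_congr rfl fun _ _ =>
      Finset.sum_congr rfl fun _ _ => Finset.sum_congr rfl fun _ _ => by ring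
  map_smul' t X := by
    have e : uncurry₄ (t • X) = (t : 𝕜) • uncurry₄ X := by
      ext; simp [uncurry₄, RCLike.real_smul_eq_coe_mul]
    simp only [e, weylContr, tfContr_smul, Pi.smul_apply, RCLike.real_smul_eq_coe_mul,
      Finset.mul_sum, smul_eq_mul, RingHom.id_apply]
    exact Finset.sum_congr rfl fun _ _ => Finset.sum_congr rfl fun _ _ =>
      Finset.sum_congr rfl fun _ _ => Finset.sum_congr rfl fun _ _ => by ring

theorem weylPairing_swap (g : Mat) (N : Arr4 𝕜) {X X' : VArr4 (Arr4 𝕜)} (π : Equiv.Perm (Fin 4))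
    (h : uncurry₄ X' = fun I => uncurry₄ X (I ∘ π)) : weylPairing g N X' = weylPairing g N X := by
  simp only [weylPairing, LinearMap.coe_mk, AddHom.coe_mk, h, weylContr_comp]

/-- In the third slot `symContr` only passes on the second upper index of the array, so a vanishing
contraction with this index carries over. -/
theorem sum_symContr_eq_zero (g h : M4 𝕜) {X : Fin 4 → Arr4 𝕜}
    (h0 : ∀ e b d, ∑ x, X x e x b d = 0) (N : Arr4 𝕜) (e a f : Fin 4) :
    ∑ x, symContr g h (X x) N e a x f = 0 := by
  have z : ∀ e a, ∑ x, contrBD (X x) N e a x f = 0 := fun e a => by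
    unfold contrBD
    rw [Finset.sum_comm]
    refine Finset.sum_eq_zero fun b _ => ?_
    rw [Finset.sum_comm]
    refine Finset.sum_eq_zero fun d _ => ?_
    rw [← Finset.sum_mul, h0, zero_mul]
  have z' : ∑ x, ∑ p, ∑ q, g p q * contrBD (X x) N p q x f = 0 := by
    rw [Finset.sum_comm]
    refine Finset.sum_eq_zero fun p _ => ?_
    rw [Finset.sum_comm]
    refine Finset.sum_eq_zero fun q _ => ?_
    rw [← Finset.mul_sum, z, mul_zero]
  simp only [symContr, Finset.sum_sub_distrib, Finset.sum_add_distrib, z, ← Finset.mul_sum, z']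
  simp

theorem symContr_smul (g h : M4 𝕜) (t : 𝕜) (Y N : Arr4 𝕜) (e a f c : Fin 4) :
    symContr g h (t • Y) N e a f c = t * symContr g h Y N e a f c := by
  have z : ∀ e a, contrBD (t • Y) N e a f c = t * contrBD Y N e a f c := fun e a => by
    simp only [contrBD, Pi.smul_apply, smul_eq_mul, Finset.mul_sum, mul_assoc]
  have z' : ∑ p, ∑ q, g p q * contrBD (t • Y) N p q f c =
      t * ∑ p, ∑ q, g p q * contrBD Y N p q f c := by
    simp only [Finset.mul_sum, z]
    exact Finset.sum_congr rfl fun _ _ => Finset.sum_congr rfl fun _ _ => by ring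
  simp only [symContr]
  rw [z', z, z]
  ring

theorem weylPairing_eq {g : Mat} (hg : g.transpose = g) (hd : g.det ≠ 0) {N : Arr4 𝕜}
    (hN : IsWeyl4 (castMat 𝕜 g) N) {X : VArr4 (Arr4 𝕜)} (hX : ∀ a b c d, X a b c d ∈ mixedSub 𝕜 g) :
    weylPairing g N X = 2 * ∑ e, ∑ a, ∑ f, ∑ c,
      symContr (castMat 𝕜 g) (castMat 𝕜 g⁻¹) (X e a f c) N e a f c :=
  pairing_weylContr hg hd (X := uncurry₄ X) (fun _ => isWeylMixed_of_mem hg hd (hX _ _ _ _)) hN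

theorem real_smul_arr4 (t : ℝ) (Y : Arr4 𝕜) : t • Y = (t : 𝕜) • Y := by
  ext; simp [RCLike.real_smul_eq_coe_mul]

/-- The pairing of the operator with Weyl tensors is a conformal functional. -/
theorem isConfFunctional_weylPairing {g : Mat} (hg : g.transpose = g) (hd : g.det ≠ 0)
    {N : Arr4 𝕜} (hN : IsWeyl4 (castMat 𝕜 g) N) :
    IsConfFunctional (mixedRep 𝕜) g g⁻¹ (mixedSub 𝕜 g) (weylPairing g N) where
  swap₁ X := weylPairing_swap g N (Equiv.swap 0 1) rfl
  swap₂ X := weylPairing_swap g N (Equiv.swap 1 2) rfl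
  swap₃ X := weylPairing_swap g N (Equiv.swap 2 3) rfl
  metric B hB := by
    rw [weylPairing_eq hg hd hN fun a b c d => (mixedSub 𝕜 g).smul_mem _ (hB c d)]
    have e : ∀ e a f c, symContr (castMat 𝕜 g) (castMat 𝕜 g⁻¹) (g e a • B f c) N e a f c =
        castMat 𝕜 g e a * symContr (castMat 𝕜 g) (castMat 𝕜 g⁻¹) (B f c) N e a f c := by
      intro e a f c
      rw [real_smul_arr4, symContr_smul, castMat_apply]
    simp only [e]
    have s : ∀ F : Fin 4 → Fin 4 → Fin 4 → Fin 4 → 𝕜,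
        ∑ e, ∑ a, ∑ f, ∑ c, F e a f c = ∑ f, ∑ c, ∑ e, ∑ a, F e a f c := by
      intro F
      have h1 : ∀ e, ∑ a, ∑ f, ∑ c, F e a f c = ∑ f, ∑ c, ∑ a, F e a f c := fun e => by
        rw [Finset.sum_comm]
        exact Finset.sum_congr rfl fun f _ => Finset.sum_comm
      simp only [h1]
      rw [Finset.sum_comm]
      exact Finset.sum_congr rfl fun f _ => Finset.sum_comm
    rw [s]
    simp only [symContr_trace (castMat_symm hg) (castMat_inv_mul hd), Finset.sum_const_zero,
      mul_zero]
  conf Q R hR := by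
    -- The difference of the two sides. Its values are Weyl arrays again, so the formula for the
    -- pairing applies to it.
    set X : VArr4 (Arr4 𝕜) := fun a b c d =>
      confAct (mixedRep 𝕜) g g⁻¹ (Q a b c) (R a b c) d - (3 : ℝ) • (Q a b c d • R a b c) with hX
    have hXm : ∀ a b c d, X a b c d ∈ mixedSub 𝕜 g := fun a b c d =>
      (mixedSub 𝕜 g).sub_mem (confAct_mem hg hd _ (hR a b c) d)
        ((mixedSub 𝕜 g).smul_mem _ ((mixedSub 𝕜 g).smul_mem _ (hR a b c)))
    have key : weylPairing g N X = 0 := by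
      rw [weylPairing_eq hg hd hN hXm]
      have h0 : ∀ a b c e k l, ∑ x, X a b c x e x k l = 0 := by
        intro a b c e k l
        obtain ⟨U, hU, hY⟩ := isWeylMixed_of_mem hg hd (hR a b c)
        have := sum_derMixed_conf (castMat_symm hg) (castMat_inv_mul hd) hU
          (fun m => ((Q a b c m : ℝ) : 𝕜)) (fun x => castMat 𝕜 (confMat g g⁻¹ (Q a b c) x))
          (by
            intro x k m
            simp only [castMat_apply, confMat, Matrix.of_apply]
            push_cast
            congr 1
            split_ifs <;> simp) e k l
        rw [← hY] at this
        simp only [hX, Pi.sub_apply, Pi.smul_apply, confAct_apply, mixedRep_ρ,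
          Finset.sum_sub_distrib, this, RCLike.real_smul_eq_coe_mul, ← Finset.mul_sum,
          RCLike.ofReal_ofNat, sub_self]
      -- By total symmetry the index `c` of the difference tensor may be exchanged with `f`; it is
      -- then contracted with an upper index of the array, where the weight formula `h0` applies.
      have h1 : ∀ e a f, ∑ c, symContr (castMat 𝕜 g) (castMat 𝕜 g⁻¹) (X e a f c) N e a f c = 0 := by
        intro e a f
        rw [← sum_symContr_eq_zero (castMat 𝕜 g) (castMat 𝕜 g⁻¹) (h0 e a f) N e a f]
        refine Finset.sum_congr rfl fun c _ => ?_
        obtain ⟨U, hU, hY⟩ := isWeylMixed_of_mem hg hd (hXm e a f c)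
        rw [hY]
        exact ((symContr_isTotSymm (castMat_symm hg) (castMat_inv_mul hd) hU hN).swap₃ e a f c).symm
      simp only [h1, Finset.sum_const_zero, mul_zero]
    have e : X = (fun a b c d => confAct (mixedRep 𝕜) g g⁻¹ (Q a b c) (R a b c) d)
        - (3 : ℝ) • (fun a b c d => Q a b c d • R a b c) := rfl
    rw [e, map_sub, map_smul, sub_eq_zero] at key
    rw [key, RCLike.real_smul_eq_coe_mul, RCLike.ofReal_ofNat]

end MixedRep

section

attribute [local instance] Matrix.normedAddCommGroup Matrix.normedSpace

/-! ### Weyl tensors and the determinant under covariant differentiation -/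

section ParallelSub

variable {𝕜 : Type*} [RCLike 𝕜]

theorem smooth_arr4 {Z : E4 → Arr4 𝕜} {u : E4}
    (h : ∀ i j k l, ContDiffAt ℝ ∞ (fun x => Z x i j k l) u) : ContDiffAt ℝ ∞ Z u :=
  contDiffAt_pi.2 fun i => contDiffAt_pi.2 fun j => contDiffAt_pi.2 fun k =>
    contDiffAt_pi.2 fun l => h i j k l

theorem smooth_apply₄ {Z : E4 → Arr4 𝕜} {u : E4} (h : ContDiffAt ℝ ∞ Z u) (i j k l : Fin 4) :
    ContDiffAt ℝ ∞ (fun x => Z x i j k l) u :=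
  smooth_apply (smooth_apply (smooth_apply (smooth_apply h i) j) k) l

theorem pd_apply₄ {Z : E4 → Arr4 𝕜} {u : E4} (h : ContDiffAt ℝ ∞ Z u) (a i j k l : Fin 4) :
    pd a Z u i j k l = pd a (fun x => Z x i j k l) u := by
  rw [pd_apply h, pd_apply (smooth_apply h i), pd_apply (smooth_apply (smooth_apply h i) j),
    pd_apply (smooth_apply (smooth_apply (smooth_apply h i) j) k)]

theorem pd_sum_sum {T : Fin 4 → Fin 4 → E4 → 𝕜} {u : E4} (h : ∀ p q, ContDiffAt ℝ ∞ (T p q) u)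
    (a : Fin 4) : pd a (fun x => ∑ p, ∑ q, T p q x) u = ∑ p, ∑ q, pd a (T p q) u := by
  rw [pd_sum _ fun p _ => ContDiffAt.sum fun q _ => h p q]
  exact Finset.sum_congr rfl fun p _ => pd_sum _ (fun q _ => h p q) a

theorem IsCurv.pd {Z : E4 → Arr4 𝕜} {s : Set E4} (hs : IsOpen s) {u : E4} (hu : u ∈ s)
    (hZ : ContDiffAt ℝ ∞ Z u) (h : ∀ x ∈ s, IsCurv (Z x)) (a : Fin 4) :
    IsCurv (WeylOp.pd a Z u) where
  antisymm i j k l := by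
    rw [pd_apply₄ hZ, pd_apply₄ hZ, ← pd_neg]
    exact pd_congr_on hs (fun x hx => (h x hx).antisymm i j k l) hu a
  pair i j k l := by
    rw [pd_apply₄ hZ, pd_apply₄ hZ]
    exact pd_congr_on hs (fun x hx => (h x hx).pair i j k l) hu a
  bianchi i j k l := by
    have e := fun i j k l => smooth_apply₄ hZ i j k l
    rw [pd_apply₄ hZ, pd_apply₄ hZ, pd_apply₄ hZ, ← pd_add (e _ _ _ _) (e _ _ _ _),
      ← pd_add ((e _ _ _ _).add (e _ _ _ _)) (e _ _ _ _),
      pd_congr_on hs (fun x hx => (h x hx).bianchi i j k l) hu a, pd_const]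

theorem lowerWith_eq_smul (g : Mat) (Y : Arr4 𝕜) (i j k l : Fin 4) :
    lowerWith (castMat 𝕜 g) (castMat 𝕜 g) Y i j k l = ∑ p, ∑ q, (g i p * g k q) • Y p q j l := by
  rw [lowerWith_apply]
  simp only [castMat_apply, RCLike.real_smul_eq_coe_mul]
  push_cast
  rfl

theorem smooth_lowerWith {A : E4 → Mat} {Y : E4 → Arr4 𝕜} {u : E4} (hA : ContDiffAt ℝ ∞ A u)
    (hY : ContDiffAt ℝ ∞ Y u) :
    ContDiffAt ℝ ∞ (fun x => lowerWith (castMat 𝕜 (A x)) (castMat 𝕜 (A x)) (Y x)) u := by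
  refine smooth_arr4 fun i j k l => ?_
  simp only [lowerWith_eq_smul]
  exact ContDiffAt.sum fun p _ => ContDiffAt.sum fun q _ =>
    ((smooth_entry hA i p).mul (smooth_entry hA k q)).smul (smooth_apply₄ hY p q j l)

theorem pd_lowerWith {A : E4 → Mat} {Y : E4 → Arr4 𝕜} {u : E4} (hA : ContDiffAt ℝ ∞ A u)
    (hY : ContDiffAt ℝ ∞ Y u) (a : Fin 4) :
    pd a (fun x => lowerWith (castMat 𝕜 (A x)) (castMat 𝕜 (A x)) (Y x)) u =
      lowerWith (castMat 𝕜 (A u)) (castMat 𝕜 (A u)) (pd a Y u)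
        + lowerWith (castMat 𝕜 (pd a A u)) (castMat 𝕜 (A u)) (Y u)
        + lowerWith (castMat 𝕜 (A u)) (castMat 𝕜 (pd a A u)) (Y u) := by
  have hg := fun i j => smooth_entry hA i j
  ext i j k l
  rw [pd_apply₄ (smooth_lowerWith hA hY)]
  simp only [lowerWith_eq_smul]
  rw [pd_sum_sum (T := fun p q x => (A x i p * A x k q) • Y x p q j l) fun p q =>
    ((hg i p).mul (hg k q)).smul (smooth_apply₄ hY p q j l)]
  have : ∀ p q, pd a (fun x => (A x i p * A x k q) • Y x p q j l) u =
      (A u i p * A u k q) • pd a Y u p q j l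
        + (pd a A u i p * A u k q + A u i p * pd a A u k q) • Y u p q j l := fun p q => by
    rw [pd_smul ((hg i p).mul (hg k q)) (smooth_apply₄ hY p q j l), pd_mul (hg i p) (hg k q),
      ← pd_entry hA, ← pd_entry hA, pd_apply₄ hY]
  simp only [this]
  simp only [Pi.add_apply, lowerWith_apply, castMat_apply, ← Finset.sum_add_distrib,
    RCLike.real_smul_eq_coe_mul]
  refine Finset.sum_congr rfl fun p _ => Finset.sum_congr rfl fun q _ => ?_
  push_cast
  ring

variable {G : E4 → Mat} {s : Set E4} (hG : IsMetricOn G s)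
include hG

/-- The covariant derivative commutes with the lowering of indices. -/
theorem lowerWith_cov {Y : E4 → Arr4 𝕜} {u : E4} (hu : u ∈ s) (hY : ContDiffAt ℝ ∞ Y u)
    (a : Fin 4) :
    lowerWith (castMat 𝕜 (G u)) (castMat 𝕜 (G u)) (cov (mixedRep 𝕜) (conn G) Y u a) =
      pd a (fun x => lowerWith (castMat 𝕜 (G x)) (castMat 𝕜 (G x)) (Y x)) u
        + derDown (castMat 𝕜 (conn G u a))
          (lowerWith (castMat 𝕜 (G u)) (castMat 𝕜 (G u)) (Y u)) := by
  have e0 : (castMat 𝕜 (conn G u a)).transpose * castMat 𝕜 (G u)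
      + castMat 𝕜 (G u) * castMat 𝕜 (conn G u a) = castMat 𝕜 (pd a G u) := by
    rw [hG.pd_metric hu, castMat_transpose, ← castMat_mul, ← castMat_mul]
    ext i j; simp [castMat_apply]
  rw [cov, mixedRep_ρ, lowerWith_add, lowerWith_derMixed, e0, pd_lowerWith (hG.smooth u hu) hY]
  abel

/-- Once the upper indices are lowered, which commutes with `∇`, the curvature symmetries are linear
with constant coefficients and survive differentiation. For the trace, the trace identity is
differentiated: the derivative of the inverse metric cancels the term from `trace_derDown`. -/
theorem isParSub_mixedSub : IsParSub (conn G) s (mixedRep 𝕜) (fun x => mixedSub 𝕜 (G x)) := by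
  intro Y hY hW u hu a
  rw [mem_mixedSub, lowerWith_cov hG hu (hY u hu)]
  set Z : E4 → Arr4 𝕜 := fun x => lowerWith (castMat 𝕜 (G x)) (castMat 𝕜 (G x)) (Y x) with hZdef
  have hZ : ContDiffAt ℝ ∞ Z u := smooth_lowerWith (hG.smooth u hu) (hY u hu)
  have hWZ : ∀ x ∈ s, IsWeyl4 (castMat 𝕜 (G x)⁻¹) (Z x) := hW
  refine ⟨(IsCurv.pd hG.isOpen hu hZ (fun x hx => (hWZ x hx).toIsCurv) a).add
    ((hWZ u hu).toIsCurv.derDown _), fun j l => ?_⟩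
  have hh := fun i k => smooth_entry (hG.smooth_inv hu) i k
  have e1 : pd a (fun x => ∑ i, ∑ k, (G x)⁻¹ i k • Z x i j k l) u = 0 := by
    rw [pd_congr_on hG.isOpen (fun x hx => ?_) hu, pd_const (0 : 𝕜)]
    have := (hWZ x hx).trace j l
    simpa only [castMat_apply, RCLike.real_smul_eq_coe_mul] using this
  rw [pd_sum_sum (T := fun i k x => (G x)⁻¹ i k • Z x i j k l) fun i k =>
    (hh i k).smul (smooth_apply₄ hZ i j k l)] at e1
  have e2 : ∀ i k, pd a (fun x => (G x)⁻¹ i k • Z x i j k l) u =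
      (G u)⁻¹ i k • pd a Z u i j k l + pd a (fun x => (G x)⁻¹) u i k • Z u i j k l := fun i k => by
    rw [pd_smul (hh i k) (smooth_apply₄ hZ i j k l), pd_apply₄ hZ, ← pd_entry (hG.smooth_inv hu)]
  simp only [e2, hG.pd_inv hu, Finset.sum_add_distrib, Matrix.neg_apply, neg_smul,
    Finset.sum_neg_distrib] at e1
  have e3 := trace_derDown (hWZ u hu).trace (castMat 𝕜 (conn G u a)) j l
  rw [castMat_transpose, ← castMat_mul, ← castMat_mul] at e3
  change ∑ i, ∑ k, castMat 𝕜 (G u)⁻¹ i k *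
    (pd a Z u + derDown (castMat 𝕜 (conn G u a)) (Z u)) i j k l = 0
  simp only [Pi.add_apply, mul_add, Finset.sum_add_distrib]
  rw [e3]
  simp only [castMat_apply, Matrix.add_apply]
  simp only [RCLike.real_smul_eq_coe_mul, Matrix.add_apply] at e1
  push_cast at e1
  linear_combination e1

open Polynomial in
/-- Jacobi's formula for the derivative of the determinant. -/
theorem pd_det {u : E4} (hu : u ∈ s) (a : Fin 4) :
    pd a (fun x => (G x).det) u = 2 * (conn G u a).trace * (G u).det := by
  have hdet : ContDiff ℝ ∞ (fun A : Mat => A.det) := by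
    simp only [Matrix.det_apply']
    exact ContDiff.sum fun σ _ => contDiff_const.mul
      (contDiff_prod fun i _ => contDiff_apply_apply ℝ ℝ (σ i) i)
  have hd := (hdet.differentiable (by simp)) (G u)
  -- The differential of the determinant in the direction `G B` is computed along the line `G (1 + t
  -- B)`, from the linear coefficient of the polynomial `det (1 + X B)`.
  have hline : ∀ B : Mat, fderiv ℝ (fun A : Mat => A.det) (G u) (G u * B) =
      (G u).det * B.trace := by
    intro B
    have h1 : HasDerivAt (fun t : ℝ => G u + t • (G u * B)) (G u * B) 0 := by
      have := ((hasDerivAt_id (0 : ℝ)).smul_const (G u * B)).const_add (G u)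
      rw [one_smul] at this
      exact this
    have hd' : HasFDerivAt (fun A : Mat => A.det) (fderiv ℝ (fun A : Mat => A.det) (G u))
        (G u + (0 : ℝ) • (G u * B)) := by
      rw [zero_smul, add_zero]
      exact hd.hasFDerivAt
    have h2 := hd'.comp_hasDerivAt (0 : ℝ) h1
    have h3 : (fun t : ℝ => (G u + t • (G u * B)).det) = fun t : ℝ =>
        (G u).det * ((1 + (X : ℝ[X]) • B.map C).det).eval t := by
      funext t
      have e : G u + t • (G u * B) = G u * (1 + t • B) := by
        rw [mul_add, mul_one, Matrix.mul_smul]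
      rw [e, Matrix.det_mul, ← coe_evalRingHom, RingHom.map_det]
      congr 2
      ext i j
      by_cases hij : i = j <;> simp [hij, mul_comm t]
    have h4 := (((1 + (X : ℝ[X]) • B.map C).det).hasDerivAt (0 : ℝ)).const_mul (G u).det
    rw [Matrix.derivative_det_one_add_X_smul] at h4
    exact (h3 ▸ h2 : HasDerivAt (fun t : ℝ => (G u).det * _) _ _).unique h4
  have hc : pd a (fun x => (G x).det) u = fderiv ℝ (fun A : Mat => A.det) (G u) (pd a G u) := by
    have := fderiv_comp u hd (differentiableAt_of_smooth (hG.smooth u hu))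
    simp only [Function.comp_def] at this
    unfold pd
    rw [this]
    rfl
  -- Metric compatibility puts the derivative in the form `G B`, where the two summands of `B` both
  -- have the trace of the connection matrix.
  have e : pd a G u = G u * ((G u)⁻¹ * (conn G u a).transpose * G u + conn G u a) := by
    rw [hG.pd_metric hu, mul_add, ← mul_assoc, ← mul_assoc, hG.mul_inv hu, one_mul]
  rw [hc, e, hline, Matrix.trace_add, mul_assoc, Matrix.trace_mul_comm, mul_assoc, hG.mul_inv hu,
    mul_one, Matrix.trace_transpose]
  ring

end ParallelSub

end

section

attribute [local instance] Matrix.normedAddCommGroup Matrix.normedSpace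

/-! ### The Hodge star: reversal of duality and parallelism -/

section Duality

variable {𝕜 : Type*} [RCLike 𝕜]

/-- The Hodge star on two-forms with lower indices. -/
def hodge (g : Mat) : M4 𝕜 →ₗ[𝕜] M4 𝕜 :=
  ((Real.sqrt |g.det| : ℝ) : 𝕜) • (dualMat ∘ₗ conjMap (castMat 𝕜 g⁻¹))

theorem hodge_apply (g : Mat) (F : M4 𝕜) : hodge g F = ((Real.sqrt |g.det| : ℝ) : 𝕜) •
    dualMat (castMat 𝕜 g⁻¹ * F * (castMat 𝕜 g⁻¹).transpose) := rfl

/-- The two-form in the last two indices. -/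
def lastSlice (Z : Arr4 𝕜) (a b : Fin 4) : M4 𝕜 := Matrix.of fun p q => Z a b p q

/-- A trace-free symmetric endomorphism of two-forms reverses duality. -/
theorem hodge_reverse {g : Mat} (hg : g.transpose = g) {S F : M4 𝕜}
    (hS : S.transpose = S) (ht : (castMat 𝕜 g⁻¹ * S).trace = 0) (hF : F.transpose = -F) {c : 𝕜}
    (hc : hodge g F = c • F) :
    hodge g (S * castMat 𝕜 g⁻¹ * F + F * castMat 𝕜 g⁻¹ * S) =
      -(c • (S * castMat 𝕜 g⁻¹ * F + F * castMat 𝕜 g⁻¹ * S)) := by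
  set h := castMat 𝕜 g⁻¹ with hh
  have hs : h.transpose = h := by rw [hh, castMat_transpose, Matrix.transpose_nonsing_inv, hg]
  -- The matrix `h * S` is trace-free, so its action on two-vectors corresponds under the dual to
  -- minus its transpose on two-forms. As `S` is symmetric, the transpose gives the same action with
  -- indices lowered, which accounts for the sign.
  have hd := dualMat_der (conjMap_antisymm hF h) (h * S)
  rw [ht, zero_smul, Matrix.transpose_mul, hs, hS, conjMap_apply, hs] at hd
  have e : h * S * (h * F * h) + h * F * h * (S * h) =
      h * (S * h * F + F * h * S) * h := by
    simp only [mul_add, add_mul, mul_assoc]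
  rw [e, add_eq_zero_iff_neg_eq] at hd
  simp only [hodge_apply, ← hh, hs] at hc ⊢
  rw [← hd, neg_add, smul_add, smul_neg, smul_neg, ← neg_add, neg_inj, smul_add]
  congr 1
  · rw [← Matrix.mul_smul, hc, Matrix.mul_smul]
  · rw [← Matrix.smul_mul, hc, Matrix.smul_mul, mul_assoc]

variable (𝕜) in
/-- The arrays `Y^{ef}_{bd}` that become Weyl tensors of duality `c` when the upper indices are
lowered. -/
def dualSub (g : Mat) (c : 𝕜) : Submodule ℝ (Arr4 𝕜) where
  carrier := {Y | Y ∈ mixedSub 𝕜 g ∧ ∀ a b,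
    hodge g (lastSlice (lowerWith (castMat 𝕜 g) (castMat 𝕜 g) Y) a b) =
      c • lastSlice (lowerWith (castMat 𝕜 g) (castMat 𝕜 g) Y) a b}
  add_mem' hY hY' := by
    refine ⟨(mixedSub 𝕜 g).add_mem hY.1 hY'.1, fun a b => ?_⟩
    have e : ∀ Z Z' : Arr4 𝕜, lastSlice (Z + Z') a b = lastSlice Z a b + lastSlice Z' a b :=
      fun _ _ => rfl
    rw [lowerWith_add, e, map_add, hY.2, hY'.2, smul_add]
  zero_mem' := by
    refine ⟨(mixedSub 𝕜 g).zero_mem, fun a b => ?_⟩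
    have : lastSlice (lowerWith (castMat 𝕜 g) (castMat 𝕜 g) (0 : Arr4 𝕜)) a b = 0 := by
      ext; simp [lastSlice, lowerWith_apply]
    rw [this, map_zero, smul_zero]
  smul_mem' t Y hY := by
    refine ⟨(mixedSub 𝕜 g).smul_mem t hY.1, fun a b => ?_⟩
    have e : ∀ Z : Arr4 𝕜, lastSlice ((t : 𝕜) • Z) a b = (t : 𝕜) • lastSlice Z a b := fun _ => rfl
    rw [real_smul_arr4, lowerWith_smul, e, map_smul, hY.2, smul_comm]

theorem mem_dualSub {g : Mat} {c : 𝕜} {Y : Arr4 𝕜} : Y ∈ dualSub 𝕜 g c ↔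
    Y ∈ mixedSub 𝕜 g ∧ ∀ a b,
      hodge g (lastSlice (lowerWith (castMat 𝕜 g) (castMat 𝕜 g) Y) a b) =
        c • lastSlice (lowerWith (castMat 𝕜 g) (castMat 𝕜 g) Y) a b := Iff.rfl

/-- The operator reverses duality, on the level of arrays. -/
theorem hodge_weylContr {g : Mat} (hg : g.transpose = g) (hd : g.det ≠ 0) {c : 𝕜}
    {X : (Fin 4 → Fin 4) → Arr4 𝕜} (hX : ∀ J, X J ∈ dualSub 𝕜 g c) (a b : Fin 4) :
    hodge g (lastSlice (weylContr g X) a b) = -(c • lastSlice (weylContr g X) a b) := by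
  set h := castMat 𝕜 g⁻¹ with hh
  have hs : h.transpose = h := by rw [hh, castMat_transpose, Matrix.transpose_nonsing_inv, hg]
  have hhg : h * castMat 𝕜 g = 1 := castMat_inv_mul hd
  have hgh : castMat 𝕜 g * h = 1 := mul_eq_one_comm.1 hhg
  set Z := fun J => lowerWith (castMat 𝕜 g) (castMat 𝕜 g) (X J) with hZ
  let K : (Fin 4 → Fin 4) → (Fin 4 → Fin 4) → 𝕜 := fun J => tfSymmPart g (Pi.single J (1 : 𝕜))
  let S : (Fin 4 → Fin 4) → Fin 4 → Fin 4 → M4 𝕜 := fun J a e =>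
    Matrix.of fun c f => K J ![a, c, e, f]
  -- The section with its first index raised, as a two-form in its second index pair; this form has
  -- duality `c`.
  let F : (Fin 4 → Fin 4) → Fin 4 → Fin 4 → M4 𝕜 := fun J b e =>
    ∑ p, h e p • lastSlice (Z J) p b
  have hFa : ∀ J b e, (F J b e).transpose = - F J b e := fun J b e => by
    simp only [F, Matrix.transpose_sum, Matrix.transpose_smul, ← Finset.sum_neg_distrib]
    exact Finset.sum_congr rfl fun p _ => by
      rw [show (lastSlice (Z J) p b).transpose = _ from (hX J).1.toIsCurv.slice' p b, smul_neg]
      rfl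
  have hFc : ∀ J b e, hodge g (F J b e) = c • F J b e := fun J b e => by
    simp only [F, map_sum, map_smul, Finset.smul_sum]
    exact Finset.sum_congr rfl fun p _ => by rw [(hX J).2 p b, smul_comm]
  have hSs : ∀ J a e, (S J a e).transpose = S J a e := fun J a e => by
    ext i j
    have t := fun a b c d => tfSymmPart_symm hg (Pi.single J (1 : 𝕜)) a b c d
    change K J ![a, j, e, i] = K J ![a, i, e, j]
    change tfSymmPart g _ _ = tfSymmPart g _ _
    rw [(t a e j i).2.1, (t a e i j).2.2, (t a e i j).2.1.symm]
  have hSt : ∀ J a e, (h * S J a e).trace = 0 := fun J a e => by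
    rw [← tfSymmPart_trace hg hd (Pi.single J (1 : 𝕜)) a e]
    simp only [Matrix.trace, Matrix.diag_apply, Matrix.mul_apply]
    refine Finset.sum_congr rfl fun i _ => Finset.sum_congr rfl fun j _ => ?_
    have t := fun a b c d => tfSymmPart_symm hg (Pi.single J (1 : 𝕜)) a b c d
    change ((g⁻¹ i j : ℝ) : 𝕜) * tfSymmPart g _ ![a, j, e, i] = _
    rw [(t a e j i).2.1, ← (t a e j i).2.2, (t e a i j).1, ← (t e a i j).2.1, ← (t e i a j).1,
      (t i e j a).2.2, (t i j e a).2.1, (t i j a e).2.2]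
  have hXF : ∀ J e f b d, X J e f b d = ∑ q, h f q * F J b e q d := by
    intro J e f b d
    have e1 : upSlice (X J) b d = h * (Matrix.of fun p q => Z J p b q d) * h.transpose := by
      have : (Matrix.of fun p q => Z J p b q d : M4 𝕜) =
        castMat 𝕜 g * upSlice (X J) b d * (castMat 𝕜 g).transpose := rfl
      rw [this, castMat_symm hg, hs, ← mul_assoc, ← mul_assoc, hhg, one_mul, mul_assoc, hgh,
        mul_one]
    have e2 := congrFun (congrFun e1 e) f
    rw [show upSlice (X J) b d e f = X J e f b d from rfl] at e2
    rw [e2]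
    simp only [Matrix.mul_apply, Matrix.transpose_apply, Matrix.of_apply, F, Matrix.sum_apply,
      Matrix.smul_apply, smul_eq_mul, lastSlice]
    exact Finset.sum_congr rfl fun q _ => mul_comm _ _
  have hT : ∀ a i b j, tfContr g X a i b j = ∑ J, ∑ e, (S J a e * h * F J b e) i j := by
    intro a i b j
    rw [tfContr_eq_sum]
    refine Finset.sum_congr rfl fun J _ => Finset.sum_congr rfl fun e _ => ?_
    rw [mul_assoc, Matrix.mul_apply]
    refine Finset.sum_congr rfl fun f _ => ?_
    rw [hXF, Matrix.mul_apply]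
    rfl
  -- Antisymmetrized in the last pair, the contraction is a sum of actions of the trace-free
  -- symmetric matrices `S` on the two-forms `F`, to which `hodge_reverse` applies.
  have hP : ∀ a b, (Matrix.of fun i j => tfContr g X a i b j - tfContr g X a j b i : M4 𝕜) =
      ∑ J, ∑ e, (S J a e * h * F J b e + F J b e * h * S J a e) := by
    intro a b
    ext i j
    simp only [Matrix.of_apply, hT, Matrix.sum_apply, Matrix.add_apply, Finset.sum_add_distrib,
      sub_eq_add_neg]
    congr 1
    simp only [← Finset.sum_neg_distrib]
    refine Finset.sum_congr rfl fun J _ => Finset.sum_congr rfl fun e _ => ?_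
    have : F J b e * h * S J a e = - (S J a e * h * F J b e).transpose := by
      rw [Matrix.transpose_mul, Matrix.transpose_mul, hFa, hs, hSs, neg_mul, neg_neg, mul_assoc]
    rw [this]
    rfl
  have hR : ∀ a b, hodge g (Matrix.of fun i j => tfContr g X a i b j - tfContr g X a j b i) =
      -(c • (Matrix.of fun i j => tfContr g X a i b j - tfContr g X a j b i : M4 𝕜)) := by
    intro a b
    rw [hP]
    simp only [map_sum, Finset.smul_sum, ← Finset.sum_neg_distrib]
    exact Finset.sum_congr rfl fun J _ => Finset.sum_congr rfl fun e _ =>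
      hodge_reverse hg (hSs J a e) (hSt J a e) (hFa J b e) (hFc J b e)
  have e : lastSlice (weylContr g X) a b =
      (Matrix.of fun i j => tfContr g X a i b j - tfContr g X a j b i : M4 𝕜)
        - Matrix.of fun i j => tfContr g X b i a j - tfContr g X b j a i := by
    ext i j
    simp only [lastSlice, weylContr, Matrix.of_apply, Matrix.sub_apply]
    ring
  rw [e, map_sub, hR, hR, smul_sub]
  abel

theorem pd_dualMat {F : E4 → M4 𝕜} {u : E4} (i j a : Fin 4) :
    pd a (fun x => dualMat (F x) i j) u =
      dualMat (Matrix.of fun p q => pd a (fun x => F x p q) u) i j := by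
  simp only [dualMat_apply]
  fin_cases i <;> fin_cases j <;> first | exact pd_neg a | exact pd_const 0 a u | rfl

variable {G : E4 → Mat} {s : Set E4} (hG : IsMetricOn G s)
include hG

/-- The volume density is parallel: its logarithmic derivative is the trace of the connection. -/
theorem pd_sqrt_det {u : E4} (hu : u ∈ s) (a : Fin 4) :
    ContDiffAt ℝ ∞ (fun x => Real.sqrt |(G x).det|) u ∧
    pd a (fun x => Real.sqrt |(G x).det|) u =
      (conn G u a).trace * Real.sqrt |(G u).det| := by
  have h0 := hG.det u hu
  have hdet : ContDiffAt ℝ ∞ (fun x => (G x).det) u :=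
    smooth_det fun i j => smooth_entry (hG.smooth u hu) i j
  have hs := (hdet.abs h0).sqrt (abs_ne_zero.2 h0)
  refine ⟨hs, ?_⟩
  have h1 := ((hasDerivAt_abs h0).sqrt (abs_ne_zero.2 h0)).comp_hasFDerivAt u
    (differentiableAt_of_smooth hdet).hasFDerivAt
  have h2 : pd a (fun x => Real.sqrt |(G x).det|) u =
      (SignType.sign (G u).det : ℝ) / (2 * Real.sqrt |(G u).det|) *
        pd a (fun x => (G x).det) u := by
    unfold pd
    have := h1.fderiv
    simp only [Function.comp_def] at this
    rw [this]
    rfl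
  have h3 : Real.sqrt |(G u).det| ≠ 0 := (Real.sqrt_pos.2 (abs_pos.2 h0)).ne'
  have h4 : Real.sqrt |(G u).det| * Real.sqrt |(G u).det| = |(G u).det| :=
    Real.mul_self_sqrt (abs_nonneg _)
  have h5 : (SignType.sign (G u).det : ℝ) * (G u).det = |(G u).det| := sign_mul_self _
  rw [h2, pd_det hG hu]
  field_simp
  linear_combination (conn G u a).trace * (h5 - h4)

/-- The Hodge star is parallel. -/
theorem isParSub_dualSub (c : 𝕜) :
    IsParSub (conn G) s (mixedRep 𝕜) (fun x => dualSub 𝕜 (G x) c) := by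
  intro Y hY hW u hu a
  have hsub : ∀ x ∈ s, Y x ∈ mixedSub 𝕜 (G x) := fun x hx => (hW x hx).1
  refine ⟨isParSub_mixedSub hG Y hY hsub u hu a, fun k l => ?_⟩
  rw [lowerWith_cov hG hu (hY u hu)]
  set Z : E4 → Arr4 𝕜 := fun x => lowerWith (castMat 𝕜 (G x)) (castMat 𝕜 (G x)) (Y x) with hZdef
  have hZ : ContDiffAt ℝ ∞ Z u := smooth_lowerWith (hG.smooth u hu) (hY u hu)
  set A := castMat 𝕜 (conn G u a) with hA
  set h := castMat 𝕜 (G u)⁻¹ with hh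
  have hs : h.transpose = h := by rw [hh, castMat_transpose, hG.inv_transpose hu]
  -- The part of the covariant derivative that acts on the last pair. The duality equation is
  -- differentiated; the terms from the inverse metric and from the density are then removed by
  -- `dualMat_der`, whose trace term is that of the density.
  have key : ∀ k l, hodge (G u) (lastSlice (pd a Z u) k l - A.transpose * lastSlice (Z u) k l
        - lastSlice (Z u) k l * A) =
      c • (lastSlice (pd a Z u) k l - A.transpose * lastSlice (Z u) k l
        - lastSlice (Z u) k l * A) := by
    intro k l
    set F := lastSlice (Z u) k l with hF
    have hFa : F.transpose = - F := (hW u hu).1.toIsCurv.slice' k l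
    have hFc : hodge (G u) F = c • F := (hW u hu).2 k l
    -- The two-form is put into the first two slots, so that `pd_lowerWith` differentiates the
    -- raising of its indices. The last two slots are dummies, later evaluated at 0.
    set W : E4 → Arr4 𝕜 := fun x p q i j => Z x k l p q with hWdef
    have hWs : ContDiffAt ℝ ∞ W u := smooth_arr4 fun p q i j => smooth_apply₄ hZ k l p q
    set V : E4 → Arr4 𝕜 := fun x => lowerWith (castMat 𝕜 (G x)⁻¹) (castMat 𝕜 (G x)⁻¹) (W x)
      with hVdef
    have hV : ContDiffAt ℝ ∞ V u := smooth_lowerWith (hG.smooth_inv hu) hWs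
    have hpdW : (Matrix.of fun p q => pd a W u p q 0 0 : M4 𝕜) = lastSlice (pd a Z u) k l := by
      ext p q
      simp only [Matrix.of_apply, lastSlice]
      rw [pd_apply₄ hWs, pd_apply₄ hZ]
    have hpdh : castMat 𝕜 (pd a (fun x => (G x)⁻¹) u) = -(A * h + h * A.transpose) := by
      rw [hG.pd_inv hu, hA, hh, castMat_transpose, ← castMat_mul, ← castMat_mul]
      ext i j; simp [castMat_apply]
    set F' := h * F * h with hF'
    have hpdV : (Matrix.of fun i j => pd a (fun x => V x i 0 j 0) u : M4 𝕜) =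
        h * (lastSlice (pd a Z u) k l - A.transpose * F - F * A) * h
          - (A * F' + F' * A.transpose) := by
      have e1 : (Matrix.of fun i j => pd a (fun x => V x i 0 j 0) u : M4 𝕜) =
          h * lastSlice (pd a Z u) k l * h
            + castMat 𝕜 (pd a (fun x => (G x)⁻¹) u) * F * h
            + h * F * (castMat 𝕜 (pd a (fun x => (G x)⁻¹) u)).transpose := by
        ext i j
        have e2 := pd_lowerWith (hG.smooth_inv hu) hWs a
        have e3 := congrFun (congrFun (congrFun (congrFun e2 i) 0) j) 0
        rw [pd_apply₄ hV] at e3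
        rw [Matrix.of_apply, e3, ← hpdW]
        simp only [lowerWith, ← hh, hs, Pi.add_apply, Matrix.add_apply]
        rfl
      rw [e1, hpdh, Matrix.transpose_neg, Matrix.transpose_add, Matrix.transpose_mul,
        Matrix.transpose_mul, hs, Matrix.transpose_transpose, hF']
      simp only [mul_add, add_mul, mul_sub, sub_mul, neg_mul, mul_neg, mul_assoc]
      abel
    obtain ⟨hσ, hdσ⟩ := pd_sqrt_det hG hu a
    have hhod : ∀ x ∈ s, ∀ i j, (Real.sqrt |(G x).det|) •
        dualMat (Matrix.of fun p q => V x p 0 q 0) i j = c * Z x k l i j := by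
      intro x hx i j
      have := congrFun (congrFun ((hW x hx).2 k l) i) j
      rw [hodge_apply, Matrix.smul_apply, Matrix.smul_apply] at this
      rw [RCLike.real_smul_eq_coe_mul]
      exact this
    have hdual : ∀ i j, ContDiffAt ℝ ∞
        (fun x => dualMat (Matrix.of fun p q => V x p 0 q 0 : M4 𝕜) i j) u := by
      intro i j
      simp only [dualMat_apply]
      have hv := fun p q => smooth_apply₄ hV p 0 q 0
      fin_cases i <;> fin_cases j <;>
        first | exact hv _ _ | exact (hv _ _).neg | exact contDiffAt_const
    have e1 : c • lastSlice (pd a Z u) k l = A.trace • hodge (G u) F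
        + ((Real.sqrt |(G u).det| : ℝ) : 𝕜) •
          dualMat (Matrix.of fun i j => pd a (fun x => V x i 0 j 0) u) := by
      ext i j
      have e2 := pd_congr_on hG.isOpen (fun x hx => hhod x hx i j) hu a
      rw [pd_smul hσ (hdual i j), pd_dualMat] at e2
      have e3 : pd a (fun x => c * Z x k l i j) u = c * pd a Z u k l i j := by
        rw [pd_apply₄ hZ]
        unfold pd
        rw [fderiv_const_mul (differentiableAt_of_smooth (smooth_apply₄ hZ k l i j))]
        rfl
      rw [e3, hdσ, mul_smul, hhod u hu] at e2
      have e4 : A.trace = (((conn G u a).trace : ℝ) : 𝕜) := by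
        simp [hA, Matrix.trace, castMat_apply]
      rw [hFc, e4]
      simp only [Matrix.smul_apply, Matrix.add_apply, smul_eq_mul, RCLike.real_smul_eq_coe_mul]
        at e2 ⊢
      change c * pd a Z u k l i j = _
      rw [← e2]
      simp only [Matrix.of_apply, hF, lastSlice]
      ring
    have hd := dualMat_der (conjMap_antisymm hFa h) A
    rw [conjMap_apply, hs, ← hF'] at hd
    have e5 : hodge (G u) F = ((Real.sqrt |(G u).det| : ℝ) : 𝕜) • dualMat F' := by
      rw [hodge_apply, ← hh, hs]
    rw [hpdV, map_sub, eq_sub_of_add_eq' hd, e5] at e1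
    rw [hodge_apply, ← hh, hs, smul_sub, smul_sub, e1, ← Matrix.mul_smul, ← Matrix.smul_mul,
      ← hFc, e5, Matrix.mul_smul, Matrix.smul_mul, smul_sub, smul_sub, smul_add,
      smul_comm A.trace]
    abel
  -- The remaining connection terms act on the first pair and only combine slices that already have
  -- duality `c`.
  have hslice : lastSlice (pd a Z u + derDown A (Z u)) k l =
      (lastSlice (pd a Z u) k l - A.transpose * lastSlice (Z u) k l - lastSlice (Z u) k l * A)
        - ∑ p, A p k • lastSlice (Z u) p l - ∑ p, A p l • lastSlice (Z u) k p := by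
    ext i j
    simp only [lastSlice, derDown, Matrix.of_apply, Pi.add_apply, Matrix.sub_apply,
      Matrix.mul_apply, Matrix.transpose_apply, Matrix.sum_apply, Matrix.smul_apply, smul_eq_mul,
      mul_comm (Z u k l i _)]
    ring
  have hFc : ∀ k l, hodge (G u) (lastSlice (Z u) k l) = c • lastSlice (Z u) k l := (hW u hu).2
  change hodge (G u) (lastSlice (pd a Z u + derDown A (Z u)) k l) =
    c • lastSlice (pd a Z u + derDown A (Z u)) k l
  have key' := key k l
  rw [hslice]
  generalize lastSlice (pd a Z u) k l - A.transpose * lastSlice (Z u) k l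
    - lastSlice (Z u) k l * A = D at key' ⊢
  simp only [map_sub, map_sum, map_smul, key', hFc, smul_sub, Finset.smul_sum, smul_comm c]

end Duality

end

section

attribute [local instance] Matrix.normedAddCommGroup Matrix.normedSpace

/-! ### Components of tensors and the coordinate formula of the covariant derivative -/

section Components

variable {𝕜 : Type*} [RCLike 𝕜] {V : Type*} [NormedAddCommGroup V] [NormedSpace ℝ V] {m n : ℕ}

/-- The components `ev U L t` of the elements of a representation transform as the components of
tensors. -/
def IsTensorRep (r : TRep V) (ev : (Fin m → Fin 4) → (Fin n → Fin 4) → V →ₗ[ℝ] 𝕜) : Prop :=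
  ∀ A t U L, ev U L (r.ρ A t) =
    ∑ k, ∑ p, A (U k) p • ev (Function.update U k p) L t
      - ∑ k, ∑ p, A p (L k) • ev U (Function.update L k p) t

/-- Components with an additional lower index. -/
def evDown (ev : (Fin m → Fin 4) → (Fin n → Fin 4) → V →ₗ[ℝ] 𝕜) (U : Fin m → Fin 4)
    (L : Fin (n + 1) → Fin 4) : (Fin 4 → V) →ₗ[ℝ] 𝕜 :=
  ev U (Fin.tail L) ∘ₗ LinearMap.proj (L 0)

/-- Components with an additional upper index. -/
def evUp (ev : (Fin m → Fin 4) → (Fin n → Fin 4) → V →ₗ[ℝ] 𝕜) (U : Fin (m + 1) → Fin 4)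
    (L : Fin n → Fin 4) : (Fin 4 → V) →ₗ[ℝ] 𝕜 :=
  ev (Fin.tail U) L ∘ₗ LinearMap.proj (U 0)

variable (𝕜) in
theorem isTensorRep_triv :
    IsTensorRep (TRep.triv 𝕜) (fun (_ : Fin 0 → Fin 4) (_ : Fin 0 → Fin 4) => LinearMap.id) := by
  intro A t U L
  simp

variable {r : TRep V} {ev : (Fin m → Fin 4) → (Fin n → Fin 4) → V →ₗ[ℝ] 𝕜}

theorem IsTensorRep.down (h : IsTensorRep r ev) : IsTensorRep r.down (evDown ev) := by
  intro A F U L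
  simp only [evDown, LinearMap.comp_apply, LinearMap.proj_apply, TRep.down_ρ, map_sub, map_sum,
    map_smul, h A, Fin.sum_univ_succ (n := n), Function.update_self, Fin.tail_update_zero,
    Fin.tail_update_succ, Function.update_of_ne (Fin.succ_ne_zero _).symm]
  simp only [Fin.tail]
  abel

theorem IsTensorRep.up (h : IsTensorRep r ev) : IsTensorRep r.up (evUp ev) := by
  intro A F U L
  simp only [evUp, LinearMap.comp_apply, LinearMap.proj_apply, TRep.up_ρ, map_add, map_sum,
    map_smul, h A, Fin.sum_univ_succ (n := m), Function.update_self, Fin.tail_update_zero,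
    Fin.tail_update_succ, Function.update_of_ne (Fin.succ_ne_zero _).symm]
  simp only [Fin.tail]
  abel

/-- The covariant derivative in terms of components. -/
theorem IsTensorRep.covDeriv_eq [FiniteDimensional ℝ V] (h : IsTensorRep r ev) {G : E4 → Mat}
    {s : Set E4} (hs : IsOpen s) {T : Comps 𝕜 m n} {t : E4 → V} (ht : SmoothOn s t)
    (hT : ∀ x ∈ s, ∀ U L, T x U L = ev U L (t x)) :
    ∀ u ∈ s, ∀ U L, covDeriv G T u U L = evDown ev U L (cov r (conn G) t u) := by
  intro u hu U L
  have e : partialDeriv (L 0) (fun v => T v U (Fin.tail L)) u =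
      ev U (Fin.tail L) (pd (L 0) t u) := by
    have e1 := pd_congr_on hs (fun x hx => hT x hx U (Fin.tail L)) hu (L 0)
    refine e1.trans ?_
    have := (LinearMap.toContinuousLinearMap (ev U (Fin.tail L))).hasFDerivAt.comp u
      (differentiableAt_of_smooth (ht u hu)).hasFDerivAt
    have e2 := this.fderiv
    unfold pd
    simp only [Function.comp_def, LinearMap.coe_toContinuousLinearMap'] at e2
    rw [e2]
    rfl
  simp only [covDeriv, e, evDown, LinearMap.comp_apply, LinearMap.proj_apply, cov, map_add, h _,
    hT u hu, RCLike.real_smul_eq_coe_mul, conn, Matrix.of_apply]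
  ring

end Components

/-! ### The coordinate formula in terms of representations -/

section Formula

variable {𝕜 : Type*} [RCLike 𝕜]

/-- The components of a `(2, 2)`-tensor as an array. -/
def arrOf (y : (Fin 2 → Fin 4) → (Fin 2 → Fin 4) → 𝕜) : Arr4 𝕜 := fun e f b d => y ![e, f] ![b, d]

/-- The operator of `quarticExpr` on fields with values in a representation. -/
def quarticOf {V : Type*} [NormedAddCommGroup V] [NormedSpace ℝ V] (r : TRep V) (G : E4 → Mat)
    (y : E4 → V) (u : E4) : VArr4 V :=
  let P := schoutenField G
  let p := (TRep.triv ℝ).down.down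
  quarticJet (P u) (cov p (conn G) P u) (cov p.down (conn G) (cov p (conn G) P) u) (y u)
    (cov r (conn G) y u) (cov r.down (conn G) (cov r (conn G) y) u)
    (cov r.down.down.down (conn G) (cov r.down.down (conn G)
      (cov r.down (conn G) (cov r (conn G) y))) u)

theorem quarticExpr_eq_ev {V : Type*} [NormedAddCommGroup V] [NormedSpace ℝ V]
    [FiniteDimensional ℝ V] {r : TRep V} {ev : (Fin 2 → Fin 4) → (Fin 2 → Fin 4) → V →ₗ[ℝ] 𝕜}
    (hr : IsTensorRep r ev) {G : E4 → Mat} {s : Set E4} (hG : IsMetricOn G s) {Y : Comps 𝕜 2 2}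
    {y : E4 → V} (hy : SmoothOn s y) (hY : ∀ x ∈ s, ∀ U L, Y x U L = ev U L (y x)) {u : E4}
    (hu : u ∈ s) (I : Fin 4 → Fin 4) (U : Fin 2 → Fin 4) (b d : Fin 4) :
    quarticExpr G Y u I U ![b, d] = ev U ![b, d] (uncurry₄ (quarticOf r G y u) I) := by
  have hΓ : ∀ a, SmoothOn s fun x => conn G x a := fun a x hx => hG.smooth_conn hx a
  have hp : IsTensorRep (TRep.triv ℝ).down.down _ := (isTensorRep_triv ℝ).down.down
  have y1 := hr.covDeriv_eq (G := G) hG.isOpen hy hY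
  have s1 := hy.cov r hΓ
  have y2 := hr.down.covDeriv_eq (G := G) hG.isOpen s1 y1
  have s2 := s1.cov r.down hΓ
  have y3 := hr.down.down.covDeriv_eq (G := G) hG.isOpen s2 y2
  have s3 := s2.cov r.down.down hΓ
  have y4 := hr.down.down.down.covDeriv_eq (G := G) hG.isOpen s3 y3
  have q0 : ∀ x ∈ s, ∀ U L, schouten G x U L = evDown (evDown
      (fun (_ : Fin 0 → Fin 4) (_ : Fin 0 → Fin 4) => LinearMap.id)) U L (schoutenField G x) :=
    fun x _ U L => rfl
  have t0 : SmoothOn s (schoutenField G) := smooth_schoutenField hG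
  have q1 := hp.covDeriv_eq (G := G) hG.isOpen t0 q0
  have t1 := t0.cov (TRep.triv ℝ).down.down hΓ
  have q2 := hp.down.covDeriv_eq (G := G) hG.isOpen t1 q1
  simp only [quarticExpr, y4 u hu, y2 u hu, y1 u hu, hY u hu, q0 u hu, q1 u hu, q2 u hu]
  simp only [uncurry₄, quarticOf, quarticJet, map_add, map_smul, RCLike.real_smul_eq_coe_mul,
    ← mul_assoc, RCLike.ofReal_ofNat]
  rfl

theorem quarticExpr_eq {G : E4 → Mat} {s : Set E4} (hG : IsMetricOn G s) {Y : Comps 𝕜 2 2}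
    (hY : SmoothOn s fun x => arrOf (Y x)) {u : E4} (hu : u ∈ s) (I : Fin 4 → Fin 4)
    (e f b d : Fin 4) : quarticExpr G Y u I ![e, f] ![b, d] =
      uncurry₄ (quarticOf (mixedRep 𝕜) G (fun x => arrOf (Y x)) u) I e f b d := by
  have vec : ∀ U : Fin 2 → Fin 4, ![U 0, U 1] = U := fun U => by
    ext i; fin_cases i <;> rfl
  have hm : IsTensorRep (mixedRep 𝕜) _ := (isTensorRep_triv 𝕜).down.down.up.up
  refine quarticExpr_eq_ev hm hG hY (fun x _ U L => ?_) hu I ![e, f] b d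
  change _ = arrOf (Y x) (U 0) (U 1) (L 0) (L 1)
  rw [arrOf, vec, vec]

theorem weylFormula_eq {G : E4 → Mat} {s : Set E4} (hG : IsMetricOn G s) {Y : Comps 𝕜 2 2}
    (hY : SmoothOn s fun x => arrOf (Y x)) {u : E4} (hu : u ∈ s) (a b c d : Fin 4) :
    weylFormula G Y u ![a, b, c, d] =
      weylContr (G u) (uncurry₄ (quarticOf (mixedRep 𝕜) G (fun x => arrOf (Y x)) u)) a b c d := by
  have h : ∀ a c b d, contracted G Y u a c b d =
      tfContr (G u) (uncurry₄ (quarticOf (mixedRep 𝕜) G (fun x => arrOf (Y x)) u)) a c b d := by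
    intro a c b d
    simp only [contracted, tfContr, quarticExpr_eq hG hY hu]
  simp only [weylFormula, weylContr, h]
  rfl

end Formula

end

section

attribute [local instance] Matrix.normedAddCommGroup Matrix.normedSpace

/-! ### Conformal change of the fourth order expression of a section -/

section ConformalChange

variable {V : Type*} [NormedAddCommGroup V] [NormedSpace ℝ V] [FiniteDimensional ℝ V]

theorem IsParSub.quarticOf_mem {G : E4 → Mat} {s : Set E4} (hG : IsMetricOn G s) {r : TRep V}
    {W : E4 → Submodule ℝ V} (hW : IsParSub (conn G) s r W) {y : E4 → V} (hy : SmoothOn s y)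
    (hyW : ∀ x ∈ s, y x ∈ W x) {u : E4} (hu : u ∈ s) (a b c d : Fin 4) :
    quarticOf r G y u a b c d ∈ W u := by
  have hΓ : ∀ a, SmoothOn s fun x => conn G x a := fun a x hx => hG.smooth_conn hx a
  have w1 := hW.cov_mem hy hyW
  have s1 := hy.cov r hΓ
  have w2 := hW.down.cov_mem s1 w1
  have s2 := s1.cov r.down hΓ
  have w3 := hW.down.down.cov_mem s2 w2
  have s3 := s2.cov r.down.down hΓ
  have w4 := hW.down.down.down.cov_mem s3 w3 u hu
  simp only [mem_piSub] at w1 w2 w4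
  simp only [quarticOf, quarticJet]
  refine add_mem (add_mem (add_mem (add_mem (w4 a b c d) ?_) ?_) ?_) ?_ <;>
    refine (W u).smul_mem _ ((W u).smul_mem _ ?_)
  · exact w2 u hu c d
  · exact w1 u hu d
  · exact hyW u hu
  · exact hyW u hu

variable {G G' : E4 → Mat} {Ω : E4 → ℝ} {s : Set E4} (h : IsConformalOn G G' Ω s)
include h

namespace IsConformalOn

/-- The two jets are assembled and passed to `quarticJet_eq`. The family `W` has to be parallel for
both connections because the intermediate terms mix derivatives of both. As the metric is parallel,
derivatives of `φ G` remain multiples of `G` and stay invisible to `Φ`. -/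
theorem quarticOf_eq {𝕜 : Type*} [RCLike 𝕜] (r : TRep V) {W : E4 → Submodule ℝ V}
    (hW : IsParSub (conn G) s r W) (hW' : IsParSub (conn G') s r W) {y : E4 → V}
    (hy : SmoothOn s y) (hyW : ∀ x ∈ s, y x ∈ W x) {u : E4} (hu : u ∈ s)
    {Φ : VArr4 V →ₗ[ℝ] 𝕜} (hΦ : IsConfFunctional r (G u) (G u)⁻¹ (W u) Φ) :
    Φ (quarticOf r G' y u) = Φ (quarticOf r G y u) := by
  have hG := h.left
  have hΓ := h.smooth_conn
  have hΓ' := h.smooth_conn'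
  have hθ := h.smooth_dlog
  have hθ1 := hθ.cov (TRep.triv ℝ).down hΓ
  have hθ2 := hθ1.cov (TRep.triv ℝ).down.down hΓ
  -- the derivatives of the section
  have T1 := hy.cov r hΓ'
  have T2 := T1.cov r.down hΓ'
  have T3 := T2.cov r.down.down hΓ'
  have hJ : ConfJet r (G u) (G u)⁻¹ (dlog Ω u) (cov (TRep.triv ℝ).down (conn G) (dlog Ω) u)
      (cov (TRep.triv ℝ).down.down (conn G) (cov (TRep.triv ℝ).down (conn G) (dlog Ω)) u)
      (cov (TRep.triv ℝ).down.down.down (conn G)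
        (cov (TRep.triv ℝ).down.down (conn G) (cov (TRep.triv ℝ).down (conn G) (dlog Ω))) u)
      (y u) (cov r (conn G) y u) (cov r.down (conn G) (cov r (conn G) y) u)
      (cov r.down.down (conn G) (cov r.down (conn G) (cov r (conn G) y)) u)
      (cov r.down.down.down (conn G)
        (cov r.down.down (conn G) (cov r.down (conn G) (cov r (conn G) y))) u)
      (cov r (conn G') y u) (cov r.down (conn G) (cov r (conn G') y) u)
      (cov r.down (conn G') (cov r (conn G') y) u)
      (cov r.down.down (conn G) (cov r.down (conn G) (cov r (conn G') y)) u)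
      (cov r.down.down (conn G) (cov r.down (conn G') (cov r (conn G') y)) u)
      (cov r.down.down (conn G') (cov r.down (conn G') (cov r (conn G') y)) u)
      (cov r.down.down.down (conn G)
        (cov r.down.down (conn G) (cov r.down (conn G) (cov r (conn G') y))) u)
      (cov r.down.down.down (conn G)
        (cov r.down.down (conn G) (cov r.down (conn G') (cov r (conn G') y))) u)
      (cov r.down.down.down (conn G)
        (cov r.down.down (conn G') (cov r.down (conn G') (cov r (conn G') y))) u)
      (cov r.down.down.down (conn G')
        (cov r.down.down (conn G') (cov r.down (conn G') (cov r (conn G') y))) u) :=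
    { t₁ := fun d => congrFun (h.cov_eq r y hu) d
      d₁ := fun c d => h.cov_cov r hy hu c d
      dd₁ := fun b c d => h.cov_cov_cov r hy hu b c d
      ddd₁ := fun a b c d => h.cov_cov_cov_cov r hy hu a b c d
      t₂ := fun c d => congrFun (congrFun (h.cov_eq r.down _ hu) c) d
      d₂ := fun b c d => congrFun (h.cov_cov r.down T1 hu b c) d
      dd₂ := fun a b c d => congrFun (h.cov_cov_cov r.down T1 hu a b c) d
      t₃ := fun b c d => congrFun (congrFun (congrFun (h.cov_eq r.down.down _ hu) b) c) d
      d₃ := fun a b c d => congrFun (congrFun (h.cov_cov r.down.down T2 hu a b) c) d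
      t₄ := fun a b c d => congrFun (congrFun (congrFun (congrFun
        (h.cov_eq r.down.down.down _ hu) a) b) c) d }
  -- the derivatives of the Schouten tensor
  obtain ⟨φ, hφ, hP⟩ := h.schouten_conf
  have S0 : SmoothOn s (schoutenField G) := smooth_schoutenField hG
  have S0' : SmoothOn s (schoutenField G') := smooth_schoutenField h.right
  have S1 := S0.cov (TRep.triv ℝ).down.down hΓ
  have S1' := S0'.cov (TRep.triv ℝ).down.down hΓ'
  have hφ1 := hφ.cov (TRep.triv ℝ) hΓ
  have hB : IsParBilin (conn G) s (TRep.triv ℝ).down (TRep.triv ℝ).down (TRep.triv ℝ).down.down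
      (fun _ => liftL (liftR (scal ℝ))) := (isParBilin_scal (TRep.triv ℝ)).liftR.liftL
  have hC : IsParBilin (conn G) s (TRep.triv ℝ) (TRep.triv ℝ).down.down
      (TRep.triv ℝ).down.down (fun _ => scal (Fin 4 → Fin 4 → ℝ)) := isParBilin_scal _
  let g : E4 → Fin 4 → Fin 4 → ℝ := fun x i j => G x i j
  have hg : SmoothOn s g := hG.smooth
  have dg : ∀ x ∈ s, cov (TRep.triv ℝ).down.down (conn G) g x = 0 := fun x hx => by
    funext a; exact cov_metric hG hx a
  have b0 := hB.smooth hθ hθ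
  have c0 := hC.smooth hφ hg
  have e0 : ∀ x ∈ s, schoutenField G' x = schoutenField G x
      - cov (TRep.triv ℝ).down (conn G) (dlog Ω) x
      + liftL (liftR (scal ℝ)) (dlog Ω x) (dlog Ω x) + scal _ (φ x) (g x) := by
    intro x hx
    ext i j
    exact hP x hx i j
  have e1 : ∀ x ∈ s, cov (TRep.triv ℝ).down.down (conn G) (schoutenField G') x =
      cov (TRep.triv ℝ).down.down (conn G) (schoutenField G) x
      - cov (TRep.triv ℝ).down.down (conn G) (cov (TRep.triv ℝ).down (conn G) (dlog Ω)) x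
      + (liftL (liftL (liftR (scal ℝ))) (cov (TRep.triv ℝ).down (conn G) (dlog Ω) x) (dlog Ω x)
        + liftR (liftL (liftR (scal ℝ))) (dlog Ω x)
          (cov (TRep.triv ℝ).down (conn G) (dlog Ω) x))
      + liftL (scal _) (cov (TRep.triv ℝ) (conn G) φ x) (g x) := by
    intro x hx
    have z : liftR (scal (Fin 4 → Fin 4 → ℝ)) (φ x)
      (cov (TRep.triv ℝ).down.down (conn G) g x) = 0 := by rw [dg x hx, map_zero]
    rw [cov_congr_on _ hG.isOpen e0 hx, cov_add _ (((S0.sub hθ1).add b0) x hx) (c0 x hx),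
      cov_add _ ((S0.sub hθ1) x hx) (b0 x hx), cov_sub _ (S0 x hx) (hθ1 x hx),
      hB.cov_eq hθ hθ hx, hC.cov_eq hφ hg hx, z, add_zero]
  have b1 := hB.liftL.smooth hθ1 hθ
  have b2 := hB.liftR.smooth hθ hθ1
  have c1 := hC.liftL.smooth hφ1 hg
  have e2 : cov (TRep.triv ℝ).down.down.down (conn G)
        (cov (TRep.triv ℝ).down.down (conn G) (schoutenField G')) u =
      cov (TRep.triv ℝ).down.down.down (conn G)
        (cov (TRep.triv ℝ).down.down (conn G) (schoutenField G)) u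
      - cov (TRep.triv ℝ).down.down.down (conn G)
        (cov (TRep.triv ℝ).down.down (conn G) (cov (TRep.triv ℝ).down (conn G) (dlog Ω))) u
      + ((liftL (liftL (liftL (liftR (scal ℝ))))
            (cov (TRep.triv ℝ).down.down (conn G) (cov (TRep.triv ℝ).down (conn G) (dlog Ω)) u)
            (dlog Ω u)
          + liftR (liftL (liftL (liftR (scal ℝ))))
            (cov (TRep.triv ℝ).down (conn G) (dlog Ω) u)
            (cov (TRep.triv ℝ).down (conn G) (dlog Ω) u))
        + (liftL (liftR (liftL (liftR (scal ℝ))))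
            (cov (TRep.triv ℝ).down (conn G) (dlog Ω) u)
            (cov (TRep.triv ℝ).down (conn G) (dlog Ω) u)
          + liftR (liftR (liftL (liftR (scal ℝ)))) (dlog Ω u)
            (cov (TRep.triv ℝ).down.down (conn G) (cov (TRep.triv ℝ).down (conn G) (dlog Ω)) u)))
      + liftL (liftL (scal _)) (cov (TRep.triv ℝ).down (conn G) (cov (TRep.triv ℝ) (conn G) φ) u)
        (g u) := by
    have z : liftR (liftL (scal (Fin 4 → Fin 4 → ℝ))) (cov (TRep.triv ℝ) (conn G) φ u)
      (cov (TRep.triv ℝ).down.down (conn G) g u) = 0 := by rw [dg u hu, map_zero]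
    rw [cov_congr_on _ hG.isOpen e1 hu,
      cov_add _ (((S1.sub hθ2).add (b1.add b2)) u hu) (c1 u hu),
      cov_add _ ((S1.sub hθ2) u hu) ((b1.add b2) u hu), cov_sub _ (S1 u hu) (hθ2 u hu),
      cov_add _ (b1 u hu) (b2 u hu), hB.liftL.cov_eq hθ1 hθ hu, hB.liftR.cov_eq hθ hθ1 hu,
      hC.liftL.cov_eq hφ1 hg hu, z, add_zero]
  have hS : ConfJetSchouten (G u) (G u)⁻¹ (dlog Ω u)
      (cov (TRep.triv ℝ).down (conn G) (dlog Ω) u)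
      (cov (TRep.triv ℝ).down.down (conn G) (cov (TRep.triv ℝ).down (conn G) (dlog Ω)) u)
      (cov (TRep.triv ℝ).down.down.down (conn G)
        (cov (TRep.triv ℝ).down.down (conn G) (cov (TRep.triv ℝ).down (conn G) (dlog Ω))) u)
      (φ u) (cov (TRep.triv ℝ) (conn G) φ u)
      (cov (TRep.triv ℝ).down (conn G) (cov (TRep.triv ℝ) (conn G) φ) u)
      (schoutenField G u) (schoutenField G' u)
      (cov (TRep.triv ℝ).down.down (conn G) (schoutenField G) u)
      (cov (TRep.triv ℝ).down.down (conn G) (schoutenField G') u)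
      (cov (TRep.triv ℝ).down.down (conn G') (schoutenField G') u)
      (cov (TRep.triv ℝ).down.down.down (conn G)
        (cov (TRep.triv ℝ).down.down (conn G) (schoutenField G)) u)
      (cov (TRep.triv ℝ).down.down.down (conn G)
        (cov (TRep.triv ℝ).down.down (conn G) (schoutenField G')) u)
      (cov (TRep.triv ℝ).down.down.down (conn G)
        (cov (TRep.triv ℝ).down.down (conn G') (schoutenField G')) u)
      (cov (TRep.triv ℝ).down.down.down (conn G')
        (cov (TRep.triv ℝ).down.down (conn G') (schoutenField G')) u) :=
    { p := hP u hu
      dp := fun a b c => congrFun (congrFun (congrFun (e1 u hu) a) b) c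
      ddp := fun a b c d => by
        have := congrFun (congrFun (congrFun (congrFun e2 a) b) c) d
        refine this.trans ?_
        simp only [Pi.add_apply, Pi.sub_apply, liftL_apply, liftR_apply, scal_apply, smul_eq_mul,
          Pi.smul_apply, g]
        ring
      p₁ := fun a b c =>
        congrFun (congrFun (congrFun (h.cov_eq (TRep.triv ℝ).down.down _ hu) a) b) c
      dp₁ := fun a b c d =>
        congrFun (congrFun (h.cov_cov (TRep.triv ℝ).down.down S0' hu a b) c) d
      p₂ := fun a b c d => congrFun (congrFun (congrFun (congrFun
        (h.cov_eq (TRep.triv ℝ).down.down.down _ hu) a) b) c) d }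
  -- membership in the parallel subspace
  have w1 := hW.cov_mem hy hyW
  have w2 := hW.down.cov_mem (hy.cov r hΓ) w1
  have w3 := hW.down.down.cov_mem ((hy.cov r hΓ).cov r.down hΓ) w2
  have v1 := hW'.cov_mem hy hyW
  have v2 := hW'.down.cov_mem T1 v1
  have v3 := hW'.down.down.cov_mem T2 v2
  have m2 := hW.down.cov_mem T1 v1
  have m3 := hW.down.down.cov_mem (T1.cov r.down hΓ) m2
  have n3 := hW.down.down.cov_mem T2 v2
  simp only [mem_piSub] at w1 w2 w3 v1 v2 v3 m2 m3 n3
  exact hΦ.quarticJet_eq hJ hS (hyW u hu) (w1 u hu) (w2 u hu) (w3 u hu) (v1 u hu) (m2 u hu)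
    (m3 u hu) (v2 u hu) (n3 u hu) (v3 u hu)

end IsConformalOn

end ConformalChange

/-! ### Conformal invariance of the coordinate formula -/

section ConformalFormula

variable {𝕜 : Type*} [RCLike 𝕜]

theorem inv_smul_mat {g : Mat} {t : ℝ} (ht : t ≠ 0) (hd : g.det ≠ 0) :
    (t • g)⁻¹ = t⁻¹ • g⁻¹ := by
  refine Matrix.inv_eq_right_inv ?_
  rw [Matrix.smul_mul, Matrix.mul_smul, smul_smul, Matrix.mul_nonsing_inv _ hd.isUnit,
    mul_inv_cancel₀ ht, one_smul]

theorem castMat_smul (t : ℝ) (g : Mat) : castMat 𝕜 (t • g) = (t : 𝕜) • castMat 𝕜 g := by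
  ext i j; simp [castMat_apply]

theorem isWeyl4_smul_metric {h : M4 𝕜} {t : 𝕜} (ht : t ≠ 0) {Z : Arr4 𝕜} :
    IsWeyl4 (t • h) Z ↔ IsWeyl4 h Z := by
  have e : ∀ b d, ∑ a, ∑ c, (t • h) a c * Z a b c d = t * ∑ a, ∑ c, h a c * Z a b c d := by
    intro b d
    simp only [Matrix.smul_apply, smul_eq_mul, Finset.mul_sum, mul_assoc]
  refine ⟨fun H => ⟨H.toIsCurv, fun b d => ?_⟩, fun H => ⟨H.toIsCurv, fun b d => ?_⟩⟩
  · have := H.trace b d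
    rw [e] at this
    exact (mul_eq_zero.1 this).resolve_left ht
  · rw [e, H.trace, mul_zero]

theorem mixedSub_smul {g : Mat} {t : ℝ} (ht : t ≠ 0) (hd : g.det ≠ 0) :
    mixedSub 𝕜 (t • g) = mixedSub 𝕜 g := by
  have ht' : (t : 𝕜) ≠ 0 := RCLike.ofReal_ne_zero.2 ht
  ext Y
  rw [mem_mixedSub, mem_mixedSub, inv_smul_mat ht hd, castMat_smul, castMat_smul,
    isWeyl4_smul_metric (RCLike.ofReal_ne_zero.2 (inv_ne_zero ht)), lowerWith_smul_left,
    lowerWith_smul_right]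
  refine ⟨fun H => ?_, fun H => (H.smul _).smul _⟩
  have := (H.smul (t : 𝕜)⁻¹).smul (t : 𝕜)⁻¹
  rwa [inv_smul_smul₀ ht', inv_smul_smul₀ ht'] at this

theorem tfSymmPart_smul_metric {g : Mat} {t : ℝ} (ht : t ≠ 0) (hd : g.det ≠ 0)
    (Q : (Fin 4 → Fin 4) → 𝕜) : tfSymmPart (t • g) Q = tfSymmPart g Q := by
  have ht' : (t : 𝕜) ≠ 0 := RCLike.ofReal_ne_zero.2 ht
  have e : ∀ S : (Fin 4 → Fin 4) → 𝕜, ∀ c d, trace₁₂ (t • g) S c d =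
      (t : 𝕜)⁻¹ * trace₁₂ g S c d := by
    intro S c d
    simp only [trace₁₂, inv_smul_mat ht hd, Matrix.smul_apply, smul_eq_mul, Finset.mul_sum]
    push_cast
    simp only [mul_assoc]
  have e2 : ∀ F : Fin 4 → Fin 4 → 𝕜, ∑ p, ∑ q, (((t • g)⁻¹ p q : ℝ) : 𝕜) * ((t : 𝕜)⁻¹ * F p q) =
      (t : 𝕜)⁻¹ * ((t : 𝕜)⁻¹ * ∑ p, ∑ q, ((g⁻¹ p q : ℝ) : 𝕜) * F p q) := by
    intro F
    simp only [inv_smul_mat ht hd, Matrix.smul_apply, smul_eq_mul, Finset.mul_sum]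
    push_cast
    exact Finset.sum_congr rfl fun p _ => Finset.sum_congr rfl fun q _ => by ring
  ext I
  simp only [tfSymmPart, e, e2, Matrix.smul_apply, smul_eq_mul]
  push_cast
  field_simp

theorem weylContr_smul_metric {g : Mat} {t : ℝ} (ht : t ≠ 0) (hd : g.det ≠ 0)
    (X : (Fin 4 → Fin 4) → Arr4 𝕜) : weylContr (t • g) X = weylContr g X := by
  have e : tfContr (t • g) X = tfContr g X := by
    ext a c b d
    simp only [tfContr, tfSymmPart_smul_metric ht hd]
  unfold weylContr
  rw [e]

/-- The conformal invariance of the operator, in a coordinate system. -/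
theorem IsConformalOn.weylFormula_eq {G G' : E4 → Mat} {Ω : E4 → ℝ} {s : Set E4}
    (h : IsConformalOn G G' Ω s) {Y : Comps 𝕜 2 2} (hY : SmoothOn s fun x => arrOf (Y x))
    (hW : ∀ x ∈ s, arrOf (Y x) ∈ mixedSub 𝕜 (G x)) {u : E4} (hu : u ∈ s) (a b c d : Fin 4) :
    weylFormula G' Y u ![a, b, c, d] = weylFormula G Y u ![a, b, c, d] := by
  have hG := h.left
  have hg := hG.symm u hu
  have hd := hG.det u hu
  have ht : ∀ x ∈ s, Ω x ^ 2 ≠ 0 := fun x hx => (pow_pos (h.pos x hx) 2).ne'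
  have hsub : ∀ x ∈ s, mixedSub 𝕜 (G' x) = mixedSub 𝕜 (G x) := fun x hx => by
    rw [h.eq x hx, mixedSub_smul (ht x hx) (hG.det x hx)]
  have hP : IsParSub (conn G) s (mixedRep 𝕜) (fun x => mixedSub 𝕜 (G x)) := isParSub_mixedSub hG
  have hP' : IsParSub (conn G') s (mixedRep 𝕜) (fun x => mixedSub 𝕜 (G x)) := by
    intro T hT hTW x hx a
    have := isParSub_mixedSub h.right T hT (fun x hx => (hsub x hx).ge (hTW x hx)) x hx a
    exact (hsub x hx).le this
  rw [WeylOp.weylFormula_eq h.right hY hu, WeylOp.weylFormula_eq hG hY hu, h.eq u hu,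
    weylContr_smul_metric (ht u hu) hd]
  set X := quarticOf (mixedRep 𝕜) G (fun x => arrOf (Y x)) u with hX
  set X' := quarticOf (mixedRep 𝕜) G' (fun x => arrOf (Y x)) u with hX'
  have m : ∀ J, IsWeylMixed (G u) (uncurry₄ X J) := fun J =>
    isWeylMixed_of_mem hg hd (hP.quarticOf_mem hG hY hW hu _ _ _ _)
  have m' : ∀ J, IsWeylMixed (G u) (uncurry₄ X' J) := fun J =>
    isWeylMixed_of_mem hg hd (hP'.quarticOf_mem h.right hY hW hu _ _ _ _)
  -- The difference of the two values is a Weyl array, so it vanishes as soon as its pairings do.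
  have hC := (weylContr_isWeyl hg hd m').add ((weylContr_isWeyl hg hd m).smul (-1))
  have h0 := IsWeyl4.eq_zero_of_pairing (castMat_symm hg) (castMat_inv_mul hd) hC fun N hN => by
    have := h.quarticOf_eq (mixedRep 𝕜) hP hP' hY hW hu (isConfFunctional_weylPairing hg hd hN)
    rw [← hX, ← hX'] at this
    simp only [weylPairing, LinearMap.coe_mk, AddHom.coe_mk] at this
    simp only [Pi.add_apply, Pi.smul_apply, smul_eq_mul, add_mul, Finset.sum_add_distrib, this,
      mul_assoc, ← Finset.mul_sum]
    ring
  have := congrFun (congrFun (congrFun (congrFun h0 a) b) c) d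
  simp only [Pi.add_apply, Pi.smul_apply, smul_eq_mul, Pi.zero_apply] at this
  linear_combination this

end ConformalFormula

end

/-! ### The trace-free symmetric part under changes of coordinates -/

section Equivariance

variable {𝕜 : Type*} [RCLike 𝕜]

/-- The change of coordinates of a covariant tensor with four indices. -/
def pull (K : Mat) (Q : (Fin 4 → Fin 4) → 𝕜) (I : Fin 4 → Fin 4) : 𝕜 :=
  ∑ J, (∏ i, ((K (J i) (I i) : ℝ) : 𝕜)) * Q J

/-- The change of coordinates of a covariant tensor with two indices. -/
def pull₂ (K : Mat) (A : Fin 4 → Fin 4 → 𝕜) (i j : Fin 4) : 𝕜 :=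
  ∑ p, ∑ q, ((K p i : ℝ) : 𝕜) * ((K q j : ℝ) : 𝕜) * A p q

theorem pull_eq (K : Mat) (Q : (Fin 4 → Fin 4) → 𝕜) (a b c d : Fin 4) :
    pull K Q ![a, b, c, d] = ∑ p, ∑ q, ∑ m, ∑ n, ((K p a : ℝ) : 𝕜) * ((K q b : ℝ) : 𝕜) *
      ((K m c : ℝ) : 𝕜) * ((K n d : ℝ) : 𝕜) * Q ![p, q, m, n] := by
  rw [pull, sum_index]
  simp only [Fin.prod_univ_four]
  rfl

theorem pull_comp (K : Mat) (Q : (Fin 4 → Fin 4) → 𝕜) (I : Fin 4 → Fin 4)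
    (σ : Equiv.Perm (Fin 4)) : pull K Q (I ∘ σ) = pull K (fun J => Q (J ∘ σ)) I := by
  unfold pull
  rw [← Equiv.sum_comp (Equiv.arrowCongr σ.symm (Equiv.refl (Fin 4)))]
  refine Finset.sum_congr rfl fun J _ => ?_
  congr 1
  exact Equiv.prod_comp σ fun i => ((K (J i) (I i) : ℝ) : 𝕜)

theorem pull_add (K : Mat) (Q Q' : (Fin 4 → Fin 4) → 𝕜) :
    pull K (Q + Q') = pull K Q + pull K Q' := by
  ext I; simp only [pull, Pi.add_apply, mul_add, Finset.sum_add_distrib]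

theorem pull_smul (K : Mat) (t : 𝕜) (Q : (Fin 4 → Fin 4) → 𝕜) :
    pull K (t • Q) = t • pull K Q := by
  ext I
  simp only [pull, Pi.smul_apply, smul_eq_mul, Finset.mul_sum]
  exact Finset.sum_congr rfl fun _ _ => by ring

theorem symmPart_pull (K : Mat) (Q : (Fin 4 → Fin 4) → 𝕜) :
    symmPart (pull K Q) = pull K (symmPart Q) := by
  ext I
  simp only [symmPart, pull_comp]
  simp only [pull, symmPart, Finset.mul_sum]
  rw [Finset.sum_comm]
  exact Finset.sum_congr rfl fun _ _ => Finset.sum_congr rfl fun _ _ => by ring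

/-- Covers at once all positions in which the products of two-index tensors occur in the trace-free
projection. -/
theorem pull_pair (K : Mat) (A B : Fin 4 → Fin 4 → 𝕜) (I : Fin 4 → Fin 4)
    (σ : Equiv.Perm (Fin 4)) :
    pull K (fun J => A (J (σ 0)) (J (σ 1)) * B (J (σ 2)) (J (σ 3))) I =
      pull₂ K A (I (σ 0)) (I (σ 1)) * pull₂ K B (I (σ 2)) (I (σ 3)) := by
  refine (pull_comp K (fun J : Fin 4 → Fin 4 => A (J 0) (J 1) * B (J 2) (J 3)) I σ).symm.trans ?_
  have vec : I ∘ σ = ![I (σ 0), I (σ 1), I (σ 2), I (σ 3)] := by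
    ext i; fin_cases i <;> rfl
  rw [vec, pull_eq]
  simp only [pull₂, Finset.sum_mul]
  refine Finset.sum_congr rfl fun p _ => Finset.sum_congr rfl fun q _ => ?_
  simp only [Finset.mul_sum]
  refine Finset.sum_congr rfl fun m _ => Finset.sum_congr rfl fun n _ => ?_
  simp only [Matrix.cons_val]
  ring

variable {g g' K : Mat}

theorem sum_inv_pull₂ (hi : K * g'⁻¹ * K.transpose = g⁻¹) (A : Fin 4 → Fin 4 → 𝕜) :
    ∑ i, ∑ j, ((g'⁻¹ i j : ℝ) : 𝕜) * pull₂ K A i j = ∑ p, ∑ q, ((g⁻¹ p q : ℝ) : 𝕜) * A p q := by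
  have s : ∀ F : Fin 4 → Fin 4 → Fin 4 → Fin 4 → 𝕜,
      ∑ i, ∑ j, ∑ p, ∑ q, F i j p q = ∑ p, ∑ q, ∑ j, ∑ i, F i j p q := by
    intro F
    have h1 : ∀ i, ∑ j, ∑ p, ∑ q, F i j p q = ∑ p, ∑ q, ∑ j, F i j p q := fun i => by
      rw [Finset.sum_comm]
      exact Finset.sum_congr rfl fun p _ => Finset.sum_comm
    simp only [h1]
    rw [Finset.sum_comm]
    refine Finset.sum_congr rfl fun p _ => ?_
    rw [Finset.sum_comm]
    exact Finset.sum_congr rfl fun q _ => Finset.sum_comm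
  simp only [pull₂, Finset.mul_sum]
  rw [s]
  refine Finset.sum_congr rfl fun p _ => Finset.sum_congr rfl fun q _ => ?_
  rw [← hi]
  simp only [Matrix.mul_apply, Matrix.transpose_apply, Finset.sum_mul]
  push_cast
  simp only [Finset.sum_mul]
  exact Finset.sum_congr rfl fun j _ => Finset.sum_congr rfl fun i _ => by ring

theorem trace₁₂_pull (hi : K * g'⁻¹ * K.transpose = g⁻¹) (S : (Fin 4 → Fin 4) → 𝕜) (c d : Fin 4) :
    trace₁₂ g' (pull K S) c d = pull₂ K (trace₁₂ g S) c d := by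
  have e : ∀ i j, pull K S ![i, j, c, d] =
      pull₂ K (fun p q => pull₂ K (fun m n => S ![p, q, m, n]) c d) i j := by
    intro i j
    rw [pull_eq]
    simp only [pull₂, Finset.mul_sum]
    exact Finset.sum_congr rfl fun _ _ => Finset.sum_congr rfl fun _ _ =>
      Finset.sum_congr rfl fun _ _ => Finset.sum_congr rfl fun _ _ => by ring
  simp only [trace₁₂, e]
  rw [sum_inv_pull₂ hi]
  simp only [pull₂, trace₁₂, Finset.mul_sum]
  have s : ∀ F : Fin 4 → Fin 4 → Fin 4 → Fin 4 → 𝕜,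
      ∑ i, ∑ j, ∑ p, ∑ q, F i j p q = ∑ p, ∑ q, ∑ i, ∑ j, F i j p q := by
    intro F
    have h1 : ∀ i, ∑ j, ∑ p, ∑ q, F i j p q = ∑ p, ∑ q, ∑ j, F i j p q := fun i => by
      rw [Finset.sum_comm]
      exact Finset.sum_congr rfl fun p _ => Finset.sum_comm
    simp only [h1]
    rw [Finset.sum_comm]
    exact Finset.sum_congr rfl fun p _ => Finset.sum_comm
  rw [s]
  exact Finset.sum_congr rfl fun _ _ => Finset.sum_congr rfl fun _ _ =>
    Finset.sum_congr rfl fun _ _ => Finset.sum_congr rfl fun _ _ => by ring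

theorem tfSymmPart_pull (hg : g' = K.transpose * g * K) (hi : K * g'⁻¹ * K.transpose = g⁻¹)
    (Q : (Fin 4 → Fin 4) → 𝕜) : tfSymmPart g' (pull K Q) = pull K (tfSymmPart g Q) := by
  set S := symmPart Q with hS
  set t := trace₁₂ g S with ht
  set tt : 𝕜 := ∑ p, ∑ q, ((g⁻¹ p q : ℝ) : 𝕜) * t p q with htt
  set γ : Fin 4 → Fin 4 → 𝕜 := fun i j => ((g i j : ℝ) : 𝕜) with hγ
  have eg : ∀ i j, ((g' i j : ℝ) : 𝕜) = pull₂ K γ i j := by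
    intro i j
    rw [hg]
    simp only [Matrix.mul_apply, Matrix.transpose_apply, pull₂, Finset.sum_mul, hγ]
    push_cast
    rw [Finset.sum_comm]
    exact Finset.sum_congr rfl fun _ _ => Finset.sum_congr rfl fun _ _ => by ring
  have et : trace₁₂ g' (pull K S) = pull₂ K t := by
    ext c d; exact trace₁₂_pull hi S c d
  let A : Equiv.Perm (Fin 4) → (Fin 4 → Fin 4) → 𝕜 := fun σ J =>
    γ (J (σ 0)) (J (σ 1)) * t (J (σ 2)) (J (σ 3))
  let B : Equiv.Perm (Fin 4) → (Fin 4 → Fin 4) → 𝕜 := fun σ J =>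
    γ (J (σ 0)) (J (σ 1)) * γ (J (σ 2)) (J (σ 3))
  have eA : ∀ σ I, pull K (A σ) I = pull₂ K γ (I (σ 0)) (I (σ 1)) * pull₂ K t (I (σ 2)) (I (σ 3)) :=
    fun σ I => pull_pair K γ t I σ
  have eB : ∀ σ I, pull K (B σ) I = pull₂ K γ (I (σ 0)) (I (σ 1)) * pull₂ K γ (I (σ 2)) (I (σ 3)) :=
    fun σ I => pull_pair K γ γ I σ
  let s02 : Equiv.Perm (Fin 4) := Equiv.swap 1 2
  let s03 : Equiv.Perm (Fin 4) := ⟨![0, 3, 1, 2], ![0, 2, 3, 1], by decide, by decide⟩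
  let s12 : Equiv.Perm (Fin 4) := ⟨![1, 2, 0, 3], ![2, 0, 1, 3], by decide, by decide⟩
  let s13 : Equiv.Perm (Fin 4) := ⟨![1, 3, 0, 2], ![2, 0, 3, 1], by decide, by decide⟩
  let s23 : Equiv.Perm (Fin 4) := ⟨![2, 3, 0, 1], ![2, 3, 0, 1], by decide, by decide⟩
  -- The projection as a combination of products `g ⊗ t` and `g ⊗ g` in permuted positions. The
  -- change of coordinates is applied to each of them separately.
  have e1 : tfSymmPart g Q = S + ((-(1 / 8) : 𝕜) • (A 1 + A s02 + A s03 + A s12 + A s13 + A s23)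
      + ((1 / 48) * tt) • (B 1 + B s02 + B s03)) := by
    ext I
    change S I - (1 / 8) * (γ (I 0) (I 1) * t (I 2) (I 3) + γ (I 0) (I 2) * t (I 1) (I 3)
        + γ (I 0) (I 3) * t (I 1) (I 2) + γ (I 1) (I 2) * t (I 0) (I 3)
        + γ (I 1) (I 3) * t (I 0) (I 2) + γ (I 2) (I 3) * t (I 0) (I 1))
        + (1 / 48) * (γ (I 0) (I 1) * γ (I 2) (I 3) + γ (I 0) (I 2) * γ (I 1) (I 3)
        + γ (I 0) (I 3) * γ (I 1) (I 2)) * tt =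
      S I + (-(1 / 8) * (γ (I 0) (I 1) * t (I 2) (I 3) + γ (I 0) (I 2) * t (I 1) (I 3)
        + γ (I 0) (I 3) * t (I 1) (I 2) + γ (I 1) (I 2) * t (I 0) (I 3)
        + γ (I 1) (I 3) * t (I 0) (I 2) + γ (I 2) (I 3) * t (I 0) (I 1))
        + (1 / 48 * tt) * (γ (I 0) (I 1) * γ (I 2) (I 3) + γ (I 0) (I 2) * γ (I 1) (I 3)
        + γ (I 0) (I 3) * γ (I 1) (I 2)))
    ring
  rw [e1]
  simp only [pull_add, pull_smul]
  ext I
  simp only [tfSymmPart, symmPart_pull, ← hS, et, sum_inv_pull₂ hi, ← htt, eg, Pi.add_apply,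
    Pi.smul_apply, smul_eq_mul, eA, eB]
  change _ = pull K S I + (-(1 / 8) * (pull₂ K γ (I 0) (I 1) * pull₂ K t (I 2) (I 3)
        + pull₂ K γ (I 0) (I 2) * pull₂ K t (I 1) (I 3)
        + pull₂ K γ (I 0) (I 3) * pull₂ K t (I 1) (I 2)
        + pull₂ K γ (I 1) (I 2) * pull₂ K t (I 0) (I 3)
        + pull₂ K γ (I 1) (I 3) * pull₂ K t (I 0) (I 2)
        + pull₂ K γ (I 2) (I 3) * pull₂ K t (I 0) (I 1))
        + (1 / 48 * tt) * (pull₂ K γ (I 0) (I 1) * pull₂ K γ (I 2) (I 3)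
        + pull₂ K γ (I 0) (I 2) * pull₂ K γ (I 1) (I 3)
        + pull₂ K γ (I 0) (I 3) * pull₂ K γ (I 1) (I 2)))
  ring

end Equivariance

section

attribute [local instance] Matrix.normedAddCommGroup Matrix.normedSpace

/-! ### Equivariance of the contraction to Weyl tensors -/

section Equivariance

variable {𝕜 : Type*} [RCLike 𝕜] {g g' K J : Mat}

theorem mixedRep_act (Y : Arr4 𝕜) (e f b d : Fin 4) : (mixedRep 𝕜).act J K Y e f b d =
    ∑ m, ∑ n, ((K m b : ℝ) : 𝕜) * ((K n d : ℝ) : 𝕜) *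
      ∑ p, ∑ q, ((J e p : ℝ) : 𝕜) * ((J f q : ℝ) : 𝕜) * Y p q m n := by
  have s : ∀ F : Fin 4 → Fin 4 → Fin 4 → Fin 4 → 𝕜,
      ∑ i, ∑ j, ∑ p, ∑ q, F i j p q = ∑ p, ∑ q, ∑ i, ∑ j, F i j p q := by
    intro F
    have h1 : ∀ i, ∑ j, ∑ p, ∑ q, F i j p q = ∑ p, ∑ q, ∑ j, F i j p q := fun i => by
      rw [Finset.sum_comm]
      exact Finset.sum_congr rfl fun p _ => Finset.sum_comm
    simp only [h1]
    rw [Finset.sum_comm]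
    exact Finset.sum_congr rfl fun p _ => Finset.sum_comm
  simp only [mixedRep, TRep.up_act, TRep.down_act, TRep.triv_act, Finset.sum_apply, Pi.smul_apply,
    RCLike.real_smul_eq_coe_mul, Finset.mul_sum]
  rw [s]
  exact Finset.sum_congr rfl fun _ _ => Finset.sum_congr rfl fun _ _ =>
    Finset.sum_congr rfl fun _ _ => Finset.sum_congr rfl fun _ _ => by ring

theorem sum_contr (hKJ : K * J = 1) (A B : Fin 4 → 𝕜) :
    ∑ e, (∑ r, ((K r e : ℝ) : 𝕜) * A r) * (∑ p, ((J e p : ℝ) : 𝕜) * B p) = ∑ p, A p * B p := by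
  have h : ∀ r p, ∑ e, ((K r e : ℝ) : 𝕜) * ((J e p : ℝ) : 𝕜) = if r = p then 1 else 0 := by
    intro r p
    have := congrFun (congrFun (congrArg (castMat 𝕜) hKJ) r) p
    rwa [castMat_mul, castMat_one, Matrix.mul_apply, Matrix.one_apply] at this
  simp only [Finset.sum_mul, Finset.mul_sum]
  rw [Finset.sum_comm]
  refine Finset.sum_congr rfl fun r _ => ?_
  rw [Finset.sum_comm]
  have : ∀ p, ∑ e, ((K p e : ℝ) : 𝕜) * A p * (((J e r : ℝ) : 𝕜) * B r) =
      (if p = r then 1 else 0) * (A p * B r) := fun p => by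
    rw [← h, Finset.sum_mul]
    exact Finset.sum_congr rfl fun _ _ => by ring
  simp [this]

theorem sum_contr₂ (hKJ : K * J = 1) (A B : Fin 4 → Fin 4 → 𝕜) :
    ∑ e, ∑ f, (∑ r, ∑ s, ((K r e : ℝ) : 𝕜) * ((K s f : ℝ) : 𝕜) * A r s) *
      (∑ p, ∑ q, ((J e p : ℝ) : 𝕜) * ((J f q : ℝ) : 𝕜) * B p q) = ∑ p, ∑ q, A p q * B p q := by
  have h1 : ∀ e f, ∑ r, ∑ s, ((K r e : ℝ) : 𝕜) * ((K s f : ℝ) : 𝕜) * A r s =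
      ∑ s, ((K s f : ℝ) : 𝕜) * ∑ r, ((K r e : ℝ) : 𝕜) * A r s := fun e f => by
    rw [Finset.sum_comm]
    simp only [Finset.mul_sum]
    exact Finset.sum_congr rfl fun _ _ => Finset.sum_congr rfl fun _ _ => by ring
  have h2 : ∀ e f, ∑ p, ∑ q, ((J e p : ℝ) : 𝕜) * ((J f q : ℝ) : 𝕜) * B p q =
      ∑ q, ((J f q : ℝ) : 𝕜) * ∑ p, ((J e p : ℝ) : 𝕜) * B p q := fun e f => by
    rw [Finset.sum_comm]
    simp only [Finset.mul_sum]
    exact Finset.sum_congr rfl fun _ _ => Finset.sum_congr rfl fun _ _ => by ring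
  simp only [h1, h2, sum_contr hKJ]
  rw [Finset.sum_comm]
  have h3 : ∀ q, ∑ e, (∑ r, ((K r e : ℝ) : 𝕜) * A r q) * ∑ p, ((J e p : ℝ) : 𝕜) * B p q =
    ∑ p, A p q * B p q := fun q => sum_contr hKJ (fun r => A r q) fun p => B p q
  rw [← Finset.sum_comm, Finset.sum_comm]
  simp only [h3]
  exact Finset.sum_comm

/-- The summed indices `e, f` are lower on the projection and upper on the section, so they
transform by `K` and its inverse `J` and cancel by `sum_contr₂`; the four free lower indices keep a
factor `K` each. -/
theorem tfContr_pull (hg : g' = K.transpose * g * K) (hi : K * g'⁻¹ * K.transpose = g⁻¹)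
    (hKJ : K * J = 1) {X X' : (Fin 4 → Fin 4) → Arr4 𝕜}
    (hX : ∀ I e f b d, X' I e f b d =
      pull K (fun I => (mixedRep 𝕜).act J K (X I) e f b d) I) (a c b d : Fin 4) :
    tfContr g' X' a c b d = ∑ k, ∑ l, ∑ m, ∑ n, ((K k a : ℝ) : 𝕜) * ((K l c : ℝ) : 𝕜) *
      ((K m b : ℝ) : 𝕜) * ((K n d : ℝ) : 𝕜) * tfContr g X k l m n := by
  have move : ∀ {ι : Type} [Fintype ι] (F : Fin 4 → Fin 4 → ι → 𝕜),
      ∑ e, ∑ f, ∑ x, F e f x = ∑ x, ∑ e, ∑ f, F e f x := by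
    intro ι _ F
    have : ∀ e, ∑ f, ∑ x, F e f x = ∑ x, ∑ f, F e f x := fun e => Finset.sum_comm
    simp only [this]
    exact Finset.sum_comm
  have move' : ∀ {ι : Type} [Fintype ι] (F : ι → Fin 4 → Fin 4 → Fin 4 → Fin 4 → 𝕜),
      ∑ x, ∑ k, ∑ l, ∑ m, ∑ n, F x k l m n = ∑ k, ∑ l, ∑ m, ∑ n, ∑ x, F x k l m n := by
    intro ι _ F
    rw [Finset.sum_comm]
    refine Finset.sum_congr rfl fun k _ => ?_
    rw [Finset.sum_comm]
    refine Finset.sum_congr rfl fun l _ => ?_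
    rw [Finset.sum_comm]
    refine Finset.sum_congr rfl fun m _ => ?_
    exact Finset.sum_comm
  let S : (Fin 4 → Fin 4) → (Fin 4 → Fin 4) → 𝕜 := fun I => tfSymmPart g (Pi.single I (1 : 𝕜))
  let α : (Fin 4 → Fin 4) → Fin 4 → Fin 4 → Fin 4 → Fin 4 → 𝕜 := fun I k l e f =>
    ∑ r, ∑ s, ((K r e : ℝ) : 𝕜) * ((K s f : ℝ) : 𝕜) * S I ![k, l, r, s]
  let β : (Fin 4 → Fin 4) → Fin 4 → Fin 4 → Fin 4 → Fin 4 → 𝕜 := fun I m n e f =>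
    ∑ p, ∑ q, ((J e p : ℝ) : 𝕜) * ((J f q : ℝ) : 𝕜) * X I p q m n
  have e1 : ∀ e f, tfSymmPart g' (fun I => X' I e f b d) ![a, c, e, f] =
      ∑ k, ∑ l, ∑ m, ∑ n, ∑ I, ((K k a : ℝ) : 𝕜) * ((K l c : ℝ) : 𝕜) *
      ((K m b : ℝ) : 𝕜) * ((K n d : ℝ) : 𝕜) * (α I k l e f * β I m n e f) := by
    intro e f
    rw [show (fun I => X' I e f b d) = pull K (fun I => (mixedRep 𝕜).act J K (X I) e f b d) from
      funext fun I => hX I e f b d, tfSymmPart_pull hg hi]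
    have e2 : pull K (tfSymmPart g fun I => (mixedRep 𝕜).act J K (X I) e f b d) ![a, c, e, f] =
        ∑ I, pull K (S I) ![a, c, e, f] * (mixedRep 𝕜).act J K (X I) e f b d := by
      simp only [pull, tfSymmPart_eq_sum (g := g) (fun I => (mixedRep 𝕜).act J K (X I) e f b d),
        Finset.mul_sum, Finset.sum_mul]
      rw [Finset.sum_comm]
      exact Finset.sum_congr rfl fun _ _ => Finset.sum_congr rfl fun _ _ => (mul_assoc _ _ _).symm
    have e3 : ∀ I, pull K (S I) ![a, c, e, f] =
        ∑ k, ∑ l, ((K k a : ℝ) : 𝕜) * ((K l c : ℝ) : 𝕜) * α I k l e f := by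
      intro I
      rw [pull_eq]
      simp only [α, Finset.mul_sum]
      exact Finset.sum_congr rfl fun _ _ => Finset.sum_congr rfl fun _ _ =>
        Finset.sum_congr rfl fun _ _ => Finset.sum_congr rfl fun _ _ => by ring
    rw [e2, ← move']
    refine Finset.sum_congr rfl fun I _ => ?_
    rw [e3, mixedRep_act]
    simp only [Finset.sum_mul]
    refine Finset.sum_congr rfl fun k _ => Finset.sum_congr rfl fun l _ => ?_
    rw [Finset.mul_sum]
    refine Finset.sum_congr rfl fun m _ => ?_
    rw [Finset.mul_sum]
    refine Finset.sum_congr rfl fun n _ => ?_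
    change _ * α I k l e f * (_ * β I m n e f) = _
    ring
  have e4 : ∀ I k l m n, ∑ e, ∑ f, α I k l e f * β I m n e f =
      ∑ p, ∑ q, S I ![k, l, p, q] * X I p q m n := fun I k l m n =>
    sum_contr₂ hKJ (fun p q => S I ![k, l, p, q]) fun p q => X I p q m n
  rw [tfContr]
  simp only [e1]
  rw [move]
  refine Finset.sum_congr rfl fun k _ => ?_
  rw [move]
  refine Finset.sum_congr rfl fun l _ => ?_
  rw [move]
  refine Finset.sum_congr rfl fun m _ => ?_
  rw [move]
  refine Finset.sum_congr rfl fun n _ => ?_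
  rw [move, tfContr_eq_sum, Finset.mul_sum]
  refine Finset.sum_congr rfl fun I _ => ?_
  simp only [← Finset.mul_sum]
  rw [e4]

theorem weylContr_pull (hg : g' = K.transpose * g * K) (hi : K * g'⁻¹ * K.transpose = g⁻¹)
    (hKJ : K * J = 1) {X X' : (Fin 4 → Fin 4) → Arr4 𝕜}
    (hX : ∀ I e f b d, X' I e f b d =
      pull K (fun I => (mixedRep 𝕜).act J K (X I) e f b d) I) (a b c d : Fin 4) :
    weylContr g' X' a b c d = ∑ p, ∑ q, ∑ m, ∑ n, ((K p a : ℝ) : 𝕜) * ((K q b : ℝ) : 𝕜) *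
      ((K m c : ℝ) : 𝕜) * ((K n d : ℝ) : 𝕜) * weylContr g X p q m n := by
  have s : ∀ F : Fin 4 → Fin 4 → Fin 4 → Fin 4 → 𝕜, ∑ i, ∑ j, ∑ k, ∑ l, F i j k l =
      ∑ i, ∑ k, ∑ j, ∑ l, F i j k l := fun F =>
    Finset.sum_congr rfl fun i _ => Finset.sum_comm
  have s' : ∀ F : Fin 4 → Fin 4 → Fin 4 → Fin 4 → 𝕜, ∑ i, ∑ j, ∑ k, ∑ l, F i j k l =
      ∑ i, ∑ j, ∑ l, ∑ k, F i j k l := fun F =>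
    Finset.sum_congr rfl fun i _ => Finset.sum_congr rfl fun j _ => Finset.sum_comm
  have s'' : ∀ F : Fin 4 → Fin 4 → Fin 4 → Fin 4 → 𝕜, ∑ i, ∑ j, ∑ k, ∑ l, F i j k l =
      ∑ j, ∑ i, ∑ k, ∑ l, F i j k l := fun F => Finset.sum_comm
  have t := tfContr_pull hg hi hKJ hX
  have t1 : tfContr g' X' a c b d = ∑ p, ∑ q, ∑ m, ∑ n, ((K p a : ℝ) : 𝕜) * ((K q b : ℝ) : 𝕜) *
      ((K m c : ℝ) : 𝕜) * ((K n d : ℝ) : 𝕜) * tfContr g X p m q n := by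
    rw [t, s]
    exact Finset.sum_congr rfl fun _ _ => Finset.sum_congr rfl fun _ _ =>
      Finset.sum_congr rfl fun _ _ => Finset.sum_congr rfl fun _ _ => by ring
  have t2 : tfContr g' X' a d b c = ∑ p, ∑ q, ∑ m, ∑ n, ((K p a : ℝ) : 𝕜) * ((K q b : ℝ) : 𝕜) *
      ((K m c : ℝ) : 𝕜) * ((K n d : ℝ) : 𝕜) * tfContr g X p n q m := by
    rw [t, s, s']
    exact Finset.sum_congr rfl fun _ _ => Finset.sum_congr rfl fun _ _ =>
      Finset.sum_congr rfl fun _ _ => Finset.sum_congr rfl fun _ _ => by ring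
  have t3 : tfContr g' X' b d a c = ∑ p, ∑ q, ∑ m, ∑ n, ((K p a : ℝ) : 𝕜) * ((K q b : ℝ) : 𝕜) *
      ((K m c : ℝ) : 𝕜) * ((K n d : ℝ) : 𝕜) * tfContr g X q n p m := by
    rw [t, s, s', s'']
    exact Finset.sum_congr rfl fun _ _ => Finset.sum_congr rfl fun _ _ =>
      Finset.sum_congr rfl fun _ _ => Finset.sum_congr rfl fun _ _ => by ring
  have t4 : tfContr g' X' b c a d = ∑ p, ∑ q, ∑ m, ∑ n, ((K p a : ℝ) : 𝕜) * ((K q b : ℝ) : 𝕜) *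
      ((K m c : ℝ) : 𝕜) * ((K n d : ℝ) : 𝕜) * tfContr g X q m p n := by
    rw [t, s, s'']
    exact Finset.sum_congr rfl fun _ _ => Finset.sum_congr rfl fun _ _ =>
      Finset.sum_congr rfl fun _ _ => Finset.sum_congr rfl fun _ _ => by ring
  simp only [weylContr, t1, t2, t3, t4, ← Finset.sum_sub_distrib, ← Finset.sum_add_distrib]
  exact Finset.sum_congr rfl fun _ _ => Finset.sum_congr rfl fun _ _ =>
    Finset.sum_congr rfl fun _ _ => Finset.sum_congr rfl fun _ _ => by ring

end Equivariance

end

section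

attribute [local instance] Matrix.normedAddCommGroup Matrix.normedSpace

/-! ### Independence of the formula from the coordinates -/

section CoordinateChange

variable {V V₁ V₂ V₃ : Type*} [NormedAddCommGroup V] [NormedSpace ℝ V]
  [NormedAddCommGroup V₁] [NormedSpace ℝ V₁] [NormedAddCommGroup V₂] [NormedSpace ℝ V₂]
  [NormedAddCommGroup V₃] [NormedSpace ℝ V₃]

/-- Equivariant bilinear maps between representations. -/
def IsEquivBilin (J K : Mat) (r₁ : TRep V₁) (r₂ : TRep V₂) (r₃ : TRep V₃)
    (B : V₁ →ₗ[ℝ] V₂ →ₗ[ℝ] V₃) : Prop :=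
  ∀ S T, r₃.act J K (B S T) = B (r₁.act J K S) (r₂.act J K T)

variable {J K : Mat} {r₁ : TRep V₁} {r₂ : TRep V₂} {r₃ : TRep V₃} {B : V₁ →ₗ[ℝ] V₂ →ₗ[ℝ] V₃}

theorem IsEquivBilin.liftL (h : IsEquivBilin J K r₁ r₂ r₃ B) :
    IsEquivBilin J K r₁.down r₂ r₃.down (liftL B) := by
  intro S T
  ext c
  simp only [TRep.down_act, liftL_apply, h _ _, map_sum, map_smul, LinearMap.sum_apply,
    LinearMap.smul_apply]

theorem IsEquivBilin.liftR (h : IsEquivBilin J K r₁ r₂ r₃ B) :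
    IsEquivBilin J K r₁ r₂.down r₃.down (liftR B) := by
  intro S T
  ext c
  simp only [TRep.down_act, liftR_apply, h _ _, map_sum, map_smul]

theorem isEquivBilin_scal (r : TRep V) : IsEquivBilin J K (TRep.triv ℝ) r r (scal V) := by
  intro c v
  simp

theorem IsTransition.quarticOf_eq [FiniteDimensional ℝ V] {τ : E4 → E4} {G' G : E4 → Mat}
    {s' s : Set E4} (h : IsTransition τ G' G s' s) (r : TRep V) {y y' : E4 → V}
    (hy : SmoothOn s y) (hy' : ∀ x ∈ s', y' x = r.act (jac τ x)⁻¹ (jac τ x) (y (τ x))) {u : E4}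
    (hu : u ∈ s') : quarticOf r G' y' u =
      r.down.down.down.down.act (jac τ u)⁻¹ (jac τ u) (quarticOf r G y (τ u)) := by
  have hΓ : ∀ a, SmoothOn s fun x => conn G x a := fun a x hx => h.right.smooth_conn hx a
  have y1 := h.cov_nat r hy hy'
  have s1 := hy.cov r hΓ
  have y2 := h.cov_nat r.down s1 y1
  have s2 := s1.cov r.down hΓ
  have y3 := h.cov_nat r.down.down s2 y2
  have s3 := s2.cov r.down.down hΓ
  have y4 := h.cov_nat r.down.down.down s3 y3
  have p0 := h.schouten_eq
  have t0 : SmoothOn s (schoutenField G) := smooth_schoutenField h.right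
  have p1 := h.cov_nat _ t0 p0
  have t1 := t0.cov (TRep.triv ℝ).down.down hΓ
  have p2 := h.cov_nat _ t1 p1
  have b := isEquivBilin_scal (J := (jac τ u)⁻¹) (K := jac τ u) r
  have b0 := isEquivBilin_scal (J := (jac τ u)⁻¹) (K := jac τ u) (TRep.triv ℝ)
  set P := schoutenField G (τ u)
  set P₁ := cov (TRep.triv ℝ).down.down (conn G) (schoutenField G) (τ u)
  set P₂ := cov (TRep.triv ℝ).down.down.down (conn G)
    (cov (TRep.triv ℝ).down.down (conn G) (schoutenField G)) (τ u)
  -- The expression is composed of lifts of scalar multiplication, all of which are equivariant;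
  -- naturality of its arguments therefore suffices.
  have e : ∀ (P : Fin 4 → Fin 4 → ℝ) (P₁ : Fin 4 → Fin 4 → Fin 4 → ℝ)
      (P₂ : Fin 4 → Fin 4 → Fin 4 → Fin 4 → ℝ) (Y : V) (Y₁ : Fin 4 → V)
      (Y₂ : Fin 4 → Fin 4 → V) (Y₄ : VArr4 V), quarticJet P P₁ P₂ Y Y₁ Y₂ Y₄ =
        Y₄ + (10 : ℝ) • liftL (liftL (liftR (liftR (scal V)))) P Y₂
          + (10 : ℝ) • liftL (liftL (liftL (liftR (scal V)))) P₁ Y₁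
          + (3 : ℝ) • liftL (liftL (liftL (liftL (scal V)))) P₂ Y
          + (9 : ℝ) • liftL (liftL (liftL (liftL (scal V))))
            (liftL (liftL (liftR (liftR (scal ℝ)))) P P) Y :=
    fun _ _ _ _ _ _ _ => rfl
  simp only [quarticOf, e, y4 u hu, y2 u hu, y1 u hu, hy' u hu, p0 u hu, p1 u hu, p2 u hu,
    map_add, map_smul]
  rw [b.liftR.liftR.liftL.liftL _ _, b.liftR.liftL.liftL.liftL _ _,
    b.liftL.liftL.liftL.liftL _ _, b.liftL.liftL.liftL.liftL _ _,
    b0.liftR.liftR.liftL.liftL _ _]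

theorem down₄_act_apply (r : TRep V) (J K : Mat) (X : VArr4 V) (a b c d : Fin 4) :
    r.down.down.down.down.act J K X a b c d =
      ∑ p, ∑ q, ∑ m, ∑ n, (K p a * K q b * K m c * K n d) • r.act J K (X p q m n) := by
  simp only [TRep.down_act, Finset.sum_apply, Pi.smul_apply, Finset.smul_sum, smul_smul]

variable {𝕜 : Type*} [RCLike 𝕜]

/-- The operator is compatible with changes of coordinates. -/
theorem IsTransition.weylFormula_eq {τ : E4 → E4} {G' G : E4 → Mat} {s' s : Set E4}
    (h : IsTransition τ G' G s' s) {Y Y' : Comps 𝕜 2 2} (hY : SmoothOn s fun x => arrOf (Y x))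
    (hY' : SmoothOn s' fun x => arrOf (Y' x))
    (hyy : ∀ x ∈ s', arrOf (Y' x) =
      (mixedRep 𝕜).act (jac τ x)⁻¹ (jac τ x) (arrOf (Y (τ x)))) {u : E4} (hu : u ∈ s')
    (L : Fin 4 → Fin 4) : weylFormula G' Y' u L = pull (jac τ u) (weylFormula G Y (τ u)) L := by
  have vec : L = ![L 0, L 1, L 2, L 3] := by ext i; fin_cases i <;> rfl
  rw [vec, pull_eq, WeylOp.weylFormula_eq h.left hY' hu]
  simp only [WeylOp.weylFormula_eq h.right hY (h.maps u hu)]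
  refine weylContr_pull (h.eq u hu) (h.metric_inv hu) (h.mul_inv hu) (fun I e f b d => ?_) _ _ _ _
  have vec : I = ![I 0, I 1, I 2, I 3] := by ext i; fin_cases i <;> rfl
  rw [vec, pull_eq, uncurry₄, h.quarticOf_eq (mixedRep 𝕜) hY hyy hu]
  refine (congrFun (congrFun (congrFun (congrFun (down₄_act_apply _ _ _ _ _ _ _ _) e) f) b)
    d).trans ?_
  simp only [Finset.sum_apply, Pi.smul_apply, RCLike.real_smul_eq_coe_mul, RCLike.ofReal_mul]
  rfl

end CoordinateChange

end

/-! ### Comparison with the pointwise definitions of Weyl tensors and the Hodge star -/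

section Comparison

variable {𝕜 : Type*} [RCLike 𝕜]

/-- The Vandermonde product of the four indices is alternating and takes the value 12 on `0, 1, 2,
3`. -/
theorem leviCivita_eq (c d p q : Fin 4) : leviCivita ![c, d, p, q] =
    ((d : ℕ) - (c : ℕ)) * ((p : ℕ) - (c : ℕ)) * ((q : ℕ) - (c : ℕ)) * ((p : ℕ) - (d : ℕ)) *
      ((q : ℕ) - (d : ℕ)) * ((q : ℕ) - (p : ℕ)) / 12 := by
  let δ : Fin 4 → Fin 4 → ℤ := fun i j => if i = j then 1 else 0
  have h : ∀ c d p q : Fin 4, 12 * (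
      δ c 0 * (δ d 1 * (δ p 2 * δ q 3 - δ p 3 * δ q 2) - δ d 2 * (δ p 1 * δ q 3 - δ p 3 * δ q 1)
        + δ d 3 * (δ p 1 * δ q 2 - δ p 2 * δ q 1))
      - δ c 1 * (δ d 0 * (δ p 2 * δ q 3 - δ p 3 * δ q 2) - δ d 2 * (δ p 0 * δ q 3 - δ p 3 * δ q 0)
        + δ d 3 * (δ p 0 * δ q 2 - δ p 2 * δ q 0))
      + δ c 2 * (δ d 0 * (δ p 1 * δ q 3 - δ p 3 * δ q 1) - δ d 1 * (δ p 0 * δ q 3 - δ p 3 * δ q 0)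
        + δ d 3 * (δ p 0 * δ q 1 - δ p 1 * δ q 0))
      - δ c 3 * (δ d 0 * (δ p 1 * δ q 2 - δ p 2 * δ q 1) - δ d 1 * (δ p 0 * δ q 2 - δ p 2 * δ q 0)
        + δ d 2 * (δ p 0 * δ q 1 - δ p 1 * δ q 0))) =
      ((d : ℕ) - (c : ℕ)) * ((p : ℕ) - (c : ℕ)) * ((q : ℕ) - (c : ℕ)) * ((p : ℕ) - (d : ℕ)) *
      ((q : ℕ) - (d : ℕ)) * ((q : ℕ) - (p : ℕ)) := by
    -- The determinant has been expanded over the integers, which leaves a finite check on 256 index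
    -- quadruples.
    set_option maxRecDepth 100000 in decide
  have hδ : ∀ i j, (if i = j then (1 : ℝ) else 0) = δ i j := fun i j => by simp [δ]
  have := congrArg (Int.cast : ℤ → ℝ) (h c d p q)
  rw [eq_div_iff (by norm_num), leviCivita, det_four]
  push_cast at this
  rw [← this]
  simp only [Matrix.of_apply, hδ]
  exact mul_comm _ _

theorem dualMat_eq_leviCivita {u : M4 𝕜} (hu : u.transpose = -u) (c d : Fin 4) :
    dualMat u c d = (1 / 2) * ∑ p, ∑ q, ((leviCivita ![c, d, p, q] : ℝ) : 𝕜) * u p q := by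
  obtain ⟨⟨a0, a1, a2, a3⟩, a4, a5, a6, a7, a8, a9⟩ := antisymm_entries hu
  obtain ⟨⟨b0, b1, b2, b3⟩, ⟨c0, c1, c2, c3⟩, ⟨d0, d1, d2, d3⟩, e0, e1, e2, e3⟩ :=
    dualMat_entries u
  simp only [leviCivita_eq]
  fin_cases c <;> fin_cases d <;>
    simp only [Fin.zero_eta, Fin.mk_one, Fin.reduceFinMk, Fin.sum_univ_four, *] <;>
    norm_num <;> ring

/-- The Hodge star on the last two indices. -/
theorem star_eq_hodge (g : Mat) {Z : (Fin 4 → Fin 4) → 𝕜}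
    (hZ : ∀ a b c d, Z ![a, b, c, d] = - Z ![a, b, d, c]) (a b c d : Fin 4) :
    star g Z ![a, b, c, d] = hodge g (lastSlice (fun a b c d => Z ![a, b, c, d]) a b) c d := by
  set F : M4 𝕜 := lastSlice (fun a b c d => Z ![a, b, c, d]) a b with hF
  have hFt : F.transpose = -F := by
    ext i j
    exact hZ a b j i
  set h := castMat 𝕜 g⁻¹ with hh
  have hu : (h * F * h.transpose).transpose = -(h * F * h.transpose) := by
    simp only [Matrix.transpose_mul, Matrix.transpose_transpose, hFt, mul_assoc, neg_mul, mul_neg]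
  rw [hodge_apply, Matrix.smul_apply, smul_eq_mul, dualMat_eq_leviCivita hu]
  have e : ∀ p q, (h * F * h.transpose) p q = ∑ e, ∑ f, h p e * h q f * F e f := by
    intro p q
    simp only [Matrix.mul_apply, Matrix.transpose_apply, Finset.sum_mul]
    rw [Finset.sum_comm]
    exact Finset.sum_congr rfl fun _ _ => Finset.sum_congr rfl fun _ _ => by ring
  have s : ∀ T : Fin 4 → Fin 4 → Fin 4 → Fin 4 → 𝕜,
      ∑ e, ∑ f, ∑ p, ∑ q, T e f p q = ∑ p, ∑ q, ∑ e, ∑ f, T e f p q := by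
    intro T
    have h1 : ∀ e, ∑ f, ∑ p, ∑ q, T e f p q = ∑ p, ∑ q, ∑ f, T e f p q := fun e => by
      rw [Finset.sum_comm]
      exact Finset.sum_congr rfl fun p _ => Finset.sum_comm
    simp only [h1]
    rw [Finset.sum_comm]
    exact Finset.sum_congr rfl fun p _ => Finset.sum_comm
  rw [star, mul_left_comm]
  congr 1
  simp only [e, RCLike.ofReal_sum, Finset.sum_mul, Finset.mul_sum]
  rw [s]
  refine Finset.sum_congr rfl fun p _ => Finset.sum_congr rfl fun q _ =>
    Finset.sum_congr rfl fun e _ => Finset.sum_congr rfl fun f _ => ?_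
  simp only [RCLike.ofReal_mul, hh, castMat_apply, hF, lastSlice, Matrix.of_apply]
  change _ * ((leviCivita ![c, d, p, q] : ℝ) : 𝕜) * _ * _ * Z ![a, b, e, f] = _
  ring

theorem isAlgWeyl_iff {g : Mat} {Z : (Fin 4 → Fin 4) → 𝕜} :
    IsAlgWeyl g Z ↔ IsWeyl4 (castMat 𝕜 g⁻¹) fun a b c d => Z ![a, b, c, d] :=
  ⟨fun h => ⟨⟨h.antisymm, h.pair, h.bianchi⟩, h.traceFree⟩,
    fun h => ⟨h.antisymm, h.pair, h.bianchi, h.trace⟩⟩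

theorem lower_eq (g : Mat) (Y : (Fin 2 → Fin 4) → (Fin 2 → Fin 4) → 𝕜) (a b c d : Fin 4) :
    lower g Y ![a, b, c, d] = lowerWith (castMat 𝕜 g) (castMat 𝕜 g) (arrOf Y) a b c d := by
  rw [lowerWith_apply, lower]
  simp only [RCLike.ofReal_mul]
  rfl

theorem isAlgWeyl_lower_iff {g : Mat} {Y : (Fin 2 → Fin 4) → (Fin 2 → Fin 4) → 𝕜} :
    IsAlgWeyl g (lower g Y) ↔ arrOf Y ∈ mixedSub 𝕜 g := by
  rw [isAlgWeyl_iff, mem_mixedSub]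
  simp only [lower_eq]

theorem mem_dualSub_of_star {g : Mat} {c : 𝕜} {Y : (Fin 2 → Fin 4) → (Fin 2 → Fin 4) → 𝕜}
    (hY : arrOf Y ∈ mixedSub 𝕜 g) (hc : ∀ L, star g (lower g Y) L = c * lower g Y L) :
    arrOf Y ∈ dualSub 𝕜 g c := by
  refine mem_dualSub.2 ⟨hY, fun a b => ?_⟩
  ext p q
  have hZ := (isAlgWeyl_iff.1 (isAlgWeyl_lower_iff.2 hY)).toIsCurv
  have := hc ![a, b, p, q]
  rw [star_eq_hodge g hZ.antisymm'] at this
  simp only [lower_eq] at this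
  exact this

/-- The formula of the operator gives Weyl tensors. -/
theorem isAlgWeyl_weylFormula {G : E4 → Mat} {s : Set E4} (hG : IsMetricOn G s) {Y : Comps 𝕜 2 2}
    (hY : SmoothOn s fun x => arrOf (Y x)) (hW : ∀ x ∈ s, arrOf (Y x) ∈ mixedSub 𝕜 (G x)) {u : E4}
    (hu : u ∈ s) : IsAlgWeyl (G u) (weylFormula G Y u) := by
  rw [isAlgWeyl_iff]
  simp only [weylFormula_eq hG hY hu]
  exact weylContr_isWeyl (hG.symm u hu) (hG.det u hu) fun J =>
    isWeylMixed_of_mem (hG.symm u hu) (hG.det u hu)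
      ((isParSub_mixedSub hG).quarticOf_mem hG hY hW hu _ _ _ _)

/-- The formula of the operator reverses duality. -/
theorem star_weylFormula {G : E4 → Mat} {s : Set E4} (hG : IsMetricOn G s) {Y : Comps 𝕜 2 2}
    (hY : SmoothOn s fun x => arrOf (Y x)) {c : 𝕜}
    (hW : ∀ x ∈ s, arrOf (Y x) ∈ dualSub 𝕜 (G x) c) {u : E4} (hu : u ∈ s) (L : Fin 4 → Fin 4) :
    star (G u) (weylFormula G Y u) L = -c * weylFormula G Y u L := by
  have vec : L = ![L 0, L 1, L 2, L 3] := by ext i; fin_cases i <;> rfl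
  have hZ := (isAlgWeyl_iff.1 (isAlgWeyl_weylFormula hG hY (fun x hx => (hW x hx).1) hu)).toIsCurv
  rw [vec, star_eq_hodge _ hZ.antisymm']
  simp only [weylFormula_eq hG hY hu]
  have key := hodge_weylContr (hG.symm u hu) (hG.det u hu)
    (X := uncurry₄ (quarticOf (mixedRep 𝕜) G (fun x => arrOf (Y x)) u))
    (fun J => (isParSub_dualSub hG c).quarticOf_mem hG hY hW hu _ _ _ _) (L 0) (L 1)
  rw [neg_mul]
  exact congrFun (congrFun key (L 2)) (L 3)

end Comparison

section

attribute [local instance] Matrix.normedAddCommGroup Matrix.normedSpace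

/-! ### Smoothness of the coordinate formula -/

section SmoothFormula

variable {𝕜 : Type*} [RCLike 𝕜]

theorem smooth_ofReal {f : E4 → ℝ} {u : E4} (hf : ContDiffAt ℝ ∞ f u) :
    ContDiffAt ℝ ∞ (fun x => ((f x : ℝ) : 𝕜)) u :=
  (RCLike.ofRealCLM (K := 𝕜)).contDiff.contDiffAt.comp u hf

theorem smooth_tfSymmPart {G : E4 → Mat} {Q : E4 → (Fin 4 → Fin 4) → 𝕜} {u : E4}
    (hG : ContDiffAt ℝ ∞ G u) (hG' : ContDiffAt ℝ ∞ (fun x => (G x)⁻¹) u)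
    (hQ : ∀ I, ContDiffAt ℝ ∞ (fun x => Q x I) u) (I : Fin 4 → Fin 4) :
    ContDiffAt ℝ ∞ (fun x => tfSymmPart (G x) (Q x) I) u := by
  have hS : ∀ I, ContDiffAt ℝ ∞ (fun x => symmPart (Q x) I) u := fun I =>
    contDiffAt_const.mul (ContDiffAt.sum fun σ _ => hQ _)
  have ht : ∀ c d, ContDiffAt ℝ ∞ (fun x => trace₁₂ (G x) (symmPart (Q x)) c d) u := fun c d =>
    ContDiffAt.sum fun p _ => ContDiffAt.sum fun q _ =>
      (smooth_ofReal (smooth_entry hG' p q)).mul (hS _)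
  have htt : ContDiffAt ℝ ∞ (fun x => ∑ p, ∑ q, (((G x)⁻¹ p q : ℝ) : 𝕜) *
      trace₁₂ (G x) (symmPart (Q x)) p q) u :=
    ContDiffAt.sum fun p _ => ContDiffAt.sum fun q _ =>
      (smooth_ofReal (smooth_entry hG' p q)).mul (ht p q)
  have hg : ∀ i j, ContDiffAt ℝ ∞ (fun x => ((G x i j : ℝ) : 𝕜)) u := fun i j =>
    smooth_ofReal (smooth_entry hG i j)
  unfold tfSymmPart
  refine ((hS I).sub (contDiffAt_const.mul ?_)).add ((contDiffAt_const.mul ?_).mul htt)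
  · exact (((((((hg _ _).mul (ht _ _)).add ((hg _ _).mul (ht _ _))).add
      ((hg _ _).mul (ht _ _))).add ((hg _ _).mul (ht _ _))).add ((hg _ _).mul (ht _ _))).add
      ((hg _ _).mul (ht _ _)))
  · exact (((hg _ _).mul (hg _ _)).add ((hg _ _).mul (hg _ _))).add ((hg _ _).mul (hg _ _))

theorem smooth_quarticOf {V : Type*} [NormedAddCommGroup V] [NormedSpace ℝ V]
    [FiniteDimensional ℝ V] (r : TRep V) {G : E4 → Mat} {s : Set E4} (hG : IsMetricOn G s)
    {y : E4 → V} (hy : SmoothOn s y) (a b c d : Fin 4) :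
    SmoothOn s fun u => quarticOf r G y u a b c d := by
  have hΓ : ∀ a, SmoothOn s fun x => conn G x a := fun a x hx => hG.smooth_conn hx a
  have s1 := hy.cov r hΓ
  have s2 := s1.cov r.down hΓ
  have s4 := (s2.cov r.down.down hΓ).cov r.down.down.down hΓ
  have t0 : SmoothOn s (schoutenField G) := smooth_schoutenField hG
  have t1 := t0.cov (TRep.triv ℝ).down.down hΓ
  have t2 := t1.cov (TRep.triv ℝ).down.down.down hΓ
  intro u hu
  simp only [quarticOf, quarticJet]
  refine (((ContDiffAt.add ?_ ?_).add ?_).add ?_).add ?_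
  · exact (((s4.apply a).apply b).apply c).apply d u hu
  · exact (((t0.apply a).apply b u hu).smul ((s2.apply c).apply d u hu)).const_smul _
  · exact ((((t1.apply a).apply b).apply c u hu).smul (s1.apply d u hu)).const_smul _
  · exact (((((t2.apply a).apply b).apply c).apply d u hu).smul (hy u hu)).const_smul _
  · exact ((((t0.apply a).apply b u hu).mul ((t0.apply c).apply d u hu)).smul
      (hy u hu)).const_smul _

theorem smooth_weylFormula {G : E4 → Mat} {s : Set E4} (hG : IsMetricOn G s) {Y : Comps 𝕜 2 2}
    (hY : SmoothOn s fun x => arrOf (Y x)) (L : Fin 4 → Fin 4) :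
    SmoothOn s fun u => weylFormula G Y u L := by
  intro u hu
  have hc : ∀ a c b d, ContDiffAt ℝ ∞ (fun x => contracted G Y x a c b d) u := by
    intro a c b d
    refine ContDiffAt.sum fun e _ => ContDiffAt.sum fun f _ =>
      smooth_tfSymmPart (hG.smooth u hu) (hG.smooth_inv hu) (fun I => ?_) _
    have h := smooth_apply₄ (smooth_quarticOf (mixedRep 𝕜) hG hY (I 0) (I 1) (I 2) (I 3) u hu)
      e f b d
    refine h.congr_of_eventuallyEq ?_
    exact Filter.eventually_of_mem (hG.isOpen.mem_nhds hu) fun x hx =>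
      quarticExpr_eq hG hY hx I e f b d
  exact (((hc _ _ _ _).sub (hc _ _ _ _)).add (hc _ _ _ _)).sub (hc _ _ _ _)

end SmoothFormula

end

/-! ### Coordinate frames of charts -/

section Frames

variable {M : Type*} [TopologicalSpace M] [ChartedSpace E4 M]

/-- The coordinate vectors of a chart at a point of the manifold. -/
def frame (φ : OpenPartialHomeomorph M E4) (x : M) (i : Fin 4) : TangentSpace (𝓡 4) x :=
  (mfderiv (𝓡 4) (𝓡 4) φ.symm (φ x) (EuclideanSpace.single i (1 : ℝ)) : E4)

/-- Unlike `coordVec`, `frame` is indexed by the point of the manifold, so that the frames of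
different charts can be compared in one tangent space. -/
theorem coordVec_eq_frame (φ : OpenPartialHomeomorph M E4) {u : E4} (hu : u ∈ φ.target)
    (i : Fin 4) : coordVec φ u i = frame φ (φ.symm u) i :=
  congrArg (fun w => (mfderiv (𝓡 4) (𝓡 4) φ.symm w (EuclideanSpace.single i (1 : ℝ)) : E4))
    (φ.right_inv hu).symm

variable {φ χ : OpenPartialHomeomorph M E4}

theorem mdifferentiable_of_mem_smoothCharts (hφ : φ ∈ smoothCharts M) :
    φ.MDifferentiable (𝓡 4) (𝓡 4) :=
  ⟨(contMDiffOn_of_mem_maximalAtlas hφ).mdifferentiableOn (by simp),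
    (contMDiffOn_symm_of_mem_maximalAtlas hφ).mdifferentiableOn (by simp)⟩

theorem coordForm_frame (hφ : φ ∈ smoothCharts M) {x : M} (hx : x ∈ φ.source) (i j : Fin 4) :
    coordForm φ x i (frame φ x j) = if i = j then 1 else 0 := by
  have h := (mdifferentiable_of_mem_smoothCharts hφ).comp_symm_deriv (φ.map_source hx)
  have h1 := congrArg (fun A : E4 →L[ℝ] E4 => A (EuclideanSpace.single j (1 : ℝ)) i) h
  rw [φ.left_inv hx] at h1
  refine h1.trans ?_
  change (EuclideanSpace.single j (1 : ℝ) : E4) i = _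
  simp [PiLp.single_apply]

theorem sum_coordForm_smul_frame (hφ : φ ∈ smoothCharts M) {x : M} (hx : x ∈ φ.source)
    (v : TangentSpace (𝓡 4) x) : ∑ i, coordForm φ x i v • frame φ x i = v := by
  have h := (mdifferentiable_of_mem_smoothCharts hφ).symm_comp_deriv hx
  have h1 := congrArg (fun A : E4 →L[ℝ] E4 => A v) h
  refine Eq.trans ?_ h1
  have h2 : ∀ w : E4, ∑ i, w i • EuclideanSpace.single i (1 : ℝ) = w := fun w => by
    ext j
    simp [Pi.single_apply]
  let A : E4 →L[ℝ] E4 := mfderiv (𝓡 4) (𝓡 4) φ.symm (φ x)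
  refine Eq.trans ?_ (congrArg A (h2 (mfderiv (𝓡 4) (𝓡 4) φ x v)))
  rw [map_sum]
  exact Finset.sum_congr rfl fun i _ => (map_smul A _ _).symm

/-- The matrix of the change of frames between two charts. -/
def frameMat (φ χ : OpenPartialHomeomorph M E4) (x : M) : Mat :=
  Matrix.of fun p i => coordForm χ x p (frame φ x i)

theorem frame_eq (hχ : χ ∈ smoothCharts M) {x : M} (hx : x ∈ χ.source) (i : Fin 4) :
    frame φ x i = ∑ p, frameMat φ χ x p i • frame χ x p :=
  (sum_coordForm_smul_frame hχ hx _).symm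

theorem coordForm_eq (hχ : χ ∈ smoothCharts M) {x : M} (hx : x ∈ χ.source) (i : Fin 4) :
    coordForm φ x i = ∑ p, frameMat χ φ x i p • coordForm χ x p := by
  ext v
  conv_lhs => rw [← sum_coordForm_smul_frame hχ hx v]
  simp only [map_sum, map_smul, LinearMap.sum_apply, LinearMap.smul_apply, smul_eq_mul]
  exact Finset.sum_congr rfl fun p _ => mul_comm _ _

theorem frameMat_mul (hφ : φ ∈ smoothCharts M) (hχ : χ ∈ smoothCharts M) {x : M}
    (hx : x ∈ φ.source) (hx' : x ∈ χ.source) : frameMat φ χ x * frameMat χ φ x = 1 := by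
  ext p q
  have h := coordForm_frame hχ hx' p q
  rw [frame_eq (φ := χ) hφ hx, map_sum] at h
  rw [Matrix.mul_apply, Matrix.one_apply, ← h]
  simp only [map_smul, smul_eq_mul]
  exact Finset.sum_congr rfl fun i _ => mul_comm _ _

theorem frameMat_inv (hφ : φ ∈ smoothCharts M) (hχ : χ ∈ smoothCharts M) {x : M}
    (hx : x ∈ φ.source) (hx' : x ∈ χ.source) : (frameMat φ χ x)⁻¹ = frameMat χ φ x :=
  Matrix.inv_eq_right_inv (frameMat_mul hφ hχ hx hx')

/-- The change of frames is the derivative of the change of coordinates. -/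
theorem jac_eq_frameMat (hφ : φ ∈ smoothCharts M) (hχ : χ ∈ smoothCharts M) {u : E4}
    (hu : u ∈ φ.target) (hx : φ.symm u ∈ χ.source) :
    jac (χ ∘ φ.symm) u = frameMat φ χ (φ.symm u) := by
  ext p c
  have h := mfderiv_comp u ((mdifferentiable_of_mem_smoothCharts hχ).mdifferentiableAt hx)
    ((mdifferentiable_of_mem_smoothCharts hφ).mdifferentiableAt_symm hu)
  rw [mfderiv_eq_fderiv] at h
  have h1 := congrArg (fun A : E4 →L[ℝ] E4 => A (EuclideanSpace.single c (1 : ℝ)) p) h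
  refine h1.trans ?_
  change coordForm χ (φ.symm u) p (coordVec φ u c) = _
  rw [coordVec_eq_frame φ hu]
  rfl

theorem contDiffAt_transition (hφ : φ ∈ smoothCharts M) (hχ : χ ∈ smoothCharts M) {u : E4}
    (hu : u ∈ φ.target) (hx : φ.symm u ∈ χ.source) : ContDiffAt ℝ ∞ (χ ∘ φ.symm) u :=
  (((contMDiffOn_of_mem_maximalAtlas hχ).contMDiffAt (χ.open_source.mem_nhds hx)).comp u
    ((contMDiffOn_symm_of_mem_maximalAtlas hφ).contMDiffAt
      (φ.open_target.mem_nhds hu))).contDiffAt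

end Frames

section

attribute [local instance] Matrix.normedAddCommGroup Matrix.normedSpace

/-! ### Metrics and tensor fields in charts -/

section Fields

variable {M : Type*} [TopologicalSpace M] [ChartedSpace E4 M]
  {φ χ : OpenPartialHomeomorph M E4}

/-- The Gram matrix of the coordinate vectors of a chart at a point. -/
def Metric.gram (g : Metric M) (φ : OpenPartialHomeomorph M E4) (x : M) : Mat :=
  Matrix.of fun i j => g.inner x (frame φ x i) (frame φ x j)

theorem Metric.comps_eq_gram (g : Metric M) {u : E4} (hu : u ∈ φ.target) :
    g.comps φ u = g.gram φ (φ.symm u) := by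
  ext i j
  simp only [Metric.comps, Metric.gram, Matrix.of_apply, coordVec_eq_frame φ hu]

theorem Metric.gram_eq (g : Metric M) (hχ : χ ∈ smoothCharts M) {x : M} (hx : x ∈ χ.source) :
    g.gram φ x = (frameMat φ χ x).transpose * g.gram χ x * frameMat φ χ x := by
  ext i j
  rw [Metric.gram, Matrix.of_apply, frame_eq (φ := φ) hχ hx i, frame_eq (φ := φ) hχ hx j]
  simp only [map_sum, map_smul, LinearMap.sum_apply, LinearMap.smul_apply, smul_eq_mul,
    Matrix.mul_apply, Matrix.transpose_apply, Metric.gram, Matrix.of_apply, Finset.sum_mul]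
  exact Finset.sum_congr rfl fun p _ => by
    rw [Finset.mul_sum]
    exact Finset.sum_congr rfl fun q _ => by ring

/-- A vector in the kernel of the Gram matrix is the coordinate vector of a tangent vector
orthogonal to the whole tangent space, hence zero. -/
theorem Metric.gram_det (g : Metric M) (hφ : φ ∈ smoothCharts M) {x : M} (hx : x ∈ φ.source) :
    (g.gram φ x).det ≠ 0 := by
  intro h0
  obtain ⟨v, hv, hgv⟩ := Matrix.exists_mulVec_eq_zero_iff.2 h0
  have e : ∑ j, v j • frame φ x j = 0 := by
    refine (g.nondegenerate x).2 _ fun w => ?_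
    rw [← sum_coordForm_smul_frame hφ hx w]
    simp only [map_sum, map_smul, LinearMap.sum_apply, LinearMap.smul_apply, smul_eq_mul,
      Finset.mul_sum]
    rw [Finset.sum_comm]
    refine Finset.sum_eq_zero fun i _ => ?_
    have := congrArg (coordForm φ x i w * ·) (congrFun hgv i)
    simp only [Matrix.mulVec, dotProduct, Metric.gram, Matrix.of_apply, Pi.zero_apply, mul_zero,
      Finset.mul_sum] at this
    rw [← this]
    exact Finset.sum_congr rfl fun j _ => by ring
  apply hv
  ext i
  have := congrArg (coordForm φ x i) e
  simpa [coordForm_frame hφ hx] using this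

theorem Metric.isMetricOn (g : Metric M) (hφ : φ ∈ smoothCharts M) :
    IsMetricOn (g.comps φ) φ.target where
  isOpen := φ.open_target
  smooth u hu := smooth_mat fun i j => (g.smooth φ hφ i j).contDiffAt (φ.open_target.mem_nhds hu)
  symm u _ := by
    ext i j
    exact g.symm _ _ _
  det u hu := by
    rw [g.comps_eq_gram hu]
    exact g.gram_det hφ (φ.map_target hu)

theorem Metric.isTransition (g : Metric M) (hφ : φ ∈ smoothCharts M) (hχ : χ ∈ smoothCharts M) :
    IsTransition (χ ∘ φ.symm) (g.comps φ) (g.comps χ) (φ.target ∩ φ.symm ⁻¹' χ.source)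
      χ.target where
  left :=
    { isOpen := φ.symm.isOpen_inter_preimage χ.open_source
      smooth := fun u hu => (g.isMetricOn hφ).smooth u hu.1
      symm := fun u hu => (g.isMetricOn hφ).symm u hu.1
      det := fun u hu => (g.isMetricOn hφ).det u hu.1 }
  right := g.isMetricOn hχ
  maps u hu := χ.map_source hu.2
  smooth u hu := contDiffAt_transition hφ hχ hu.1 hu.2
  det u hu := by
    rw [jac_eq_frameMat hφ hχ hu.1 hu.2]
    have := congrArg Matrix.det (frameMat_mul hφ hχ (φ.map_target hu.1) hu.2)
    rw [Matrix.det_mul, Matrix.det_one] at this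
    exact left_ne_zero_of_mul_eq_one this
  eq u hu := by
    rw [jac_eq_frameMat hφ hχ hu.1 hu.2, g.comps_eq_gram hu.1, Function.comp_apply,
      g.comps_eq_gram (χ.map_source hu.2), g.gram_eq hχ hu.2, χ.left_inv hu.2]

variable {𝕜 : Type*} [RCLike 𝕜]

/-- The components of a tensor in the coordinate frame of a chart at a point. -/
def TensorField.frameComps {r s : ℕ} (T : TensorField M 𝕜 r s) (φ : OpenPartialHomeomorph M E4)
    (x : M) (U : Fin r → Fin 4) (L : Fin s → Fin 4) : 𝕜 :=
  T x (fun k => coordForm φ x (U k)) fun k => frame φ x (L k)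

theorem TensorField.comps_eq_frameComps {r s : ℕ} (T : TensorField M 𝕜 r s) {u : E4}
    (hu : u ∈ φ.target) : T.comps φ u = T.frameComps φ (φ.symm u) := by
  ext U L
  simp only [TensorField.comps, TensorField.frameComps, coordVec_eq_frame φ hu]

theorem sum_index₂ {V : Type*} [AddCommMonoid V] (F : (Fin 2 → Fin 4) → V) :
    ∑ I, F I = ∑ a, ∑ b, F ![a, b] := by
  rw [← (finTwoArrowEquiv (Fin 4)).symm.sum_comp, Fintype.sum_prod_type]
  rfl

theorem multilinear_expand {V W : Type*} [AddCommGroup V] [Module ℝ V] [AddCommGroup W]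
    [Module ℝ W] {r s : ℕ} (T : MultilinearMap ℝ (fun _ : Fin r => V)
      (MultilinearMap ℝ (fun _ : Fin s => W) 𝕜)) (A : Fin r → Fin 4 → ℝ) (B : Fin s → Fin 4 → ℝ)
    (α : Fin 4 → V) (w : Fin 4 → W) :
    T (fun k => ∑ p, A k p • α p) (fun k => ∑ q, B k q • w q) =
      ∑ Q : Fin s → Fin 4, ∑ P : Fin r → Fin 4,
        (((∏ k, B k (Q k)) * ∏ k, A k (P k) : ℝ) : 𝕜) * T (fun k => α (P k)) fun k => w (Q k) := by
  rw [T.map_sum, sum_apply, Finset.sum_comm]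
  refine Finset.sum_congr rfl fun P _ => ?_
  rw [MultilinearMap.map_smul_univ, smul_apply, MultilinearMap.map_sum,
    Finset.smul_sum]
  refine Finset.sum_congr rfl fun Q _ => ?_
  rw [MultilinearMap.map_smul_univ, smul_smul, RCLike.real_smul_eq_coe_mul, mul_comm (∏ _, _)]

theorem TensorField.frameComps_eq {r s : ℕ} (T : TensorField M 𝕜 r s) (hχ : χ ∈ smoothCharts M)
    {x : M} (hx : x ∈ χ.source) (U : Fin r → Fin 4) (L : Fin s → Fin 4) :
    T.frameComps φ x U L = ∑ Q : Fin s → Fin 4, ∑ P : Fin r → Fin 4,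
      (((∏ k, frameMat φ χ x (Q k) (L k)) * ∏ k, frameMat χ φ x (U k) (P k) : ℝ) : 𝕜) *
        T.frameComps χ x P Q := by
  refine Eq.trans ?_ (multilinear_expand (T x) (fun k => frameMat χ φ x (U k))
    (fun k q => frameMat φ χ x q (L k)) (coordForm χ x) (frame χ x))
  rw [TensorField.frameComps, funext fun k => coordForm_eq (φ := φ) hχ hx (U k),
    funext fun k => frame_eq (φ := φ) hχ hx (L k)]

theorem TensorField.arrOf_frameComps (Y : TensorField M 𝕜 2 2) (hφ : φ ∈ smoothCharts M)
    (hχ : χ ∈ smoothCharts M) {x : M} (hx : x ∈ φ.source) (hx' : x ∈ χ.source) :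
    arrOf (Y.frameComps φ x) = (mixedRep 𝕜).act (frameMat φ χ x)⁻¹ (frameMat φ χ x)
      (arrOf (Y.frameComps χ x)) := by
  ext e f b d
  rw [mixedRep_act, arrOf, Y.frameComps_eq hχ hx', frameMat_inv hφ hχ hx hx', sum_index₂]
  refine Finset.sum_congr rfl fun m _ => Finset.sum_congr rfl fun n _ => ?_
  rw [sum_index₂]
  simp only [Finset.mul_sum]
  refine Finset.sum_congr rfl fun p _ => Finset.sum_congr rfl fun q _ => ?_
  simp only [Fin.prod_univ_two, Matrix.cons_val_zero, Matrix.cons_val_one, RCLike.ofReal_mul,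
    arrOf]
  ring

theorem TensorField.IsSmooth.smoothOn {Y : TensorField M 𝕜 2 2} (hY : Y.IsSmooth)
    (hφ : φ ∈ smoothCharts M) : SmoothOn φ.target fun u => arrOf (Y.comps φ u) := fun _ hu =>
  smooth_arr4 fun _ _ _ _ => (hY φ hφ _ _).contDiffAt (φ.open_target.mem_nhds hu)

theorem ofComponents_apply {s : ℕ} (φ : OpenPartialHomeomorph M E4) (x : M)
    (z : (Fin s → Fin 4) → 𝕜) (α : Fin 0 → Module.Dual ℝ (TangentSpace (𝓡 4) x))
    (v : Fin s → TangentSpace (𝓡 4) x) :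
    ofComponents φ x z α v = ∑ L, ((∏ k, coordForm φ x (L k) (v k) : ℝ) : 𝕜) * z L := by
  rw [ofComponents, MultilinearMap.constOfIsEmpty_apply, Function.const_apply, sum_apply]
  exact Finset.sum_congr rfl fun L _ => RCLike.real_smul_eq_coe_mul _ _

theorem comps_ofComponents (z : M → (Fin 4 → Fin 4) → 𝕜) (χ : M → OpenPartialHomeomorph M E4)
    {u : E4} (hu : u ∈ φ.target) (L : Fin 4 → Fin 4) :
    TensorField.comps (fun x => ofComponents (χ x) x (z x)) φ u ![] L =
      pull (frameMat φ (χ (φ.symm u)) (φ.symm u)) (z (φ.symm u)) L := by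
  rw [TensorField.comps_eq_frameComps _ hu, TensorField.frameComps, ofComponents_apply]
  simp only [RCLike.ofReal_prod]
  rfl

end Fields

end

section

attribute [local instance] Matrix.normedAddCommGroup Matrix.normedSpace

/-! ### The operator on the manifold -/

section Operator

variable {𝕜 : Type*} [RCLike 𝕜] {M : Type*} [TopologicalSpace M] [ChartedSpace E4 M]
  {φ : OpenPartialHomeomorph M E4} {g : Metric M} {Y : TensorField M 𝕜 2 2}

theorem IsWeylUDUD.mem_mixedSub (hW : IsWeylUDUD g Y) (hφ : φ ∈ smoothCharts M) :
    ∀ u ∈ φ.target, arrOf (Y.comps φ u) ∈ mixedSub 𝕜 (g.comps φ u) := fun u hu =>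
  isAlgWeyl_lower_iff.1 (hW φ hφ u hu)

/-- The change of coordinates of the formula for the operator. -/
theorem weylFormula_change {χ : OpenPartialHomeomorph M E4} (hY : Y.IsSmooth)
    (hφ : φ ∈ smoothCharts M) (hχ : χ ∈ smoothCharts M) {u : E4} (hu : u ∈ φ.target)
    (hx : φ.symm u ∈ χ.source) (L : Fin 4 → Fin 4) :
    weylFormula (g.comps φ) (Y.comps φ) u L = pull (frameMat φ χ (φ.symm u))
      (weylFormula (g.comps χ) (Y.comps χ) (χ (φ.symm u))) L := by
  have h := g.isTransition hφ hχ
  rw [← jac_eq_frameMat hφ hχ hu hx]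
  refine h.weylFormula_eq (hY.smoothOn hχ) (fun x hx => hY.smoothOn hφ x hx.1)
    (fun v hv => ?_) ⟨hu, hx⟩ L
  rw [jac_eq_frameMat hφ hχ hv.1 hv.2, Y.comps_eq_frameComps hv.1, Function.comp_apply,
    Y.comps_eq_frameComps (χ.map_source hv.2), χ.left_inv hv.2]
  exact Y.arrOf_frameComps hφ hχ (φ.map_target hv.1) hv.2

theorem Metric.isConformalOn {g' : Metric M} {Ω : M → ℝ} (hΩ : ContMDiff (𝓡 4) 𝓘(ℝ, ℝ) ∞ Ω)
    (hpos : ∀ x, 0 < Ω x) (h : ∀ x v w, g'.inner x v w = Ω x ^ 2 * g.inner x v w)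
    (hφ : φ ∈ smoothCharts M) :
    IsConformalOn (g.comps φ) (g'.comps φ) (Ω ∘ φ.symm) φ.target where
  left := g.isMetricOn hφ
  right := g'.isMetricOn hφ
  smooth u hu := (hΩ.contMDiffAt.comp u ((contMDiffOn_symm_of_mem_maximalAtlas hφ).contMDiffAt
    (φ.open_target.mem_nhds hu))).contDiffAt
  pos u _ := hpos _
  eq u _ := by
    ext i j
    exact h _ _ _

variable [IsManifold (𝓡 4) ∞ M]

/-- The components of the operator in a smooth chart. -/
theorem comps_weylOperator (hY : Y.IsSmooth) (hφ : φ ∈ smoothCharts M) {u : E4}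
    (hu : u ∈ φ.target) (L : Fin 4 → Fin 4) :
    (weylOperator g Y).comps φ u ![] L = weylFormula (g.comps φ) (Y.comps φ) u L := by
  rw [weylFormula_change hY hφ (IsManifold.chart_mem_maximalAtlas (φ.symm u)) hu
    (mem_chart_source E4 _)]
  exact comps_ofComponents (fun x => weylFormula (g.comps (chartAt E4 x))
    (Y.comps (chartAt E4 x)) (chartAt E4 x x)) (fun x => chartAt E4 x) hu L

theorem weylOperator_isSmooth (hY : Y.IsSmooth) : (weylOperator g Y).IsSmooth := by
  intro φ hφ U L u hu
  have h := smooth_weylFormula (g.isMetricOn hφ) (hY.smoothOn hφ) L u hu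
  refine (h.contDiffWithinAt).congr (fun v hv => ?_) ?_ <;> rw [Subsingleton.elim U ![]]
  · exact comps_weylOperator hY hφ hv L
  · exact comps_weylOperator hY hφ hu L

theorem isWeylDDDD_weylOperator (hY : Y.IsSmooth) (hW : IsWeylUDUD g Y) :
    IsWeylDDDD g (weylOperator g Y) := by
  intro φ hφ u hu
  rw [funext (comps_weylOperator hY hφ hu)]
  exact isAlgWeyl_weylFormula (g.isMetricOn hφ) (hY.smoothOn hφ) (hW.mem_mixedSub hφ) hu

/-- The value at a point is defined through the preferred chart there, for both metrics, so the
invariance in this one coordinate system is enough. -/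
theorem weylOperator_conformal (hY : Y.IsSmooth) (hW : IsWeylUDUD g Y) {g' : Metric M}
    (h : g.IsConformalTo g') : weylOperator g' Y = weylOperator g Y := by
  obtain ⟨Ω, hΩ, hpos, hg⟩ := h
  funext x
  have hφ : chartAt E4 x ∈ smoothCharts M := IsManifold.chart_mem_maximalAtlas x
  refine congrArg (ofComponents (chartAt E4 x) x) (funext fun L => ?_)
  have vec : L = ![L 0, L 1, L 2, L 3] := by ext i; fin_cases i <;> rfl
  rw [vec]
  exact (Metric.isConformalOn hΩ hpos hg hφ).weylFormula_eq (hY.smoothOn hφ)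
    (hW.mem_mixedSub hφ) (mem_chart_target E4 x) _ _ _ _

theorem isDualDDDD_weylOperator (hY : Y.IsSmooth) (hW : IsWeylUDUD g Y) {o : OrientedAtlas M}
    {c : 𝕜} (hc : IsDualUDUD g o c Y) : IsDualDDDD g o (-c) (weylOperator g Y) := by
  intro φ ho u hu L
  have hφ := o.smooth ho
  rw [funext (comps_weylOperator hY hφ hu)]
  exact star_weylFormula (g.isMetricOn hφ) (hY.smoothOn hφ)
    (fun v hv => mem_dualSub_of_star (hW.mem_mixedSub hφ v hv) (hc φ ho v hv)) hu L

end Operator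

end

end WeylOp

end

theorem corollary2 {𝕜 : Type*} [RCLike 𝕜] {M : Type*} [TopologicalSpace M]
    [ChartedSpace WeylOp.E4 M] [IsManifold (𝓡 4) ∞ M] (g : WeylOp.Metric M)
    (Y : WeylOp.TensorField M 𝕜 2 2) (hY : Y.IsSmooth) (hW : WeylOp.IsWeylUDUD g Y) :
    -- the components of `D_g Y` are given by the formula in every smooth chart
    (∀ φ ∈ WeylOp.smoothCharts M, ∀ u ∈ φ.target, ∀ L : Fin 4 → Fin 4,
      (WeylOp.weylOperator g Y).comps φ u ![] L =
        WeylOp.weylFormula (g.comps φ) (Y.comps φ) u L) ∧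
    -- `D_g Y` is a smooth section of `𝒲_{abcd}`
    (WeylOp.weylOperator g Y).IsSmooth ∧
    WeylOp.IsWeylDDDD g (WeylOp.weylOperator g Y) ∧
    -- conformal invariance
    (∀ g' : WeylOp.Metric M, g.IsConformalTo g' →
      WeylOp.weylOperator g' Y = WeylOp.weylOperator g Y) ∧
    -- duality is reversed
    (∀ (o : WeylOp.OrientedAtlas M) (c : 𝕜), WeylOp.IsDualUDUD g o c Y →
      WeylOp.IsDualDDDD g o (-c) (WeylOp.weylOperator g Y)) := by
  exact ⟨fun φ hφ u hu L => WeylOp.comps_weylOperator hY hφ hu L,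
    WeylOp.weylOperator_isSmooth hY, WeylOp.isWeylDDDD_weylOperator hY hW,
    fun g' h => WeylOp.weylOperator_conformal hY hW h,
    fun o c hc => WeylOp.isDualDDDD_weylOperator hY hW hc⟩
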